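/- **Notation.** Let $n\in\mathbb N$, let $b_1,\dots,b_n,b,\gamma$ be real numbers, $B=\mathrm{diag}(b_1,\dots,b_n)$, and let $J\subseteq\mathbb R$ be an open set of times. Write $\xi=x+y$, $\eta=y-x$, $\partial_\xi=\partial_y+\partial_x$, $\partial_\eta=\partial_y-\partial_x$. Let $q_{12}(x,y;t)$ (a column of length $n$) and $q_{21}(x,y;t)$ (a row of length $n$) be complex-valued, of Schwartz class in $(x,y)\in\mathbb R^2$ for each $t$, depending continuously on $t\in J$ in the Schwartz topology and pointwise differentiable in $t$. Suppose that together with an $n\times n$ matrix function $P(x,y;t)$ and a scalar function $p(x,y;t)$ they satisfy, for $t\in J$, the dispersive $2n$-wave system $$\partial_t q_{12}-B\,\partial_\xi q_{12}+b\,\partial_\eta q_{12}-i\gamma\,\partial_x\partial_y q_{12}=Pq_{12}-p\,q_{12},$$ $$\partial_t q_{21}-\partial_\xi q_{21}\,B+b\,\partial_\eta q_{21}+i\gamma\,\partial_x\partial_y q_{21}=p\,q_{21}-q_{21}P,$$ $$\partial_\eta P=[q_{12}q_{21},B]-i\gamma\,\partial_x(q_{12}q_{21}),\qquad \partial_\xi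 p=i\gamma\,\partial_x(q_{21}q_{12}).$$ (For $P$ and $p$ only these directional derivatives along the characteristics need to exist.) Suppose moreover that, for every $t\in J$, $P\to 0$ as $y\to+\infty$ along every characteristic $\xi=\mathrm{const}$, and $p\to 0$ as $y\to-\infty$ along every characteristic $\eta=\mathrm{const}$. **Scattering operator.** Let $\sigma=\mathrm{diag}(1,\dots,1,-1)$ (of size $n+1$) and $Q=\begin{pmatrix}0&q_{12}\\ q_{21}&0\end{pmatrix}$. For $h=(h_1,h_2)$ with values in $\mathbb C^n\times\mathbb C$ put $(\mathcal F_xh)(y)=(h_1(y+x),h_2(y-x))$. For fixed $t$ consider solutions $\psi\in C(\mathbb R_y;L_2(\mathbb R_x,\mathbb C^{n+1}))$ of $$\partial_y\psi-\sigma\,\partial_x\psi+Q(x,y;t)\psi=0$$ (integrated along characteristics) for which there are $a_\pm\in L_2(\mathbb R,\mathbb C^{n+1})$ with $\psi(x,y)=\mathcal F_xa_\pm(y)+o(1)$ in $L_2(\mathbb R_x)$ as $y\to\pm\infty$. The scattering operator $S=S(t)$ is the operator that takes $a_-$ to $a_+$. **Theorem.** For every $t\in J$ the scattering operator $S(t)$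 is well defined on all of $L_2(\mathbb R,\mathbb C^{n+1})$; it is bounded, with bounded inverse, and $S=I+F$, $S^{-1}=I+G$ with Hilbert–Schmidt integral operators $$(Fa)(y)=\int_{-\infty}^{\infty} F(y,\tau;t)\,a(\tau)\,d\tau,\qquad (Ga)(y)=\int_{-\infty}^{\infty} G(y,\tau;t)\,a(\tau)\,d\tau .$$ In the block decomposition belonging to $\mathbb C^{n+1}=\mathbb C^n\times\mathbb C$, the kernels can be chosen such that $F_{12}(y,\tau;t)$ and $G_{21}(y,\tau;t)$ are twice continuously differentiable in $(y,\tau)\in\mathbb R^2$ and differentiable in $t\in J$, and they satisfy, for all $t\in J$ and $(y,\tau)\in\mathbb R^2$, $$\partial_tF_{12}-2\left(B\,\partial_yF_{12}-b\,\partial_\tau F_{12}\right)-i\gamma\left(\partial_y^2F_{12}-\partial_\tau^2F_{12}\right)=0,$$ $$\partial_tG_{21}+2\left(b\,\partial_yG_{21}-\partial_\tau G_{21}\,B\right)-i\gamma\left(\partial_y^2G_{21}-\partial_\tau^2G_{21}\right)=0.$$ -/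

import Mathlib

open MeasureTheory Filter Topology Matrix
open scoped SchwartzMap

noncomputable section

/-- The partial derivative `∂f/∂u` of a function of two real variables `(u, v)`. -/
def pderivFst (f : ℝ → ℝ → ℂ) (u v : ℝ) : ℂ := deriv (fun s => f s v) u

/-- The partial derivative `∂f/∂v` of a function of two real variables `(u, v)`. -/
def pderivSnd (f : ℝ → ℝ → ℂ) (u v : ℝ) : ℂ := deriv (fun s => f u s) v

/-! ### The dispersive `2n`-wave interaction system

Functions of the plane take the argument `(x, y) : ℝ × ℝ`; the time is a separate first argument.
`∂_ξ = ∂_y + ∂_x` and `∂_η = ∂_y - ∂_x`. -/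

/-- The product `q₁₂ q₂₁` of a column and a row, as a matrix-valued function of `(x, y)`. -/
def colRow {n : ℕ} (u v : 𝓢(ℝ × ℝ, Fin n → ℂ)) (x y : ℝ) : Matrix (Fin n) (Fin n) ℂ :=
  vecMulVec (u (x, y)) (v (x, y))

/-- The matrix `diag(b₁, …, bₙ)` with complex entries. -/
def speedMatrix {n : ℕ} (bs : Fin n → ℝ) : Matrix (Fin n) (Fin n) ℂ :=
  Matrix.diagonal fun k => (bs k : ℂ)

/-- `q₁₂` (column), `q₂₁` (row), `P` (matrix) and `p` (scalar) solve, for times in `J`,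
the dispersive `2n`-wave system
`∂ₜq₁₂ - B ∂_ξ q₁₂ + b ∂_η q₁₂ - iγ ∂ₓ∂_y q₁₂ = P q₁₂ - p q₁₂`,
`∂ₜq₂₁ - ∂_ξ q₂₁ B + b ∂_η q₂₁ + iγ ∂ₓ∂_y q₂₁ = p q₂₁ - q₂₁ P`,
`∂_η P = [q₁₂ q₂₁, B] - iγ ∂ₓ(q₁₂ q₂₁)`, `∂_ξ p = iγ ∂ₓ(q₂₁ q₁₂)`.
For `P` and `p` only the derivatives in the characteristic directions `∂_η` (the vector `(-1, 1)`)
and `∂_ξ` (the vector `(1, 1)`) are asked to exist. -/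
structure IsDispersiveWaveSolution {n : ℕ} (J : Set ℝ) (bs : Fin n → ℝ) (b γ : ℝ)
    (q₁₂ q₂₁ : ℝ → 𝓢(ℝ × ℝ, Fin n → ℂ))
    (P : ℝ → ℝ × ℝ → Matrix (Fin n) (Fin n) ℂ) (p : ℝ → ℝ × ℝ → ℂ) : Prop where
  differentiable₁₂ : ∀ t ∈ J, ∀ (x y : ℝ) (k : Fin n),
    DifferentiableAt ℝ (fun s => q₁₂ s (x, y) k) t
  differentiable₂₁ : ∀ t ∈ J, ∀ (x y : ℝ) (k : Fin n),
    DifferentiableAt ℝ (fun s => q₂₁ s (x, y) k) t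
  eq₁₂ : ∀ t ∈ J, ∀ (x y : ℝ) (k : Fin n),
    let u : ℝ → ℝ → ℂ := fun x y => q₁₂ t (x, y) k
    deriv (fun s => q₁₂ s (x, y) k) t
        - bs k * (pderivSnd u x y + pderivFst u x y)
        + b * (pderivSnd u x y - pderivFst u x y)
        - Complex.I * γ * pderivFst (pderivSnd u) x y
      = (P t (x, y) *ᵥ q₁₂ t (x, y)) k - p t (x, y) * q₁₂ t (x, y) k
  eq₂₁ : ∀ t ∈ J, ∀ (x y : ℝ) (k : Fin n),
    let u : ℝ → ℝ → ℂ := fun x y => q₂₁ t (x, y) k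
    deriv (fun s => q₂₁ s (x, y) k) t
        - (pderivSnd u x y + pderivFst u x y) * bs k
        + b * (pderivSnd u x y - pderivFst u x y)
        + Complex.I * γ * pderivFst (pderivSnd u) x y
      = p t (x, y) * q₂₁ t (x, y) k - (q₂₁ t (x, y) ᵥ* P t (x, y)) k
  eqP : ∀ t ∈ J, ∀ (x y : ℝ) (i j : Fin n),
    HasLineDerivAt ℝ (fun z : ℝ × ℝ => P t z i j)
      ((colRow (q₁₂ t) (q₂₁ t) x y * speedMatrix bs
          - speedMatrix bs * colRow (q₁₂ t) (q₂₁ t) x y) i j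
        - Complex.I * γ * pderivFst (fun x y => colRow (q₁₂ t) (q₂₁ t) x y i j) x y)
      (x, y) ((-1, 1) : ℝ × ℝ)
  eqp : ∀ t ∈ J, ∀ x y : ℝ,
    HasLineDerivAt ℝ (p t)
      (Complex.I * γ * pderivFst (fun x y => q₂₁ t (x, y) ⬝ᵥ q₁₂ t (x, y)) x y)
      (x, y) ((1, 1) : ℝ × ℝ)

/-! ### Scattering for the Manakov-type system `∂_y ψ - σ ∂ₓψ + Qψ = 0` -/

/-- `ℂⁿ⁺¹`, split as `ℂⁿ × ℂ`. -/
abbrev Wave (n : ℕ) : Type := EuclideanSpace ℂ (Fin n ⊕ Unit)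

/-- `L²(ℝ, ℂⁿ⁺¹)`. -/
abbrev Profile (n : ℕ) : Type := Lp (Wave n) 2 (volume : Measure ℝ)

/-- The off-diagonal potential `Q(x, y)` with upper right column `q₁₂` and lower left row `q₂₁`. -/
def potential {n : ℕ} (u v : 𝓢(ℝ × ℝ, Fin n → ℂ)) (x y : ℝ) :
    Matrix (Fin n ⊕ Unit) (Fin n ⊕ Unit) ℂ :=
  Matrix.fromBlocks 0 (Matrix.replicateCol Unit (u (x, y)))
    (Matrix.replicateRow Unit (v (x, y))) 0

/-- The shift `(𝓕ₓ h)(y) = (h₁(y + x), h₂(y - x))`. -/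
def waveShift {n : ℕ} (x : ℝ) (h : ℝ → Wave n) (y : ℝ) : Wave n :=
  WithLp.toLp 2 (Sum.elim (fun k => h (y + x) (Sum.inl k)) (fun u => h (y - x) (Sum.inr u)))

/-- `ψ(x, y)` is a solution of `∂_y ψ - σ ∂ₓψ + Qψ = 0`, with `σ = diag(1, …, 1, -1)`, in the class
`C(ℝ_y; L²(ℝ_x, ℂⁿ⁺¹))`. The equation is integrated along its characteristics: the first `n`
components satisfy `(∂_y - ∂ₓ)ψ = -Qψ`, hence are followed on the lines `s ↦ (ξ - s, s)`; the last
one satisfies `(∂_y + ∂ₓ)ψ = -Qψ` and is followed on the lines `s ↦ (s - η, s)`. -/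
structure IsWaveSolution {n : ℕ} (Q : ℝ → ℝ → Matrix (Fin n ⊕ Unit) (Fin n ⊕ Unit) ℂ)
    (ψ : ℝ → ℝ → Wave n) : Prop where
  measurable : Measurable (Function.uncurry ψ)
  memLp : ∀ y, MemLp (fun x => ψ x y) 2 volume
  continuous : ∀ y₀, Tendsto (fun y => eLpNorm (fun x => ψ x y - ψ x y₀) 2 volume) (𝓝 y₀) (𝓝 0)
  eq_fst : ∀ y₀ y : ℝ, ∀ k : Fin n, ∀ᵐ ξ : ℝ,
    ψ (ξ - y) y (Sum.inl k) = ψ (ξ - y₀) y₀ (Sum.inl k)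
      - ∫ s in y₀..y, (Q (ξ - s) s *ᵥ (ψ (ξ - s) s).ofLp) (Sum.inl k)
  eq_snd : ∀ y₀ y : ℝ, ∀ᵐ η : ℝ,
    ψ (y - η) y (Sum.inr ()) = ψ (y₀ - η) y₀ (Sum.inr ())
      - ∫ s in y₀..y, (Q (s - η) s *ᵥ (ψ (s - η) s).ofLp) (Sum.inr ())

/-- `ψ(x, y) = 𝓕ₓ a(y) + o(1)` in `L²(ℝ_x, ℂⁿ⁺¹)` as `y` tends along `l`. -/
def HasWaveAsymptotics {n : ℕ} (ψ : ℝ → ℝ → Wave n) (a : Profile n) (l : Filter ℝ) : Prop :=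
  Tendsto (fun y => eLpNorm (fun x => ψ x y - waveShift x a y) 2 volume) l (𝓝 0)

/-- `S` is the scattering operator of the system with potential `Q`: it takes the incident wave
`a₋` (the asymptotics as `y → -∞`) of a solution to its scattered wave `a₊` (`y → +∞`); every `a₋`
is incident to some solution, and the solutions with incident wave `a₋` and a scattered wave all
have the scattered wave `S a₋`. -/
def IsScatteringOperator {n : ℕ} (Q : ℝ → ℝ → Matrix (Fin n ⊕ Unit) (Fin n ⊕ Unit) ℂ)
    (S : Profile n ≃L[ℂ] Profile n) : Prop :=
  ∀ am ap : Profile n, S am = ap ↔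
    ∃ ψ : ℝ → ℝ → Wave n,
      IsWaveSolution Q ψ ∧ HasWaveAsymptotics ψ am atBot ∧ HasWaveAsymptotics ψ ap atTop

/-- `T` is the Hilbert–Schmidt integral operator `(T a)(y) = ∫ K(y, τ) a(τ) dτ`. -/
def IsHilbertSchmidtKernel {n : ℕ} (T : Profile n →L[ℂ] Profile n)
    (K : ℝ → ℝ → Matrix (Fin n ⊕ Unit) (Fin n ⊕ Unit) ℂ) : Prop :=
  (∀ i j, MemLp (fun z : ℝ × ℝ => K z.1 z.2 i j) 2 volume) ∧
  ∀ a : Profile n, ∀ᵐ y : ℝ, ∀ i, (T a) y i = ∫ τ, (K y τ *ᵥ (a τ).ofLp) i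

end

/-!
In the characteristic coordinates `ξ = y + x`, `η = y - x` the wave equation is
`∂ψ₁/∂η = -½ u ψ₂`, `∂ψ₂/∂ξ = -½ v ψ₁`, where `u` and `v` are the Schwartz functions `q₁₂` and `q₂₁`
read as operator-valued potentials (`charPotential`). The derivatives `∂_ξ`, `∂_η` of the dispersive
system are twice the partial derivatives in these coordinates.

**Impulse response.** An impulse `δ(η - τ)` incident in the second component excites kernels
`k₁(ξ, η, τ)` and `k₂(ξ, η, τ)` (`kerFst`, `kerSnd`), which solve a Goursat problem:
`k₁ = -½ u(ξ, τ) - ½ ∫_τ^η u k₂`, `k₂ = -½ ∫_{-∞}^ξ v k₁`. It is a Volterra equation, uniquely solvable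
for potentials of any size: in the bounded continuous functions of `(ξ, η, τ)` with the weight
`cosh (l (arctan η - arctan τ))` and `l` large, the integral operator is a contraction
(`isUnit_one_sub_goursatOp`). As `η → ∞` the kernel `k₁` tends to the kernel `transmission u v (ξ, τ)`.
Inversion of operators is smooth, so the impulse response depends smoothly on the potentials, measured
in bounded functions with the weights `1 + η²` and `1 + ξ²`. Translating the potentials translates the
response, so the transmission kernel is `C²` (`contDiff_transmission`). It is differentiable in time as
well: by the dispersive system the pointwise time derivatives of the potentials are continuous functions
of the potentials, which makes them derivatives in the weighted norm (`continuous_rateFst`).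

**Evolution.** Write the dispersive system with `c = i γ` and constant operators `B₁`, `B₂` in place of
`B` and `b`. Its two linear operators, applied to the impulse response, are a Lax pair in disguise:
the combinations `laxFst` and `laxSnd` of the time derivative of the response, its derivatives in `ξ`
and `τ`, and the fields `P` and `p` satisfy the Goursat problem without an incident impulse, hence
vanish (`eq_zero_of_homogeneous_goursat`). Letting `η → ∞` in the first of them, where `P → 0`, leaves
the linear equation with constant coefficients for the transmission kernel
(`transmission_evolution`, `IsCharacteristicSolution.hasDerivAt_transmission`).

**The scattering operator.** Superposing impulse responses yields, for every incident profile `a`, a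
wave (`scatteredWave`, `IsBlockPotential.isWaveSolution`) whose outgoing profile is `a` plus the
integral of `a` against a kernel bounded by `C / ((1 + y²) (1 + τ²))`, which is therefore of
Hilbert–Schmidt type. Waves with the same incident profile agree, by an energy inequality and
Grönwall's lemma (`IsWaveSolution.eLpNorm_eq_zero`). The reflection `ψ(-x, -y)` exchanges incident and
outgoing profiles, so it furnishes the inverse of the scattering operator together with its kernel
(`IsBlockPotential.exists_isScatteringOperator`).

**The two blocks.** The first component of the scattered wave is produced by two kernels: the
transmission kernel, which acts on what is incident in the second component, and a kernel with a jump
at the front `τ = y`, which acts on what is incident in the first. The latter has a factor `v` on the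
right and annihilates the last basis vector, so the column `F₁₂` consists of entries of the
transmission kernel and inherits its regularity and evolution equation
(`waveMatrix_fullKernel_inl_inr`). The row `G₂₁` is in the same way a transmission kernel of the
reflected system (`waveMatrix_fullKernel_inr_inl`); the dispersive system is invariant under
`(ξ, η) ↦ (-η, -ξ)` with `u` and `v` exchanged up to sign (`IsCharacteristicSolution.reflect`).
-/

open scoped BoundedContinuousFunction

noncomputable section

/-! ### Integration along half-lines with an integrable weight -/

/-- The integrable weight `1 / (1 + s²)`. -/
def decayWeight (s : ℝ) : ℝ := (1 + s ^ 2)⁻¹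

lemma decayWeight_pos (s : ℝ) : 0 < decayWeight s := by unfold decayWeight; positivity

lemma decayWeight_le_one (s : ℝ) : decayWeight s ≤ 1 :=
  inv_le_one_of_one_le₀ (by nlinarith [sq_nonneg s])

lemma decayWeight_neg (s : ℝ) : decayWeight (-s) = decayWeight s := by simp [decayWeight]

lemma continuous_decayWeight : Continuous decayWeight := by
  unfold decayWeight
  exact Continuous.inv₀ (by fun_prop) fun s => by positivity

lemma integrable_decayWeight : Integrable decayWeight := integrable_inv_one_add_sq

lemma integral_decayWeight : ∫ s, decayWeight s = Real.pi := integral_univ_inv_one_add_sq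

lemma decayWeight_mul_one_add_sq (s : ℝ) : decayWeight s * (1 + s ^ 2) = 1 := by
  unfold decayWeight
  exact inv_mul_cancel₀ (by positivity)

/-- Continuity in the parameter of an integral over a half-line with moving end point. -/
lemma continuous_setIntegral_Iic_of_dominated {Z E : Type*} [TopologicalSpace Z]
    [FirstCountableTopology Z] [NormedAddCommGroup E] [NormedSpace ℝ E]
    {c : Z → ℝ} (hc : Continuous c) {h : Z → ℝ → E} {g : ℝ → ℝ}
    (hm : ∀ z, AEStronglyMeasurable (h z)) (hcont : ∀ s, Continuous fun z => h z s)
    (hg : Integrable g) (hbd : ∀ z s, ‖h z s‖ ≤ g s) :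
    Continuous fun z => ∫ s in Set.Iic (c z), h z s := by
  have h1 : ∀ z, ∫ s in Set.Iic (c z), h z s = ∫ s, (Set.Iic (c z)).indicator (h z) s :=
    fun z => (integral_indicator measurableSet_Iic).symm
  simp_rw [h1]
  refine continuous_iff_continuousAt.2 fun z₀ => ?_
  refine continuousAt_of_dominated (bound := g)
    (Eventually.of_forall fun z => (hm z).indicator measurableSet_Iic)
    (Eventually.of_forall fun z => Eventually.of_forall fun s => ?_) hg ?_
  · exact (norm_indicator_le_norm_self _ _).trans (hbd z s)
  · have hne : ∀ᵐ s : ℝ, s ≠ c z₀ := by simp [ae_iff, measure_singleton]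
    filter_upwards [hne] with s hs
    rcases lt_or_gt_of_ne hs with hlt | hgt
    · have : ∀ᶠ z in 𝓝 z₀, h z s = (Set.Iic (c z)).indicator (h z) s := by
        filter_upwards [hc.continuousAt.eventually (lt_mem_nhds hlt)] with z hz
        rw [Set.indicator_of_mem (Set.mem_Iic.2 hz.le)]
      exact (hcont s).continuousAt.congr this
    · have : ∀ᶠ z in 𝓝 z₀, (0 : E) = (Set.Iic (c z)).indicator (h z) s := by
        filter_upwards [hc.continuousAt.eventually (gt_mem_nhds hgt)] with z hz
        rw [Set.indicator_of_notMem (by simpa using hz)]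
      exact continuousAt_const.congr this

variable {𝔸 : Type*} [NormedRing 𝔸] [NormedAlgebra ℂ 𝔸]

/-- Bounded continuous `𝔸`-valued functions of `(ξ, η, τ)`, where `ξ`, `η` are the characteristic
coordinates of the observation point and `τ` is the position of the incident impulse. -/
abbrev Triple (𝔸 : Type*) [NormedRing 𝔸] : Type _ := (ℝ × ℝ × ℝ) →ᵇ 𝔸

lemma integrable_decayWeight_smul {h : ℝ → 𝔸} (hc : Continuous h) {C : ℝ}
    (hbd : ∀ s, ‖h s‖ ≤ C) : Integrable fun s => decayWeight s • h s := by
  refine Integrable.mono' (integrable_decayWeight.mul_const C)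
    (continuous_decayWeight.smul hc).aestronglyMeasurable (Eventually.of_forall fun s => ?_)
  rw [norm_smul, Real.norm_of_nonneg (decayWeight_pos s).le]
  exact mul_le_mul_of_nonneg_left (hbd s) (decayWeight_pos s).le

lemma norm_setIntegral_decayWeight_smul_le {h : ℝ → 𝔸} {C : ℝ}
    (hbd : ∀ s, ‖h s‖ ≤ C) (S : Set ℝ) : ‖∫ s in S, decayWeight s • h s‖ ≤ Real.pi * C := by
  have hC : 0 ≤ C := (norm_nonneg _).trans (hbd 0)
  calc ‖∫ s in S, decayWeight s • h s‖ ≤ ∫ s in S, decayWeight s * C := by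
        refine norm_integral_le_of_norm_le ((integrable_decayWeight.mul_const C).integrableOn)
          (Eventually.of_forall fun s => ?_)
        rw [norm_smul, Real.norm_of_nonneg (decayWeight_pos s).le]
        exact mul_le_mul_of_nonneg_left (hbd s) (decayWeight_pos s).le
    _ ≤ ∫ s, decayWeight s * C :=
        setIntegral_le_integral (integrable_decayWeight.mul_const C)
          (Eventually.of_forall fun s => mul_nonneg (decayWeight_pos s).le hC)
    _ = Real.pi * C := by rw [integral_mul_const, integral_decayWeight]

/-- The operator `f ↦ (z ↦ ∫_{s ≤ c(z)} f(g(z, s)) ds / (1 + s²))` on bounded functions. -/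
def halfLineIntegral (c : ℝ × ℝ × ℝ → ℝ) (hc : Continuous c)
    (g : (ℝ × ℝ × ℝ) → ℝ → ℝ × ℝ × ℝ) (hg : Continuous (Function.uncurry g)) :
    Triple 𝔸 →L[ℂ] Triple 𝔸 :=
  LinearMap.mkContinuous
    { toFun := fun f => BoundedContinuousFunction.ofNormedAddCommGroup
        (fun z => ∫ s in Set.Iic (c z), decayWeight s • f (g z s))
        (continuous_setIntegral_Iic_of_dominated hc
          (g := fun s => decayWeight s * ‖f‖)
          (fun z => (continuous_decayWeight.smul
            (f.continuous.comp (hg.comp (by fun_prop : Continuous fun s => (z, s))))).aestronglyMeasurable)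
          (fun s => (f.continuous.comp
            (hg.comp (by fun_prop : Continuous fun z => (z, s)))).const_smul (decayWeight s))
          (integrable_decayWeight.mul_const _)
          (fun z s => by
            rw [norm_smul, Real.norm_of_nonneg (decayWeight_pos s).le]
            exact mul_le_mul_of_nonneg_left (f.norm_coe_le_norm _) (decayWeight_pos s).le))
        (Real.pi * ‖f‖)
        (fun z => norm_setIntegral_decayWeight_smul_le (fun s => f.norm_coe_le_norm _) _)
      map_add' := fun f₁ f₂ => by
        ext z
        have h : ∀ f : Triple 𝔸, Integrable fun s => decayWeight s • f (g z s) := fun f =>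
          integrable_decayWeight_smul
            (f.continuous.comp (hg.comp (by fun_prop : Continuous fun s => (z, s))))
            (fun s => f.norm_coe_le_norm _)
        simp only [BoundedContinuousFunction.coe_ofNormedAddCommGroup,
          BoundedContinuousFunction.coe_add, Pi.add_apply, smul_add]
        exact integral_add (h f₁).integrableOn (h f₂).integrableOn
      map_smul' := fun a f => by
        ext z
        simp only [BoundedContinuousFunction.coe_ofNormedAddCommGroup,
          BoundedContinuousFunction.coe_smul, RingHom.id_apply]
        rw [← integral_smul]
        simp_rw [smul_comm a] }
    Real.pi
    (fun f => BoundedContinuousFunction.norm_ofNormedAddCommGroup_le _ (by positivity)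
      (fun z => norm_setIntegral_decayWeight_smul_le (fun s => f.norm_coe_le_norm _) _))

/-- `f ↦ ∫_{-∞}^ξ f(s, η, τ) ds / (1 + s²)`. -/
def leftIntegral : Triple 𝔸 →L[ℂ] Triple 𝔸 :=
  halfLineIntegral (fun z => z.1) (by fun_prop) (fun z s => (s, z.2.1, z.2.2)) (by
    unfold Function.uncurry; fun_prop)

/-- `f ↦ ∫_η^∞ f(ξ, s, τ) ds / (1 + s²)`, with the substitution `s ↦ -s` built in. -/
def rightIntegral : Triple 𝔸 →L[ℂ] Triple 𝔸 :=
  halfLineIntegral (fun z => -z.2.1) (by fun_prop) (fun z s => (z.1, -s, z.2.2)) (by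
    unfold Function.uncurry; fun_prop)

lemma leftIntegral_apply (f : Triple 𝔸) (ξ η τ : ℝ) :
    leftIntegral f (ξ, η, τ) = ∫ s in Set.Iic ξ, decayWeight s • f (s, η, τ) := rfl

lemma rightIntegral_apply (f : Triple 𝔸) (ξ η τ : ℝ) :
    rightIntegral f (ξ, η, τ) = ∫ s in Set.Ioi η, decayWeight s • f (ξ, s, τ) := by
  have h : rightIntegral f (ξ, η, τ)
    = ∫ s in Set.Iic (-η), decayWeight s • f (ξ, -s, τ) := rfl
  rw [h]
  have h2 := integral_comp_neg_Iic (-η) fun s => decayWeight s • f (ξ, s, τ)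
  simp only [decayWeight_neg, neg_neg] at h2
  exact h2

/-- Pull-back of bounded functions along a continuous map, as a linear operator. -/
def pullback (g : ℝ × ℝ × ℝ → ℝ × ℝ × ℝ) (hg : Continuous g) : Triple 𝔸 →L[ℂ] Triple 𝔸 :=
  LinearMap.mkContinuous
    { toFun := fun f => f.compContinuous ⟨g, hg⟩
      map_add' := fun _ _ => rfl
      map_smul' := fun _ _ => rfl }
    1 (fun f => by
      rw [one_mul]
      exact (BoundedContinuousFunction.norm_le (norm_nonneg _)).2 fun z => f.norm_coe_le_norm _)

/-- Restriction to the front `η = τ` of the wave. -/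
def frontTrace : Triple 𝔸 →L[ℂ] Triple 𝔸 :=
  pullback (fun z => (z.1, z.2.2, z.2.2)) (by fun_prop)

/-- `f ↦ ∫_τ^η f(ξ, s, τ) ds / (1 + s²)`. -/
def frontIntegral : Triple 𝔸 →L[ℂ] Triple 𝔸 :=
  frontTrace ∘L rightIntegral - rightIntegral

lemma integrable_slice_left (f : Triple 𝔸) (η τ : ℝ) :
    Integrable fun s => decayWeight s • f (s, η, τ) :=
  integrable_decayWeight_smul (by fun_prop) fun s => f.norm_coe_le_norm _

lemma integrable_slice_mid (f : Triple 𝔸) (ξ τ : ℝ) :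
    Integrable fun s => decayWeight s • f (ξ, s, τ) :=
  integrable_decayWeight_smul (by fun_prop) fun s => f.norm_coe_le_norm _

lemma frontIntegral_apply (f : Triple 𝔸) (ξ η τ : ℝ) :
    frontIntegral f (ξ, η, τ) = ∫ s in τ..η, decayWeight s • f (ξ, s, τ) := by
  have h : frontIntegral f (ξ, η, τ)
    = rightIntegral f (ξ, τ, τ) - rightIntegral f (ξ, η, τ) := rfl
  rw [h, rightIntegral_apply, rightIntegral_apply]
  exact (intervalIntegral.integral_Ioi_sub_Ioi' (integrable_slice_mid f ξ τ).integrableOn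
    (integrable_slice_mid f ξ τ).integrableOn)

lemma tendsto_leftIntegral_atBot (f : Triple 𝔸) (η τ : ℝ) :
    Tendsto (fun x => leftIntegral f (x, η, τ)) atBot (𝓝 0) := by
  have h := intervalIntegral_tendsto_integral_Iic (μ := volume) (0 : ℝ)
    (integrable_slice_left f η τ).integrableOn tendsto_id
  have h1 : ∀ x, leftIntegral f (x, η, τ)
      = (∫ s in Set.Iic 0, decayWeight s • f (s, η, τ)) - ∫ s in x..0, decayWeight s • f (s, η, τ) :=
    fun x => by
      rw [leftIntegral_apply, ← intervalIntegral.integral_Iic_sub_Iic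
        (integrable_slice_left f η τ).integrableOn (integrable_slice_left f η τ).integrableOn]
      abel
  rw [funext h1]
  simpa using h.const_sub (∫ s in Set.Iic 0, decayWeight s • f (s, η, τ))

lemma tendsto_rightIntegral_atTop (f : Triple 𝔸) (ξ τ : ℝ) :
    Tendsto (fun y => rightIntegral f (ξ, y, τ)) atTop (𝓝 0) := by
  have h := intervalIntegral_tendsto_integral_Ioi (μ := volume) (0 : ℝ)
    (integrable_slice_mid f ξ τ).integrableOn tendsto_id
  have h1 : ∀ y, rightIntegral f (ξ, y, τ)
      = (∫ s in Set.Ioi 0, decayWeight s • f (ξ, s, τ)) - ∫ s in 0..y, decayWeight s • f (ξ, s, τ) :=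
    fun y => by
      rw [rightIntegral_apply, ← intervalIntegral.integral_Ioi_sub_Ioi'
        (integrable_slice_mid f ξ τ).integrableOn (integrable_slice_mid f ξ τ).integrableOn]
      abel
  rw [funext h1]
  simpa using h.const_sub (∫ s in Set.Ioi 0, decayWeight s • f (ξ, s, τ))

/-- Differentiation under the integral sign: `∂_η` commutes with the integration over `ξ`. -/
lemma hasDerivAt_leftIntegral_mid {f g : Triple 𝔸}
    (hfg : ∀ ξ η τ, HasDerivAt (fun y => f (ξ, y, τ)) (g (ξ, η, τ)) η) (ξ η τ : ℝ) :
    HasDerivAt (fun y => leftIntegral f (ξ, y, τ)) (leftIntegral g (ξ, η, τ)) η := by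
  simp_rw [leftIntegral_apply]
  refine (hasDerivAt_integral_of_dominated_loc_of_deriv_le (s := Set.univ)
    (bound := fun s => decayWeight s * ‖g‖) univ_mem
    (Eventually.of_forall fun y => (integrable_slice_left f y τ).integrableOn.aestronglyMeasurable)
    (integrable_slice_left f η τ).integrableOn
    (integrable_slice_left g η τ).integrableOn.aestronglyMeasurable
    (Eventually.of_forall fun s y _ => ?_) (integrable_decayWeight.mul_const _).integrableOn
    (Eventually.of_forall fun s y _ => (hfg s y τ).const_smul _)).2
  refine (norm_smul_le (decayWeight s) _).trans ?_
  rw [Real.norm_of_nonneg (decayWeight_pos s).le]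
  exact mul_le_mul_of_nonneg_left (g.norm_coe_le_norm _) (decayWeight_pos s).le

variable [CompleteSpace 𝔸]

lemma hasDerivAt_leftIntegral (f : Triple 𝔸) (ξ η τ : ℝ) :
    HasDerivAt (fun x => leftIntegral f (x, η, τ)) (decayWeight ξ • f (ξ, η, τ)) ξ := by
  have hc : Continuous fun s => decayWeight s • f (s, η, τ) :=
    continuous_decayWeight.smul (by fun_prop)
  have h1 : ∀ x, leftIntegral f (x, η, τ)
      = (∫ s in Set.Iic 0, decayWeight s • f (s, η, τ)) + ∫ s in 0..x, decayWeight s • f (s, η, τ) :=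
    fun x => by
      rw [leftIntegral_apply, ← intervalIntegral.integral_Iic_sub_Iic
        (integrable_slice_left f η τ).integrableOn (integrable_slice_left f η τ).integrableOn]
      abel
  simp_rw [h1]
  exact (intervalIntegral.integral_hasDerivAt_right (hc.intervalIntegrable _ _)
    hc.stronglyMeasurable.stronglyMeasurableAtFilter hc.continuousAt).const_add _

lemma hasDerivAt_frontIntegral (f : Triple 𝔸) (ξ η τ : ℝ) :
    HasDerivAt (fun y => frontIntegral f (ξ, y, τ)) (decayWeight η • f (ξ, η, τ)) η := by
  have hc : Continuous fun s => decayWeight s • f (ξ, s, τ) :=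
    continuous_decayWeight.smul (by fun_prop)
  simp_rw [frontIntegral_apply]
  exact intervalIntegral.integral_hasDerivAt_right (hc.intervalIntegrable _ _)
    hc.stronglyMeasurable.stronglyMeasurableAtFilter hc.continuousAt

lemma hasDerivAt_rightIntegral (f : Triple 𝔸) (ξ η τ : ℝ) :
    HasDerivAt (fun y => rightIntegral f (ξ, y, τ)) (-(decayWeight η • f (ξ, η, τ))) η := by
  have h : ∀ y, rightIntegral f (ξ, y, τ) = rightIntegral f (ξ, τ, τ) - frontIntegral f (ξ, y, τ) :=
    fun y => by
      have h : frontIntegral f (ξ, y, τ)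
        = rightIntegral f (ξ, τ, τ) - rightIntegral f (ξ, y, τ) := rfl
      rw [h]; abel
  rw [funext h]
  exact (hasDerivAt_frontIntegral f ξ η τ).const_sub _

/-- A function is recovered from its derivative and its vanishing at `-∞`. -/
lemma eq_leftIntegral_of_hasDerivAt {h : ℝ → 𝔸} {f : Triple 𝔸} {η τ : ℝ}
    (hd : ∀ ξ, HasDerivAt h (decayWeight ξ • f (ξ, η, τ)) ξ) (h0 : Tendsto h atBot (𝓝 0)) (ξ : ℝ) :
    h ξ = leftIntegral f (ξ, η, τ) := by
  have hd' : ∀ x, HasDerivAt (fun x => h x - leftIntegral f (x, η, τ)) 0 x := fun x => by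
    simpa using (hd x).fun_sub (hasDerivAt_leftIntegral f x η τ)
  have hconst := is_const_of_deriv_eq_zero (fun x => (hd' x).differentiableAt)
    (fun x => (hd' x).deriv)
  have hlim := h0.sub (tendsto_leftIntegral_atBot f η τ)
  have : Tendsto (fun x => h x - leftIntegral f (x, η, τ)) atBot
      (𝓝 (h ξ - leftIntegral f (ξ, η, τ))) :=
    tendsto_const_nhds.congr fun x => hconst ξ x
  have h2 := tendsto_nhds_unique this hlim
  rw [sub_zero] at h2
  exact sub_eq_zero.1 h2

/-- A function is recovered from its derivative and its vanishing at `+∞`. -/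
lemma eq_rightIntegral_of_hasDerivAt {h : ℝ → 𝔸} {f : Triple 𝔸} {ξ τ : ℝ}
    (hd : ∀ η, HasDerivAt h (-(decayWeight η • f (ξ, η, τ))) η) (h0 : Tendsto h atTop (𝓝 0))
    (η : ℝ) : h η = rightIntegral f (ξ, η, τ) := by
  have hd' : ∀ x, HasDerivAt (fun x => h x - rightIntegral f (ξ, x, τ)) 0 x := fun x => by
    simpa using (hd x).fun_sub (hasDerivAt_rightIntegral f ξ x τ)
  have hconst := is_const_of_deriv_eq_zero (fun x => (hd' x).differentiableAt)
    (fun x => (hd' x).deriv)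
  have hlim := h0.sub (tendsto_rightIntegral_atTop f ξ τ)
  have : Tendsto (fun x => h x - rightIntegral f (ξ, x, τ)) atTop
      (𝓝 (h η - rightIntegral f (ξ, η, τ))) :=
    tendsto_const_nhds.congr fun x => hconst η x
  have h2 := tendsto_nhds_unique this hlim
  rw [sub_zero] at h2
  exact sub_eq_zero.1 h2

/-- A function is recovered from its derivative and its vanishing on the front. -/
lemma eq_frontIntegral_of_hasDerivAt {h : ℝ → 𝔸} {f : Triple 𝔸} {ξ τ : ℝ}
    (hd : ∀ η, HasDerivAt h (decayWeight η • f (ξ, η, τ)) η) (h0 : h τ = 0)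
    (η : ℝ) : h η = frontIntegral f (ξ, η, τ) := by
  have hd' : ∀ x, HasDerivAt (fun x => h x - frontIntegral f (ξ, x, τ)) 0 x := fun x => by
    simpa using (hd x).fun_sub (hasDerivAt_frontIntegral f ξ x τ)
  have hconst := is_const_of_deriv_eq_zero (fun x => (hd' x).differentiableAt)
    (fun x => (hd' x).deriv)
  have h2 := hconst η τ
  rw [h0, frontIntegral_apply f ξ τ τ, intervalIntegral.integral_same, sub_zero] at h2
  exact sub_eq_zero.1 h2

end

noncomputable section

variable {𝔸 : Type*} [NormedRing 𝔸] [NormedAlgebra ℂ 𝔸]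

/-! ### The Goursat problem with an incident impulse -/

/-- Multiplication by a bounded continuous real function. -/
def scaleBy (φ : (ℝ × ℝ × ℝ) →ᵇ ℝ) : Triple 𝔸 →L[ℂ] Triple 𝔸 :=
  LinearMap.mkContinuous
    { toFun := fun f => BoundedContinuousFunction.ofNormedAddCommGroup (fun z => φ z • f z)
        (by fun_prop) (‖φ‖ * ‖f‖) (fun z => by
          rw [norm_smul]
          exact mul_le_mul (φ.norm_coe_le_norm z) (f.norm_coe_le_norm z) (norm_nonneg _)
            (norm_nonneg _))
      map_add' := fun f g => by ext z; simp
      map_smul' := fun a f => by ext z; exact smul_comm (φ z) a (f z) }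
    ‖φ‖ (fun f => BoundedContinuousFunction.norm_ofNormedAddCommGroup_le _ (by positivity)
      fun z => by
          rw [norm_smul]
          exact mul_le_mul (φ.norm_coe_le_norm z) (f.norm_coe_le_norm z) (norm_nonneg _)
            (norm_nonneg _))

@[simp] lemma scaleBy_apply (φ : (ℝ × ℝ × ℝ) →ᵇ ℝ) (f : Triple 𝔸) (z : ℝ × ℝ × ℝ) :
    scaleBy φ f z = φ z • f z := rfl

lemma scaleBy_mul_scaleBy {φ ψ : (ℝ × ℝ × ℝ) →ᵇ ℝ} (h : ∀ z, φ z * ψ z = 1) :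
    (scaleBy φ * scaleBy ψ : Triple 𝔸 →L[ℂ] Triple 𝔸) = 1 := by
  ext f z
  change φ z • ψ z • f z = f z
  rw [smul_smul, h, one_smul]

/-- The Volterra operator `f ↦ ¼ ∫_τ^η U(ξ, s) ∫_{-∞}^ξ V(s', s) f(s', s, τ) ds' ds` (with weights)
of the Goursat problem. The inner integral runs from `τ` in either direction. -/
def goursatOp (U V : Triple 𝔸) : Triple 𝔸 →L[ℂ] Triple 𝔸 :=
  (4⁻¹ : ℂ) • (frontIntegral ∘L (ContinuousLinearMap.mul ℂ (Triple 𝔸) U ∘L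
    (leftIntegral ∘L ContinuousLinearMap.mul ℂ (Triple 𝔸) V)))

lemma goursatOp_apply (U V f : Triple 𝔸) :
    goursatOp U V f = (4⁻¹ : ℂ) • frontIntegral (U * leftIntegral (V * f)) := rfl

lemma contDiff_goursatOp {n : WithTop ℕ∞} :
    ContDiff ℂ n fun p : Triple 𝔸 × Triple 𝔸 => goursatOp p.1 p.2 := by
  unfold goursatOp
  refine ContDiff.const_smul _ (contDiff_const.clm_comp (ContDiff.clm_comp ?_
    (contDiff_const.clm_comp ?_)))
  · exact (ContinuousLinearMap.mul ℂ (Triple 𝔸)).contDiff.comp contDiff_fst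
  · exact (ContinuousLinearMap.mul ℂ (Triple 𝔸)).contDiff.comp contDiff_snd

lemma abs_arctan_sub_le (x y : ℝ) : |Real.arctan x - Real.arctan y| ≤ Real.pi := by
  have h1 := Real.arctan_lt_pi_div_two x
  have h2 := Real.arctan_lt_pi_div_two y
  have h3 := Real.neg_pi_div_two_lt_arctan x
  have h4 := Real.neg_pi_div_two_lt_arctan y
  rw [abs_le]; constructor <;> linarith

/-- The weight `cosh (l (arctan η - arctan τ))`: the integral operator is contractive in the
correspondingly weighted norm once `l` is large. It is `cosh` rather than `exp` since the kernels
are functions of all `η`, on both sides of the front `η = τ`; and `arctan` keeps it bounded. -/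
def coshWeight (l : ℝ) : (ℝ × ℝ × ℝ) →ᵇ ℝ :=
  BoundedContinuousFunction.ofNormedAddCommGroup
    (fun z => Real.cosh (l * (Real.arctan z.2.1 - Real.arctan z.2.2))) (by fun_prop)
    (Real.cosh (l * Real.pi)) (fun z => by
      rw [Real.norm_of_nonneg (Real.cosh_pos _).le, Real.cosh_le_cosh, abs_mul, abs_mul]
      exact mul_le_mul_of_nonneg_left ((abs_arctan_sub_le _ _).trans (le_abs_self _))
        (abs_nonneg _))

/-- The reciprocal of `coshWeight l`. -/
def coshWeightInv (l : ℝ) : (ℝ × ℝ × ℝ) →ᵇ ℝ :=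
  BoundedContinuousFunction.ofNormedAddCommGroup
    (fun z => (Real.cosh (l * (Real.arctan z.2.1 - Real.arctan z.2.2)))⁻¹)
    (Continuous.inv₀ (by fun_prop) fun z => (Real.cosh_pos _).ne')
    1 (fun z => by
      rw [Real.norm_of_nonneg (by positivity)]
      exact inv_le_one_of_one_le₀ (Real.one_le_cosh _))

lemma abs_integral_coshWeight_le {l : ℝ} (hl : 0 < l) (η τ : ℝ) :
    |∫ s in τ..η, decayWeight s * Real.cosh (l * (Real.arctan s - Real.arctan τ))|
      ≤ l⁻¹ * Real.cosh (l * (Real.arctan η - Real.arctan τ)) := by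
  have hd : ∀ s : ℝ, HasDerivAt
      (fun s => l⁻¹ * Real.sinh (l * (Real.arctan s - Real.arctan τ)))
      (decayWeight s * Real.cosh (l * (Real.arctan s - Real.arctan τ))) s := fun s => by
    have h := ((((Real.hasDerivAt_arctan s).sub_const (Real.arctan τ)).const_mul l).sinh).const_mul
      l⁻¹
    refine h.congr_deriv ?_
    unfold decayWeight
    field_simp
  have hint : ∫ s in τ..η, decayWeight s * Real.cosh (l * (Real.arctan s - Real.arctan τ))
      = l⁻¹ * Real.sinh (l * (Real.arctan η - Real.arctan τ)) := by
    rw [intervalIntegral.integral_eq_sub_of_hasDerivAt (fun s _ => hd s)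
      ((continuous_decayWeight.mul (by fun_prop)).intervalIntegrable _ _)]
    simp
  rw [hint, abs_mul, abs_of_pos (inv_pos.2 hl)]
  refine mul_le_mul_of_nonneg_left ?_ (inv_pos.2 hl).le
  rw [Real.abs_sinh]
  exact (Real.sinh_lt_cosh _).le.trans (Real.cosh_abs _).le

lemma norm_leftIntegral_mul_le (V f : Triple 𝔸) {C ξ η τ : ℝ} (hf : ∀ s, ‖f (s, η, τ)‖ ≤ C) :
    ‖leftIntegral (V * f) (ξ, η, τ)‖ ≤ Real.pi * (‖V‖ * C) := by
  rw [leftIntegral_apply]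
  refine norm_setIntegral_decayWeight_smul_le (fun s => ?_) _
  exact (norm_mul_le _ _).trans (mul_le_mul (V.norm_coe_le_norm _) (hf s) (norm_nonneg _)
    (norm_nonneg _))

/-- In the norm weighted by `coshWeight l` the Goursat operator has norm `O(1 / l)`. -/
lemma norm_goursatOp_coshWeight_le (U V f : Triple 𝔸) {l : ℝ} (hl : 0 < l) (z : ℝ × ℝ × ℝ) :
    ‖goursatOp U V (scaleBy (coshWeight l) f) z‖
      ≤ (4⁻¹ * (Real.pi * ‖U‖ * ‖V‖) * l⁻¹ * ‖f‖) * coshWeight l z := by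
  obtain ⟨ξ, η, τ⟩ := z
  set φ : ℝ → ℝ := fun s => Real.cosh (l * (Real.arctan s - Real.arctan τ)) with hφ
  have hφ0 : ∀ s, 0 < φ s := fun s => Real.cosh_pos _
  have h1 : ∀ s, ‖leftIntegral (V * scaleBy (coshWeight l) f) (ξ, s, τ)‖
      ≤ Real.pi * (‖V‖ * (φ s * ‖f‖)) := fun s => by
    refine norm_leftIntegral_mul_le _ _ fun s' => ?_
    rw [scaleBy_apply, norm_smul]
    refine mul_le_mul (le_of_eq ?_) (f.norm_coe_le_norm _) (norm_nonneg _) (hφ0 s).le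
    exact Real.norm_of_nonneg (hφ0 s).le
  rw [goursatOp_apply, BoundedContinuousFunction.coe_smul, norm_smul, frontIntegral_apply]
  have h2 : ‖∫ s in τ..η, decayWeight s •
      (U * leftIntegral (V * scaleBy (coshWeight l) f)) (ξ, s, τ)‖
      ≤ |∫ s in τ..η, (Real.pi * ‖U‖ * ‖V‖ * ‖f‖) * (decayWeight s * φ s)| := by
    refine intervalIntegral.norm_integral_le_abs_of_norm_le (Eventually.of_forall fun s => ?_)
      (((continuous_decayWeight.mul (by fun_prop)).const_mul _).intervalIntegrable _ _)
    rw [norm_smul, Real.norm_of_nonneg (decayWeight_pos s).le]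
    calc decayWeight s * ‖(U * leftIntegral (V * scaleBy (coshWeight l) f)) (ξ, s, τ)‖
        ≤ decayWeight s * (‖U‖ * (Real.pi * (‖V‖ * (φ s * ‖f‖)))) := by
          refine mul_le_mul_of_nonneg_left ((norm_mul_le _ _).trans ?_) (decayWeight_pos s).le
          exact mul_le_mul (U.norm_coe_le_norm _) (h1 s) (norm_nonneg _) (norm_nonneg _)
      _ = _ := by ring
  have h3 := abs_integral_coshWeight_le hl η τ
  rw [intervalIntegral.integral_const_mul, abs_mul, abs_of_nonneg (by positivity)] at h2
  have h4 : ‖(4⁻¹ : ℂ)‖ = 4⁻¹ := by simp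
  rw [h4]
  calc _ ≤ 4⁻¹ * ((Real.pi * ‖U‖ * ‖V‖ * ‖f‖) * (l⁻¹ * φ η)) := by
        refine mul_le_mul_of_nonneg_left (h2.trans ?_) (by norm_num)
        exact mul_le_mul_of_nonneg_left h3 (by positivity)
    _ = (4⁻¹ * (Real.pi * ‖U‖ * ‖V‖) * l⁻¹ * ‖f‖) * φ η := by ring

variable [CompleteSpace 𝔸]

/-- The Volterra equation of the second kind is uniquely solvable for arbitrary potentials:
conjugated with the weight, the operator becomes a contraction. -/
lemma isUnit_one_sub_goursatOp (U V : Triple 𝔸) : IsUnit (1 - goursatOp U V) := by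
  set C := 4⁻¹ * (Real.pi * ‖U‖ * ‖V‖) with hC
  have hC0 : 0 ≤ C := by positivity
  -- the weighted norm is at most `C / l`
  set l := C + 1 with hl
  have hl0 : 0 < l := by positivity
  have e1 : ∀ z, coshWeight l z * coshWeightInv l z = 1 := fun z =>
    mul_inv_cancel₀ (Real.cosh_pos _).ne'
  have hu1 := scaleBy_mul_scaleBy (𝔸 := 𝔸) e1
  have hu2 := scaleBy_mul_scaleBy (𝔸 := 𝔸) fun z => (mul_comm _ _).trans (e1 z)
  set M : Triple 𝔸 →L[ℂ] Triple 𝔸 := scaleBy (coshWeight l) with hM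
  set M' : Triple 𝔸 →L[ℂ] Triple 𝔸 := scaleBy (coshWeightInv l) with hM'
  have hnorm : ‖M' * goursatOp U V * M‖ < 1 := by
    refine lt_of_le_of_lt (ContinuousLinearMap.opNorm_le_bound _
      (by positivity : 0 ≤ C * l⁻¹) fun f => ?_) ?_
    · refine (BoundedContinuousFunction.norm_le (by positivity)).2 fun z => ?_
      have hz : 0 < coshWeight l z := Real.cosh_pos _
      have h := norm_goursatOp_coshWeight_le U V f hl0 z
      have h' : (M' * goursatOp U V * M) f z
        = (coshWeight l z)⁻¹ • goursatOp U V (scaleBy (coshWeight l) f) z := rfl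
      rw [h', norm_smul, Real.norm_of_nonneg (inv_pos.2 hz).le, inv_mul_le_iff₀ hz, mul_comm]
      exact h
    · rw [← div_eq_mul_inv, div_lt_one hl0]
      linarith
  have hfac : 1 - goursatOp U V = M * (1 - M' * goursatOp U V * M) * M' := by
    have : M * (1 - M' * goursatOp U V * M) * M'
        = M * M' - (M * M') * goursatOp U V * (M * M') := by
      simp only [mul_sub, sub_mul, mul_one, mul_assoc]
    rw [this, hu1]; simp
  rw [hfac]
  have uM : IsUnit M := ⟨⟨M, M', hu1, hu2⟩, rfl⟩
  have uM' : IsUnit M' := ⟨⟨M', M, hu2, hu1⟩, rfl⟩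
  exact (uM.mul (isUnit_one_sub_of_norm_lt_one (R := Triple 𝔸 →L[ℂ] Triple 𝔸) hnorm)).mul uM'

lemma eq_inverse_of_eq_add_goursatOp {U V f g : Triple 𝔸} (h : f = g + goursatOp U V f) :
    f = Ring.inverse (1 - goursatOp U V) g := by
  have h1 : (1 - goursatOp U V) f = g := by
    change f - goursatOp U V f = g
    nth_rewrite 1 [h]; abel
  have h2 := Ring.inverse_mul_cancel _ (isUnit_one_sub_goursatOp U V)
  rw [← h1]
  exact (congrArg (fun A : Triple 𝔸 →L[ℂ] Triple 𝔸 => A f) h2).symm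

/-- The weight `1 / (1 + η²)` as a bounded function. -/
def midWeight : (ℝ × ℝ × ℝ) →ᵇ ℝ :=
  BoundedContinuousFunction.ofNormedAddCommGroup (fun z => decayWeight z.2.1)
    (continuous_decayWeight.comp (by fun_prop)) 1 (fun z => by
      rw [Real.norm_of_nonneg (decayWeight_pos _).le]; exact decayWeight_le_one _)

/-- The value `-½ u(ξ, τ)` of the first component on the front, in terms of `U = (1 + η²) u`. -/
def frontValue (U : Triple 𝔸) : Triple 𝔸 := (-2⁻¹ : ℂ) • frontTrace (scaleBy midWeight U)

/-- The first component of the wave generated by the impulse `δ(η - τ)` in the second component,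
for the potential `u = U / (1 + η²)`, `v = V / (1 + ξ²)`. -/
def goursatFst (U V : Triple 𝔸) : Triple 𝔸 :=
  Ring.inverse (1 - goursatOp U V) (frontValue U)

/-- The regular part of the second component of the wave generated by an impulse in the second
component. -/
def goursatSnd (U V : Triple 𝔸) : Triple 𝔸 := (-2⁻¹ : ℂ) • leftIntegral (V * goursatFst U V)

lemma goursatFst_eq_add_goursatOp (U V : Triple 𝔸) :
    goursatFst U V = frontValue U + goursatOp U V (goursatFst U V) := by
  have h2 := Ring.mul_inverse_cancel _ (isUnit_one_sub_goursatOp U V)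
  have h3 : (1 - goursatOp U V) (goursatFst U V) = frontValue U :=
    congrArg (fun A : Triple 𝔸 →L[ℂ] Triple 𝔸 => A (frontValue U)) h2
  rw [← h3]
  exact (sub_add_cancel (goursatFst U V) (goursatOp U V (goursatFst U V))).symm

lemma goursatFst_eq (U V : Triple 𝔸) :
    goursatFst U V = frontValue U + (-2⁻¹ : ℂ) • frontIntegral (U * goursatSnd U V) := by
  conv_lhs => rw [goursatFst_eq_add_goursatOp, goursatOp_apply]
  rw [goursatSnd, mul_smul_comm, map_smul, smul_smul]
  norm_num

/-- The pair `(k₁, k₂)` is determined by its two integral equations. -/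
lemma goursatFst_unique {U V f g : Triple 𝔸} (h2 : g = (-2⁻¹ : ℂ) • leftIntegral (V * f))
    (h1 : f = frontValue U + (-2⁻¹ : ℂ) • frontIntegral (U * g)) : f = goursatFst U V := by
  refine eq_inverse_of_eq_add_goursatOp ?_
  conv_lhs => rw [h1, h2]
  rw [goursatOp_apply, mul_smul_comm, map_smul, smul_smul]
  norm_num

/-- Without an incident impulse the Goursat problem has only the zero solution. -/
lemma eq_zero_of_homogeneous_goursat {U V f g : Triple 𝔸}
    (h2 : g = (-2⁻¹ : ℂ) • leftIntegral (V * f))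
    (h1 : f = (-2⁻¹ : ℂ) • frontIntegral (U * g)) : f = 0 := by
  have h : f = 0 + goursatOp U V f := by
    conv_lhs => rw [h1, h2]
    rw [goursatOp_apply, mul_smul_comm, map_smul, smul_smul]
    norm_num
  rw [eq_inverse_of_eq_add_goursatOp h, map_zero]

/-- The impulse response depends smoothly on the potentials, because inversion of operators is smooth. -/
lemma contDiff_goursatFst {n : WithTop ℕ∞} :
    ContDiff ℂ n fun p : Triple 𝔸 × Triple 𝔸 => goursatFst p.1 p.2 := by
  refine contDiff_iff_contDiffAt.2 fun p => ContDiffAt.clm_apply ?_ ?_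
  · obtain ⟨x, hx⟩ := isUnit_one_sub_goursatOp p.1 p.2
    have h := contDiffAt_ringInverse ℂ (n := n) (R := Triple 𝔸 →L[ℂ] Triple 𝔸) x
    rw [hx] at h
    have h1 : ContDiff ℂ n fun p : Triple 𝔸 × Triple 𝔸 => 1 - goursatOp p.1 p.2 :=
      contDiff_const.sub contDiff_goursatOp
    exact ContDiffAt.comp (g := Ring.inverse) p h h1.contDiffAt
  · refine ContDiff.contDiffAt ?_
    unfold frontValue
    exact ContDiff.const_smul _ ((ContinuousLinearMap.contDiff (𝕜 := ℂ) (E := Triple 𝔸)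
      (F := Triple 𝔸) (frontTrace ∘L scaleBy midWeight)).comp contDiff_fst)

end

noncomputable section

variable {𝔸 : Type*} [NormedRing 𝔸] [NormedAlgebra ℂ 𝔸]

/-! ### Families of bounded functions depending differentiably on parameters -/

/-- Evaluation at a point, as a real-linear map. -/
abbrev evalAt (p : ℝ × ℝ × ℝ) : Triple 𝔸 →L[ℝ] 𝔸 := BoundedContinuousFunction.evalCLM ℝ p

/-- Pointwise differentiability is differentiability for the supremum norm if the pointwise
derivative depends continuously on the parameter in the supremum norm. -/
lemma hasFDerivAt_of_pointwise {Z : Type*} [NormedAddCommGroup Z] [NormedSpace ℝ Z]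
    {f : Z → Triple 𝔸} {f' : Z → Z →L[ℝ] Triple 𝔸} {z : Z} {s : Set Z} (hs : s ∈ 𝓝 z)
    (hf' : ContinuousAt f' z)
    (h : ∀ y ∈ s, ∀ p, HasFDerivAt (fun y => f y p) ((evalAt p).comp (f' y)) y) :
    HasFDerivAt f (f' z) z := by
  refine HasFDerivAt.of_isLittleO (Asymptotics.isLittleO_iff.2 fun c hc => ?_)
  have h1 : ∀ᶠ y in 𝓝 z, ‖f' y - f' z‖ ≤ c := by
    filter_upwards [(Metric.continuousAt_iff' (f := f') (b := z)).1 hf' c hc] with y hy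
    exact (dist_eq_norm (f' y) (f' z)).symm.le.trans hy.le
  obtain ⟨r, hr, hball⟩ := Metric.mem_nhds_iff.1 (inter_mem hs h1)
  filter_upwards [Metric.ball_mem_nhds z hr] with y hy
  refine (BoundedContinuousFunction.norm_le (by positivity)).2 fun p => ?_
  have hev : ‖(evalAt p : Triple 𝔸 →L[ℝ] 𝔸)‖ ≤ 1 :=
    ContinuousLinearMap.opNorm_le_bound _ zero_le_one fun g => by
      rw [one_mul]; exact g.norm_coe_le_norm p
  refine (convex_ball z r).norm_image_sub_le_of_norm_hasFDerivWithin_le'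
    (f := fun y => f y p) (φ := (evalAt p).comp (f' z))
    (fun x hx => (h x (hball hx).1 p).hasFDerivWithinAt) (fun x hx => ?_)
    (Metric.mem_ball_self hr) hy
  rw [← ContinuousLinearMap.comp_sub]
  calc _ ≤ ‖(evalAt p : Triple 𝔸 →L[ℝ] 𝔸)‖ * ‖f' x - f' z‖ := ContinuousLinearMap.opNorm_comp_le _ _
    _ ≤ 1 * c := mul_le_mul hev (hball hx).2 (norm_nonneg (f' x - f' z)) zero_le_one
    _ = c := one_mul c

lemma hasDerivAt_of_pointwise {f f' : ℝ → Triple 𝔸} {t : ℝ} {s : Set ℝ} (hs : s ∈ 𝓝 t)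
    (hf' : ContinuousAt f' t) (h : ∀ y ∈ s, ∀ p, HasDerivAt (fun y => f y p) (f' y p) y) :
    HasDerivAt f (f' t) t := by
  have := hasFDerivAt_of_pointwise (f := f)
    (f' := fun y => ContinuousLinearMap.toSpanSingleton ℝ (f' y)) hs
    ((ContinuousLinearMap.toSpanSingletonCLE (𝕜 := ℝ) (E := Triple 𝔸)).continuous.continuousAt.comp hf')
    (fun y hy p => by
      refine (h y hy p).hasFDerivAt.congr_fderiv ?_
      ext; simp)
  simpa using this.hasDerivAt

lemma HasDerivAt.eval {f : ℝ → Triple 𝔸} {f' : Triple 𝔸} {t : ℝ} (h : HasDerivAt f f' t)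
    (p : ℝ × ℝ × ℝ) : HasDerivAt (fun s => f s p) (f' p) t :=
  ((evalAt p : Triple 𝔸 →L[ℝ] 𝔸).hasFDerivAt (x := f t)).comp_hasDerivAt t h

lemma HasDerivAt.mapTriple {f : ℝ → Triple 𝔸} {f' : Triple 𝔸} {t : ℝ} (h : HasDerivAt f f' t)
    (L : Triple 𝔸 →L[ℂ] Triple 𝔸) : HasDerivAt (fun s => L (f s)) (L f') t :=
  (L.restrictScalars ℝ).hasFDerivAt.comp_hasDerivAt t h

/-! ### Schwartz functions as bounded functions with a weight -/

/-- The polynomial weight `(1 + ξ²)(1 + η²)`. -/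
def growthWeight (z : ℝ × ℝ) : ℝ := (1 + z.1 ^ 2) * (1 + z.2 ^ 2)

lemma growthWeight_pos (z : ℝ × ℝ) : 0 < growthWeight z := by unfold growthWeight; positivity

lemma growthWeight_le (z : ℝ × ℝ) : growthWeight z ≤ (1 + ‖z‖) ^ 4 := by
  have h1 : |z.1| ≤ ‖z‖ := norm_fst_le z
  have h2 : |z.2| ≤ ‖z‖ := norm_snd_le z
  have h1' : 1 + z.1 ^ 2 ≤ (1 + ‖z‖) ^ 2 := by
    rw [← sq_abs]; nlinarith [abs_nonneg z.1, norm_nonneg z]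
  have h2' : 1 + z.2 ^ 2 ≤ (1 + ‖z‖) ^ 2 := by
    rw [← sq_abs z.2]; nlinarith [abs_nonneg z.2, norm_nonneg z]
  calc growthWeight z ≤ (1 + ‖z‖) ^ 2 * (1 + ‖z‖) ^ 2 :=
        mul_le_mul h1' h2' (by positivity) (by positivity)
    _ = _ := by ring

lemma hasTemperateGrowth_growthWeight : Function.HasTemperateGrowth growthWeight := by
  unfold growthWeight
  have h1 : Function.HasTemperateGrowth fun z : ℝ × ℝ => z.1 :=
    (ContinuousLinearMap.fst ℝ ℝ ℝ).hasTemperateGrowth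
  have h2 : Function.HasTemperateGrowth fun z : ℝ × ℝ => z.2 :=
    (ContinuousLinearMap.snd ℝ ℝ ℝ).hasTemperateGrowth
  have h3 : Function.HasTemperateGrowth fun _ : ℝ × ℝ => (1 : ℝ) :=
    Function.HasTemperateGrowth.const 1
  exact (h3.add (h1.pow 2)).mul (h3.add (h2.pow 2))

/-- `u ↦ ((ξ, η, τ) ↦ (1 + ξ²)(1 + η²) u(ξ, η))`. -/
def weighted (u : 𝓢(ℝ × ℝ, 𝔸)) : Triple 𝔸 :=
  (SchwartzMap.toBoundedContinuousFunctionCLM ℝ (ℝ × ℝ) 𝔸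
    (SchwartzMap.smulLeftCLM 𝔸 growthWeight u)).compContinuous
    ⟨fun z : ℝ × ℝ × ℝ => (z.1, z.2.1), by fun_prop⟩

lemma weighted_apply (u : 𝓢(ℝ × ℝ, 𝔸)) (ξ η τ : ℝ) :
    weighted u (ξ, η, τ) = growthWeight (ξ, η) • u (ξ, η) := by
  change (SchwartzMap.smulLeftCLM 𝔸 growthWeight u) (ξ, η) = _
  rw [SchwartzMap.smulLeftCLM_apply_apply hasTemperateGrowth_growthWeight]

lemma continuous_weighted : Continuous (weighted : 𝓢(ℝ × ℝ, 𝔸) → Triple 𝔸) := by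
  unfold weighted
  exact (BoundedContinuousFunction.continuous_compContinuous _).comp
    ((SchwartzMap.toBoundedContinuousFunctionCLM ℝ (ℝ × ℝ) 𝔸).continuous.comp
      (SchwartzMap.smulLeftCLM 𝔸 growthWeight).continuous)

lemma SchwartzMap.exists_one_add_norm_pow_le {F : Type*} [NormedAddCommGroup F] [NormedSpace ℝ F]
    (u : 𝓢(ℝ × ℝ, F)) : ∃ C, 0 ≤ C ∧ ∀ z, (1 + ‖z‖) ^ 4 * ‖u z‖ ≤ C := by
  have h := fun z => SchwartzMap.one_add_le_sup_seminorm_apply (𝕜 := ℝ) (m := (4, 0)) (k := 4)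
    (n := 0) le_rfl le_rfl u z
  simp_rw [norm_iteratedFDeriv_zero] at h
  exact ⟨_, (by positivity : (0 : ℝ) ≤ (1 + ‖(0 : ℝ × ℝ)‖) ^ 4 * ‖u 0‖).trans (h 0), h⟩

/-- The translate `z ↦ u(z + a)`. -/
abbrev shiftBy (a : ℝ × ℝ) (u : 𝓢(ℝ × ℝ, 𝔸)) : 𝓢(ℝ × ℝ, 𝔸) :=
  SchwartzMap.compSubConstCLM ℝ (-a) u

lemma shiftBy_apply (a z : ℝ × ℝ) (u : 𝓢(ℝ × ℝ, 𝔸)) : shiftBy a u z = u (z + a) := by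
  rw [shiftBy, SchwartzMap.compSubConstCLM_apply, sub_neg_eq_add]

open LineDeriv in
/-- `∂u/∂ξ` -/
abbrev dxi (u : 𝓢(ℝ × ℝ, 𝔸)) : 𝓢(ℝ × ℝ, 𝔸) := ∂_{((1, 0) : ℝ × ℝ)} u

open LineDeriv in
/-- `∂u/∂η` -/
abbrev deta (u : 𝓢(ℝ × ℝ, 𝔸)) : 𝓢(ℝ × ℝ, 𝔸) := ∂_{((0, 1) : ℝ × ℝ)} u

lemma fderiv_apply_eq (u : 𝓢(ℝ × ℝ, 𝔸)) (z h : ℝ × ℝ) :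
    fderiv ℝ u z h = h.1 • dxi u z + h.2 • deta u z := by
  rw [SchwartzMap.lineDerivOp_apply_eq_fderiv, SchwartzMap.lineDerivOp_apply_eq_fderiv,
    ← map_smul, ← map_smul, ← map_add]
  simp

lemma hasDerivAt_fst (u : 𝓢(ℝ × ℝ, 𝔸)) (ξ η : ℝ) :
    HasDerivAt (fun x => u (x, η)) (dxi u (ξ, η)) ξ := by
  have h := (u.hasFDerivAt (ξ, η)).comp_hasDerivAt ξ
    ((hasDerivAt_id ξ).prodMk (hasDerivAt_const ξ η))
  rw [fderiv_apply_eq] at h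
  refine h.congr_deriv ?_
  simp

lemma hasDerivAt_snd (u : 𝓢(ℝ × ℝ, 𝔸)) (ξ η : ℝ) :
    HasDerivAt (fun y => u (ξ, y)) (deta u (ξ, η)) η := by
  have h := (u.hasFDerivAt (ξ, η)).comp_hasDerivAt η
    ((hasDerivAt_const η ξ).prodMk (hasDerivAt_id η))
  rw [fderiv_apply_eq] at h
  refine h.congr_deriv ?_
  simp

lemma continuous_weighted_shiftBy (u : 𝓢(ℝ × ℝ, 𝔸)) :
    Continuous fun a => weighted (shiftBy a u) := by
  obtain ⟨C, hC0, hC⟩ := (SchwartzMap.fderivCLM ℝ (ℝ × ℝ) 𝔸 u).exists_one_add_norm_pow_le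
  refine continuous_iff_continuousAt.2 fun a => ?_
  set D := (2 + ‖a‖) ^ 4 * C with hD
  have key : ∀ b ∈ Metric.ball a 1,
      ‖weighted (shiftBy b u) - weighted (shiftBy a u)‖ ≤ D * ‖b - a‖ := fun b hb => by
    refine (BoundedContinuousFunction.norm_le (by positivity)).2 fun p => ?_
    obtain ⟨ξ, η, τ⟩ := p
    set z : ℝ × ℝ := (ξ, η) with hz
    have e : (weighted (shiftBy b u) - weighted (shiftBy a u)) (ξ, η, τ)
        = growthWeight z • (u (z + b) - u (z + a)) := by
      rw [BoundedContinuousFunction.coe_sub, Pi.sub_apply, weighted_apply, weighted_apply,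
        shiftBy_apply, shiftBy_apply, smul_sub]
    rw [e, norm_smul, Real.norm_of_nonneg (growthWeight_pos z).le]
    have hmv : ‖u (z + b) - u (z + a)‖ ≤ (D / growthWeight z) * ‖b - a‖ := by
      refine (convex_ball a 1).norm_image_sub_le_of_norm_hasFDerivWithin_le
        (f := fun c => u (z + c)) (f' := fun c => fderiv ℝ u (z + c)) (fun c _ => ?_)
        (fun c hc => ?_) (Metric.mem_ball_self one_pos) hb
      · exact ((u.hasFDerivAt (z + c)).comp c
          ((hasFDerivAt_id c).const_add z)).hasFDerivWithinAt
      · have h1 := hC (z + c)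
        rw [SchwartzMap.fderivCLM_apply] at h1
        rw [le_div_iff₀ (growthWeight_pos z)]
        have hc' : ‖c‖ ≤ ‖a‖ + 1 := by
          have h2 : ‖c - a‖ < 1 := by simpa [dist_eq_norm] using hc
          have := norm_add_le a (c - a)
          rw [add_sub_cancel] at this
          linarith
        have h3 : ‖z‖ ≤ ‖z + c‖ + ‖c‖ := by
          have := norm_sub_le (z + c) c
          rwa [add_sub_cancel_right] at this
        have h4 : growthWeight z ≤ (2 + ‖a‖) ^ 4 * (1 + ‖z + c‖) ^ 4 := by
          refine (growthWeight_le z).trans ?_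
          rw [← mul_pow]
          refine pow_le_pow_left₀ (by positivity) ?_ 4
          nlinarith [norm_nonneg (z + c), norm_nonneg a]
        calc ‖fderiv ℝ u (z + c)‖ * growthWeight z
            ≤ ‖fderiv ℝ u (z + c)‖ * ((2 + ‖a‖) ^ 4 * (1 + ‖z + c‖) ^ 4) :=
              mul_le_mul_of_nonneg_left h4 (norm_nonneg _)
          _ = (2 + ‖a‖) ^ 4 * ((1 + ‖z + c‖) ^ 4 * ‖fderiv ℝ u (z + c)‖) := by ring
          _ ≤ D := mul_le_mul_of_nonneg_left h1 (by positivity)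
    calc growthWeight z * ‖u (z + b) - u (z + a)‖
        ≤ growthWeight z * ((D / growthWeight z) * ‖b - a‖) :=
          mul_le_mul_of_nonneg_left hmv (growthWeight_pos z).le
      _ = D * ‖b - a‖ := by field_simp [(growthWeight_pos z).ne']
  rw [ContinuousAt, tendsto_iff_norm_sub_tendsto_zero]
  refine squeeze_zero' (Eventually.of_forall fun _ => norm_nonneg _)
    (eventually_of_mem (Metric.ball_mem_nhds a one_pos) key) ?_
  have : Tendsto (fun b => D * ‖b - a‖) (𝓝 a) (𝓝 (D * ‖a - a‖)) :=
    Continuous.tendsto (by fun_prop) a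
  simpa using this

lemma hasFDerivAt_weighted_shiftBy (u : 𝓢(ℝ × ℝ, 𝔸)) (a : ℝ × ℝ) :
    HasFDerivAt (fun a => weighted (shiftBy a u))
      ((ContinuousLinearMap.fst ℝ ℝ ℝ).smulRight (weighted (shiftBy a (dxi u)))
        + (ContinuousLinearMap.snd ℝ ℝ ℝ).smulRight (weighted (shiftBy a (deta u)))) a := by
  refine hasFDerivAt_of_pointwise (f' := fun a =>
    (ContinuousLinearMap.fst ℝ ℝ ℝ).smulRight (weighted (shiftBy a (dxi u)))
        + (ContinuousLinearMap.snd ℝ ℝ ℝ).smulRight (weighted (shiftBy a (deta u))))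
    univ_mem ?_ fun b _ p => ?_
  · refine Continuous.continuousAt (Continuous.add ?_ ?_)
    · exact (ContinuousLinearMap.smulRightL ℝ (ℝ × ℝ) (Triple 𝔸)
        (ContinuousLinearMap.fst ℝ ℝ ℝ)).continuous.comp (continuous_weighted_shiftBy _)
    · exact (ContinuousLinearMap.smulRightL ℝ (ℝ × ℝ) (Triple 𝔸)
        (ContinuousLinearMap.snd ℝ ℝ ℝ)).continuous.comp (continuous_weighted_shiftBy _)
  · obtain ⟨ξ, η, τ⟩ := p
    simp_rw [weighted_apply, shiftBy_apply]
    refine (((u.hasFDerivAt ((ξ, η) + b)).comp b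
      ((hasFDerivAt_id b).const_add (ξ, η))).const_smul (growthWeight (ξ, η))).congr_fderiv ?_
    refine ContinuousLinearMap.ext fun h => ?_
    have e : ((evalAt (ξ, η, τ)).comp
      ((ContinuousLinearMap.fst ℝ ℝ ℝ).smulRight (weighted (shiftBy b (dxi u)))
        + (ContinuousLinearMap.snd ℝ ℝ ℝ).smulRight (weighted (shiftBy b (deta u))))) h
        = h.1 • weighted (shiftBy b (dxi u)) (ξ, η, τ)
          + h.2 • weighted (shiftBy b (deta u)) (ξ, η, τ) := rfl
    rw [e, weighted_apply, weighted_apply, shiftBy_apply, shiftBy_apply]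
    change growthWeight (ξ, η) • fderiv ℝ u ((ξ, η) + b) h = _
    rw [fderiv_apply_eq, smul_add, smul_comm, smul_comm (growthWeight (ξ, η)) h.2]

/-- Translation acts smoothly on a Schwartz potential in the weighted supremum norm, each derivative
costing one derivative of the potential. -/
lemma contDiff_weighted_shiftBy (n : ℕ) (u : 𝓢(ℝ × ℝ, 𝔸)) :
    ContDiff ℝ n fun a => weighted (shiftBy a u) := by
  induction n generalizing u with
  | zero => exact contDiff_zero.2 (continuous_weighted_shiftBy u)
  | succ n ih =>
    push_cast
    rw [contDiff_succ_iff_hasFDerivAt]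
    · refine ⟨_, ?_, fun a => hasFDerivAt_weighted_shiftBy u a⟩
      refine ContDiff.add ?_ ?_
      · exact (ContinuousLinearMap.smulRightL ℝ (ℝ × ℝ) (Triple 𝔸)
          (ContinuousLinearMap.fst ℝ ℝ ℝ)).contDiff.comp (ih _)
      · exact (ContinuousLinearMap.smulRightL ℝ (ℝ × ℝ) (Triple 𝔸)
          (ContinuousLinearMap.snd ℝ ℝ ℝ)).contDiff.comp (ih _)

end

noncomputable section

variable {𝔸 : Type*} [NormedRing 𝔸] [NormedAlgebra ℂ 𝔸]

/-! ### Derivatives of the impulse response with respect to parameters -/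

lemma triple_smul_apply (c : ℂ) (f : Triple 𝔸) (z : ℝ × ℝ × ℝ) : (c • f) z = c • f z := rfl

/-- The weight `1 / (1 + ξ²)` as a bounded function. -/
def leftWeight : (ℝ × ℝ × ℝ) →ᵇ ℝ :=
  BoundedContinuousFunction.ofNormedAddCommGroup (fun z => decayWeight z.1)
    (continuous_decayWeight.comp (by fun_prop)) 1 (fun z => by
      rw [Real.norm_of_nonneg (decayWeight_pos _).le]; exact decayWeight_le_one _)

/-- The bounded function `(1 + η²) u(ξ, η)`: the weight is that of the integration over `η`, in which
`u` appears. -/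
def etaWeighted (u : 𝓢(ℝ × ℝ, 𝔸)) : Triple 𝔸 := scaleBy leftWeight (weighted u)

/-- The bounded function `(1 + ξ²) v(ξ, η)`: the weight is that of the integration over `ξ`, in which
`v` appears. -/
def xiWeighted (v : 𝓢(ℝ × ℝ, 𝔸)) : Triple 𝔸 := scaleBy midWeight (weighted v)

lemma etaWeighted_apply (u : 𝓢(ℝ × ℝ, 𝔸)) (ξ η τ : ℝ) :
    etaWeighted u (ξ, η, τ) = (1 + η ^ 2) • u (ξ, η) := by
  change decayWeight ξ • weighted u (ξ, η, τ) = _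
  rw [weighted_apply, smul_smul, growthWeight, ← mul_assoc, decayWeight_mul_one_add_sq, one_mul]

lemma xiWeighted_apply (u : 𝓢(ℝ × ℝ, 𝔸)) (ξ η τ : ℝ) :
    xiWeighted u (ξ, η, τ) = (1 + ξ ^ 2) • u (ξ, η) := by
  change decayWeight η • weighted u (ξ, η, τ) = _
  rw [weighted_apply, smul_smul, growthWeight, mul_comm (1 + (ξ, η).1 ^ 2), ← mul_assoc,
    decayWeight_mul_one_add_sq, one_mul]

lemma decayWeight_smul_etaWeighted_mul (u : 𝓢(ℝ × ℝ, 𝔸)) (f : Triple 𝔸) (ξ η τ : ℝ) :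
    decayWeight η • (etaWeighted u * f) (ξ, η, τ) = u (ξ, η) * f (ξ, η, τ) := by
  rw [BoundedContinuousFunction.mul_apply, etaWeighted_apply, smul_mul_assoc, smul_smul,
    decayWeight_mul_one_add_sq, one_smul]

lemma decayWeight_smul_xiWeighted_mul (v : 𝓢(ℝ × ℝ, 𝔸)) (f : Triple 𝔸) (ξ η τ : ℝ) :
    decayWeight ξ • (xiWeighted v * f) (ξ, η, τ) = v (ξ, η) * f (ξ, η, τ) := by
  rw [BoundedContinuousFunction.mul_apply, xiWeighted_apply, smul_mul_assoc, smul_smul,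
    decayWeight_mul_one_add_sq, one_smul]

lemma leftIntegral_xiWeighted_mul (v : 𝓢(ℝ × ℝ, 𝔸)) (f : Triple 𝔸) (ξ η τ : ℝ) :
    leftIntegral (xiWeighted v * f) (ξ, η, τ) = ∫ s in Set.Iic ξ, v (s, η) * f (s, η, τ) := by
  simp_rw [leftIntegral_apply, decayWeight_smul_xiWeighted_mul]

lemma frontIntegral_etaWeighted_mul (u : 𝓢(ℝ × ℝ, 𝔸)) (f : Triple 𝔸) (ξ η τ : ℝ) :
    frontIntegral (etaWeighted u * f) (ξ, η, τ) = ∫ s in τ..η, u (ξ, s) * f (ξ, s, τ) := by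
  simp_rw [frontIntegral_apply, decayWeight_smul_etaWeighted_mul]

lemma frontValue_etaWeighted (u : 𝓢(ℝ × ℝ, 𝔸)) (ξ η τ : ℝ) :
    frontValue (etaWeighted u) (ξ, η, τ) = (-2⁻¹ : ℂ) • u (ξ, τ) := by
  change (-2⁻¹ : ℂ) • (decayWeight τ • etaWeighted u (ξ, τ, τ)) = _
  rw [etaWeighted_apply, smul_smul, decayWeight_mul_one_add_sq, one_smul]

/-- The field `k₁ - ½ ∫_η^∞ u k₂`, which does not depend on `η`: it is the limit of `k₁` as
`η → ∞`. -/
def farField (U V : Triple 𝔸) : Triple 𝔸 :=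
  goursatFst U V + (-2⁻¹ : ℂ) • rightIntegral (U * goursatSnd U V)

/-- The translation `(ξ, η, τ) ↦ (ξ + a₁, η + a₂, τ + a₂)`. -/
def tripleShift (a : ℝ × ℝ) : Triple 𝔸 →L[ℂ] Triple 𝔸 :=
  pullback (fun z => (z.1 + a.1, z.2.1 + a.2, z.2.2 + a.2)) (by fun_prop)

@[simp] lemma tripleShift_apply (a : ℝ × ℝ) (f : Triple 𝔸) (ξ η τ : ℝ) :
    tripleShift a f (ξ, η, τ) = f (ξ + a.1, η + a.2, τ + a.2) := rfl

/-- The first component `k₁(ξ, η, τ)` of the response to an impulse, for Schwartz potentials. The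
response itself is `k₁` behind the front, for `η ≥ τ`, and zero ahead of it; the values for `η < τ`
extend `k₁` by the same integral equations, so that it is smooth. -/
def kerFst (u v : 𝓢(ℝ × ℝ, 𝔸)) : Triple 𝔸 := goursatFst (etaWeighted u) (xiWeighted v)

/-- The regular part `k₂(ξ, η, τ)` of the second component of the response to an impulse, extended to
`η < τ` like `kerFst`. -/
def kerSnd (u v : 𝓢(ℝ × ℝ, 𝔸)) : Triple 𝔸 := goursatSnd (etaWeighted u) (xiWeighted v)

lemma kerSnd_apply (u v : 𝓢(ℝ × ℝ, 𝔸)) (ξ η τ : ℝ) :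
    kerSnd u v (ξ, η, τ) = (-2⁻¹ : ℂ) • ∫ s in Set.Iic ξ, v (s, η) * kerFst u v (s, η, τ) := by
  rw [← leftIntegral_xiWeighted_mul]
  rfl

variable [CompleteSpace 𝔸]

/-- The far field does not depend on `η`. -/
lemma farField_apply_eq (U V : Triple 𝔸) (ξ η η' τ : ℝ) :
    farField U V (ξ, η, τ) = farField U V (ξ, η', τ) := by
  have h : farField U V
      = frontValue U + (-2⁻¹ : ℂ) • frontTrace (rightIntegral (U * goursatSnd U V)) := by
    rw [farField]
    conv_lhs => rw [goursatFst_eq]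
    rw [add_assoc, ← smul_add]
    congr 2
    exact sub_add_cancel _ _
  rw [h]
  rfl

lemma tendsto_goursatFst_atTop (U V : Triple 𝔸) (ξ τ : ℝ) :
    Tendsto (fun η => goursatFst U V (ξ, η, τ)) atTop (𝓝 (farField U V (ξ, τ, τ))) := by
  have h := (tendsto_rightIntegral_atTop (U * goursatSnd U V) ξ τ).const_smul (2⁻¹ : ℂ)
  have h2 := h.const_add (farField U V (ξ, τ, τ))
  rw [smul_zero, add_zero] at h2
  refine h2.congr fun η => ?_
  rw [farField_apply_eq U V ξ τ η τ]
  change goursatFst U V (ξ, η, τ) + (-2⁻¹ : ℂ) • rightIntegral (U * goursatSnd U V) (ξ, η, τ) + _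
    = _
  rw [add_assoc, ← add_smul]
  simp

lemma contDiff_goursatFst_comp {Z : Type*} [NormedAddCommGroup Z] [NormedSpace ℝ Z]
    {n : WithTop ℕ∞} {U V : Z → Triple 𝔸} (hU : ContDiff ℝ n U) (hV : ContDiff ℝ n V) :
    ContDiff ℝ n fun s => goursatFst (U s) (V s) := by
  have hc : ContDiff ℝ n fun p : Triple 𝔸 × Triple 𝔸 => goursatFst p.1 p.2 :=
    contDiff_goursatFst.restrict_scalars ℝ
  exact ContDiff.comp (g := fun p : Triple 𝔸 × Triple 𝔸 => goursatFst p.1 p.2)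
    (f := fun s => (U s, V s)) hc (hU.prodMk hV)

/-- First derivatives of the impulse response along a curve of potentials. -/
lemma exists_hasDerivAt_goursat {U V : ℝ → Triple 𝔸} {U' V' : Triple 𝔸} {t : ℝ}
    (hU : HasDerivAt U U' t) (hV : HasDerivAt V V' t) :
    ∃ a b : Triple 𝔸, HasDerivAt (fun s => goursatFst (U s) (V s)) a t ∧
      HasDerivAt (fun s => goursatSnd (U s) (V s)) b t ∧
      a = frontValue U' +
        (-2⁻¹ : ℂ) • frontIntegral (U' * goursatSnd (U t) (V t) + U t * b) ∧
      b = (-2⁻¹ : ℂ) • leftIntegral (V' * goursatFst (U t) (V t) + V t * a) := by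
  have hc := (contDiff_goursatFst (𝔸 := 𝔸) (n := 1)).restrict_scalars ℝ
  have hk : HasDerivAt (fun s => goursatFst (U s) (V s))
      (deriv (fun s => goursatFst (U s) (V s)) t) t :=
    (DifferentiableAt.comp (g := fun p : Triple 𝔸 × Triple 𝔸 => goursatFst p.1 p.2)
      (f := fun s => (U s, V s)) t (hc.differentiable one_ne_zero (U t, V t))
      (hU.differentiableAt.prodMk hV.differentiableAt)).hasDerivAt
  set a := deriv (fun s => goursatFst (U s) (V s)) t with ha
  have hb : HasDerivAt (fun s => goursatSnd (U s) (V s))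
      ((-2⁻¹ : ℂ) • leftIntegral (V' * goursatFst (U t) (V t) + V t * a)) t :=
    ((hV.mul hk).mapTriple leftIntegral).const_smul (-2⁻¹ : ℂ)
  refine ⟨a, _, hk, hb, ?_, rfl⟩
  have hF : HasDerivAt (fun s => frontValue (U s)) (frontValue U') t :=
    (hU.mapTriple (frontTrace ∘L scaleBy midWeight)).const_smul (-2⁻¹ : ℂ)
  have h2 := hF.add (((hU.mul hb).mapTriple frontIntegral).const_smul (-2⁻¹ : ℂ))
  refine hk.unique (h2.congr_of_eventuallyEq (Eventually.of_forall fun s => ?_))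
  exact goursatFst_eq (U s) (V s)

/-- The derivatives of first and second order of the impulse response along a curve of potentials:
they solve the equations obtained by differentiating the integral equations. -/
structure IsGoursatJet (U V U₁ V₁ U₂ V₂ a₁ b₁ a₂ b₂ : ℝ → Triple 𝔸) : Prop where
  fst : ∀ s, HasDerivAt (fun s => goursatFst (U s) (V s)) (a₁ s) s
  snd : ∀ s, HasDerivAt (fun s => goursatSnd (U s) (V s)) (b₁ s) s
  fst₂ : ∀ s, HasDerivAt a₁ (a₂ s) s
  snd₂ : ∀ s, HasDerivAt b₁ (b₂ s) s
  eq_fst : ∀ s, a₁ s = frontValue (U₁ s) +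
    (-2⁻¹ : ℂ) • frontIntegral (U₁ s * goursatSnd (U s) (V s) + U s * b₁ s)
  eq_snd : ∀ s, b₁ s = (-2⁻¹ : ℂ) • leftIntegral (V₁ s * goursatFst (U s) (V s) + V s * a₁ s)
  eq_fst₂ : ∀ s, a₂ s = frontValue (U₂ s) + (-2⁻¹ : ℂ) • frontIntegral
    (U₂ s * goursatSnd (U s) (V s) + U₁ s * b₁ s + (U₁ s * b₁ s + U s * b₂ s))
  eq_snd₂ : ∀ s, b₂ s = (-2⁻¹ : ℂ) • leftIntegral
    (V₂ s * goursatFst (U s) (V s) + V₁ s * a₁ s + (V₁ s * a₁ s + V s * a₂ s))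

lemma exists_isGoursatJet {U V U₁ V₁ U₂ V₂ : ℝ → Triple 𝔸}
    (hU : ∀ s, HasDerivAt U (U₁ s) s) (hV : ∀ s, HasDerivAt V (V₁ s) s)
    (hU₁ : ∀ s, HasDerivAt U₁ (U₂ s) s) (hV₁ : ∀ s, HasDerivAt V₁ (V₂ s) s)
    (hU2 : ContDiff ℝ 2 U) (hV2 : ContDiff ℝ 2 V) :
    ∃ a₁ b₁ a₂ b₂, IsGoursatJet U V U₁ V₁ U₂ V₂ a₁ b₁ a₂ b₂ := by
  have hk : ContDiff ℝ 2 fun s => goursatFst (U s) (V s) := contDiff_goursatFst_comp hU2 hV2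
  choose a₁ b₁ h1 h2 h3 h4 using fun s => exists_hasDerivAt_goursat (hU s) (hV s)
  have ha₁ : a₁ = deriv fun s => goursatFst (U s) (V s) := funext fun s => (h1 s).deriv.symm
  have hd : Differentiable ℝ a₁ := by
    rw [ha₁]
    exact ((contDiff_succ_iff_deriv (n := 1)).1 hk).2.2.differentiable one_ne_zero
  have hb : ∀ s, HasDerivAt b₁ ((-2⁻¹ : ℂ) • leftIntegral
      (V₂ s * goursatFst (U s) (V s) + V₁ s * a₁ s + (V₁ s * a₁ s + V s * deriv a₁ s))) s :=
    fun s => by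
      rw [funext h4]
      exact ((((hV₁ s).mul (h1 s)).add ((hV s).mul (hd s).hasDerivAt)).mapTriple
        leftIntegral).const_smul (-2⁻¹ : ℂ)
  refine ⟨a₁, b₁, deriv a₁, _, h1, h2, fun s => (hd s).hasDerivAt, hb, h3, h4, fun s => ?_,
    fun s => rfl⟩
  have hF : HasDerivAt (fun s => frontValue (U₁ s)) (frontValue (U₂ s)) s :=
    ((hU₁ s).mapTriple (frontTrace ∘L scaleBy midWeight)).const_smul (-2⁻¹ : ℂ)
  have h5 := hF.add (((((hU₁ s).mul (h2 s)).add ((hU s).mul (hb s))).mapTriple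
    frontIntegral).const_smul (-2⁻¹ : ℂ))
  refine (hd s).hasDerivAt.unique (h5.congr_of_eventuallyEq (Eventually.of_forall fun s => ?_))
  exact h3 s

lemma contDiff_farField {n : WithTop ℕ∞} :
    ContDiff ℂ n fun p : Triple 𝔸 × Triple 𝔸 => farField p.1 p.2 := by
  have hk := contDiff_goursatFst (𝔸 := 𝔸) (n := n)
  have hs : ContDiff ℂ n fun p : Triple 𝔸 × Triple 𝔸 => goursatSnd p.1 p.2 :=
    ContDiff.const_smul _ ((ContinuousLinearMap.contDiff (𝕜 := ℂ) (E := Triple 𝔸)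
      (F := Triple 𝔸) leftIntegral).comp (contDiff_snd.mul hk))
  exact hk.add (ContDiff.const_smul _ ((ContinuousLinearMap.contDiff (𝕜 := ℂ) (E := Triple 𝔸)
      (F := Triple 𝔸) rightIntegral).comp (contDiff_fst.mul hs)))

/-! ### The transmission kernel and its behaviour under translations -/

/-- The kernel `(ξ, τ) ↦ lim_{η → ∞} k₁(ξ, η, τ)` by which an impulse incident in the second
component is scattered into the first one. -/
def transmission (u v : 𝓢(ℝ × ℝ, 𝔸)) (z : ℝ × ℝ) : 𝔸 :=
  farField (etaWeighted u) (xiWeighted v) (z.1, z.2, z.2)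

lemma kerFst_apply (u v : 𝓢(ℝ × ℝ, 𝔸)) (ξ η τ : ℝ) :
    kerFst u v (ξ, η, τ) = (-2⁻¹ : ℂ) • u (ξ, τ)
      + (-2⁻¹ : ℂ) • ∫ s in τ..η, u (ξ, s) * kerSnd u v (ξ, s, τ) := by
  have h := congrArg (fun f : Triple 𝔸 => f (ξ, η, τ))
    (goursatFst_eq (etaWeighted u) (xiWeighted v))
  change kerFst u v (ξ, η, τ) = frontValue (etaWeighted u) (ξ, η, τ)
    + (-2⁻¹ : ℂ) • frontIntegral (etaWeighted u * kerSnd u v) (ξ, η, τ) at h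
  rw [h, frontValue_etaWeighted, frontIntegral_etaWeighted_mul]

lemma tendsto_kerFst_atTop (u v : 𝓢(ℝ × ℝ, 𝔸)) (ξ τ : ℝ) :
    Tendsto (fun η => kerFst u v (ξ, η, τ)) atTop (𝓝 (transmission u v (ξ, τ))) :=
  tendsto_goursatFst_atTop _ _ ξ τ

/-- Translating the potentials translates the impulse response, by uniqueness for the Goursat problem. -/
lemma kerFst_shiftBy (a : ℝ × ℝ) (u v : 𝓢(ℝ × ℝ, 𝔸)) :
    kerFst (shiftBy a u) (shiftBy a v) = tripleShift a (kerFst u v) ∧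
    kerSnd (shiftBy a u) (shiftBy a v) = tripleShift a (kerSnd u v) := by
  have hs : tripleShift a (kerSnd u v) = (-2⁻¹ : ℂ) •
      leftIntegral (xiWeighted (shiftBy a v) * tripleShift a (kerFst u v)) := by
    ext ⟨ξ, η, τ⟩
    rw [tripleShift_apply, kerSnd_apply, triple_smul_apply,
      leftIntegral_xiWeighted_mul]
    congr 1
    have hp : MeasurePreserving (fun s : ℝ => s + a.1) := measurePreserving_add_right volume a.1
    have h := hp.setIntegral_preimage_emb (measurableEmbedding_addRight a.1)
      (fun s => v (s, η + a.2) * kerFst u v (s, η + a.2, τ + a.2)) (Set.Iic (ξ + a.1))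
    rw [← h]
    have hset : (fun s : ℝ => s + a.1) ⁻¹' Set.Iic (ξ + a.1) = Set.Iic ξ := by ext s; simp
    rw [hset]
    refine integral_congr_ae (Eventually.of_forall fun s => ?_)
    simp only [shiftBy_apply, tripleShift_apply]
    rfl
  have hf : tripleShift a (kerFst u v) = frontValue (etaWeighted (shiftBy a u)) + (-2⁻¹ : ℂ) •
      frontIntegral (etaWeighted (shiftBy a u) * tripleShift a (kerSnd u v)) := by
    ext ⟨ξ, η, τ⟩
    rw [tripleShift_apply, kerFst_apply, BoundedContinuousFunction.coe_add, Pi.add_apply,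
      frontValue_etaWeighted, triple_smul_apply, frontIntegral_etaWeighted_mul,
      ← intervalIntegral.integral_comp_add_right (fun s =>
        u (ξ + a.1, s) * kerSnd u v (ξ + a.1, s, τ + a.2))]
    simp only [shiftBy_apply]
    rfl
  have h1 := goursatFst_unique hs hf
  refine ⟨h1.symm, ?_⟩
  rw [hs, h1]
  rfl

lemma farField_shiftBy (a : ℝ × ℝ) (u v : 𝓢(ℝ × ℝ, 𝔸)) (ξ η τ : ℝ) :
    farField (etaWeighted (shiftBy a u)) (xiWeighted (shiftBy a v)) (ξ, η, τ)
      = transmission u v ((ξ, τ) + a) := by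
  rw [farField_apply_eq _ _ ξ η τ τ]
  have h1 := tendsto_kerFst_atTop (shiftBy a u) (shiftBy a v) ξ τ
  have h2 := (tendsto_kerFst_atTop u v (ξ + a.1) (τ + a.2)).comp (tendsto_atTop_add_const_right
    atTop a.2 tendsto_id)
  rw [(kerFst_shiftBy a u v).1] at h1
  exact tendsto_nhds_unique h1 h2

end

noncomputable section

variable {𝔸 : Type*} [NormedRing 𝔸] [NormedAlgebra ℂ 𝔸]

/-! ### Derivatives of the impulse response along translations -/

open LineDeriv in
lemma hasDerivAt_weighted_shiftBy (u : 𝓢(ℝ × ℝ, 𝔸)) (e : ℝ × ℝ) (s : ℝ) :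
    HasDerivAt (fun s : ℝ => weighted (shiftBy (s • e) u))
      (weighted (shiftBy (s • e) (∂_{e} u))) s := by
  have h := (hasFDerivAt_weighted_shiftBy u (s • e)).comp_hasDerivAt s
    ((hasDerivAt_id s).smul_const e)
  refine h.congr_deriv ?_
  ext ⟨ξ, η, τ⟩
  have e1 : (((ContinuousLinearMap.fst ℝ ℝ ℝ).smulRight (weighted (shiftBy (s • e) (dxi u)))
        + (ContinuousLinearMap.snd ℝ ℝ ℝ).smulRight (weighted (shiftBy (s • e) (deta u))))
        ((1 : ℝ) • e)) (ξ, η, τ)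
      = ((1 : ℝ) • e).1 • weighted (shiftBy (s • e) (dxi u)) (ξ, η, τ)
        + ((1 : ℝ) • e).2 • weighted (shiftBy (s • e) (deta u)) (ξ, η, τ) := rfl
  refine e1.trans ?_
  rw [one_smul, weighted_apply, weighted_apply, weighted_apply, shiftBy_apply, shiftBy_apply,
    shiftBy_apply, SchwartzMap.lineDerivOp_apply_eq_fderiv e, fderiv_apply_eq, smul_add,
    smul_comm, smul_comm e.2]

open LineDeriv in
lemma hasDerivAt_etaWeighted_shiftBy (u : 𝓢(ℝ × ℝ, 𝔸)) (e : ℝ × ℝ) (s : ℝ) :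
    HasDerivAt (fun s : ℝ => etaWeighted (shiftBy (s • e) u))
      (etaWeighted (shiftBy (s • e) (∂_{e} u))) s :=
  (hasDerivAt_weighted_shiftBy u e s).mapTriple (scaleBy leftWeight)

open LineDeriv in
lemma hasDerivAt_xiWeighted_shiftBy (u : 𝓢(ℝ × ℝ, 𝔸)) (e : ℝ × ℝ) (s : ℝ) :
    HasDerivAt (fun s : ℝ => xiWeighted (shiftBy (s • e) u))
      (xiWeighted (shiftBy (s • e) (∂_{e} u))) s :=
  (hasDerivAt_weighted_shiftBy u e s).mapTriple (scaleBy midWeight)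

lemma contDiff_etaWeighted_shiftBy (u : 𝓢(ℝ × ℝ, 𝔸)) :
    ContDiff ℝ 2 fun a : ℝ × ℝ => etaWeighted (shiftBy a u) :=
  ((scaleBy leftWeight : Triple 𝔸 →L[ℂ] Triple 𝔸).restrictScalars ℝ).contDiff.comp
    (contDiff_weighted_shiftBy 2 u)

lemma contDiff_xiWeighted_shiftBy (u : 𝓢(ℝ × ℝ, 𝔸)) :
    ContDiff ℝ 2 fun a : ℝ × ℝ => xiWeighted (shiftBy a u) :=
  ((scaleBy midWeight : Triple 𝔸 →L[ℂ] Triple 𝔸).restrictScalars ℝ).contDiff.comp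
    (contDiff_weighted_shiftBy 2 u)

lemma shiftBy_zero (u : 𝓢(ℝ × ℝ, 𝔸)) : shiftBy ((0 : ℝ × ℝ)) u = u := by
  ext z; rw [shiftBy_apply, add_zero]

lemma frontValue_apply {U : Triple 𝔸} {x : 𝔸} {ξ τ : ℝ}
    (h : decayWeight τ • U (ξ, τ, τ) = x) (η : ℝ) :
    frontValue U (ξ, η, τ) = (-2⁻¹ : ℂ) • x := by
  rw [← h]; rfl

lemma tendsto_front_add_integral_atTop (U g : Triple 𝔸) (ξ τ : ℝ) :
    Tendsto (fun η => (frontValue U + (-2⁻¹ : ℂ) • frontIntegral g) (ξ, η, τ)) atTop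
      (𝓝 ((frontValue U + (-2⁻¹ : ℂ) • frontIntegral g + (-2⁻¹ : ℂ) • rightIntegral g)
        (ξ, τ, τ))) := by
  have h := ((tendsto_rightIntegral_atTop g ξ τ).const_smul (2⁻¹ : ℂ)).const_add
    ((frontValue U + (-2⁻¹ : ℂ) • frontIntegral g + (-2⁻¹ : ℂ) • rightIntegral g) (ξ, τ, τ))
  rw [smul_zero, add_zero] at h
  refine h.congr fun η => ?_
  have e : ∀ y, frontIntegral g (ξ, y, τ)
    = rightIntegral g (ξ, τ, τ) - rightIntegral g (ξ, y, τ) := fun y => rfl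
  simp only [BoundedContinuousFunction.add_apply, triple_smul_apply, e]
  have e2 : frontValue U (ξ, τ, τ) = frontValue U (ξ, η, τ) := rfl
  rw [e2]
  module

lemma HasDerivAt.shift_zero {f : ℝ → 𝔸} {f' : 𝔸} {s : ℝ} (h : HasDerivAt f f' s) :
    HasDerivAt (fun r => f (s + r)) f' 0 := by
  have h' : HasDerivAt f f' (s + 0) := by rwa [add_zero]
  exact h'.comp_const_add s 0

variable [CompleteSpace 𝔸]

/-- Integral equations for the derivatives, at the potentials `u`, `v` themselves, of the impulse
response under translation of the potentials in the direction `e`; `f₁` and `f₂` are the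
corresponding derivatives of the transmission kernel. -/
structure IsTranslationJet (e : ℝ × ℝ) (u v u₁ v₁ u₂ v₂ : 𝓢(ℝ × ℝ, 𝔸))
    (a₁ b₁ a₂ b₂ : Triple 𝔸) (f₁ f₂ : ℝ × ℝ → 𝔸) : Prop where
  eq_fst : a₁ = frontValue (etaWeighted u₁) +
    (-2⁻¹ : ℂ) • frontIntegral (etaWeighted u₁ * kerSnd u v + etaWeighted u * b₁)
  eq_snd : b₁ = (-2⁻¹ : ℂ) • leftIntegral (xiWeighted v₁ * kerFst u v + xiWeighted v * a₁)
  eq_fst₂ : a₂ = frontValue (etaWeighted u₂) + (-2⁻¹ : ℂ) • frontIntegral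
    (etaWeighted u₂ * kerSnd u v + etaWeighted u₁ * b₁ + (etaWeighted u₁ * b₁ + etaWeighted u * b₂))
  eq_snd₂ : b₂ = (-2⁻¹ : ℂ) • leftIntegral
    (xiWeighted v₂ * kerFst u v + xiWeighted v₁ * a₁ + (xiWeighted v₁ * a₁ + xiWeighted v * a₂))
  deriv_fst : ∀ ξ η τ, HasDerivAt
    (fun s : ℝ => kerFst u v (ξ + s * e.1, η + s * e.2, τ + s * e.2)) (a₁ (ξ, η, τ)) 0
  deriv_snd : ∀ ξ η τ, HasDerivAt
    (fun s : ℝ => kerSnd u v (ξ + s * e.1, η + s * e.2, τ + s * e.2)) (b₁ (ξ, η, τ)) 0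
  deriv_fst₂ : ∀ ξ η τ, HasDerivAt
    (fun s : ℝ => a₁ (ξ + s * e.1, η + s * e.2, τ + s * e.2)) (a₂ (ξ, η, τ)) 0
  deriv_snd₂ : ∀ ξ η τ, HasDerivAt
    (fun s : ℝ => b₁ (ξ + s * e.1, η + s * e.2, τ + s * e.2)) (b₂ (ξ, η, τ)) 0
  tendsto₁ : ∀ ξ τ, Tendsto (fun η => a₁ (ξ, η, τ)) atTop (𝓝 (f₁ (ξ, τ)))
  tendsto₂ : ∀ ξ τ, Tendsto (fun η => a₂ (ξ, η, τ)) atTop (𝓝 (f₂ (ξ, τ)))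
  deriv₁ : ∀ z, HasDerivAt (fun s : ℝ => transmission u v (z + s • e)) (f₁ z) 0
  deriv₂ : ∀ z, HasDerivAt (fun s : ℝ => f₁ (z + s • e)) (f₂ z) 0

open LineDeriv in
/-- Differentiating the impulse response of the translated potentials in the translation parameter is,
by `kerFst_shiftBy`, the same as differentiating the impulse response in its own arguments. -/
lemma exists_isTranslationJet (e : ℝ × ℝ) (u v : 𝓢(ℝ × ℝ, 𝔸)) :
    ∃ a₁ b₁ a₂ b₂ f₁ f₂, IsTranslationJet e u v (∂_{e} u) (∂_{e} v) (∂_{e} (∂_{e} u))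
      (∂_{e} (∂_{e} v)) a₁ b₁ a₂ b₂ f₁ f₂ := by
  obtain ⟨a₁, b₁, a₂, b₂, H⟩ := exists_isGoursatJet
    (hasDerivAt_etaWeighted_shiftBy u e) (hasDerivAt_xiWeighted_shiftBy v e)
    (hasDerivAt_etaWeighted_shiftBy (∂_{e} u) e) (hasDerivAt_xiWeighted_shiftBy (∂_{e} v) e)
    ((contDiff_etaWeighted_shiftBy u).comp (contDiff_id.smul contDiff_const))
    ((contDiff_xiWeighted_shiftBy v).comp (contDiff_id.smul contDiff_const))
  have hz : (0 : ℝ) • e = 0 := zero_smul ℝ e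
  have cov1 : ∀ s : ℝ, goursatFst (etaWeighted (shiftBy (s • e) u)) (xiWeighted (shiftBy (s • e) v))
      = tripleShift (s • e) (kerFst u v) := fun s => (kerFst_shiftBy (s • e) u v).1
  have cov2 : ∀ s : ℝ, goursatSnd (etaWeighted (shiftBy (s • e) u)) (xiWeighted (shiftBy (s • e) v))
      = tripleShift (s • e) (kerSnd u v) := fun s => (kerFst_shiftBy (s • e) u v).2
  -- pointwise derivatives of the translated responses
  have d1 : ∀ s ξ η τ, HasDerivAt
      (fun s : ℝ => kerFst u v (ξ + s * e.1, η + s * e.2, τ + s * e.2)) (a₁ s (ξ, η, τ)) s :=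
    fun s ξ η τ => ((H.fst s).eval (ξ, η, τ)).congr_of_eventuallyEq
      (Eventually.of_forall fun r => by dsimp only; rw [cov1]; rfl)
  have d2 : ∀ s ξ η τ, HasDerivAt
      (fun s : ℝ => kerSnd u v (ξ + s * e.1, η + s * e.2, τ + s * e.2)) (b₁ s (ξ, η, τ)) s :=
    fun s ξ η τ => ((H.snd s).eval (ξ, η, τ)).congr_of_eventuallyEq
      (Eventually.of_forall fun r => by dsimp only; rw [cov2]; rfl)
  have c1 : ∀ s ξ η τ, a₁ s (ξ, η, τ) = a₁ 0 (ξ + s * e.1, η + s * e.2, τ + s * e.2) :=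
    fun s ξ η τ => by
      have h1 := (d1 s ξ η τ).shift_zero
      refine h1.unique ((d1 0 (ξ + s * e.1) (η + s * e.2) (τ + s * e.2)).congr_of_eventuallyEq
        (Eventually.of_forall fun r => ?_))
      dsimp only
      congr 2
      · ring
      · congr 1 <;> ring
  have c2 : ∀ s ξ η τ, b₁ s (ξ, η, τ) = b₁ 0 (ξ + s * e.1, η + s * e.2, τ + s * e.2) :=
    fun s ξ η τ => by
      have h1 := (d2 s ξ η τ).shift_zero
      refine h1.unique ((d2 0 (ξ + s * e.1) (η + s * e.2) (τ + s * e.2)).congr_of_eventuallyEq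
        (Eventually.of_forall fun r => ?_))
      dsimp only
      congr 2
      · ring
      · congr 1 <;> ring
  -- the derivatives of the far field
  set F : ℝ → Triple 𝔸 := fun s => farField (etaWeighted (shiftBy (s • e) u))
    (xiWeighted (shiftBy (s • e) v)) with hF
  set F₁ : ℝ → Triple 𝔸 := fun s => a₁ s + (-2⁻¹ : ℂ) • rightIntegral
    (etaWeighted (shiftBy (s • e) (∂_{e} u)) *
      goursatSnd (etaWeighted (shiftBy (s • e) u)) (xiWeighted (shiftBy (s • e) v))
      + etaWeighted (shiftBy (s • e) u) * b₁ s) with hF₁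
  have hFd : ∀ s, HasDerivAt F (F₁ s) s := fun s =>
    (H.fst s).add ((((hasDerivAt_etaWeighted_shiftBy u e s).mul (H.snd s)).mapTriple
      rightIntegral).const_smul (-2⁻¹ : ℂ))
  set F₂ : Triple 𝔸 := a₂ 0 + (-2⁻¹ : ℂ) • rightIntegral
    (etaWeighted (shiftBy ((0 : ℝ) • e) (∂_{e} (∂_{e} u))) *
      goursatSnd (etaWeighted (shiftBy ((0 : ℝ) • e) u)) (xiWeighted (shiftBy ((0 : ℝ) • e) v))
      + etaWeighted (shiftBy ((0 : ℝ) • e) (∂_{e} u)) * b₁ 0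
      + (etaWeighted (shiftBy ((0 : ℝ) • e) (∂_{e} u)) * b₁ 0
        + etaWeighted (shiftBy ((0 : ℝ) • e) u) * b₂ 0)) with hF₂
  have hF₁d : HasDerivAt F₁ F₂ 0 :=
    (H.fst₂ 0).add (((((hasDerivAt_etaWeighted_shiftBy (∂_{e} u) e 0).mul
      (H.snd 0)).add ((hasDerivAt_etaWeighted_shiftBy u e 0).mul (H.snd₂ 0))).mapTriple
        rightIntegral).const_smul (-2⁻¹ : ℂ))
  have t1 : ∀ s z, HasDerivAt (fun s : ℝ => transmission u v (z + s • e)) (F₁ s (z.1, z.2, z.2)) s :=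
    fun s z => ((hFd s).eval (z.1, z.2, z.2)).congr_of_eventuallyEq
      (Eventually.of_forall fun r => (farField_shiftBy (r • e) u v z.1 z.2 z.2).symm)
  have c3 : ∀ (s : ℝ) (z : ℝ × ℝ), F₁ s (z.1, z.2, z.2)
      = F₁ 0 ((z + s • e).1, (z + s • e).2, (z + s • e).2) := fun s z => by
    have h1 := (t1 s z).shift_zero
    refine h1.unique ((t1 0 (z + s • e)).congr_of_eventuallyEq
      (Eventually.of_forall fun r => ?_))
    dsimp only
    rw [add_smul, add_assoc]
  have e1 := H.eq_fst 0
  have e2 := H.eq_snd 0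
  have e3 := H.eq_fst₂ 0
  have e4 := H.eq_snd₂ 0
  simp only [hz, shiftBy_zero] at e1 e2 e3 e4
  refine ⟨a₁ 0, b₁ 0, a₂ 0, b₂ 0, fun z => F₁ 0 (z.1, z.2, z.2),
    fun z => F₂ (z.1, z.2, z.2), e1, e2, e3, e4, d1 0, d2 0,
    fun ξ η τ => ?_, fun ξ η τ => ?_, fun ξ τ => ?_, fun ξ τ => ?_, t1 0, fun z => ?_⟩
  rotate_left 4
  · exact (hF₁d.eval (z.1, z.2, z.2)).congr_of_eventuallyEq
      (Eventually.of_forall fun r => (c3 r z).symm)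
  · exact ((H.fst₂ 0).eval (ξ, η, τ)).congr_of_eventuallyEq
      (Eventually.of_forall fun r => (c1 r ξ η τ).symm)
  · exact ((H.snd₂ 0).eval (ξ, η, τ)).congr_of_eventuallyEq
      (Eventually.of_forall fun r => (c2 r ξ η τ).symm)
  · have h := tendsto_front_add_integral_atTop (etaWeighted (∂_{e} u))
      (etaWeighted (∂_{e} u) * goursatSnd (etaWeighted u) (xiWeighted v) + etaWeighted u * b₁ 0) ξ τ
    rw [← e1] at h
    simp only [hF₁, hz, shiftBy_zero]
    exact h
  · have h := tendsto_front_add_integral_atTop (etaWeighted (∂_{e} (∂_{e} u)))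
      (etaWeighted (∂_{e} (∂_{e} u)) * goursatSnd (etaWeighted u) (xiWeighted v)
        + etaWeighted (∂_{e} u) * b₁ 0 + (etaWeighted (∂_{e} u) * b₁ 0 + etaWeighted u * b₂ 0)) ξ τ
    rw [← e3] at h
    simp only [hF₂, hz, shiftBy_zero]
    exact h

/-- The transmission kernel is twice continuously differentiable: translating its arguments
amounts to translating the potentials, on which it depends smoothly. -/
lemma contDiff_transmission (u v : 𝓢(ℝ × ℝ, 𝔸)) : ContDiff ℝ 2 (transmission u v) := by
  have h1 : ContDiff ℝ 2 fun p : Triple 𝔸 × Triple 𝔸 => farField p.1 p.2 :=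
    contDiff_farField.restrict_scalars ℝ
  have h2 := ContDiff.comp (g := fun p : Triple 𝔸 × Triple 𝔸 => farField p.1 p.2)
    (f := fun a : ℝ × ℝ => (etaWeighted (shiftBy a u), xiWeighted (shiftBy a v))) h1
    ((contDiff_etaWeighted_shiftBy u).prodMk (contDiff_xiWeighted_shiftBy v))
  have h3 := (evalAt (𝔸 := 𝔸) (0, 0, 0)).contDiff.comp h2
  have e : transmission u v = fun a : ℝ × ℝ =>
      farField (etaWeighted (shiftBy a u)) (xiWeighted (shiftBy a v)) (0, 0, 0) := by
    ext a
    rw [farField_shiftBy]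
    congr 1
    exact (zero_add a).symm
  rw [e]
  exact h3

end

noncomputable section

/-! ### The evolution equation of the transmission kernel -/

lemma tendsto_zero_mul_bounded {R : Type*} [NormedRing R] {l : Filter ℝ} {f g : ℝ → R}
    (hf : Tendsto f l (𝓝 0)) {C : ℝ} (hg : ∀ s, ‖g s‖ ≤ C) : Tendsto (fun s => f s * g s) l (𝓝 0) := by
  refine squeeze_zero_norm (a := fun s => ‖f s‖ * C) (fun s => ?_) ?_
  · exact (norm_mul_le _ _).trans (mul_le_mul_of_nonneg_left (hg s) (norm_nonneg _))
  · simpa using hf.norm.mul_const C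

variable {𝔸 : Type*} [NormedRing 𝔸] [NormedAlgebra ℂ 𝔸]

/-- The first component `W₁` of the Lax operator applied to the impulse response: the deviation of
`k₁` from the linear evolution, corrected by terms that contain the potentials. Subscripts `t`, `x`
and `b` stand for derivatives in time, in `ξ` and in the joint direction of `η` and `τ`. -/
def laxFst {R : Type*} [Ring R] [Module ℂ R] (c : ℂ) (B₁ B₂ P u v k₁ k₂ kt kx kxx kb kbb k₂b : R) :
    R :=
  kt - (2 : ℂ) • (B₁ * kx) + (2 : ℂ) • (kb * B₂) - c • (kxx - kbb) - P * k₁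
    + u * (k₂ * B₂ - B₂ * k₂) + c • (u * k₂b) + (c * 2⁻¹) • (u * (v * k₁))

/-- The second component `W₂` of the Lax operator applied to the impulse response, with the subscripts
of `laxFst`; the subscript `e` stands for the derivative in `η` alone. -/
def laxSnd {R : Type*} [Ring R] [Module ℂ R] (c : ℂ)
    (B₁ B₂ p u v vx k₁ k₂ kx k₂t k₂b k₂bb k₂e k₂be : R) : R :=
  k₂t + (2 : ℂ) • (k₂b * B₂) + c • k₂bb - p * k₂ + v * (B₁ * k₁)
    + (c * 2⁻¹) • (v * kx - vx * k₁) - (2 : ℂ) • (k₂e * B₂ - B₂ * k₂e) - (2 * c) • k₂be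
    + (c * 2⁻¹) • (v * (u * k₂))

/-- `∂W₁/∂η = -½ u W₂`. The left-hand side is the `η`-derivative of `laxFst`, in which the derivatives
of the kernels are those of the Goursat problem and the derivatives of `u` and `P` those of the
dispersive system. -/
lemma laxFst_deriv_identity (c : ℂ)
    (B₁ B₂ P p u ux ue uxx uee v vx ve k₁ k₂ kx k₂t k₂b k₂bb k₂e k₂be : 𝔸) :
    (-2⁻¹ : ℂ) • (((2 : ℂ) • (B₁ * ux) - (2 : ℂ) • (ue * B₂) + c • (uxx - uee) + P * u - u * p) * k₂
        + u * k₂t)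
      - (2 : ℂ) • (B₁ * ((-2⁻¹ : ℂ) • (ux * k₂ + u * ((-2⁻¹ : ℂ) • (v * k₁)))))
      + (2 : ℂ) • (((-2⁻¹ : ℂ) • (ue * k₂ + u * k₂b)) * B₂)
      - c • ((-2⁻¹ : ℂ) • (uxx * k₂ + ux * ((-2⁻¹ : ℂ) • (v * k₁))
            + (ux * ((-2⁻¹ : ℂ) • (v * k₁)) + u * ((-2⁻¹ : ℂ) • (vx * k₁ + v * kx))))
          - (-2⁻¹ : ℂ) • (uee * k₂ + ue * k₂b + (ue * k₂b + u * k₂bb)))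
      - (((2⁻¹ : ℂ) • (u * (v * B₁) - B₁ * (u * v))
            - (c * 2⁻¹) • (ux * v + u * vx - ue * v - u * ve)) * k₁
          + P * ((-2⁻¹ : ℂ) • (u * k₂)))
      + (ue * (k₂ * B₂ - B₂ * k₂) + u * (k₂e * B₂ - B₂ * k₂e))
      + c • (ue * k₂b + u * k₂be)
      + (c * 2⁻¹) • (ue * (v * k₁) + u * (ve * k₁ + v * ((-2⁻¹ : ℂ) • (u * k₂))))
    = (-2⁻¹ : ℂ) • (u * laxSnd c B₁ B₂ p u v vx k₁ k₂ kx k₂t k₂b k₂bb k₂e k₂be) := by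
  unfold laxSnd
  simp only [mul_add, add_mul, mul_sub, sub_mul, smul_mul_assoc, mul_smul_comm, mul_assoc,
    smul_add, smul_sub, smul_smul]
  module

/-- `∂W₂/∂ξ = -½ v W₁`, the counterpart of `laxFst_deriv_identity`. -/
lemma laxSnd_deriv_identity (c : ℂ)
    (B₁ B₂ P p u ux ue v vx ve vxx vee k₁ k₂ kt kx kxx kb kbb k₂b : 𝔸) :
    (-2⁻¹ : ℂ) • (((2 : ℂ) • (vx * B₁) - (2 : ℂ) • (B₂ * ve) - c • (vxx - vee) + p * v - v * P) * k₁
        + v * kt)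
      + (2 : ℂ) • (((-2⁻¹ : ℂ) • (ve * k₁ + v * kb)) * B₂)
      + c • ((-2⁻¹ : ℂ) • (vee * k₁ + ve * kb + (ve * kb + v * kbb)))
      - (((2⁻¹ : ℂ) • (B₂ * (v * u) - v * (u * B₂))
            + (c * 2⁻¹) • (vx * u + v * ux - ve * u - v * ue)) * k₂
          + p * ((-2⁻¹ : ℂ) • (v * k₁)))
      + (vx * (B₁ * k₁) + v * (B₁ * kx))
      + (c * 2⁻¹) • (vx * kx + v * kxx - (vxx * k₁ + vx * kx))
      - (2 : ℂ) • (((-2⁻¹ : ℂ) • (ve * k₁ + v * ((-2⁻¹ : ℂ) • (u * k₂)))) * B₂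
          - B₂ * ((-2⁻¹ : ℂ) • (ve * k₁ + v * ((-2⁻¹ : ℂ) • (u * k₂)))))
      - (2 * c) • ((-2⁻¹ : ℂ) • (vee * k₁ + ve * ((-2⁻¹ : ℂ) • (u * k₂))
          + (ve * kb + v * ((-2⁻¹ : ℂ) • (ue * k₂ + u * k₂b)))))
      + (c * 2⁻¹) • (vx * (u * k₂) + v * (ux * k₂ + u * ((-2⁻¹ : ℂ) • (v * k₁))))
    = (-2⁻¹ : ℂ) • (v * laxFst c B₁ B₂ P u v k₁ k₂ kt kx kxx kb kbb k₂b) := by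
  unfold laxFst
  simp only [mul_add, add_mul, mul_sub, sub_mul, smul_mul_assoc, mul_smul_comm, mul_assoc,
    smul_add, smul_sub, smul_smul]
  module

/-- `W₁` vanishes on the front `η = τ`, where `k₁ = -½ u` and `p` has the value expressed by the kernels. -/
lemma laxFst_front_identity (c : ℂ) (B₁ B₂ P u ux ue uxx uee v k₂ k₂b : 𝔸) :
    laxFst c B₁ B₂ P u v ((-2⁻¹ : ℂ) • u) k₂
      ((-2⁻¹ : ℂ) • ((2 : ℂ) • (B₁ * ux) - (2 : ℂ) • (ue * B₂) + c • (uxx - uee) + P * u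
        - u * ((2 : ℂ) • (B₂ * k₂ - k₂ * B₂) + (c * 2⁻¹) • (v * u) - (2 * c) • k₂b)))
      ((-2⁻¹ : ℂ) • ux) ((-2⁻¹ : ℂ) • uxx) ((-2⁻¹ : ℂ) • ue) ((-2⁻¹ : ℂ) • uee) k₂b = 0 := by
  unfold laxFst
  simp only [mul_add, mul_sub, smul_mul_assoc, mul_smul_comm, mul_assoc,
    smul_add, smul_sub, smul_smul]
  module

/-- A Schwartz function of `(ξ, η)` as a bounded function. -/
def plain (u : 𝓢(ℝ × ℝ, 𝔸)) : Triple 𝔸 :=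
  u.toBoundedContinuousFunction.compContinuous ⟨fun z : ℝ × ℝ × ℝ => (z.1, z.2.1), by fun_prop⟩

lemma plain_apply (u : 𝓢(ℝ × ℝ, 𝔸)) (ξ η τ : ℝ) : plain u (ξ, η, τ) = u (ξ, η) := rfl

/-- The constant bounded function. -/
abbrev constTriple (B : 𝔸) : Triple 𝔸 := BoundedContinuousFunction.const _ B

/-- The data of the dispersive system at one instant, in characteristic coordinates: `U'` and `V'`
are the weighted time derivatives of `u` and `v`. -/
structure IsLaxData (c : ℂ) (B₁ B₂ : 𝔸) (u v : 𝓢(ℝ × ℝ, 𝔸)) (U' V' P p : Triple 𝔸) : Prop where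
  eq_u : ∀ ξ η τ, decayWeight η • U' (ξ, η, τ) =
    (2 : ℂ) • (B₁ * dxi u (ξ, η)) - (2 : ℂ) • (deta u (ξ, η) * B₂)
      + c • (dxi (dxi u) (ξ, η) - deta (deta u) (ξ, η))
      + P (ξ, η, τ) * u (ξ, η) - u (ξ, η) * p (ξ, η, τ)
  eq_v : ∀ ξ η τ, decayWeight ξ • V' (ξ, η, τ) =
    (2 : ℂ) • (dxi v (ξ, η) * B₁) - (2 : ℂ) • (B₂ * deta v (ξ, η))
      - c • (dxi (dxi v) (ξ, η) - deta (deta v) (ξ, η))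
      + p (ξ, η, τ) * v (ξ, η) - v (ξ, η) * P (ξ, η, τ)
  deriv_P : ∀ ξ η τ, HasDerivAt (fun y => P (ξ, y, τ))
    ((2⁻¹ : ℂ) • (u (ξ, η) * (v (ξ, η) * B₁) - B₁ * (u (ξ, η) * v (ξ, η)))
      - (c * 2⁻¹) • (dxi u (ξ, η) * v (ξ, η) + u (ξ, η) * dxi v (ξ, η)
          - deta u (ξ, η) * v (ξ, η) - u (ξ, η) * deta v (ξ, η))) η
  tendsto_P : ∀ ξ τ, Tendsto (fun η => P (ξ, η, τ)) atTop (𝓝 0)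
  deriv_p : ∀ ξ η τ, HasDerivAt (fun x => p (x, η, τ))
    ((2⁻¹ : ℂ) • (B₂ * (v (ξ, η) * u (ξ, η)) - v (ξ, η) * (u (ξ, η) * B₂))
      + (c * 2⁻¹) • (dxi v (ξ, η) * u (ξ, η) + v (ξ, η) * dxi u (ξ, η)
          - deta v (ξ, η) * u (ξ, η) - v (ξ, η) * deta u (ξ, η))) ξ
  tendsto_p : ∀ η τ, Tendsto (fun ξ => p (ξ, η, τ)) atBot (𝓝 0)

lemma tendsto_schwartz_fst_atBot (u : 𝓢(ℝ × ℝ, 𝔸)) (η : ℝ) :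
    Tendsto (fun x => u (x, η)) atBot (𝓝 0) := by
  have h := u.tendsto_cocompact
  refine h.comp (Tendsto.mono_right ?_ le_rfl)
  refine (tendsto_cocompact_of_tendsto_dist_comp_atTop (0 : ℝ × ℝ) ?_)
  refine tendsto_atTop_mono (fun x => ?_) tendsto_abs_atBot_atTop
  rw [dist_zero_right]
  exact norm_fst_le (x, η)

lemma tendsto_schwartz_snd_atTop (u : 𝓢(ℝ × ℝ, 𝔸)) (ξ : ℝ) :
    Tendsto (fun y => u (ξ, y)) atTop (𝓝 0) := by
  have h := u.tendsto_cocompact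
  refine h.comp (Tendsto.mono_right ?_ le_rfl)
  refine (tendsto_cocompact_of_tendsto_dist_comp_atTop (0 : ℝ × ℝ) ?_)
  refine tendsto_atTop_mono (fun x => ?_) tendsto_abs_atTop_atTop
  rw [dist_zero_right]
  exact norm_snd_le (ξ, x)

lemma hasDerivAt_xiWeighted_snd (v : 𝓢(ℝ × ℝ, 𝔸)) (ξ η τ : ℝ) :
    HasDerivAt (fun y => xiWeighted v (ξ, y, τ)) (xiWeighted (deta v) (ξ, η, τ)) η := by
  simp_rw [xiWeighted_apply]
  exact (hasDerivAt_snd v ξ η).const_smul _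

/-- A function given by `leftIntegral` vanishes as `ξ → -∞`. -/
lemma tendsto_leftIntegral_smul {b g : Triple 𝔸}
    (h : b = (-2⁻¹ : ℂ) • leftIntegral g) (η τ : ℝ) :
    Tendsto (fun s => b (s, η, τ)) atBot (𝓝 0) := by
  rw [h]
  simpa using (tendsto_leftIntegral_atBot g η τ).const_smul (-2⁻¹ : ℂ)

lemma eq_zero_of_deriv_eq_zero_of_tendsto {h : ℝ → 𝔸} (hd : ∀ x, HasDerivAt h 0 x)
    (h0 : Tendsto h atBot (𝓝 0)) (x : ℝ) : h x = 0 := by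
  have hconst := is_const_of_deriv_eq_zero (fun x => (hd x).differentiableAt)
    (fun x => (hd x).deriv)
  exact tendsto_nhds_unique (tendsto_const_nhds.congr fun y => hconst x y) h0

variable [CompleteSpace 𝔸]

lemma hasDerivAt_frontIntegral_mul {a U g : Triple 𝔸}
    (h : a = frontValue U + (-2⁻¹ : ℂ) • frontIntegral g) (ξ η τ : ℝ) {x : 𝔸}
    (hx : decayWeight η • g (ξ, η, τ) = x) :
    HasDerivAt (fun y => a (ξ, y, τ)) ((-2⁻¹ : ℂ) • x) η := by
  rw [h, ← hx]
  exact ((hasDerivAt_frontIntegral g ξ η τ).const_smul (-2⁻¹ : ℂ)).const_add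
    (frontValue U (ξ, η, τ))

lemma hasDerivAt_leftIntegral_mul {b g : Triple 𝔸}
    (h : b = (-2⁻¹ : ℂ) • leftIntegral g) (ξ η τ : ℝ) {x : 𝔸}
    (hx : decayWeight ξ • g (ξ, η, τ) = x) :
    HasDerivAt (fun s => b (s, η, τ)) ((-2⁻¹ : ℂ) • x) ξ := by
  rw [h, ← hx]
  exact (hasDerivAt_leftIntegral g ξ η τ).const_smul (-2⁻¹ : ℂ)

/-- The transmission kernel evolves linearly. The Lax operator maps the impulse response to a
solution `(W₁, W₂)` of the same Goursat problem without incident wave, so `W₁ = 0`; as `η → ∞` the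
terms of `W₁` with coefficients decay and the linear evolution equation remains. -/
lemma transmission_evolution {c : ℂ} {B₁ B₂ : 𝔸} {u v : 𝓢(ℝ × ℝ, 𝔸)} {U' V' P p : Triple 𝔸}
    (D : IsLaxData c B₁ B₂ u v U' V' P p)
    {x₁ y₁ x₂ y₂ a₁ b₁ a₂ b₂ at' bt : Triple 𝔸} {f₁ f₂ g₁ g₂ : ℝ × ℝ → 𝔸}
    (hX : IsTranslationJet (1, 0) u v (dxi u) (dxi v) (dxi (dxi u)) (dxi (dxi v))
      x₁ y₁ x₂ y₂ f₁ f₂)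
    (hE : IsTranslationJet (0, 1) u v (deta u) (deta v) (deta (deta u)) (deta (deta v))
      a₁ b₁ a₂ b₂ g₁ g₂)
    (hat : at' = frontValue U' +
      (-2⁻¹ : ℂ) • frontIntegral (U' * kerSnd u v + etaWeighted u * bt))
    (hbt : bt = (-2⁻¹ : ℂ) • leftIntegral (V' * kerFst u v + xiWeighted v * at')) (ξ τ : ℝ) :
    (at' + (-2⁻¹ : ℂ) • rightIntegral (U' * kerSnd u v + etaWeighted u * bt)) (ξ, τ, τ)
      = (2 : ℂ) • (B₁ * f₁ (ξ, τ)) - (2 : ℂ) • (g₁ (ξ, τ) * B₂)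
        + c • (f₂ (ξ, τ) - g₂ (ξ, τ)) := by
  set k₁ := kerFst u v with hk₁
  set k₂ := kerSnd u v with hk₂
  have hk1eq : k₁ = frontValue (etaWeighted u) + (-2⁻¹ : ℂ) • frontIntegral (etaWeighted u * k₂) :=
    goursatFst_eq _ _
  have hk2eq : k₂ = (-2⁻¹ : ℂ) • leftIntegral (xiWeighted v * k₁) := rfl
  have wU : ∀ (w : 𝓢(ℝ × ℝ, 𝔸)) (f : Triple 𝔸) (ξ η τ : ℝ),
      decayWeight η • (etaWeighted w (ξ, η, τ) * f (ξ, η, τ)) = w (ξ, η) * f (ξ, η, τ) :=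
    decayWeight_smul_etaWeighted_mul
  have wV : ∀ (w : 𝓢(ℝ × ℝ, 𝔸)) (f : Triple 𝔸) (ξ η τ : ℝ),
      decayWeight ξ • (xiWeighted w (ξ, η, τ) * f (ξ, η, τ)) = w (ξ, η) * f (ξ, η, τ) :=
    decayWeight_smul_xiWeighted_mul
  have wf : ∀ (w : 𝓢(ℝ × ℝ, 𝔸)) (ξ τ : ℝ),
      decayWeight τ • etaWeighted w (ξ, τ, τ) = w (ξ, τ) := fun w ξ τ => by
    rw [etaWeighted_apply, smul_smul, decayWeight_mul_one_add_sq, one_smul]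
  -- derivatives in `ξ`
  have k₂x : ∀ ξ η τ, HasDerivAt (fun s => k₂ (s, η, τ))
      ((-2⁻¹ : ℂ) • (v (ξ, η) * k₁ (ξ, η, τ))) ξ := fun ξ η τ =>
    hasDerivAt_leftIntegral_mul hk2eq ξ η τ (wV _ _ _ _ _)
  have shift : ∀ {f : Triple 𝔸} {f' : 𝔸} {ξ η τ : ℝ}, HasDerivAt
      (fun s : ℝ => f (ξ + s * ((1, 0) : ℝ × ℝ).1, η + s * ((1, 0) : ℝ × ℝ).2,
        τ + s * ((1, 0) : ℝ × ℝ).2)) f' 0 → HasDerivAt (fun s => f (s, η, τ)) f' ξ := by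
    intro f f' ξ η τ h
    simp only [mul_one, mul_zero, add_zero] at h
    have h' : HasDerivAt (fun s => f (ξ + s, η, τ)) f' (ξ - ξ) := by rwa [sub_self]
    simpa using h'.comp_sub_const ξ ξ
  have k₁x : ∀ ξ η τ, HasDerivAt (fun s => k₁ (s, η, τ)) (x₁ (ξ, η, τ)) ξ := fun ξ η τ =>
    shift (hX.deriv_fst ξ η τ)
  have x₁x : ∀ ξ η τ, HasDerivAt (fun s => x₁ (s, η, τ)) (x₂ (ξ, η, τ)) ξ := fun ξ η τ =>
    shift (hX.deriv_fst₂ ξ η τ)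
  have y₁v : ∀ ξ η τ, y₁ (ξ, η, τ) = (-2⁻¹ : ℂ) • (v (ξ, η) * k₁ (ξ, η, τ)) := fun ξ η τ =>
    (shift (hX.deriv_snd ξ η τ)).unique (k₂x ξ η τ)
  have y₂v : ∀ ξ η τ, y₂ (ξ, η, τ) = (-2⁻¹ : ℂ) •
      (dxi v (ξ, η) * k₁ (ξ, η, τ) + v (ξ, η) * x₁ (ξ, η, τ)) := fun ξ η τ => by
    have h := (((hasDerivAt_fst v ξ η).mul (k₁x ξ η τ)).const_smul (-2⁻¹ : ℂ))
    refine (shift (hX.deriv_snd₂ ξ η τ)).unique (h.congr_of_eventuallyEq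
      (Eventually.of_forall fun s => y₁v s η τ))
  have btx : ∀ ξ η τ, HasDerivAt (fun s => bt (s, η, τ)) _ ξ := fun ξ η τ =>
    hasDerivAt_leftIntegral_mul hbt ξ η τ (x := decayWeight ξ • V' (ξ, η, τ) * k₁ (ξ, η, τ)
      + v (ξ, η) * at' (ξ, η, τ)) (by
      rw [BoundedContinuousFunction.add_apply, BoundedContinuousFunction.mul_apply,
        BoundedContinuousFunction.mul_apply, smul_add, wV, smul_mul_assoc])
  have b₁x : ∀ ξ η τ, HasDerivAt (fun s => b₁ (s, η, τ)) _ ξ := fun ξ η τ =>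
    hasDerivAt_leftIntegral_mul hE.eq_snd ξ η τ (x := deta v (ξ, η) * k₁ (ξ, η, τ)
      + v (ξ, η) * a₁ (ξ, η, τ)) (by
      rw [BoundedContinuousFunction.add_apply, BoundedContinuousFunction.mul_apply,
        BoundedContinuousFunction.mul_apply, smul_add, wV, wV])
  have b₂x : ∀ ξ η τ, HasDerivAt (fun s => b₂ (s, η, τ)) _ ξ := fun ξ η τ =>
    hasDerivAt_leftIntegral_mul hE.eq_snd₂ ξ η τ (x := deta (deta v) (ξ, η) * k₁ (ξ, η, τ)
      + deta v (ξ, η) * a₁ (ξ, η, τ) + (deta v (ξ, η) * a₁ (ξ, η, τ)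
      + v (ξ, η) * a₂ (ξ, η, τ))) (by
      simp only [BoundedContinuousFunction.add_apply, BoundedContinuousFunction.mul_apply,
        smul_add (decayWeight ξ), wV]; rfl)
  -- derivatives in `η`
  set k₁e : Triple 𝔸 := (-2⁻¹ : ℂ) • (plain u * k₂) with hk₁e
  set a₁e : Triple 𝔸 := (-2⁻¹ : ℂ) • (plain (deta u) * k₂ + plain u * b₁) with ha₁e
  have k₁η : ∀ ξ η τ, HasDerivAt (fun y => k₁ (ξ, y, τ)) (k₁e (ξ, η, τ)) η := fun ξ η τ =>
    hasDerivAt_frontIntegral_mul hk1eq ξ η τ (wU _ _ _ _ _)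
  have a₁η : ∀ ξ η τ, HasDerivAt (fun y => a₁ (ξ, y, τ)) (a₁e (ξ, η, τ)) η := fun ξ η τ =>
    hasDerivAt_frontIntegral_mul hE.eq_fst ξ η τ (by
      rw [BoundedContinuousFunction.add_apply, BoundedContinuousFunction.mul_apply,
        BoundedContinuousFunction.mul_apply, smul_add, wU, wU]; rfl)
  have x₁η : ∀ ξ η τ, HasDerivAt (fun y => x₁ (ξ, y, τ)) _ η := fun ξ η τ =>
    hasDerivAt_frontIntegral_mul hX.eq_fst ξ η τ (x := dxi u (ξ, η) * k₂ (ξ, η, τ)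
        + u (ξ, η) * ((-2⁻¹ : ℂ) • (v (ξ, η) * k₁ (ξ, η, τ)))) (by
      rw [BoundedContinuousFunction.add_apply, BoundedContinuousFunction.mul_apply,
        BoundedContinuousFunction.mul_apply, smul_add, wU, wU, y₁v])
  have x₂η : ∀ ξ η τ, HasDerivAt (fun y => x₂ (ξ, y, τ)) _ η := fun ξ η τ =>
    hasDerivAt_frontIntegral_mul hX.eq_fst₂ ξ η τ (x := dxi (dxi u) (ξ, η) * k₂ (ξ, η, τ)
        + dxi u (ξ, η) * ((-2⁻¹ : ℂ) • (v (ξ, η) * k₁ (ξ, η, τ)))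
        + (dxi u (ξ, η) * ((-2⁻¹ : ℂ) • (v (ξ, η) * k₁ (ξ, η, τ)))
          + u (ξ, η) * ((-2⁻¹ : ℂ) • (dxi v (ξ, η) * k₁ (ξ, η, τ)
            + v (ξ, η) * x₁ (ξ, η, τ))))) (by
      simp only [BoundedContinuousFunction.add_apply, BoundedContinuousFunction.mul_apply,
        smul_add (decayWeight η), wU]; simp only [y₁v, y₂v]; rfl)
  have a₂η : ∀ ξ η τ, HasDerivAt (fun y => a₂ (ξ, y, τ)) _ η := fun ξ η τ =>
    hasDerivAt_frontIntegral_mul hE.eq_fst₂ ξ η τ (x := deta (deta u) (ξ, η) * k₂ (ξ, η, τ)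
        + deta u (ξ, η) * b₁ (ξ, η, τ) + (deta u (ξ, η) * b₁ (ξ, η, τ)
          + u (ξ, η) * b₂ (ξ, η, τ))) (by
      simp only [BoundedContinuousFunction.add_apply, BoundedContinuousFunction.mul_apply,
        smul_add (decayWeight η), wU]; rfl)
  have atη : ∀ ξ η τ, HasDerivAt (fun y => at' (ξ, y, τ)) _ η := fun ξ η τ =>
    hasDerivAt_frontIntegral_mul hat ξ η τ (x := decayWeight η • U' (ξ, η, τ) * k₂ (ξ, η, τ)
        + u (ξ, η) * bt (ξ, η, τ)) (by
      rw [BoundedContinuousFunction.add_apply, BoundedContinuousFunction.mul_apply,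
        BoundedContinuousFunction.mul_apply, smul_add, wU, smul_mul_assoc])
  set k₂e : Triple 𝔸 := (-2⁻¹ : ℂ) • leftIntegral (xiWeighted (deta v) * k₁ + xiWeighted v * k₁e)
    with hk₂e
  set b₁e : Triple 𝔸 := (-2⁻¹ : ℂ) • leftIntegral (xiWeighted (deta (deta v)) * k₁
    + xiWeighted (deta v) * k₁e + (xiWeighted (deta v) * a₁ + xiWeighted v * a₁e)) with hb₁e
  have k₂η : ∀ ξ η τ, HasDerivAt (fun y => k₂ (ξ, y, τ)) (k₂e (ξ, η, τ)) η := fun ξ η τ => by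
    refine (hasDerivAt_leftIntegral_mid (fun ξ η τ => ?_) ξ η τ).const_smul (-2⁻¹ : ℂ)
    exact (hasDerivAt_xiWeighted_snd v ξ η τ).mul (k₁η ξ η τ)
  have b₁η : ∀ ξ η τ, HasDerivAt (fun y => b₁ (ξ, y, τ)) (b₁e (ξ, η, τ)) η := fun ξ η τ => by
    rw [hE.eq_snd]
    refine (hasDerivAt_leftIntegral_mid (fun ξ η τ => ?_) ξ η τ).const_smul (-2⁻¹ : ℂ)
    exact ((hasDerivAt_xiWeighted_snd (deta v) ξ η τ).mul (k₁η ξ η τ)).add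
      ((hasDerivAt_xiWeighted_snd v ξ η τ).mul (a₁η ξ η τ))
  have k₂ex : ∀ ξ η τ, HasDerivAt (fun s => k₂e (s, η, τ)) _ ξ := fun ξ η τ =>
    hasDerivAt_leftIntegral_mul hk₂e ξ η τ (x := deta v (ξ, η) * k₁ (ξ, η, τ)
      + v (ξ, η) * ((-2⁻¹ : ℂ) • (u (ξ, η) * k₂ (ξ, η, τ)))) (by
      rw [BoundedContinuousFunction.add_apply, BoundedContinuousFunction.mul_apply,
        BoundedContinuousFunction.mul_apply, smul_add, wV, wV]; rfl)
  have b₁ex : ∀ ξ η τ, HasDerivAt (fun s => b₁e (s, η, τ)) _ ξ := fun ξ η τ =>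
    hasDerivAt_leftIntegral_mul hb₁e ξ η τ (x := deta (deta v) (ξ, η) * k₁ (ξ, η, τ)
      + deta v (ξ, η) * ((-2⁻¹ : ℂ) • (u (ξ, η) * k₂ (ξ, η, τ)))
      + (deta v (ξ, η) * a₁ (ξ, η, τ) + v (ξ, η) * ((-2⁻¹ : ℂ) • (deta u (ξ, η) * k₂ (ξ, η, τ)
        + u (ξ, η) * b₁ (ξ, η, τ))))) (by
      simp only [BoundedContinuousFunction.add_apply, BoundedContinuousFunction.mul_apply,
        smul_add (decayWeight ξ), wV]; rfl)
  -- `p` on the front is expressed by the kernels: both sides have the same `ξ`-derivative and vanish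
  -- as `ξ → -∞`
  have hfront : ∀ ξ τ, k₁ (ξ, τ, τ) = (-2⁻¹ : ℂ) • u (ξ, τ) := fun ξ τ => by
    rw [hk₁, kerFst_apply, intervalIntegral.integral_same, smul_zero, add_zero]
  have front : ∀ {a U g : Triple 𝔸}, a = frontValue U + (-2⁻¹ : ℂ) • frontIntegral g →
      ∀ {x : 𝔸} {ξ τ : ℝ}, decayWeight τ • U (ξ, τ, τ) = x → a (ξ, τ, τ) = (-2⁻¹ : ℂ) • x := by
    intro a U g h x ξ τ hx
    rw [h, BoundedContinuousFunction.add_apply, frontValue_apply hx, triple_smul_apply,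
      frontIntegral_apply, intervalIntegral.integral_same, smul_zero, add_zero]
  have hp : ∀ ξ τ, p (ξ, τ, τ) = (2 : ℂ) • (B₂ * k₂ (ξ, τ, τ) - k₂ (ξ, τ, τ) * B₂)
      + (c * 2⁻¹) • (v (ξ, τ) * u (ξ, τ)) - (2 * c) • b₁ (ξ, τ, τ) := by
    intro ξ τ
    refine sub_eq_zero.1 (eq_zero_of_deriv_eq_zero_of_tendsto (h := fun s => p (s, τ, τ)
      - ((2 : ℂ) • (B₂ * k₂ (s, τ, τ) - k₂ (s, τ, τ) * B₂)
      + (c * 2⁻¹) • (v (s, τ) * u (s, τ)) - (2 * c) • b₁ (s, τ, τ))) (fun s => ?_) ?_ ξ)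
    · refine ((D.deriv_p s τ τ).fun_sub (((((k₂x s τ τ).const_mul B₂).fun_sub
        ((k₂x s τ τ).mul_const B₂)).const_smul (2 : ℂ)).fun_add
        (((hasDerivAt_fst v s τ).fun_mul (hasDerivAt_fst u s τ)).const_smul (c * 2⁻¹))
        |>.fun_sub ((b₁x s τ τ).const_smul (2 * c)))).congr_deriv ?_
      rw [hfront, front hE.eq_fst (wf _ _ _)]
      simp only [smul_mul_assoc, mul_smul_comm, mul_assoc,
        smul_add, smul_sub, smul_smul]
      module
    · have hk := tendsto_leftIntegral_smul hk2eq τ τ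
      have hb := tendsto_leftIntegral_smul hE.eq_snd τ τ
      have h1 := (((hk.const_mul B₂).sub (hk.mul_const B₂)).const_smul (2 : ℂ)).add
        (((tendsto_schwartz_fst_atBot v τ).mul (tendsto_schwartz_fst_atBot u τ)).const_smul
          (c * 2⁻¹)) |>.sub (hb.const_smul (2 * c))
      simpa using (D.tendsto_p τ τ).sub h1
  -- `W₁` vanishes on the front and `W₂` as `ξ → -∞`, so they solve the homogeneous Goursat problem
  set W₁ : Triple 𝔸 := laxFst c (constTriple B₁) (constTriple B₂) P (plain u) (plain v) k₁ k₂
    at' x₁ x₂ a₁ a₂ b₁ with hW₁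
  set W₂ : Triple 𝔸 := laxSnd c (constTriple B₁) (constTriple B₂) p (plain u) (plain v)
    (plain (dxi v)) k₁ k₂ x₁ bt b₁ b₂ k₂e b₁e with hW₂
  have W₁v : ∀ ξ η τ, W₁ (ξ, η, τ) = laxFst c B₁ B₂ (P (ξ, η, τ)) (u (ξ, η)) (v (ξ, η))
    (k₁ (ξ, η, τ)) (k₂ (ξ, η, τ)) (at' (ξ, η, τ)) (x₁ (ξ, η, τ)) (x₂ (ξ, η, τ)) (a₁ (ξ, η, τ))
    (a₂ (ξ, η, τ)) (b₁ (ξ, η, τ)) := fun ξ η τ => rfl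
  have W₂v : ∀ ξ η τ, W₂ (ξ, η, τ) = laxSnd c B₁ B₂ (p (ξ, η, τ)) (u (ξ, η)) (v (ξ, η))
    (dxi v (ξ, η)) (k₁ (ξ, η, τ)) (k₂ (ξ, η, τ)) (x₁ (ξ, η, τ)) (bt (ξ, η, τ)) (b₁ (ξ, η, τ))
    (b₂ (ξ, η, τ)) (k₂e (ξ, η, τ)) (b₁e (ξ, η, τ)) := fun ξ η τ => rfl
  have W₁η : ∀ ξ η τ, HasDerivAt (fun y => W₁ (ξ, y, τ))
      ((-2⁻¹ : ℂ) • (u (ξ, η) * W₂ (ξ, η, τ))) η := fun ξ η τ => by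
    rw [W₂v, ← laxFst_deriv_identity c B₁ B₂ (P (ξ, η, τ)) (p (ξ, η, τ)) (u (ξ, η))
      (dxi u (ξ, η)) (deta u (ξ, η)) (dxi (dxi u) (ξ, η)) (deta (deta u) (ξ, η)) (v (ξ, η))
      (dxi v (ξ, η)) (deta v (ξ, η)), ← D.eq_u ξ η τ]
    exact ((((((((atη ξ η τ).fun_sub (((x₁η ξ η τ).const_mul B₁).const_smul (2 : ℂ))).fun_add
      (((a₁η ξ η τ).mul_const B₂).const_smul (2 : ℂ))).fun_sub
      (((x₂η ξ η τ).fun_sub (a₂η ξ η τ)).const_smul c)).fun_sub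
      ((D.deriv_P ξ η τ).fun_mul (k₁η ξ η τ))).fun_add
      ((hasDerivAt_snd u ξ η).fun_mul (((k₂η ξ η τ).mul_const B₂).fun_sub
        ((k₂η ξ η τ).const_mul B₂)))).fun_add
      (((hasDerivAt_snd u ξ η).fun_mul (b₁η ξ η τ)).const_smul c)).fun_add
      (((hasDerivAt_snd u ξ η).fun_mul ((hasDerivAt_snd v ξ η).fun_mul (k₁η ξ η τ))).const_smul
        (c * 2⁻¹)))
  have W₂x : ∀ ξ η τ, HasDerivAt (fun s => W₂ (s, η, τ))
      ((-2⁻¹ : ℂ) • (v (ξ, η) * W₁ (ξ, η, τ))) ξ := fun ξ η τ => by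
    rw [W₁v, ← laxSnd_deriv_identity c B₁ B₂ (P (ξ, η, τ)) (p (ξ, η, τ)) (u (ξ, η))
      (dxi u (ξ, η)) (deta u (ξ, η)) (v (ξ, η)) (dxi v (ξ, η)) (deta v (ξ, η))
      (dxi (dxi v) (ξ, η)) (deta (deta v) (ξ, η)), ← D.eq_v ξ η τ]
    exact (((((((((btx ξ η τ).fun_add (((b₁x ξ η τ).mul_const B₂).const_smul (2 : ℂ))).fun_add
      ((b₂x ξ η τ).const_smul c)).fun_sub
      ((D.deriv_p ξ η τ).fun_mul (k₂x ξ η τ))).fun_add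
      ((hasDerivAt_fst v ξ η).fun_mul ((k₁x ξ η τ).const_mul B₁))).fun_add
      ((((hasDerivAt_fst v ξ η).fun_mul (x₁x ξ η τ)).fun_sub
        ((hasDerivAt_fst (dxi v) ξ η).fun_mul (k₁x ξ η τ))).const_smul (c * 2⁻¹))).fun_sub
      ((((k₂ex ξ η τ).mul_const B₂).fun_sub ((k₂ex ξ η τ).const_mul B₂)).const_smul (2 : ℂ))).fun_sub
      ((b₁ex ξ η τ).const_smul (2 * c))).fun_add
      (((hasDerivAt_fst v ξ η).fun_mul ((hasDerivAt_fst u ξ η).fun_mul (k₂x ξ η τ))).const_smul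
        (c * 2⁻¹)))
  have W₁f : ∀ ξ τ, W₁ (ξ, τ, τ) = 0 := fun ξ τ => by
    rw [W₁v, hfront, front hat (D.eq_u ξ τ τ), hp, front hX.eq_fst (wf _ _ _),
      front hX.eq_fst₂ (wf _ _ _), front hE.eq_fst (wf _ _ _), front hE.eq_fst₂ (wf _ _ _)]
    exact laxFst_front_identity c B₁ B₂ _ _ _ _ _ _ _ _ _
  have W₂l : ∀ η τ, Tendsto (fun s => W₂ (s, η, τ)) atBot (𝓝 0) := fun η τ => by
    have hv := tendsto_schwartz_fst_atBot v η
    have hvk : Tendsto (fun s => v (s, η) * (B₁ * k₁ (s, η, τ))) atBot (𝓝 0) :=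
      tendsto_zero_mul_bounded hv fun s => (constTriple B₁ * k₁).norm_coe_le_norm (s, η, τ)
    have hvx : Tendsto (fun s => v (s, η) * x₁ (s, η, τ)) atBot (𝓝 0) :=
      tendsto_zero_mul_bounded hv fun s => x₁.norm_coe_le_norm (s, η, τ)
    have hvxk : Tendsto (fun s => dxi v (s, η) * k₁ (s, η, τ)) atBot (𝓝 0) :=
      tendsto_zero_mul_bounded (tendsto_schwartz_fst_atBot (dxi v) η)
        fun s => k₁.norm_coe_le_norm (s, η, τ)
    have hvuk : Tendsto (fun s => v (s, η) * (u (s, η) * k₂ (s, η, τ))) atBot (𝓝 0) :=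
      tendsto_zero_mul_bounded hv fun s => (plain u * k₂).norm_coe_le_norm (s, η, τ)
    have hke := tendsto_leftIntegral_smul hk₂e η τ
    have h := ((((((((tendsto_leftIntegral_smul hbt η τ).add
      (((tendsto_leftIntegral_smul hE.eq_snd η τ).mul_const B₂).const_smul (2 : ℂ))).add
      ((tendsto_leftIntegral_smul hE.eq_snd₂ η τ).const_smul c)).sub
      ((D.tendsto_p η τ).mul (tendsto_leftIntegral_smul hk2eq η τ))).add hvk).add
      ((hvx.sub hvxk).const_smul (c * 2⁻¹))).sub
      (((hke.mul_const B₂).sub (hke.const_mul B₂)).const_smul (2 : ℂ))).sub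
      ((tendsto_leftIntegral_smul hb₁e η τ).const_smul (2 * c))).add (hvuk.const_smul (c * 2⁻¹))
    simp only [zero_mul, mul_zero, smul_zero, add_zero, sub_zero] at h
    exact h
  have hW₂eq : W₂ = (-2⁻¹ : ℂ) • leftIntegral (xiWeighted v * W₁) := by
    ext ⟨ξ, η, τ⟩
    have h := eq_leftIntegral_of_hasDerivAt (h := fun s => W₂ (s, η, τ))
      (f := (-2⁻¹ : ℂ) • (xiWeighted v * W₁)) (η := η) (τ := τ) (fun s => ?_) (W₂l η τ) ξ
    · rw [map_smul] at h; exact h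
    · refine (W₂x s η τ).congr_deriv ?_
      rw [triple_smul_apply, smul_comm, decayWeight_smul_xiWeighted_mul]
  have hW₁eq : W₁ = (-2⁻¹ : ℂ) • frontIntegral (etaWeighted u * W₂) := by
    ext ⟨ξ, η, τ⟩
    have h := eq_frontIntegral_of_hasDerivAt (h := fun s => W₁ (ξ, s, τ))
      (f := (-2⁻¹ : ℂ) • (etaWeighted u * W₂)) (ξ := ξ) (τ := τ) (fun s => ?_) (W₁f ξ τ) η
    · rw [map_smul] at h; exact h
    · refine (W₁η ξ s τ).congr_deriv ?_
      rw [triple_smul_apply, smul_comm, decayWeight_smul_etaWeighted_mul]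
  have hzero : W₁ = 0 := eq_zero_of_homogeneous_goursat hW₂eq hW₁eq
  -- as `η → ∞` every term of `W₁` that contains `P` or `u` disappears
  have hu := tendsto_schwartz_snd_atTop u ξ
  have l1 : Tendsto (fun η => P (ξ, η, τ) * k₁ (ξ, η, τ)) atTop (𝓝 0) :=
    tendsto_zero_mul_bounded (D.tendsto_P ξ τ) fun s => k₁.norm_coe_le_norm (ξ, s, τ)
  have l2 : Tendsto (fun η => u (ξ, η) * (k₂ (ξ, η, τ) * B₂ - B₂ * k₂ (ξ, η, τ))) atTop (𝓝 0) :=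
    tendsto_zero_mul_bounded hu fun s =>
      (k₂ * constTriple B₂ - constTriple B₂ * k₂).norm_coe_le_norm (ξ, s, τ)
  have l3 : Tendsto (fun η => u (ξ, η) * b₁ (ξ, η, τ)) atTop (𝓝 0) :=
    tendsto_zero_mul_bounded hu fun s => b₁.norm_coe_le_norm (ξ, s, τ)
  have l4 : Tendsto (fun η => u (ξ, η) * (v (ξ, η) * k₁ (ξ, η, τ))) atTop (𝓝 0) :=
    tendsto_zero_mul_bounded hu fun s => (plain v * k₁).norm_coe_le_norm (ξ, s, τ)
  have l0 := tendsto_front_add_integral_atTop U' (U' * k₂ + etaWeighted u * bt) ξ τ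
  rw [← hat] at l0
  have h := (((((((l0.sub (((hX.tendsto₁ ξ τ).const_mul B₁).const_smul (2 : ℂ))).add
    (((hE.tendsto₁ ξ τ).mul_const B₂).const_smul (2 : ℂ))).sub
    (((hX.tendsto₂ ξ τ).sub (hE.tendsto₂ ξ τ)).const_smul c)).sub l1).add l2).add
    (l3.const_smul c)).add (l4.const_smul (c * 2⁻¹)))
  have hlim := tendsto_nhds_unique (h.congr (f₂ := fun _ => (0 : 𝔸)) fun η => by
    have := congrArg (fun f : Triple 𝔸 => f (ξ, η, τ)) hzero
    exact this) tendsto_const_nhds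
  simp only [smul_zero, add_zero, sub_zero] at hlim
  rw [sub_eq_zero, sub_add_eq_add_sub, sub_eq_iff_eq_add] at hlim
  rw [eq_sub_of_add_eq hlim]
  abel

end

noncomputable section

variable {𝔸 : Type*} [NormedRing 𝔸] [NormedAlgebra ℂ 𝔸]

/-! ### The evolution equation along a solution of the dispersive system -/

/-- The dispersive system in characteristic coordinates, for potentials with values in an algebra.
The partial derivatives with respect to `ξ = x + y` and `η = y - x` are the ordinary ones, so
`∂_y + ∂_x = 2 ∂/∂ξ` and `∂_y - ∂_x = 2 ∂/∂η`; `B₁` and `B₂` stand for `B` and `b`, and `c` for `i γ`.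
In an algebra `B₂` need not commute with `v u`, so the equation for `p` has a commutator term, which
makes the system symmetric under `IsCharacteristicSolution.reflect`. -/
structure IsCharacteristicSolution (J : Set ℝ) (c : ℂ) (B₁ B₂ : 𝔸) (u v : ℝ → 𝓢(ℝ × ℝ, 𝔸))
    (P p : ℝ → ℝ × ℝ → 𝔸) : Prop where
  deriv_u : ∀ t ∈ J, ∀ z, HasDerivAt (fun s => u s z)
    ((2 : ℂ) • (B₁ * dxi (u t) z) - (2 : ℂ) • (deta (u t) z * B₂)
      + c • (dxi (dxi (u t)) z - deta (deta (u t)) z) + P t z * u t z - u t z * p t z) t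
  deriv_v : ∀ t ∈ J, ∀ z, HasDerivAt (fun s => v s z)
    ((2 : ℂ) • (dxi (v t) z * B₁) - (2 : ℂ) • (B₂ * deta (v t) z)
      - c • (dxi (dxi (v t)) z - deta (deta (v t)) z) + p t z * v t z - v t z * P t z) t
  deriv_P : ∀ t ∈ J, ∀ ξ η, HasDerivAt (fun y => P t (ξ, y))
    ((2⁻¹ : ℂ) • (u t (ξ, η) * (v t (ξ, η) * B₁) - B₁ * (u t (ξ, η) * v t (ξ, η)))
      - (c * 2⁻¹) • (dxi (u t) (ξ, η) * v t (ξ, η) + u t (ξ, η) * dxi (v t) (ξ, η)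
          - deta (u t) (ξ, η) * v t (ξ, η) - u t (ξ, η) * deta (v t) (ξ, η))) η
  tendsto_P : ∀ t ∈ J, ∀ ξ, Tendsto (fun η => P t (ξ, η)) atTop (𝓝 0)
  deriv_p : ∀ t ∈ J, ∀ ξ η, HasDerivAt (fun x => p t (x, η))
    ((2⁻¹ : ℂ) • (B₂ * (v t (ξ, η) * u t (ξ, η)) - v t (ξ, η) * (u t (ξ, η) * B₂))
      + (c * 2⁻¹) • (dxi (v t) (ξ, η) * u t (ξ, η) + v t (ξ, η) * dxi (u t) (ξ, η)
          - deta (v t) (ξ, η) * u t (ξ, η) - v t (ξ, η) * deta (u t) (ξ, η))) ξ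
  tendsto_p : ∀ t ∈ J, ∀ η, Tendsto (fun ξ => p t (ξ, η)) atBot (𝓝 0)

/-- The field `P` of the dispersive system as a bounded function determined by `u` and `v`. -/
def interactionFst (c : ℂ) (B₁ : 𝔸) (u v : 𝓢(ℝ × ℝ, 𝔸)) : Triple 𝔸 :=
  rightIntegral (-((2⁻¹ : ℂ) • (etaWeighted u * (plain v * constTriple B₁)
      - constTriple B₁ * (etaWeighted u * plain v))
    - (c * 2⁻¹) • (etaWeighted (dxi u) * plain v + etaWeighted u * plain (dxi v)
      - etaWeighted (deta u) * plain v - etaWeighted u * plain (deta v))))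

/-- The field `p` of the dispersive system as a bounded function determined by `u` and `v`. -/
def interactionSnd (c : ℂ) (B₂ : 𝔸) (u v : 𝓢(ℝ × ℝ, 𝔸)) : Triple 𝔸 :=
  leftIntegral ((2⁻¹ : ℂ) • (constTriple B₂ * (xiWeighted v * plain u)
      - xiWeighted v * (plain u * constTriple B₂))
    + (c * 2⁻¹) • (xiWeighted (dxi v) * plain u + xiWeighted v * plain (dxi u)
      - xiWeighted (deta v) * plain u - xiWeighted v * plain (deta u)))

/-- The weighted time derivative of `u` under the flow of the dispersive system. -/
def rateFst (c : ℂ) (B₁ B₂ : 𝔸) (u v : 𝓢(ℝ × ℝ, 𝔸)) : Triple 𝔸 :=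
  (2 : ℂ) • (constTriple B₁ * etaWeighted (dxi u)) - (2 : ℂ) • (etaWeighted (deta u) * constTriple B₂)
    + c • (etaWeighted (dxi (dxi u)) - etaWeighted (deta (deta u)))
    + interactionFst c B₁ u v * etaWeighted u - etaWeighted u * interactionSnd c B₂ u v

/-- The weighted time derivative of `v` under the flow of the dispersive system. -/
def rateSnd (c : ℂ) (B₁ B₂ : 𝔸) (u v : 𝓢(ℝ × ℝ, 𝔸)) : Triple 𝔸 :=
  (2 : ℂ) • (xiWeighted (dxi v) * constTriple B₁) - (2 : ℂ) • (constTriple B₂ * xiWeighted (deta v))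
    - c • (xiWeighted (dxi (dxi v)) - xiWeighted (deta (deta v)))
    + interactionSnd c B₂ u v * xiWeighted v - xiWeighted v * interactionFst c B₁ u v

lemma continuous_etaWeighted : Continuous (etaWeighted : 𝓢(ℝ × ℝ, 𝔸) → Triple 𝔸) :=
  (scaleBy leftWeight).continuous.comp continuous_weighted

lemma continuous_xiWeighted : Continuous (xiWeighted : 𝓢(ℝ × ℝ, 𝔸) → Triple 𝔸) :=
  (scaleBy midWeight).continuous.comp continuous_weighted

lemma continuous_plain : Continuous (plain : 𝓢(ℝ × ℝ, 𝔸) → Triple 𝔸) :=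
  (BoundedContinuousFunction.continuous_compContinuous _).comp
    (SchwartzMap.toBoundedContinuousFunctionCLM ℝ (ℝ × ℝ) 𝔸).continuous

lemma continuous_dxi : Continuous (dxi : 𝓢(ℝ × ℝ, 𝔸) → 𝓢(ℝ × ℝ, 𝔸)) := by
  unfold dxi; fun_prop

lemma continuous_deta : Continuous (deta : 𝓢(ℝ × ℝ, 𝔸) → 𝓢(ℝ × ℝ, 𝔸)) := by
  unfold deta; fun_prop

lemma continuous_interactionFst (c : ℂ) (B₁ : 𝔸) :
    Continuous fun q : 𝓢(ℝ × ℝ, 𝔸) × 𝓢(ℝ × ℝ, 𝔸) => interactionFst c B₁ q.1 q.2 := by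
  have he : Continuous (etaWeighted : 𝓢(ℝ × ℝ, 𝔸) → Triple 𝔸) := continuous_etaWeighted
  have hp : Continuous (plain : 𝓢(ℝ × ℝ, 𝔸) → Triple 𝔸) := continuous_plain
  have h1 : Continuous (dxi : 𝓢(ℝ × ℝ, 𝔸) → 𝓢(ℝ × ℝ, 𝔸)) := continuous_dxi
  have h2 : Continuous (deta : 𝓢(ℝ × ℝ, 𝔸) → 𝓢(ℝ × ℝ, 𝔸)) := continuous_deta
  unfold interactionFst
  fun_prop

lemma continuous_interactionSnd (c : ℂ) (B₂ : 𝔸) :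
    Continuous fun q : 𝓢(ℝ × ℝ, 𝔸) × 𝓢(ℝ × ℝ, 𝔸) => interactionSnd c B₂ q.1 q.2 := by
  have he : Continuous (xiWeighted : 𝓢(ℝ × ℝ, 𝔸) → Triple 𝔸) := continuous_xiWeighted
  have hp : Continuous (plain : 𝓢(ℝ × ℝ, 𝔸) → Triple 𝔸) := continuous_plain
  have h1 : Continuous (dxi : 𝓢(ℝ × ℝ, 𝔸) → 𝓢(ℝ × ℝ, 𝔸)) := continuous_dxi
  have h2 : Continuous (deta : 𝓢(ℝ × ℝ, 𝔸) → 𝓢(ℝ × ℝ, 𝔸)) := continuous_deta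
  unfold interactionSnd
  fun_prop

/-- The time derivative of the potential depends continuously on the potentials in the Schwartz
topology. This turns the pointwise time derivatives of a solution into derivatives in the weighted
supremum norm. -/
lemma continuous_rateFst (c : ℂ) (B₁ B₂ : 𝔸) :
    Continuous fun q : 𝓢(ℝ × ℝ, 𝔸) × 𝓢(ℝ × ℝ, 𝔸) => rateFst c B₁ B₂ q.1 q.2 := by
  have he : Continuous (etaWeighted : 𝓢(ℝ × ℝ, 𝔸) → Triple 𝔸) := continuous_etaWeighted
  have h1 : Continuous (dxi : 𝓢(ℝ × ℝ, 𝔸) → 𝓢(ℝ × ℝ, 𝔸)) := continuous_dxi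
  have h2 : Continuous (deta : 𝓢(ℝ × ℝ, 𝔸) → 𝓢(ℝ × ℝ, 𝔸)) := continuous_deta
  have h3 := continuous_interactionFst c B₁
  have h4 := continuous_interactionSnd c B₂
  unfold rateFst
  fun_prop

lemma continuous_rateSnd (c : ℂ) (B₁ B₂ : 𝔸) :
    Continuous fun q : 𝓢(ℝ × ℝ, 𝔸) × 𝓢(ℝ × ℝ, 𝔸) => rateSnd c B₁ B₂ q.1 q.2 := by
  have he : Continuous (xiWeighted : 𝓢(ℝ × ℝ, 𝔸) → Triple 𝔸) := continuous_xiWeighted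
  have h1 : Continuous (dxi : 𝓢(ℝ × ℝ, 𝔸) → 𝓢(ℝ × ℝ, 𝔸)) := continuous_dxi
  have h2 : Continuous (deta : 𝓢(ℝ × ℝ, 𝔸) → 𝓢(ℝ × ℝ, 𝔸)) := continuous_deta
  have h3 := continuous_interactionFst c B₁
  have h4 := continuous_interactionSnd c B₂
  unfold rateSnd
  fun_prop

variable [CompleteSpace 𝔸]

/-- The decay of `P` as `η → ∞` makes it the function determined by `u` and `v`. -/
lemma IsCharacteristicSolution.fst_eq {J : Set ℝ} {c : ℂ} {B₁ B₂ : 𝔸} {u v : ℝ → 𝓢(ℝ × ℝ, 𝔸)}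
    {P p : ℝ → ℝ × ℝ → 𝔸} (h : IsCharacteristicSolution J c B₁ B₂ u v P p) {t : ℝ} (ht : t ∈ J)
    (ξ η τ : ℝ) : interactionFst c B₁ (u t) (v t) (ξ, η, τ) = P t (ξ, η) := by
  refine (eq_rightIntegral_of_hasDerivAt (fun y => ?_) (h.tendsto_P t ht ξ) η).symm
  refine (h.deriv_P t ht ξ y).congr_deriv ?_
  have e1 : ∀ w : 𝓢(ℝ × ℝ, 𝔸), w (ξ, y) = decayWeight y • etaWeighted w (ξ, y, τ) := fun w => by
    rw [etaWeighted_apply, smul_smul, decayWeight_mul_one_add_sq, one_smul]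
  rw [BoundedContinuousFunction.neg_apply, smul_neg, neg_neg]
  simp only [BoundedContinuousFunction.sub_apply, BoundedContinuousFunction.add_apply,
    BoundedContinuousFunction.mul_apply, triple_smul_apply, plain_apply, smul_sub, smul_add,
    BoundedContinuousFunction.const_apply]
  rw [e1 (u t), e1 (dxi (u t)), e1 (deta (u t))]
  simp only [smul_mul_assoc, mul_smul_comm, smul_comm (decayWeight y)]

lemma IsCharacteristicSolution.snd_eq {J : Set ℝ} {c : ℂ} {B₁ B₂ : 𝔸} {u v : ℝ → 𝓢(ℝ × ℝ, 𝔸)}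
    {P p : ℝ → ℝ × ℝ → 𝔸} (h : IsCharacteristicSolution J c B₁ B₂ u v P p) {t : ℝ} (ht : t ∈ J)
    (ξ η τ : ℝ) : interactionSnd c B₂ (u t) (v t) (ξ, η, τ) = p t (ξ, η) := by
  refine (eq_leftIntegral_of_hasDerivAt (fun x => ?_) (h.tendsto_p t ht η) ξ).symm
  refine (h.deriv_p t ht x η).congr_deriv ?_
  have e1 : ∀ w : 𝓢(ℝ × ℝ, 𝔸), w (x, η) = decayWeight x • xiWeighted w (x, η, τ) := fun w => by
    rw [xiWeighted_apply, smul_smul, decayWeight_mul_one_add_sq, one_smul]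
  simp only [BoundedContinuousFunction.sub_apply, BoundedContinuousFunction.add_apply,
    BoundedContinuousFunction.mul_apply, triple_smul_apply, plain_apply, smul_sub, smul_add,
    BoundedContinuousFunction.const_apply]
  rw [e1 (v t), e1 (dxi (v t)), e1 (deta (v t))]
  simp only [smul_mul_assoc, mul_smul_comm, smul_comm (decayWeight x)]

lemma IsCharacteristicSolution.rateFst_eq {J : Set ℝ} {c : ℂ} {B₁ B₂ : 𝔸}
    {u v : ℝ → 𝓢(ℝ × ℝ, 𝔸)} {P p : ℝ → ℝ × ℝ → 𝔸}
    (h : IsCharacteristicSolution J c B₁ B₂ u v P p) {t : ℝ} (ht : t ∈ J) (ξ η τ : ℝ) :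
    rateFst c B₁ B₂ (u t) (v t) (ξ, η, τ) = (1 + η ^ 2) •
      ((2 : ℂ) • (B₁ * dxi (u t) (ξ, η)) - (2 : ℂ) • (deta (u t) (ξ, η) * B₂)
      + c • (dxi (dxi (u t)) (ξ, η) - deta (deta (u t)) (ξ, η)) + P t (ξ, η) * u t (ξ, η)
      - u t (ξ, η) * p t (ξ, η)) := by
  unfold rateFst
  simp only [BoundedContinuousFunction.sub_apply, BoundedContinuousFunction.add_apply,
    BoundedContinuousFunction.mul_apply, triple_smul_apply, smul_sub, smul_add,
    BoundedContinuousFunction.const_apply, h.fst_eq ht, h.snd_eq ht, etaWeighted_apply,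
    smul_mul_assoc, mul_smul_comm, smul_comm (1 + η ^ 2)]

lemma IsCharacteristicSolution.rateSnd_eq {J : Set ℝ} {c : ℂ} {B₁ B₂ : 𝔸}
    {u v : ℝ → 𝓢(ℝ × ℝ, 𝔸)} {P p : ℝ → ℝ × ℝ → 𝔸}
    (h : IsCharacteristicSolution J c B₁ B₂ u v P p) {t : ℝ} (ht : t ∈ J) (ξ η τ : ℝ) :
    rateSnd c B₁ B₂ (u t) (v t) (ξ, η, τ) = (1 + ξ ^ 2) •
      ((2 : ℂ) • (dxi (v t) (ξ, η) * B₁) - (2 : ℂ) • (B₂ * deta (v t) (ξ, η))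
      - c • (dxi (dxi (v t)) (ξ, η) - deta (deta (v t)) (ξ, η)) + p t (ξ, η) * v t (ξ, η)
      - v t (ξ, η) * P t (ξ, η)) := by
  unfold rateSnd
  simp only [BoundedContinuousFunction.sub_apply, BoundedContinuousFunction.add_apply,
    BoundedContinuousFunction.mul_apply, triple_smul_apply, smul_sub, smul_add,
    BoundedContinuousFunction.const_apply, h.fst_eq ht, h.snd_eq ht, xiWeighted_apply,
    smul_mul_assoc, mul_smul_comm, smul_comm (1 + ξ ^ 2)]

/-- Along a solution of the dispersive system the transmission kernel solves a linear equation with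
constant coefficients. -/
theorem IsCharacteristicSolution.hasDerivAt_transmission {J : Set ℝ} (hJ : IsOpen J) {c : ℂ}
    {B₁ B₂ : 𝔸} {u v : ℝ → 𝓢(ℝ × ℝ, 𝔸)} {P p : ℝ → ℝ × ℝ → 𝔸}
    (h : IsCharacteristicSolution J c B₁ B₂ u v P p) (hu : ContinuousOn u J)
    (hv : ContinuousOn v J) {t : ℝ} (ht : t ∈ J) :
    ∃ f₁ f₂ g₁ g₂ : ℝ × ℝ → 𝔸,
      (∀ z, HasDerivAt (fun s : ℝ => transmission (u t) (v t) (z + s • ((1, 0) : ℝ × ℝ))) (f₁ z) 0) ∧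
      (∀ z, HasDerivAt (fun s : ℝ => f₁ (z + s • ((1, 0) : ℝ × ℝ))) (f₂ z) 0) ∧
      (∀ z, HasDerivAt (fun s : ℝ => transmission (u t) (v t) (z + s • ((0, 1) : ℝ × ℝ))) (g₁ z) 0) ∧
      (∀ z, HasDerivAt (fun s : ℝ => g₁ (z + s • ((0, 1) : ℝ × ℝ))) (g₂ z) 0) ∧
      ∀ z, HasDerivAt (fun s => transmission (u s) (v s) z)
        ((2 : ℂ) • (B₁ * f₁ z) - (2 : ℂ) • (g₁ z * B₂) + c • (f₂ z - g₂ z)) t := by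
  obtain ⟨x₁, y₁, x₂, y₂, f₁, f₂, hX⟩ := exists_isTranslationJet (1, 0) (u t) (v t)
  obtain ⟨a₁, b₁, a₂, b₂, g₁, g₂, hE⟩ := exists_isTranslationJet (0, 1) (u t) (v t)
  refine ⟨f₁, f₂, g₁, g₂, hX.deriv₁, hX.deriv₂, hE.deriv₁, hE.deriv₂, fun z => ?_⟩
  have hJt := hJ.mem_nhds ht
  have hq : ContinuousAt (fun s => (u s, v s)) t :=
    (hu.continuousAt hJt).prodMk (hv.continuousAt hJt)
  have hU : HasDerivAt (fun s => etaWeighted (u s)) (rateFst c B₁ B₂ (u t) (v t)) t := by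
    refine hasDerivAt_of_pointwise (f' := fun s => rateFst c B₁ B₂ (u s) (v s)) hJt
      (ContinuousAt.comp (g := fun q : 𝓢(ℝ × ℝ, 𝔸) × 𝓢(ℝ × ℝ, 𝔸) => rateFst c B₁ B₂ q.1 q.2)
        (f := fun s => (u s, v s)) (continuous_rateFst c B₁ B₂).continuousAt hq) fun s hs q => ?_
    obtain ⟨ξ, η, τ⟩ := q
    rw [h.rateFst_eq hs]
    simp_rw [etaWeighted_apply]
    exact (h.deriv_u s hs (ξ, η)).const_smul _
  have hV : HasDerivAt (fun s => xiWeighted (v s)) (rateSnd c B₁ B₂ (u t) (v t)) t := by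
    refine hasDerivAt_of_pointwise (f' := fun s => rateSnd c B₁ B₂ (u s) (v s)) hJt
      (ContinuousAt.comp (g := fun q : 𝓢(ℝ × ℝ, 𝔸) × 𝓢(ℝ × ℝ, 𝔸) => rateSnd c B₁ B₂ q.1 q.2)
        (f := fun s => (u s, v s)) (continuous_rateSnd c B₁ B₂).continuousAt hq) fun s hs q => ?_
    obtain ⟨ξ, η, τ⟩ := q
    rw [h.rateSnd_eq hs]
    simp_rw [xiWeighted_apply]
    exact (h.deriv_v s hs (ξ, η)).const_smul _
  obtain ⟨a, b, hka, hkb, ha, hb⟩ := exists_hasDerivAt_goursat hU hV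
  have D : IsLaxData c B₁ B₂ (u t) (v t) (rateFst c B₁ B₂ (u t) (v t))
      (rateSnd c B₁ B₂ (u t) (v t)) (interactionFst c B₁ (u t) (v t))
      (interactionSnd c B₂ (u t) (v t)) :=
    { eq_u := fun ξ η τ => by
        rw [h.rateFst_eq ht, h.fst_eq ht, h.snd_eq ht, smul_smul, decayWeight_mul_one_add_sq,
          one_smul]
      eq_v := fun ξ η τ => by
        rw [h.rateSnd_eq ht, h.fst_eq ht, h.snd_eq ht, smul_smul, decayWeight_mul_one_add_sq,
          one_smul]
      deriv_P := fun ξ η τ => by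
        simp_rw [h.fst_eq ht]
        exact h.deriv_P t ht ξ η
      tendsto_P := fun ξ τ => by
        simp_rw [h.fst_eq ht]
        exact h.tendsto_P t ht ξ
      deriv_p := fun ξ η τ => by
        simp_rw [h.snd_eq ht]
        exact h.deriv_p t ht ξ η
      tendsto_p := fun η τ => by
        simp_rw [h.snd_eq ht]
        exact h.tendsto_p t ht η }
  rw [← transmission_evolution D hX hE ha hb z.1 z.2]
  exact (hka.fun_add (((hU.fun_mul hkb).mapTriple rightIntegral).const_smul (-2⁻¹ : ℂ))).eval
    (z.1, z.2, z.2)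

end

noncomputable section

variable {𝔸 : Type*} [NormedRing 𝔸] [NormedAlgebra ℂ 𝔸]

/-! ### Decay of the impulse response -/

lemma SchwartzMap.exists_norm_le_decayWeight (u : 𝓢(ℝ × ℝ, 𝔸)) :
    ∃ C, 0 ≤ C ∧ ∀ ξ η, ‖u (ξ, η)‖ ≤ C * (decayWeight ξ * decayWeight η) := by
  refine ⟨‖weighted u‖, norm_nonneg _, fun ξ η => ?_⟩
  have h := (weighted u).norm_coe_le_norm (ξ, η, 0)
  rw [weighted_apply, norm_smul, Real.norm_of_nonneg (growthWeight_pos _).le] at h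
  have e : ‖u (ξ, η)‖ = growthWeight (ξ, η) * ‖u (ξ, η)‖ * (decayWeight ξ * decayWeight η) := by
    have h1 := decayWeight_mul_one_add_sq ξ
    have h2 := decayWeight_mul_one_add_sq η
    calc ‖u (ξ, η)‖ = (decayWeight ξ * (1 + ξ ^ 2)) * (decayWeight η * (1 + η ^ 2)) * ‖u (ξ, η)‖ := by
          rw [h1, h2, one_mul, one_mul]
      _ = _ := by unfold growthWeight; ring
  rw [e]
  exact mul_le_mul_of_nonneg_right h (mul_pos (decayWeight_pos _) (decayWeight_pos _)).le

/-- The weight `1 / (1 + τ²)` as a bounded function. -/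
def impulseWeight : (ℝ × ℝ × ℝ) →ᵇ ℝ :=
  BoundedContinuousFunction.ofNormedAddCommGroup (fun z => decayWeight z.2.2)
    (continuous_decayWeight.comp (by fun_prop)) 1 (fun z => by
      rw [Real.norm_of_nonneg (decayWeight_pos _).le]; exact decayWeight_le_one _)

lemma goursatOp_scaleBy_impulseWeight (U V f : Triple 𝔸) :
    goursatOp U V (scaleBy impulseWeight f) = scaleBy impulseWeight (goursatOp U V f) := by
  have hl : leftIntegral (V * scaleBy impulseWeight f)
      = scaleBy impulseWeight (leftIntegral (V * f)) := by
    ext ⟨ξ, η, τ⟩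
    change (∫ s in Set.Iic ξ, decayWeight s • (V (s, η, τ) * decayWeight τ • f (s, η, τ)))
      = decayWeight τ • ∫ s in Set.Iic ξ, decayWeight s • (V (s, η, τ) * f (s, η, τ))
    rw [← integral_smul]
    simp_rw [mul_smul_comm, smul_comm (decayWeight τ)]
  ext ⟨ξ, η, τ⟩
  rw [goursatOp_apply, hl]
  change (4⁻¹ : ℂ) • frontIntegral (U * scaleBy impulseWeight (leftIntegral (V * f))) (ξ, η, τ)
    = decayWeight τ • ((4⁻¹ : ℂ) • frontIntegral (U * leftIntegral (V * f)) (ξ, η, τ))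
  rw [frontIntegral_apply, frontIntegral_apply, smul_comm (decayWeight τ),
    ← intervalIntegral.integral_smul (decayWeight τ)]
  congr 2
  funext s
  change decayWeight s • (U (ξ, s, τ) * decayWeight τ • leftIntegral (V * f) (ξ, s, τ))
    = decayWeight τ • decayWeight s • (U (ξ, s, τ) * leftIntegral (V * f) (ξ, s, τ))
  rw [mul_smul_comm, smul_comm (decayWeight τ)]

lemma norm_neg_half_smul (x : 𝔸) : ‖(-2⁻¹ : ℂ) • x‖ = 2⁻¹ * ‖x‖ := by
  rw [norm_smul]; norm_num

/-- The part of the impulse response in the second component that has passed the whole potential: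
the limit of `k₂` as `ξ → ∞`. -/
def reflection (u v : 𝓢(ℝ × ℝ, 𝔸)) (z : ℝ × ℝ) : 𝔸 :=
  (-2⁻¹ : ℂ) • ∫ s, v (s, z.1) * kerFst u v (s, z.1, z.2)

lemma integrable_potential_mul_kerFst (u v : 𝓢(ℝ × ℝ, 𝔸)) (η τ : ℝ) :
    Integrable fun s => v (s, η) * kerFst u v (s, η, τ) :=
  (integrable_slice_left (xiWeighted v * kerFst u v) η τ).congr (Eventually.of_forall fun s =>
    decayWeight_smul_xiWeighted_mul v (kerFst u v) s η τ)

lemma tendsto_kerSnd_atTop (u v : 𝓢(ℝ × ℝ, 𝔸)) (η τ : ℝ) :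
    Tendsto (fun ξ => kerSnd u v (ξ, η, τ)) atTop (𝓝 (reflection u v (η, τ))) := by
  simp_rw [kerSnd_apply]
  exact ((aecover_Iic tendsto_id).integral_tendsto_of_countably_generated
    (integrable_potential_mul_kerFst u v η τ)).const_smul (-2⁻¹ : ℂ)

lemma tendsto_kerSnd_atBot (u v : 𝓢(ℝ × ℝ, 𝔸)) (η τ : ℝ) :
    Tendsto (fun ξ => kerSnd u v (ξ, η, τ)) atBot (𝓝 0) :=
  tendsto_leftIntegral_smul (b := kerSnd u v) rfl η τ

lemma continuous_reflection (u v : 𝓢(ℝ × ℝ, 𝔸)) : Continuous (reflection u v) := by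
  refine Continuous.const_smul ?_ _
  refine continuous_of_dominated (bound := fun s => decayWeight s * ‖xiWeighted v * kerFst u v‖)
    (fun z => (integrable_potential_mul_kerFst u v z.1 z.2).aestronglyMeasurable)
    (fun z => Eventually.of_forall fun s => ?_) (integrable_decayWeight.mul_const _)
    (Eventually.of_forall fun s => ?_)
  · rw [← decayWeight_smul_xiWeighted_mul, norm_smul, Real.norm_of_nonneg (decayWeight_pos s).le]
    exact mul_le_mul_of_nonneg_left (BoundedContinuousFunction.norm_coe_le_norm _ _)
      (decayWeight_pos s).le
  · exact (v.continuous.comp (by fun_prop)).mul ((kerFst u v).continuous.comp (by fun_prop))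

variable [CompleteSpace 𝔸]

/-- The Goursat operator commutes with multiplication by functions of `τ`, so the response inherits the
decay in `τ` of its value on the front. -/
lemma exists_norm_kerFst_le_impulse (u v : 𝓢(ℝ × ℝ, 𝔸)) :
    ∃ C, 0 ≤ C ∧ ∀ ξ η τ, ‖kerFst u v (ξ, η, τ)‖ ≤ C * decayWeight τ := by
  set U := etaWeighted u
  set V := xiWeighted v
  -- the equation for `(1 + τ²) k₁`, whose front value is still bounded
  set g : Triple 𝔸 := (-2⁻¹ : ℂ) • frontTrace U with hg
  set f := Ring.inverse (1 - goursatOp U V) g with hf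
  have hfg : f = g + goursatOp U V f := by
    have h := congrArg (fun A : Triple 𝔸 →L[ℂ] Triple 𝔸 => A g)
      (Ring.mul_inverse_cancel _ (isUnit_one_sub_goursatOp U V))
    change f - goursatOp U V f = g at h
    rw [← h]; abel
  have hk : scaleBy impulseWeight f = kerFst u v := by
    refine eq_inverse_of_eq_add_goursatOp ?_
    rw [goursatOp_scaleBy_impulseWeight]
    conv_lhs => rw [hfg]
    rw [map_add]
    congr 1
    ext ⟨ξ, η, τ⟩
    change decayWeight τ • ((-2⁻¹ : ℂ) • U (ξ, τ, τ)) = (-2⁻¹ : ℂ) • (decayWeight τ • U (ξ, τ, τ))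
    rw [smul_comm]
  refine ⟨‖f‖, norm_nonneg _, fun ξ η τ => ?_⟩
  rw [← hk, scaleBy_apply, norm_smul, mul_comm]
  exact mul_le_mul (f.norm_coe_le_norm _) (Real.norm_of_nonneg (decayWeight_pos τ).le).le
    (norm_nonneg _) (norm_nonneg _)

/-- The impulse response decays in the position of the impulse and in the characteristic coordinate
that stays fixed along the motion of the component. -/
lemma exists_norm_ker_le (u v : 𝓢(ℝ × ℝ, 𝔸)) :
    ∃ C, 0 ≤ C ∧ (∀ ξ η τ, ‖kerFst u v (ξ, η, τ)‖ ≤ C * (decayWeight ξ * decayWeight τ)) ∧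
      ∀ ξ η τ, ‖kerSnd u v (ξ, η, τ)‖ ≤ C * (decayWeight η * decayWeight τ) := by
  obtain ⟨A, hA, hk⟩ := exists_norm_kerFst_le_impulse u v
  obtain ⟨Cu, hCu, hu⟩ := u.exists_norm_le_decayWeight
  obtain ⟨Cv, hCv, hv⟩ := v.exists_norm_le_decayWeight
  have hw := fun s => (decayWeight_pos s).le
  have h2 : ∀ ξ η τ, ‖kerSnd u v (ξ, η, τ)‖ ≤ (Real.pi * (Cv * A)) * (decayWeight η * decayWeight τ) := by
    intro ξ η τ
    rw [kerSnd_apply, norm_neg_half_smul]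
    have h : ‖∫ s in Set.Iic ξ, v (s, η) * kerFst u v (s, η, τ)‖
        ≤ ∫ s, decayWeight s * (Cv * decayWeight η * (A * decayWeight τ)) := by
      refine (norm_integral_le_of_norm_le ((integrable_decayWeight.mul_const _).integrableOn)
        (Eventually.of_forall fun s => ?_)).trans (setIntegral_le_integral
        (integrable_decayWeight.mul_const _) (Eventually.of_forall fun s => ?_))
      · calc _ ≤ ‖v (s, η)‖ * ‖kerFst u v (s, η, τ)‖ := norm_mul_le _ _
          _ ≤ (Cv * (decayWeight s * decayWeight η)) * (A * decayWeight τ) :=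
            mul_le_mul (hv _ _) (hk _ _ _) (norm_nonneg _)
              (mul_nonneg hCv (mul_nonneg (hw _) (hw _)))
          _ = _ := by ring
      · exact mul_nonneg (hw s) (mul_nonneg (mul_nonneg hCv (hw _)) (mul_nonneg hA (hw _)))
    rw [integral_mul_const, integral_decayWeight] at h
    calc _ ≤ ‖∫ s in Set.Iic ξ, v (s, η) * kerFst u v (s, η, τ)‖ := by
          linarith [norm_nonneg (∫ s in Set.Iic ξ, v (s, η) * kerFst u v (s, η, τ))]
      _ ≤ _ := h
      _ = _ := by ring
  set B := Real.pi * (Cv * A) with hB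
  have hB0 : 0 ≤ B := mul_nonneg Real.pi_pos.le (mul_nonneg hCv hA)
  have h1 : ∀ ξ η τ, ‖kerFst u v (ξ, η, τ)‖
      ≤ (Cu + Real.pi * (Cu * B)) * (decayWeight ξ * decayWeight τ) := by
    intro ξ η τ
    have h : ‖∫ s in τ..η, u (ξ, s) * kerSnd u v (ξ, s, τ)‖
        ≤ ∫ s, decayWeight s * (Cu * decayWeight ξ * (B * decayWeight τ)) := by
      have hi : Integrable fun s => decayWeight s * (Cu * decayWeight ξ * (B * decayWeight τ)) :=
        integrable_decayWeight.mul_const _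
      rw [intervalIntegral.norm_intervalIntegral_eq]
      refine (norm_integral_le_of_norm_le hi.integrableOn
        (Eventually.of_forall fun s => ?_)).trans (setIntegral_le_integral hi
        (Eventually.of_forall fun s => ?_))
      · calc _ ≤ ‖u (ξ, s)‖ * ‖kerSnd u v (ξ, s, τ)‖ := norm_mul_le _ _
          _ ≤ (Cu * (decayWeight ξ * decayWeight s)) * (B * (decayWeight s * decayWeight τ)) :=
            mul_le_mul (hu _ _) (h2 _ _ _) (norm_nonneg _)
              (mul_nonneg hCu (mul_nonneg (hw _) (hw _)))
          _ = decayWeight s * (decayWeight s * (Cu * decayWeight ξ * (B * decayWeight τ))) := by ring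
          _ ≤ _ := mul_le_of_le_one_left (mul_nonneg (hw s) (mul_nonneg (mul_nonneg hCu (hw _))
              (mul_nonneg hB0 (hw _)))) (decayWeight_le_one s)
      · exact mul_nonneg (hw s) (mul_nonneg (mul_nonneg hCu (hw _)) (mul_nonneg hB0 (hw _)))
    rw [integral_mul_const, integral_decayWeight] at h
    rw [kerFst_apply]
    refine (norm_add_le _ _).trans ?_
    rw [norm_neg_half_smul, norm_neg_half_smul]
    have h0 := hu ξ τ
    calc _ ≤ ‖u (ξ, τ)‖ + ‖∫ s in τ..η, u (ξ, s) * kerSnd u v (ξ, s, τ)‖ := by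
          linarith [norm_nonneg (u (ξ, τ)),
            norm_nonneg (∫ s in τ..η, u (ξ, s) * kerSnd u v (ξ, s, τ))]
      _ ≤ _ := add_le_add h0 h
      _ = _ := by ring
  refine ⟨max (Cu + Real.pi * (Cu * B)) B, le_max_of_le_right hB0, fun ξ η τ => ?_, fun ξ η τ => ?_⟩
  · exact (h1 ξ η τ).trans (mul_le_mul_of_nonneg_right (le_max_left _ _)
      (mul_nonneg (hw _) (hw _)))
  · exact (h2 ξ η τ).trans (mul_le_mul_of_nonneg_right (le_max_right _ _)
      (mul_nonneg (hw _) (hw _)))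

lemma exists_norm_farKernel_le (u v : 𝓢(ℝ × ℝ, 𝔸)) :
    ∃ C, 0 ≤ C ∧ (∀ z, ‖transmission u v z‖ ≤ C * (decayWeight z.1 * decayWeight z.2)) ∧
      ∀ z, ‖reflection u v z‖ ≤ C * (decayWeight z.1 * decayWeight z.2) := by
  obtain ⟨C, hC, h1, h2⟩ := exists_norm_ker_le u v
  exact ⟨C, hC, fun z => le_of_tendsto (tendsto_kerFst_atTop u v z.1 z.2).norm
    (Eventually.of_forall fun η => h1 _ _ _), fun z => le_of_tendsto
    (tendsto_kerSnd_atTop u v z.1 z.2).norm (Eventually.of_forall fun η => h2 _ _ _)⟩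

/-- An impulse annihilated by the potential `u` has no response. -/
lemma kerFst_mul_eq_zero {u v : 𝓢(ℝ × ℝ, 𝔸)} {E : 𝔸} (hE : ∀ z, u z * E = 0)
    (z : ℝ × ℝ × ℝ) : kerFst u v z * E = 0 := by
  have h1 : kerSnd u v * constTriple E
      = (-2⁻¹ : ℂ) • leftIntegral (xiWeighted v * (kerFst u v * constTriple E)) := by
    ext ⟨ξ, η, τ⟩
    rw [triple_smul_apply, leftIntegral_xiWeighted_mul, BoundedContinuousFunction.mul_apply,
      kerSnd_apply, smul_mul_assoc, BoundedContinuousFunction.const_apply,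
      ← integral_mul_const_of_integrable (integrable_potential_mul_kerFst u v η τ).integrableOn]
    simp_rw [BoundedContinuousFunction.mul_apply, mul_assoc]
    rfl
  have h2 : kerFst u v * constTriple E
      = (-2⁻¹ : ℂ) • frontIntegral (etaWeighted u * (kerSnd u v * constTriple E)) := by
    ext ⟨ξ, η, τ⟩
    rw [triple_smul_apply, frontIntegral_etaWeighted_mul, BoundedContinuousFunction.mul_apply,
      kerFst_apply, add_mul, smul_mul_assoc, smul_mul_assoc, BoundedContinuousFunction.const_apply,
      hE, smul_zero, zero_add]
    congr 1
    have hc : Continuous fun s => u (ξ, s) * kerSnd u v (ξ, s, τ) :=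
      (u.continuous.comp (by fun_prop)).mul ((kerSnd u v).continuous.comp (by fun_prop))
    have := (ContinuousLinearMap.mul ℝ 𝔸).flip E |>.intervalIntegral_comp_comm
      (hc.intervalIntegrable (μ := volume) τ η)
    simp only [ContinuousLinearMap.flip_apply, ContinuousLinearMap.mul_apply'] at this
    rw [← this]
    simp_rw [BoundedContinuousFunction.mul_apply, mul_assoc]
    rfl
  have h := eq_zero_of_homogeneous_goursat h1 h2
  exact congrArg (fun f : Triple 𝔸 => f z) h

/-- Incident waves annihilated by `u` are not reflected. -/
lemma reflection_mul_eq_zero {u v : 𝓢(ℝ × ℝ, 𝔸)} {E : 𝔸} (hE : ∀ z, u z * E = 0)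
    (z : ℝ × ℝ) : reflection u v z * E = 0 := by
  rw [reflection, smul_mul_assoc,
    ← integral_mul_const_of_integrable (integrable_potential_mul_kerFst u v z.1 z.2)]
  simp_rw [mul_assoc, kerFst_mul_eq_zero hE, mul_zero]
  simp

end

noncomputable section

/-! ### Waves generated by an incident profile -/

variable {H : Type*} [NormedAddCommGroup H] [NormedSpace ℂ H]

/-- Profiles on which all the kernels act: measurable and integrable against `1 / (1 + τ²)`. -/
structure IsIncident (a : ℝ → H) : Prop where
  aestronglyMeasurable : AEStronglyMeasurable a
  integrable : Integrable fun τ => decayWeight τ * ‖a τ‖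

lemma IsIncident.clm_apply {a : ℝ → H} (ha : IsIncident a) {K : ℝ → H →L[ℂ] H}
    (hK : AEStronglyMeasurable K) : AEStronglyMeasurable fun τ => K τ (a τ) :=
  (ContinuousLinearMap.id ℂ (H →L[ℂ] H)).aestronglyMeasurable_comp₂ hK ha.aestronglyMeasurable

lemma norm_clm_apply_le {K : H →L[ℂ] H} {x : H} {A w : ℝ} (h : ‖K‖ ≤ A * w) :
    ‖K x‖ ≤ A * (w * ‖x‖) :=
  ((K.le_opNorm x).trans (mul_le_mul_of_nonneg_right h (norm_nonneg _))).trans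
    (mul_assoc _ _ _).le

lemma IsIncident.integrable_apply {a : ℝ → H} (ha : IsIncident a) {K : ℝ → H →L[ℂ] H}
    (hK : AEStronglyMeasurable K) {A : ℝ} (hb : ∀ τ, ‖K τ‖ ≤ A * decayWeight τ) :
    Integrable fun τ => K τ (a τ) :=
  (ha.integrable.const_mul A).mono' (ha.clm_apply hK)
    (Eventually.of_forall fun τ => norm_clm_apply_le (hb τ))

lemma IsIncident.norm_setIntegral_apply_le {a : ℝ → H} (ha : IsIncident a) {K : ℝ → H →L[ℂ] H}
    {A : ℝ} (hA : 0 ≤ A) (hb : ∀ τ, ‖K τ‖ ≤ A * decayWeight τ) (S : Set ℝ) :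
    ‖∫ τ in S, K τ (a τ)‖ ≤ A * ∫ τ, decayWeight τ * ‖a τ‖ := by
  rw [← integral_const_mul]
  exact (norm_integral_le_of_norm_le (ha.integrable.const_mul A).integrableOn
    (Eventually.of_forall fun τ => norm_clm_apply_le (hb τ))).trans
    (setIntegral_le_integral (ha.integrable.const_mul A) (Eventually.of_forall fun τ =>
      mul_nonneg hA (mul_nonneg (decayWeight_pos τ).le (norm_nonneg _))))

/-- The first component of the wave generated by the profile `a` incident in the second one: impulses
at `τ` have been felt only behind their fronts, for `τ ≤ η`. -/
def fieldFst (u v : 𝓢(ℝ × ℝ, H →L[ℂ] H)) (a : ℝ → H) (z : ℝ × ℝ) : H :=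
  ∫ τ in Set.Iic z.2, kerFst u v (z.1, z.2, τ) (a τ)

/-- The second component, without the incident profile itself, of the wave generated by the profile
`a` incident in the second one. -/
def fieldSnd (u v : 𝓢(ℝ × ℝ, H →L[ℂ] H)) (a : ℝ → H) (z : ℝ × ℝ) : H :=
  ∫ τ in Set.Iic z.2, kerSnd u v (z.1, z.2, τ) (a τ)

lemma continuous_triple_slice (f : Triple (H →L[ℂ] H)) (ξ η : ℝ) :
    Continuous fun τ => f (ξ, η, τ) := by fun_prop

lemma tendsto_clm_apply_const {ι : Type*} {l : Filter ι} {K : ι → H →L[ℂ] H} {L : H →L[ℂ] H}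
    (h : Tendsto K l (𝓝 L)) (x : H) : Tendsto (fun i => K i x) l (𝓝 (L x)) :=
  ((ContinuousLinearMap.apply ℂ H x).continuous.tendsto L).comp h

lemma schwartz_norm_le (u : 𝓢(ℝ × ℝ, H →L[ℂ] H)) : ∃ C, 0 ≤ C ∧
    (∀ ξ η, ‖u (ξ, η)‖ ≤ C * decayWeight ξ) ∧ ∀ ξ η, ‖u (ξ, η)‖ ≤ C * decayWeight η := by
  obtain ⟨C, hC, h⟩ := u.exists_norm_le_decayWeight
  refine ⟨C, hC, fun ξ η => (h ξ η).trans ?_, fun ξ η => (h ξ η).trans ?_⟩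
  · exact mul_le_mul_of_nonneg_left (mul_le_of_le_one_right (decayWeight_pos _).le
      (decayWeight_le_one _)) hC
  · exact mul_le_mul_of_nonneg_left (mul_le_of_le_one_left (decayWeight_pos _).le
      (decayWeight_le_one _)) hC

lemma IsIncident.integrable_prod {a : ℝ → H} (ha : IsIncident a) {L : ℝ → H →L[ℂ] H}
    {K : ℝ × ℝ → H →L[ℂ] H} (hL : Continuous L) (hK : Continuous K) {A B : ℝ}
    (hLb : ∀ s, ‖L s‖ ≤ A * decayWeight s) (hKb : ∀ s τ, ‖K (s, τ)‖ ≤ B * decayWeight τ) :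
    Integrable (fun q : ℝ × ℝ => L q.1 (K q (a q.2))) (volume.prod volume) := by
  refine ((integrable_decayWeight.const_mul A).mul_prod (ha.integrable.const_mul B)).mono' ?_
    (Eventually.of_forall fun q => ?_)
  · refine (ContinuousLinearMap.id ℂ (H →L[ℂ] H)).aestronglyMeasurable_comp₂
      (hL.comp continuous_fst).aestronglyMeasurable ?_
    exact (ContinuousLinearMap.id ℂ (H →L[ℂ] H)).aestronglyMeasurable_comp₂
      hK.aestronglyMeasurable ha.aestronglyMeasurable.comp_snd
  · exact ((L q.1).le_opNorm _).trans (mul_le_mul (hLb q.1) (norm_clm_apply_le (hKb q.1 q.2))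
      (norm_nonneg _) ((norm_nonneg _).trans (hLb q.1)))

variable [CompleteSpace H]

lemma exists_norm_ker_le' (u v : 𝓢(ℝ × ℝ, H →L[ℂ] H)) : ∃ C, 0 ≤ C ∧
    (∀ ξ η τ, ‖kerFst u v (ξ, η, τ)‖ ≤ C * decayWeight ξ * decayWeight τ) ∧
    (∀ ξ η τ, ‖kerSnd u v (ξ, η, τ)‖ ≤ C * decayWeight η * decayWeight τ) ∧
    (∀ ξ η τ, ‖kerFst u v (ξ, η, τ)‖ ≤ C * decayWeight τ) ∧
    ∀ ξ η τ, ‖kerSnd u v (ξ, η, τ)‖ ≤ C * decayWeight τ := by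
  obtain ⟨C, hC, h1, h2⟩ := exists_norm_ker_le u v
  have h : ∀ s τ, C * decayWeight s * decayWeight τ ≤ C * decayWeight τ := fun s τ =>
    mul_le_mul_of_nonneg_right (mul_le_of_le_one_right hC (decayWeight_le_one s))
      (decayWeight_pos τ).le
  have h1' : ∀ ξ η τ, ‖kerFst u v (ξ, η, τ)‖ ≤ C * decayWeight ξ * decayWeight τ :=
    fun ξ η τ => (h1 ξ η τ).trans (mul_assoc _ _ _).ge
  have h2' : ∀ ξ η τ, ‖kerSnd u v (ξ, η, τ)‖ ≤ C * decayWeight η * decayWeight τ :=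
    fun ξ η τ => (h2 ξ η τ).trans (mul_assoc _ _ _).ge
  exact ⟨C, hC, h1', h2', fun ξ η τ => (h1' ξ η τ).trans (h _ _),
    fun ξ η τ => (h2' ξ η τ).trans (h _ _)⟩

lemma IsIncident.exists_norm_field_le {a : ℝ → H} (ha : IsIncident a)
    (u v : 𝓢(ℝ × ℝ, H →L[ℂ] H)) : ∃ C, 0 ≤ C ∧
      (∀ z, ‖fieldFst u v a z‖ ≤ C * decayWeight z.1) ∧
      ∀ z, ‖fieldSnd u v a z‖ ≤ C * decayWeight z.2 := by
  obtain ⟨C, hC, h1, h2, -⟩ := exists_norm_ker_le' u v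
  have hI : 0 ≤ ∫ τ, decayWeight τ * ‖a τ‖ :=
    integral_nonneg fun τ => mul_nonneg (decayWeight_pos τ).le (norm_nonneg _)
  refine ⟨C * ∫ τ, decayWeight τ * ‖a τ‖, mul_nonneg hC hI, fun z => ?_, fun z => ?_⟩
  · exact (ha.norm_setIntegral_apply_le (mul_nonneg hC (decayWeight_pos z.1).le)
      (h1 z.1 z.2) _).trans (by ring_nf; rfl)
  · exact (ha.norm_setIntegral_apply_le (mul_nonneg hC (decayWeight_pos z.2).le)
      (h2 z.1 z.2) _).trans (by ring_nf; rfl)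

lemma IsIncident.continuous_fieldFst {a : ℝ → H} (ha : IsIncident a)
    (u v : 𝓢(ℝ × ℝ, H →L[ℂ] H)) : Continuous (fieldFst u v a) := by
  obtain ⟨C, hC, -, -, h, -⟩ := exists_norm_ker_le' u v
  exact continuous_setIntegral_Iic_of_dominated continuous_snd
    (fun z => ha.clm_apply (continuous_triple_slice (kerFst u v) z.1 z.2).aestronglyMeasurable)
    (fun τ => ((kerFst u v).continuous.comp (by fun_prop)).clm_apply continuous_const)
    (ha.integrable.const_mul C) fun z τ => norm_clm_apply_le (h z.1 z.2 τ)

lemma IsIncident.continuous_fieldSnd {a : ℝ → H} (ha : IsIncident a)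
    (u v : 𝓢(ℝ × ℝ, H →L[ℂ] H)) : Continuous (fieldSnd u v a) := by
  obtain ⟨C, hC, -, -, -, h⟩ := exists_norm_ker_le' u v
  exact continuous_setIntegral_Iic_of_dominated continuous_snd
    (fun z => ha.clm_apply (continuous_triple_slice (kerSnd u v) z.1 z.2).aestronglyMeasurable)
    (fun τ => ((kerSnd u v).continuous.comp (by fun_prop)).clm_apply continuous_const)
    (ha.integrable.const_mul C) fun z τ => norm_clm_apply_le (h z.1 z.2 τ)

lemma IsIncident.tendsto_fieldFst_atBot {a : ℝ → H} (ha : IsIncident a)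
    (u v : 𝓢(ℝ × ℝ, H →L[ℂ] H)) (ξ : ℝ) :
    Tendsto (fun η => fieldFst u v a (ξ, η)) atBot (𝓝 0) := by
  obtain ⟨C, hC, -, -, h, -⟩ := exists_norm_ker_le' u v
  have e : ∀ η, fieldFst u v a (ξ, η)
      = ∫ τ, (Set.Iic η).indicator (fun τ => kerFst u v (ξ, η, τ) (a τ)) τ := fun η =>
    (integral_indicator measurableSet_Iic).symm
  simp_rw [e]
  rw [← integral_zero ℝ H (μ := volume)]
  refine tendsto_integral_filter_of_dominated_convergence (fun τ => C * (decayWeight τ * ‖a τ‖))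
    (Eventually.of_forall fun η => (ha.clm_apply
      (continuous_triple_slice (kerFst u v) ξ η).aestronglyMeasurable).indicator measurableSet_Iic)
    (Eventually.of_forall fun η => Eventually.of_forall fun τ => ?_) (ha.integrable.const_mul C)
    (Eventually.of_forall fun τ => ?_)
  · exact (norm_indicator_le_norm_self _ _).trans (norm_clm_apply_le (h ξ η τ))
  · refine tendsto_const_nhds.congr' ?_
    filter_upwards [eventually_lt_atBot τ] with η hη
    rw [Set.indicator_of_notMem (by simpa using hη)]

lemma IsIncident.tendsto_fieldFst_atTop {a : ℝ → H} (ha : IsIncident a)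
    (u v : 𝓢(ℝ × ℝ, H →L[ℂ] H)) (ξ : ℝ) :
    Tendsto (fun η => fieldFst u v a (ξ, η)) atTop (𝓝 (∫ τ, transmission u v (ξ, τ) (a τ))) := by
  obtain ⟨C, hC, -, -, h, -⟩ := exists_norm_ker_le' u v
  have e : ∀ η, fieldFst u v a (ξ, η)
      = ∫ τ, (Set.Iic η).indicator (fun τ => kerFst u v (ξ, η, τ) (a τ)) τ := fun η =>
    (integral_indicator measurableSet_Iic).symm
  simp_rw [e]
  refine tendsto_integral_filter_of_dominated_convergence (fun τ => C * (decayWeight τ * ‖a τ‖))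
    (Eventually.of_forall fun η => (ha.clm_apply
      (continuous_triple_slice (kerFst u v) ξ η).aestronglyMeasurable).indicator measurableSet_Iic)
    (Eventually.of_forall fun η => Eventually.of_forall fun τ => ?_) (ha.integrable.const_mul C)
    (Eventually.of_forall fun τ => ?_)
  · exact (norm_indicator_le_norm_self _ _).trans (norm_clm_apply_le (h ξ η τ))
  · refine (tendsto_clm_apply_const (tendsto_kerFst_atTop u v ξ τ) (a τ)).congr' ?_
    filter_upwards [eventually_ge_atTop τ] with η hη
    rw [Set.indicator_of_mem (Set.mem_Iic.2 hη)]

lemma IsIncident.tendsto_fieldSnd_of_tendsto {a : ℝ → H} (ha : IsIncident a)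
    (u v : 𝓢(ℝ × ℝ, H →L[ℂ] H)) (η : ℝ) {l : Filter ℝ} [l.IsCountablyGenerated]
    {K : ℝ → H →L[ℂ] H} (hK : ∀ τ, Tendsto (fun ξ => kerSnd u v (ξ, η, τ)) l (𝓝 (K τ))) :
    Tendsto (fun ξ => fieldSnd u v a (ξ, η)) l (𝓝 (∫ τ in Set.Iic η, K τ (a τ))) := by
  obtain ⟨C, hC, -, -, -, h⟩ := exists_norm_ker_le' u v
  exact tendsto_integral_filter_of_dominated_convergence (fun τ => C * (decayWeight τ * ‖a τ‖))
    (Eventually.of_forall fun ξ => (ha.clm_apply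
      (continuous_triple_slice (kerSnd u v) ξ η).aestronglyMeasurable).restrict)
    (Eventually.of_forall fun ξ => Eventually.of_forall fun τ => norm_clm_apply_le (h ξ η τ))
    (ha.integrable.const_mul C).integrableOn
    (Eventually.of_forall fun τ => tendsto_clm_apply_const (hK τ) (a τ))

lemma IsIncident.tendsto_fieldSnd_atBot {a : ℝ → H} (ha : IsIncident a)
    (u v : 𝓢(ℝ × ℝ, H →L[ℂ] H)) (η : ℝ) :
    Tendsto (fun ξ => fieldSnd u v a (ξ, η)) atBot (𝓝 0) := by
  simpa using ha.tendsto_fieldSnd_of_tendsto u v η (K := fun _ => 0)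
    (fun τ => tendsto_kerSnd_atBot u v η τ)

lemma IsIncident.tendsto_fieldSnd_atTop {a : ℝ → H} (ha : IsIncident a)
    (u v : 𝓢(ℝ × ℝ, H →L[ℂ] H)) (η : ℝ) : Tendsto (fun ξ => fieldSnd u v a (ξ, η)) atTop
      (𝓝 (∫ τ in Set.Iic η, reflection u v (η, τ) (a τ))) :=
  ha.tendsto_fieldSnd_of_tendsto u v η (fun τ => tendsto_kerSnd_atTop u v η τ)

/-- The second field solves the integrated wave equation along `η = const`, by superposition of impulse
responses. -/
lemma IsIncident.fieldSnd_eq {a : ℝ → H} (ha : IsIncident a)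
    (u v : 𝓢(ℝ × ℝ, H →L[ℂ] H)) (ξ η : ℝ) :
    fieldSnd u v a (ξ, η)
      = (-2⁻¹ : ℂ) • ∫ s in Set.Iic ξ, v (s, η) (fieldFst u v a (s, η)) := by
  obtain ⟨C, hC, -, -, h, -⟩ := exists_norm_ker_le' u v
  obtain ⟨A, hA, hv, -⟩ := schwartz_norm_le v
  have hp := ha.integrable_prod (L := fun s => v (s, η)) (K := fun q => kerFst u v (q.1, η, q.2))
    (v.continuous.comp (by fun_prop)) ((kerFst u v).continuous.comp (by fun_prop))
    (fun s => hv s η) (fun s τ => h s η τ)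
  have e1 : fieldSnd u v a (ξ, η) = (-2⁻¹ : ℂ) • ∫ τ in Set.Iic η, ∫ s in Set.Iic ξ,
      v (s, η) (kerFst u v (s, η, τ) (a τ)) := by
    rw [fieldSnd, ← integral_smul]
    refine integral_congr_ae (Eventually.of_forall fun τ => ?_)
    simp only [kerSnd_apply]
    rw [_root_.smul_apply, ContinuousLinearMap.integral_apply
      (integrable_potential_mul_kerFst u v η τ).integrableOn]
    rfl
  rw [e1, integral_integral_swap (f := fun τ s => v (s, η) (kerFst u v (s, η, τ) (a τ)))]
  · congr 1
    refine integral_congr_ae (Eventually.of_forall fun s => ?_)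
    exact (v (s, η)).integral_comp_comm (ha.integrable_apply
      (continuous_triple_slice (kerFst u v) s η).aestronglyMeasurable (h s η)).integrableOn
  · rw [Measure.prod_restrict]
    exact hp.swap.integrableOn

/-- The first field solves the integrated wave equation along `ξ = const`. The front value `-½ u(ξ, τ)`
of `k₁`, integrated against the profile, accounts for the incident wave on the right-hand side. -/
lemma IsIncident.fieldFst_eq {a : ℝ → H} (ha : IsIncident a)
    (u v : 𝓢(ℝ × ℝ, H →L[ℂ] H)) (ξ η : ℝ) :
    fieldFst u v a (ξ, η)
      = (-2⁻¹ : ℂ) • ∫ s in Set.Iic η, u (ξ, s) (a s + fieldSnd u v a (ξ, s)) := by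
  obtain ⟨C, hC, -, -, h1, h⟩ := exists_norm_ker_le' u v
  obtain ⟨A, hA, -, hu⟩ := schwartz_norm_le u
  have e : ∀ τ, (∫ s in τ..η, u (ξ, s) * kerSnd u v (ξ, s, τ))
      = (-2 : ℂ) • kerFst u v (ξ, η, τ) - u (ξ, τ) := fun τ => by
    rw [kerFst_apply]; module
  set g : ℝ × ℝ → H := fun q => u (ξ, q.1) (kerSnd u v (ξ, q.1, q.2) (a q.2)) with hg
  have hp : Integrable g (volume.prod volume) :=
    ha.integrable_prod (L := fun s => u (ξ, s)) (K := fun q => kerSnd u v (ξ, q.1, q.2))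
      (u.continuous.comp (by fun_prop)) ((kerSnd u v).continuous.comp (by fun_prop))
      (fun s => hu ξ s) (fun s τ => h ξ s τ)
  -- the triangle `τ ≤ s ≤ η` over which both iterated integrals run
  set T : Set (ℝ × ℝ) := {q | q.2 ≤ q.1 ∧ q.1 ≤ η} with hT
  have hTm : MeasurableSet T :=
    (measurableSet_le measurable_snd measurable_fst).inter
      (measurableSet_le measurable_fst measurable_const)
  have hsw := integral_integral_swap (f := fun s τ => T.indicator g (s, τ)) (hp.indicator hTm)
  have hl : (∫ s, ∫ τ, T.indicator g (s, τ))
      = ∫ s in Set.Iic η, u (ξ, s) (fieldSnd u v a (ξ, s)) := by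
    rw [← integral_indicator measurableSet_Iic]
    refine integral_congr_ae (Eventually.of_forall fun s => ?_)
    by_cases hs : s ≤ η
    · simp only [Set.indicator_of_mem (Set.mem_Iic.2 hs)]
      rw [fieldSnd, ← (u (ξ, s)).integral_comp_comm (ha.integrable_apply
        (continuous_triple_slice (kerSnd u v) ξ s).aestronglyMeasurable (h ξ s)).integrableOn,
        ← integral_indicator measurableSet_Iic]
      refine integral_congr_ae (Eventually.of_forall fun τ => ?_)
      by_cases hτ : τ ≤ s
      · rw [Set.indicator_of_mem (Set.mem_Iic.2 hτ)]
        exact Set.indicator_of_mem (s := T) ⟨hτ, hs⟩ g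
      · rw [Set.indicator_of_notMem (by simpa using hτ)]
        exact Set.indicator_of_notMem (s := T) (fun hq => hτ hq.1) g
    · rw [Set.indicator_of_notMem (by simpa using hs)]
      have : ∀ τ, T.indicator g (s, τ) = 0 := fun τ =>
        Set.indicator_of_notMem (s := T) (fun hq => hs hq.2) g
      simp_rw [this, integral_zero]
  have hr : (∫ τ, ∫ s, T.indicator g (s, τ))
      = ∫ τ in Set.Iic η, (∫ s in τ..η, u (ξ, s) * kerSnd u v (ξ, s, τ)) (a τ) := by
    rw [← integral_indicator measurableSet_Iic]
    refine integral_congr_ae (Eventually.of_forall fun τ => ?_)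
    by_cases hτ : τ ≤ η
    · simp only [Set.indicator_of_mem (Set.mem_Iic.2 hτ)]
      have hc : Continuous fun s => u (ξ, s) * kerSnd u v (ξ, s, τ) :=
        (u.continuous.comp (by fun_prop)).mul ((kerSnd u v).continuous.comp (by fun_prop))
      rw [ContinuousLinearMap.intervalIntegral_apply (hc.intervalIntegrable τ η),
        intervalIntegral.integral_of_le hτ, ← integral_Icc_eq_integral_Ioc,
        ← integral_indicator measurableSet_Icc]
      refine integral_congr_ae (Eventually.of_forall fun s => ?_)
      by_cases hs : s ∈ Set.Icc τ η
      · rw [Set.indicator_of_mem hs]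
        exact Set.indicator_of_mem (s := T) hs g
      · rw [Set.indicator_of_notMem hs]
        exact Set.indicator_of_notMem (s := T) hs g
    · rw [Set.indicator_of_notMem (by simpa using hτ)]
      have : ∀ s, T.indicator g (s, τ) = 0 := fun s =>
        Set.indicator_of_notMem (s := T) (fun hq => hτ (le_trans hq.1 hq.2)) g
      simp_rw [this, integral_zero]
  have hua : Integrable fun s => u (ξ, s) (a s) :=
    ha.integrable_apply (u.continuous.comp (by fun_prop)).aestronglyMeasurable (hu ξ)
  have huD : IntegrableOn (fun s => u (ξ, s) (fieldSnd u v a (ξ, s))) (Set.Iic η) := by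
    obtain ⟨B, hB, -, hD⟩ := ha.exists_norm_field_le u v
    refine Integrable.integrableOn ((integrable_decayWeight.const_mul (A * B)).mono'
      ((u.continuous.comp (by fun_prop)).clm_apply
        ((ha.continuous_fieldSnd u v).comp (by fun_prop))).aestronglyMeasurable
      (Eventually.of_forall fun s => ?_))
    refine ((u (ξ, s)).le_opNorm _).trans ?_
    calc ‖u (ξ, s)‖ * ‖fieldSnd u v a (ξ, s)‖ ≤ (A * decayWeight s) * B := by
          refine mul_le_mul (hu ξ s) ((hD (ξ, s)).trans ?_) (norm_nonneg _)
            (mul_nonneg hA (decayWeight_pos s).le)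
          exact mul_le_of_le_one_right hB (decayWeight_le_one _)
      _ = _ := by ring
  simp_rw [map_add]
  rw [integral_add hua.integrableOn huD, ← hl, hsw, hr, ← integral_add hua.integrableOn,
    fieldFst, ← integral_smul]
  · refine integral_congr_ae (Eventually.of_forall fun τ => ?_)
    simp only [kerFst_apply, _root_.add_apply, _root_.smul_apply,
      smul_add]
  · refine Integrable.integrableOn (ha.integrable_apply (A := 2 * C + A) ?_ fun τ => ?_)
    · have hcu : Continuous fun τ => u (ξ, τ) := u.continuous.comp (by fun_prop)
      have hck : Continuous fun τ => (-2 : ℂ) • kerFst u v (ξ, η, τ) - u (ξ, τ) :=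
        ((continuous_triple_slice (kerFst u v) ξ η).const_smul (-2 : ℂ)).sub hcu
      rw [funext e]
      exact hck.aestronglyMeasurable
    · rw [e τ]
      refine (norm_sub_le _ _).trans ?_
      rw [norm_smul, norm_neg, add_mul, mul_assoc]
      refine add_le_add (mul_le_mul (by norm_num) (h1 ξ η τ) (norm_nonneg _) (by norm_num)) (hu ξ τ)

end

noncomputable section

/-! ### The scattered part of a wave with both components incident -/

variable {H : Type*} [NormedAddCommGroup H] [NormedSpace ℂ H]

/-- The potential with the characteristic coordinates exchanged. -/
def swapPotential (u : 𝓢(ℝ × ℝ, H →L[ℂ] H)) : 𝓢(ℝ × ℝ, H →L[ℂ] H) :=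
  SchwartzMap.compCLMOfContinuousLinearEquiv ℝ (ContinuousLinearEquiv.prodComm ℝ ℝ ℝ) u

lemma swapPotential_apply (u : 𝓢(ℝ × ℝ, H →L[ℂ] H)) (ξ η : ℝ) :
    swapPotential u (ξ, η) = u (η, ξ) := rfl

lemma swapPotential_swapPotential (u : 𝓢(ℝ × ℝ, H →L[ℂ] H)) :
    swapPotential (swapPotential u) = u := rfl

/-- The first component, without the incident profile itself, of the wave generated by the profile
`a` incident in both components. The second component is the same with the potentials and the
characteristic coordinates exchanged. -/
def scatteredField (u v : 𝓢(ℝ × ℝ, H →L[ℂ] H)) (a : ℝ → H) (z : ℝ × ℝ) : H :=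
  fieldFst u v a z + fieldSnd (swapPotential v) (swapPotential u) a (z.2, z.1)

/-- The integral kernel by which an incident profile is scattered into the first component: the
first part of the kernel acts on what is incident in the second component, the second one on what
is incident in the first. The indicator is the front condition, which survives in the limit only for
the second part. -/
def scatteringKernel (u v : 𝓢(ℝ × ℝ, H →L[ℂ] H)) (z : ℝ × ℝ) : H →L[ℂ] H :=
  transmission u v z +
    {z : ℝ × ℝ | z.2 ≤ z.1}.indicator (reflection (swapPotential v) (swapPotential u)) z

lemma IsIncident.integrable_potential_apply {a : ℝ → H} (ha : IsIncident a)
    (u : 𝓢(ℝ × ℝ, H →L[ℂ] H)) (ξ : ℝ) {f : ℝ → H} (hf : Continuous f) {C : ℝ}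
    (hC : ∀ s, ‖f s‖ ≤ C) : Integrable fun s => u (ξ, s) (a s + f s) := by
  obtain ⟨A, hA, -, hu⟩ := schwartz_norm_le u
  have hcu : Continuous fun s => u (ξ, s) := u.continuous.comp (by fun_prop)
  simp_rw [map_add]
  refine (ha.integrable_apply hcu.aestronglyMeasurable (hu ξ)).add
    ((integrable_decayWeight.const_mul (A * C)).mono' (hcu.clm_apply hf).aestronglyMeasurable
      (Eventually.of_forall fun s => ((u (ξ, s)).le_opNorm _).trans ?_))
  calc ‖u (ξ, s)‖ * ‖f s‖ ≤ (A * decayWeight s) * C :=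
        mul_le_mul (hu ξ s) (hC s) (norm_nonneg _) (mul_nonneg hA (decayWeight_pos s).le)
    _ = _ := by ring

variable [CompleteSpace H]

lemma IsIncident.continuous_scatteredField {a : ℝ → H} (ha : IsIncident a)
    (u v : 𝓢(ℝ × ℝ, H →L[ℂ] H)) : Continuous (scatteredField u v a) :=
  (ha.continuous_fieldFst u v).add ((ha.continuous_fieldSnd _ _).comp (by fun_prop))

lemma IsIncident.exists_norm_scatteredField_le {a : ℝ → H} (ha : IsIncident a)
    (u v : 𝓢(ℝ × ℝ, H →L[ℂ] H)) :
    ∃ C, 0 ≤ C ∧ ∀ z, ‖scatteredField u v a z‖ ≤ C * decayWeight z.1 := by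
  obtain ⟨C₁, hC₁, h₁, -⟩ := ha.exists_norm_field_le u v
  obtain ⟨C₂, hC₂, -, h₂⟩ := ha.exists_norm_field_le (swapPotential v) (swapPotential u)
  refine ⟨C₁ + C₂, add_nonneg hC₁ hC₂, fun z => (norm_add_le _ _).trans ?_⟩
  rw [add_mul]
  exact add_le_add (h₁ z) (h₂ (z.2, z.1))

lemma IsIncident.tendsto_scatteredField_atBot {a : ℝ → H} (ha : IsIncident a)
    (u v : 𝓢(ℝ × ℝ, H →L[ℂ] H)) (ξ : ℝ) :
    Tendsto (fun η => scatteredField u v a (ξ, η)) atBot (𝓝 0) := by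
  have h := (ha.tendsto_fieldFst_atBot u v ξ).add
    (ha.tendsto_fieldSnd_atBot (swapPotential v) (swapPotential u) ξ)
  rwa [add_zero] at h

lemma exists_norm_scatteringKernel_le (u v : 𝓢(ℝ × ℝ, H →L[ℂ] H)) : ∃ C, 0 ≤ C ∧
    ∀ z, ‖scatteringKernel u v z‖ ≤ C * (decayWeight z.1 * decayWeight z.2) := by
  obtain ⟨C₁, hC₁, h₁, -⟩ := exists_norm_farKernel_le u v
  obtain ⟨C₂, hC₂, -, h₂⟩ := exists_norm_farKernel_le (swapPotential v) (swapPotential u)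
  refine ⟨C₁ + C₂, add_nonneg hC₁ hC₂, fun z => (norm_add_le _ _).trans ?_⟩
  rw [add_mul]
  exact add_le_add (h₁ z) ((norm_indicator_le_norm_self _ _).trans (h₂ z))

lemma stronglyMeasurable_scatteringKernel (u v : 𝓢(ℝ × ℝ, H →L[ℂ] H)) :
    StronglyMeasurable (scatteringKernel u v) :=
  (contDiff_transmission u v).continuous.stronglyMeasurable.add
    ((continuous_reflection _ _).stronglyMeasurable.indicator
      (measurableSet_le measurable_snd measurable_fst))

lemma IsIncident.tendsto_scatteredField_atTop {a : ℝ → H} (ha : IsIncident a)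
    (u v : 𝓢(ℝ × ℝ, H →L[ℂ] H)) (ξ : ℝ) : Tendsto (fun η => scatteredField u v a (ξ, η)) atTop
      (𝓝 (∫ τ, scatteringKernel u v (ξ, τ) (a τ))) := by
  obtain ⟨C₁, hC₁, h₁, -⟩ := exists_norm_farKernel_le u v
  obtain ⟨C₂, hC₂, -, h₂⟩ := exists_norm_farKernel_le (swapPotential v) (swapPotential u)
  have hT : Integrable fun τ => transmission u v (ξ, τ) (a τ) :=
    ha.integrable_apply (K := fun τ => transmission u v (ξ, τ))
      ((contDiff_transmission u v).continuous.comp (by fun_prop)).aestronglyMeasurable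
      (A := C₁ * decayWeight ξ) fun τ => (h₁ (ξ, τ)).trans (mul_assoc _ _ _).ge
  have hR : Integrable fun τ => reflection (swapPotential v) (swapPotential u) (ξ, τ) (a τ) :=
    ha.integrable_apply (K := fun τ => reflection (swapPotential v) (swapPotential u) (ξ, τ))
      ((continuous_reflection _ _).comp (by fun_prop)).aestronglyMeasurable
      (A := C₂ * decayWeight ξ) fun τ => (h₂ (ξ, τ)).trans (mul_assoc _ _ _).ge
  have e : (∫ τ, scatteringKernel u v (ξ, τ) (a τ)) = (∫ τ, transmission u v (ξ, τ) (a τ))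
      + ∫ τ in Set.Iic ξ, reflection (swapPotential v) (swapPotential u) (ξ, τ) (a τ) := by
    rw [← integral_indicator measurableSet_Iic, ← integral_add hT (hR.indicator measurableSet_Iic)]
    refine integral_congr_ae (Eventually.of_forall fun τ => ?_)
    by_cases hτ : τ ≤ ξ
    · simp only [scatteringKernel, _root_.add_apply]
      rw [Set.indicator_of_mem (Set.mem_Iic.2 hτ),
        Set.indicator_of_mem (s := {z : ℝ × ℝ | z.2 ≤ z.1}) (a := (ξ, τ)) hτ]
    · simp only [scatteringKernel, _root_.add_apply]
      rw [Set.indicator_of_notMem (s := {z : ℝ × ℝ | z.2 ≤ z.1}) (a := (ξ, τ)) hτ,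
        Set.indicator_of_notMem (s := Set.Iic ξ) (by simpa using hτ)]
      rfl
  rw [e]
  exact (ha.tendsto_fieldFst_atTop u v ξ).add
    (ha.tendsto_fieldSnd_atTop (swapPotential v) (swapPotential u) ξ)

lemma IsIncident.integrable_scatteredField {a : ℝ → H} (ha : IsIncident a)
    (u v : 𝓢(ℝ × ℝ, H →L[ℂ] H)) (ξ : ℝ) : Integrable fun s => u (ξ, s)
      (a s + scatteredField (swapPotential v) (swapPotential u) a (s, ξ)) := by
  obtain ⟨C, hC, h⟩ := ha.exists_norm_scatteredField_le (swapPotential v) (swapPotential u)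
  exact ha.integrable_potential_apply u ξ ((ha.continuous_scatteredField _ _).comp (by fun_prop))
    (C := C) fun s => (h (s, ξ)).trans (mul_le_of_le_one_right hC (decayWeight_le_one _))

/-- The wave equation for the scattered field, integrated along the characteristics. -/
lemma IsIncident.scatteredField_eq {a : ℝ → H} (ha : IsIncident a)
    (u v : 𝓢(ℝ × ℝ, H →L[ℂ] H)) (ξ η : ℝ) :
    scatteredField u v a (ξ, η) = (-2⁻¹ : ℂ) • ∫ s in Set.Iic η, u (ξ, s)
      (a s + scatteredField (swapPotential v) (swapPotential u) a (s, ξ)) := by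
  obtain ⟨C₁, hC₁, -, h₁⟩ := ha.exists_norm_field_le u v
  obtain ⟨A, hA, -, hu⟩ := schwartz_norm_le u
  have i₁ : Integrable fun s => u (ξ, s) (a s + fieldSnd u v a (ξ, s)) :=
    ha.integrable_potential_apply u ξ ((ha.continuous_fieldSnd u v).comp (by fun_prop)) (C := C₁)
      fun s => (h₁ (ξ, s)).trans (mul_le_of_le_one_right hC₁ (decayWeight_le_one _))
  have i₂ : Integrable fun s =>
      u (ξ, s) (a s + scatteredField (swapPotential v) (swapPotential u) a (s, ξ))
        - u (ξ, s) (a s + fieldSnd u v a (ξ, s)) := (ha.integrable_scatteredField u v ξ).sub i₁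
  have e : ∀ s, u (ξ, s) (a s + scatteredField (swapPotential v) (swapPotential u) a (s, ξ))
        - u (ξ, s) (a s + fieldSnd u v a (ξ, s))
      = swapPotential u (s, ξ) (fieldFst (swapPotential v) (swapPotential u) a (s, ξ)) := fun s => by
    rw [scatteredField, swapPotential_swapPotential, swapPotential_swapPotential,
      swapPotential_apply, ← map_sub]
    congr 1
    abel
  rw [scatteredField, ha.fieldFst_eq u v, ha.fieldSnd_eq, ← smul_add]
  simp_rw [← e]
  rw [← integral_add i₁.integrableOn i₂.integrableOn]
  congr 1
  refine integral_congr_ae (Eventually.of_forall fun s => ?_)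
  simp

end

noncomputable section

/-! ### Convergence in `L²` on the line -/

section L2
variable {E : Type*} [NormedAddCommGroup E]

lemma memLp_decayWeight : MemLp decayWeight 2 volume := by
  rw [memLp_two_iff_integrable_sq continuous_decayWeight.aestronglyMeasurable]
  refine integrable_decayWeight.mono' (continuous_decayWeight.pow 2).aestronglyMeasurable
    (Eventually.of_forall fun s => ?_)
  rw [Real.norm_of_nonneg (sq_nonneg _), sq]
  exact mul_le_of_le_one_left (decayWeight_pos s).le (decayWeight_le_one s)

lemma MeasureTheory.MemLp.isIncident [NormedSpace ℂ E] {a : ℝ → E} (ha : MemLp a 2 volume) :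
    IsIncident a :=
  ⟨ha.1, memLp_decayWeight.integrable_mul ha.norm⟩

lemma tendsto_eLpNorm_two_zero_of_dominated {ι : Type*} {l : Filter ι} [l.IsCountablyGenerated]
    {f : ι → ℝ → E} {g : ℝ → ℝ} (hg : MemLp g 2 volume) (hm : ∀ i, AEStronglyMeasurable (f i))
    (hb : ∀ i x, ‖f i x‖ ≤ g x) (hl : ∀ x, Tendsto (fun i => f i x) l (𝓝 0)) :
    Tendsto (fun i => eLpNorm (f i) 2 volume) l (𝓝 0) := by
  simp_rw [eLpNorm_eq_lintegral_rpow_enorm_toReal (two_ne_zero) (ENNReal.ofNat_ne_top)]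
  have h : Tendsto (fun i => ∫⁻ x, ‖f i x‖ₑ ^ (2 : ENNReal).toReal) l (𝓝 (∫⁻ _ : ℝ, 0)) := by
    refine tendsto_lintegral_filter_of_dominated_convergence'
      (fun x => ‖g x‖ₑ ^ (2 : ENNReal).toReal)
      (Eventually.of_forall fun i => (hm i).enorm.pow_const _)
      (Eventually.of_forall fun i => Eventually.of_forall fun x => ?_)
      (lintegral_rpow_enorm_lt_top_of_eLpNorm_lt_top two_ne_zero ENNReal.ofNat_ne_top hg.2).ne
      (Eventually.of_forall fun x => ?_)
    · refine ENNReal.rpow_le_rpow ?_ ENNReal.toReal_nonneg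
      exact enorm_le_iff_norm_le.2 ((hb i x).trans (le_abs_self _))
    · have h2 := (hl x).enorm
      rw [enorm_zero] at h2
      have h3 := (ENNReal.continuous_rpow_const (y := (2 : ENNReal).toReal)).tendsto 0 |>.comp h2
      simpa [Function.comp_def] using h3
  rw [lintegral_zero] at h
  have h3 := (ENNReal.continuous_rpow_const (y := 1 / (2 : ENNReal).toReal)).tendsto 0 |>.comp h
  simpa [Function.comp_def] using h3

/-- Translations act continuously on `L²`. -/
lemma tendsto_eLpNorm_translate [NormedSpace ℝ E] {a : ℝ → E} (ha : MemLp a 2 volume) (y₀ : ℝ) :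
    Tendsto (fun y => eLpNorm (fun x => a (y + x) - a (y₀ + x)) 2 volume) (𝓝 y₀) (𝓝 0) := by
  set g : ℝ → C(ℝ, ℝ) := fun y => ⟨fun x => y + x, by fun_prop⟩ with hg
  have hmp : ∀ y : ℝ, MeasurePreserving (g y) := fun y => measurePreserving_add_left volume y
  have hgc : Continuous g := ContinuousMap.continuous_of_continuous_uncurry g
    (continuous_fst.add continuous_snd)
  have h := Filter.Tendsto.compMeasurePreservingLp (μ := (volume : Measure ℝ))
    (tendsto_const_nhds (x := ha.toLp a)) (hgc.tendsto y₀) hmp (hmp y₀) ENNReal.ofNat_ne_top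
  rw [tendsto_iff_edist_tendsto_0] at h
  refine h.congr fun y => ?_
  rw [Lp.toLp_compMeasurePreserving ha (hmp y), Lp.toLp_compMeasurePreserving ha (hmp y₀),
    Lp.edist_toLp_toLp]
  rfl

lemma measurePreserving_sub_left_real (y : ℝ) : MeasurePreserving (fun x : ℝ => y - x) := by
  simpa using Measure.measurePreserving_sub_left volume y

lemma eLpNorm_comp_add_left {f : ℝ → E} (hf : AEStronglyMeasurable f) (y : ℝ) :
    eLpNorm (fun x => f (y + x)) 2 volume = eLpNorm f 2 volume :=
  eLpNorm_comp_measurePreserving hf (measurePreserving_add_left volume y)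

lemma eLpNorm_comp_sub_left {f : ℝ → E} (hf : AEStronglyMeasurable f) (y : ℝ) :
    eLpNorm (fun x => f (y - x)) 2 volume = eLpNorm f 2 volume :=
  eLpNorm_comp_measurePreserving hf (measurePreserving_sub_left_real y)

end L2

/-! ### Waves with values in `ℂⁿ × ℂ` -/

section Wave
variable {n : ℕ}

/-- The wave with the `ℂⁿ`-part of `h₁` and the `ℂ`-part of `h₂`. -/
def mixWave (h₁ h₂ : Wave n) : Wave n :=
  WithLp.toLp 2 (Sum.elim (fun k => h₁ (Sum.inl k)) (fun u => h₂ (Sum.inr u)))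

@[simp] lemma mixWave_inl (h₁ h₂ : Wave n) (k : Fin n) :
    mixWave h₁ h₂ (Sum.inl k) = h₁ (Sum.inl k) := rfl

@[simp] lemma mixWave_inr (h₁ h₂ : Wave n) (k : Unit) :
    mixWave h₁ h₂ (Sum.inr k) = h₂ (Sum.inr k) := rfl

lemma mixWave_self (h : Wave n) : mixWave h h = h := by
  ext (k | k) <;> rfl

lemma mixWave_sub (h₁ h₂ h₁' h₂' : Wave n) :
    mixWave h₁ h₂ - mixWave h₁' h₂' = mixWave (h₁ - h₁') (h₂ - h₂') := by
  ext (k | k) <;> rfl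

lemma mixWave_add (h₁ h₂ h₁' h₂' : Wave n) :
    mixWave h₁ h₂ + mixWave h₁' h₂' = mixWave (h₁ + h₁') (h₂ + h₂') := by
  ext (k | k) <;> rfl

lemma waveShift_eq (x : ℝ) (h : ℝ → Wave n) (y : ℝ) :
    waveShift x h y = mixWave (h (y + x)) (h (y - x)) := rfl

lemma norm_mixWave_zero_right (h : Wave n) : ‖mixWave h 0‖ ≤ ‖h‖ := by
  rw [EuclideanSpace.norm_eq, EuclideanSpace.norm_eq]
  refine Real.sqrt_le_sqrt (Finset.sum_le_sum fun i _ => ?_)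
  rcases i with k | k
  · exact le_rfl
  · change ‖(0 : ℂ)‖ ^ 2 ≤ _
    rw [norm_zero]
    exact pow_le_pow_left₀ le_rfl (norm_nonneg _) 2

lemma norm_mixWave_zero_left (h : Wave n) : ‖mixWave 0 h‖ ≤ ‖h‖ := by
  rw [EuclideanSpace.norm_eq, EuclideanSpace.norm_eq]
  refine Real.sqrt_le_sqrt (Finset.sum_le_sum fun i _ => ?_)
  rcases i with k | k
  · change ‖(0 : ℂ)‖ ^ 2 ≤ _
    rw [norm_zero]
    exact pow_le_pow_left₀ le_rfl (norm_nonneg _) 2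
  · exact le_rfl

lemma norm_mixWave_le (h₁ h₂ : Wave n) : ‖mixWave h₁ h₂‖ ≤ ‖h₁‖ + ‖h₂‖ := by
  have e : mixWave h₁ h₂ = mixWave h₁ 0 + mixWave 0 h₂ := by
    rw [mixWave_add, add_zero, zero_add]
  rw [e]
  exact (norm_add_le _ _).trans (add_le_add (norm_mixWave_zero_right _) (norm_mixWave_zero_left _))

lemma continuous_mixWave : Continuous fun p : Wave n × Wave n => mixWave p.1 p.2 := by
  refine (PiLp.continuous_toLp 2 _).comp (continuous_pi fun i => ?_)
  rcases i with k | k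
  · exact (EuclideanSpace.proj (𝕜 := ℂ) (Sum.inl k : Fin n ⊕ Unit)).continuous.comp continuous_fst
  · exact (EuclideanSpace.proj (𝕜 := ℂ) (Sum.inr k : Fin n ⊕ Unit)).continuous.comp continuous_snd

lemma eLpNorm_mixWave_le {f g : ℝ → Wave n} (hf : AEStronglyMeasurable f)
    (hg : AEStronglyMeasurable g) :
    eLpNorm (fun x => mixWave (f x) (g x)) 2 volume ≤ eLpNorm f 2 volume + eLpNorm g 2 volume := by
  have h1 : eLpNorm (fun x => mixWave (f x) (g x)) 2 volume
      ≤ eLpNorm (fun x => ‖f x‖ + ‖g x‖) 2 volume :=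
    eLpNorm_mono fun x => (norm_mixWave_le _ _).trans (le_abs_self _)
  refine h1.trans ((eLpNorm_add_le hf.norm hg.norm (by norm_num)).trans ?_)
  rw [eLpNorm_norm, eLpNorm_norm]

lemma MeasureTheory.MemLp.mixWave {f g : ℝ → Wave n} (hf : MemLp f 2 volume) (hg : MemLp g 2 volume) :
    MemLp (fun x => mixWave (f x) (g x)) 2 volume :=
  ⟨continuous_mixWave.comp_aestronglyMeasurable (hf.1.prodMk hg.1),
    (eLpNorm_mixWave_le hf.1 hg.1).trans_lt (ENNReal.add_lt_top.2 ⟨hf.2, hg.2⟩)⟩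

/-- The free wave with an `L²` profile is a continuous curve in `L²`. -/
lemma tendsto_eLpNorm_waveShift {a : ℝ → Wave n} (ha : MemLp a 2 volume) (y₀ : ℝ) :
    Tendsto (fun y => eLpNorm (fun x => waveShift x a y - waveShift x a y₀) 2 volume)
      (𝓝 y₀) (𝓝 0) := by
  have h := tendsto_eLpNorm_translate ha y₀
  have hm : ∀ y : ℝ, AEStronglyMeasurable (fun x => a (y + x)) := fun y =>
    ha.1.comp_measurePreserving (measurePreserving_add_left volume y)
  have hm' : ∀ y : ℝ, AEStronglyMeasurable (fun x => a (y - x)) := fun y =>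
    ha.1.comp_measurePreserving (measurePreserving_sub_left_real y)
  have h2 := h.add h
  rw [add_zero] at h2
  refine tendsto_of_tendsto_of_tendsto_of_le_of_le tendsto_const_nhds h2 (fun _ => zero_le) fun y => ?_
  simp_rw [waveShift_eq, mixWave_sub]
  refine (eLpNorm_mixWave_le ((hm y).sub (hm y₀)) ((hm' y).sub (hm' y₀))).trans
    (add_le_add le_rfl (le_of_eq ?_))
  have e := eLpNorm_comp_measurePreserving (p := 2) ((hm y).sub (hm y₀))
    (Measure.measurePreserving_neg volume)
  refine Eq.trans (congrArg (fun f => eLpNorm f 2 volume) (funext fun x => ?_)) e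
  simp [sub_eq_add_neg]

lemma tendsto_eLpNorm_diagonal {W : ℝ × ℝ → Wave n} (hW : Continuous W) {C : ℝ}
    (hC : ∀ z, ‖W z‖ ≤ C * decayWeight z.1) {e : ℝ → Wave n} (he : AEStronglyMeasurable e)
    {l : Filter ℝ} [l.IsCountablyGenerated] [l.NeBot]
    (hl : ∀ ξ, Tendsto (fun y => W (ξ, 2 * y - ξ)) l (𝓝 (e ξ))) :
    Tendsto (fun y => eLpNorm (fun ξ => W (ξ, 2 * y - ξ) - e ξ) 2 volume) l (𝓝 0) := by
  refine tendsto_eLpNorm_two_zero_of_dominated (memLp_decayWeight.const_mul (C + C))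
    (fun y => (hW.comp (by fun_prop)).aestronglyMeasurable.sub he) (fun y ξ => ?_) fun ξ => ?_
  · rw [add_mul]
    refine (norm_sub_le _ _).trans (add_le_add (hC _) ?_)
    exact le_of_tendsto (hl ξ).norm (Eventually.of_forall fun y => hC _)
  · simpa using (hl ξ).sub_const (e ξ)

/-- Convergence along characteristics, together with a bound by the integrable weight, gives
asymptotics in `L²`. -/
lemma tendsto_eLpNorm_mix {W₁ W₂ : ℝ × ℝ → Wave n} (hW₁ : Continuous W₁) (hW₂ : Continuous W₂)
    {C₁ C₂ : ℝ} (hC₁ : ∀ z, ‖W₁ z‖ ≤ C₁ * decayWeight z.1)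
    (hC₂ : ∀ z, ‖W₂ z‖ ≤ C₂ * decayWeight z.1) {a e : ℝ → Wave n} {e₁ e₂ : ℝ → Wave n}
    (he₁ : AEStronglyMeasurable e₁) (he₂ : AEStronglyMeasurable e₂)
    (he : ∀ s, e s = a s + mixWave (e₁ s) (e₂ s)) {l : Filter ℝ} [l.IsCountablyGenerated] [l.NeBot]
    (hl₁ : ∀ ξ, Tendsto (fun y => W₁ (ξ, 2 * y - ξ)) l (𝓝 (e₁ ξ)))
    (hl₂ : ∀ η, Tendsto (fun y => W₂ (η, 2 * y - η)) l (𝓝 (e₂ η))) :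
    Tendsto (fun y => eLpNorm (fun x => mixWave (a (y + x) + W₁ (y + x, y - x))
      (a (y - x) + W₂ (y - x, y + x)) - waveShift x e y) 2 volume) l (𝓝 0) := by
  have h := (tendsto_eLpNorm_diagonal hW₁ hC₁ he₁ hl₁).add
    (tendsto_eLpNorm_diagonal hW₂ hC₂ he₂ hl₂)
  rw [add_zero] at h
  refine tendsto_of_tendsto_of_tendsto_of_le_of_le tendsto_const_nhds h (fun _ => zero_le) fun y => ?_
  have hm₁ : AEStronglyMeasurable (fun ξ => W₁ (ξ, 2 * y - ξ) - e₁ ξ) :=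
    (hW₁.comp (by fun_prop)).aestronglyMeasurable.sub he₁
  have hm₂ : AEStronglyMeasurable (fun ξ => W₂ (ξ, 2 * y - ξ) - e₂ ξ) :=
    (hW₂.comp (by fun_prop)).aestronglyMeasurable.sub he₂
  have e : ∀ x, mixWave (a (y + x) + W₁ (y + x, y - x)) (a (y - x) + W₂ (y - x, y + x))
      - waveShift x e y = mixWave (W₁ (y + x, 2 * y - (y + x)) - e₁ (y + x))
        (W₂ (y - x, 2 * y - (y - x)) - e₂ (y - x)) := fun x => by
    rw [waveShift_eq, he, he, mixWave_sub]
    have e1 : 2 * y - (y + x) = y - x := by ring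
    have e2 : 2 * y - (y - x) = y + x := by ring
    rw [e1, e2]
    ext (k | k)
    · simp
    · simp
  simp_rw [e]
  refine (eLpNorm_mixWave_le
    (hm₁.comp_measurePreserving (measurePreserving_add_left volume y))
    (hm₂.comp_measurePreserving (measurePreserving_sub_left_real y))).trans (le_of_eq ?_)
  rw [← eLpNorm_comp_add_left hm₁ y, ← eLpNorm_comp_sub_left hm₂ y]
  rfl

end Wave

end

noncomputable section

/-! ### Existence of waves with a given incident profile -/

/-- The wave equation along the characteristic `x + y = ξ`, parametrised by the time `y`; there
`η = 2 y - ξ`, and the Jacobian `2` cancels the factor `½` of the equation in `(ξ, η)`. -/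
lemma IsIncident.scatteredField_sub {H : Type*} [NormedAddCommGroup H] [NormedSpace ℂ H]
    [CompleteSpace H] {a : ℝ → H} (ha : IsIncident a)
    (u v : 𝓢(ℝ × ℝ, H →L[ℂ] H)) (ξ y₀ y : ℝ) :
    scatteredField u v a (ξ, 2 * y - ξ) = scatteredField u v a (ξ, 2 * y₀ - ξ)
      - ∫ s in y₀..y, u (ξ, 2 * s - ξ) (a (2 * s - ξ)
          + scatteredField (swapPotential v) (swapPotential u) a (2 * s - ξ, ξ)) := by
  have hi := ha.integrable_scatteredField u v ξ
  rw [eq_sub_iff_add_eq', ← eq_sub_iff_add_eq, ha.scatteredField_eq, ha.scatteredField_eq,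
    ← smul_sub, intervalIntegral.integral_Iic_sub_Iic hi.integrableOn hi.integrableOn,
    intervalIntegral.integral_comp_mul_sub (fun s => u (ξ, s) (a s
      + scatteredField (swapPotential v) (swapPotential u) a (s, ξ))) two_ne_zero ξ,
    intervalIntegral.integral_symm, smul_neg, neg_smul]
  rw [← Complex.coe_smul]
  simp

variable {n : ℕ}

/-- The matrix potential `Q(x, y)` has the off-diagonal blocks `u` and `v`, given as operator-valued
functions of the characteristic coordinates; only the block in the upper right of `u` and the one in
the lower left of `v` matter. -/
structure IsBlockPotential (Q : ℝ → ℝ → Matrix (Fin n ⊕ Unit) (Fin n ⊕ Unit) ℂ)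
    (u v : 𝓢(ℝ × ℝ, Wave n →L[ℂ] Wave n)) : Prop where
  fst : ∀ (x y : ℝ) (h h' : Wave n), h (Sum.inr ()) = h' (Sum.inr ()) → ∀ k,
    (Q x y *ᵥ h.ofLp) (Sum.inl k) = u (y + x, y - x) h' (Sum.inl k)
  snd : ∀ (x y : ℝ) (h h' : Wave n), (∀ k, h (Sum.inl k) = h' (Sum.inl k)) →
    (Q x y *ᵥ h.ofLp) (Sum.inr ()) = v (y + x, y - x) h' (Sum.inr ())

/-- The wave with incident profile `a`. -/
def scatteredWave (u v : 𝓢(ℝ × ℝ, Wave n →L[ℂ] Wave n)) (a : ℝ → Wave n) (x y : ℝ) : Wave n :=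
  mixWave (a (y + x) + scatteredField u v a (y + x, y - x))
    (a (y - x) + scatteredField (swapPotential v) (swapPotential u) a (y - x, y + x))

/-- The scattered profile of the wave with incident profile `a`. -/
def scatteredProfile (u v : 𝓢(ℝ × ℝ, Wave n →L[ℂ] Wave n)) (a : ℝ → Wave n) (s : ℝ) : Wave n :=
  a s + mixWave (∫ τ, scatteringKernel u v (s, τ) (a τ))
    (∫ τ, scatteringKernel (swapPotential v) (swapPotential u) (s, τ) (a τ))

lemma coord_intervalIntegral {f : ℝ → Wave n} (hf : Integrable f) (a b : ℝ) (i : Fin n ⊕ Unit) :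
    (∫ s in a..b, f s) i = ∫ s in a..b, f s i :=
  ((EuclideanSpace.proj (𝕜 := ℂ) i).intervalIntegral_comp_comm
    (hf.intervalIntegrable (a := a) (b := b))).symm

lemma IsIncident.integrable_scatteredField_diagonal {a : ℝ → Wave n} (ha : IsIncident a)
    (u v : 𝓢(ℝ × ℝ, Wave n →L[ℂ] Wave n)) (ξ : ℝ) :
    Integrable fun s => u (ξ, 2 * s - ξ) (a (2 * s - ξ)
          + scatteredField (swapPotential v) (swapPotential u) a (2 * s - ξ, ξ)) :=
  ((ha.integrable_scatteredField u v ξ).comp_sub_right ξ).comp_mul_left' (two_ne_zero)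

lemma memLp_of_norm_le_decayWeight {f : ℝ → Wave n} (hf : AEStronglyMeasurable f) {C : ℝ}
    (h : ∀ s, ‖f s‖ ≤ C * decayWeight s) : MemLp f 2 volume :=
  (memLp_decayWeight.const_mul C).mono' hf (Eventually.of_forall h)

/-- The superposition of impulse responses is a wave in the class `C(ℝ; L²)`. -/
lemma IsBlockPotential.isWaveSolution {Q : ℝ → ℝ → Matrix (Fin n ⊕ Unit) (Fin n ⊕ Unit) ℂ}
    {u v : 𝓢(ℝ × ℝ, Wave n →L[ℂ] Wave n)} (hQ : IsBlockPotential Q u v) {a : ℝ → Wave n}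
    (ham : Measurable a) (ha : MemLp a 2 volume) : IsWaveSolution Q (scatteredWave u v a) := by
  have hi := ha.isIncident
  set W₁ := scatteredField u v a with hW₁
  set W₂ := scatteredField (swapPotential v) (swapPotential u) a with hW₂
  have c₁ : Continuous W₁ := hi.continuous_scatteredField _ _
  have c₂ : Continuous W₂ := hi.continuous_scatteredField _ _
  obtain ⟨C₁, -, h₁⟩ := hi.exists_norm_scatteredField_le u v
  obtain ⟨C₂, -, h₂⟩ := hi.exists_norm_scatteredField_le (swapPotential v) (swapPotential u)
  have m₁ : ∀ y, MemLp (fun s => a s + W₁ (s, 2 * y - s)) 2 volume := fun y =>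
    ha.add (memLp_of_norm_le_decayWeight (c₁.comp (by fun_prop)).aestronglyMeasurable
      fun s => h₁ (s, 2 * y - s))
  have m₂ : ∀ y, MemLp (fun s => a s + W₂ (s, 2 * y - s)) 2 volume := fun y =>
    ha.add (memLp_of_norm_le_decayWeight (c₂.comp (by fun_prop)).aestronglyMeasurable
      fun s => h₂ (s, 2 * y - s))
  have hmem : ∀ y, MemLp (fun x => scatteredWave u v a x y) 2 volume := fun y => by
    have e : (fun x => scatteredWave u v a x y) = fun x =>
        mixWave ((fun s => a s + W₁ (s, 2 * y - s)) (y + x))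
          ((fun s => a s + W₂ (s, 2 * y - s)) (y - x)) := by
      funext x
      have e1 : 2 * y - (y + x) = y - x := by ring
      have e2 : 2 * y - (y - x) = y + x := by ring
      simp only [scatteredWave, e1, e2, ← hW₁, ← hW₂]
    rw [e]
    exact ((m₁ y).comp_measurePreserving (measurePreserving_add_left volume y)).mixWave
      ((m₂ y).comp_measurePreserving (measurePreserving_sub_left_real y))
  refine ⟨?_, hmem, fun y₀ => ?_, fun y₀ y k => Eventually.of_forall fun ξ => ?_,
    fun y₀ y => Eventually.of_forall fun η => ?_⟩
  · refine continuous_mixWave.measurable.comp (Measurable.prodMk ?_ ?_)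
    · exact (ham.comp (measurable_snd.add measurable_fst)).add
        (c₁.measurable.comp ((measurable_snd.add measurable_fst).prodMk
          (measurable_snd.sub measurable_fst)))
    · exact (ham.comp (measurable_snd.sub measurable_fst)).add
        (c₂.measurable.comp ((measurable_snd.sub measurable_fst).prodMk
          (measurable_snd.add measurable_fst)))
  -- continuity at `y₀`: the wave is compared with the free wave that agrees with it at time `y₀`
  · set e : ℝ → Wave n := fun s => a s + mixWave (W₁ (s, 2 * y₀ - s)) (W₂ (s, 2 * y₀ - s)) with he
    have hd₁ : Continuous fun s => W₁ (s, 2 * y₀ - s) := c₁.comp (by fun_prop)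
    have hd₂ : Continuous fun s => W₂ (s, 2 * y₀ - s) := c₂.comp (by fun_prop)
    have hem : MemLp e 2 volume := ha.add ((memLp_of_norm_le_decayWeight
      hd₁.aestronglyMeasurable fun s => h₁ (s, 2 * y₀ - s)).mixWave
        (memLp_of_norm_le_decayWeight hd₂.aestronglyMeasurable fun s => h₂ (s, 2 * y₀ - s)))
    have t₁ := tendsto_eLpNorm_mix c₁ c₂ h₁ h₂ (a := a) hd₁.aestronglyMeasurable
      hd₂.aestronglyMeasurable (fun s => rfl) (l := 𝓝 y₀)
      (fun ξ => Continuous.tendsto (f := fun y => W₁ (ξ, 2 * y - ξ)) (c₁.comp (by fun_prop)) y₀)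
      (fun ξ => Continuous.tendsto (f := fun y => W₂ (ξ, 2 * y - ξ)) (c₂.comp (by fun_prop)) y₀)
    have t := t₁.add (tendsto_eLpNorm_waveShift hem y₀)
    rw [add_zero] at t
    have hs : ∀ y, AEStronglyMeasurable (fun x => waveShift x e y) := fun y =>
      ((hem.comp_measurePreserving (measurePreserving_add_left volume y)).mixWave
        (hem.comp_measurePreserving (measurePreserving_sub_left_real y))).1
    refine tendsto_of_tendsto_of_tendsto_of_le_of_le tendsto_const_nhds t (fun _ => zero_le)
      fun y => ?_
    refine le_trans (le_of_eq ?_) (eLpNorm_add_le ((hmem y).1.sub (hs y)) ((hs y).sub (hs y₀))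
      (by norm_num))
    congr 1
    funext x
    have e0 : scatteredWave u v a x y₀ = waveShift x e y₀ := by
      have e1 : 2 * y₀ - (y₀ + x) = y₀ - x := by ring
      have e2 : 2 * y₀ - (y₀ - x) = y₀ + x := by ring
      rw [waveShift_eq, scatteredWave, he, ← hW₁, ← hW₂]
      simp only [e1, e2]
      ext (k | k)
      · simp
      · simp
    rw [e0]
    exact (sub_add_sub_cancel _ _ _).symm
  · have e1 : ∀ s, s + (ξ - s) = ξ := fun s => by ring
    have e2 : ∀ s, s - (ξ - s) = 2 * s - ξ := fun s => by ring
    have hint : ∀ s, (Q (ξ - s) s *ᵥ (scatteredWave u v a (ξ - s) s).ofLp) (Sum.inl k)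
        = u (ξ, 2 * s - ξ) (a (2 * s - ξ) + W₂ (2 * s - ξ, ξ)) (Sum.inl k) := fun s => by
      rw [hQ.fst (ξ - s) s _ (a (2 * s - ξ) + W₂ (2 * s - ξ, ξ)), e1, e2]
      rw [scatteredWave, mixWave_inr, e1, e2]
    simp_rw [hint]
    rw [← coord_intervalIntegral (hi.integrable_scatteredField_diagonal u v ξ)]
    have h := congrArg (fun w : Wave n => w (Sum.inl k)) (hi.scatteredField_sub u v ξ y₀ y)
    simp only [PiLp.sub_apply] at h
    rw [scatteredWave, scatteredWave, mixWave_inl, mixWave_inl, e1, e2, e1, e2, PiLp.add_apply,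
      PiLp.add_apply, h]
    ring
  · have e1 : ∀ s, s - (s - η) = η := fun s => by ring
    have e2 : ∀ s, s + (s - η) = 2 * s - η := fun s => by ring
    have hint : ∀ s, (Q (s - η) s *ᵥ (scatteredWave u v a (s - η) s).ofLp) (Sum.inr ())
        = swapPotential v (η, 2 * s - η) (a (2 * s - η) + W₁ (2 * s - η, η)) (Sum.inr ()) :=
      fun s => by
      rw [hQ.snd (s - η) s _ (a (2 * s - η) + W₁ (2 * s - η, η)), e1, e2, swapPotential_apply]
      intro k
      rw [scatteredWave, mixWave_inl, e1, e2]
    have hj : Integrable fun s =>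
        swapPotential v (η, 2 * s - η) (a (2 * s - η) + W₁ (2 * s - η, η)) :=
      hi.integrable_scatteredField_diagonal (swapPotential v) (swapPotential u) η
    simp_rw [hint]
    rw [← coord_intervalIntegral hj]
    have h := congrArg (fun w : Wave n => w (Sum.inr ()))
      (hi.scatteredField_sub (swapPotential v) (swapPotential u) η y₀ y)
    simp only [PiLp.sub_apply] at h
    rw [scatteredWave, scatteredWave, mixWave_inr, mixWave_inr, e1, e2, e1, e2, PiLp.add_apply,
      PiLp.add_apply, h]
    simp only [swapPotential_swapPotential]
    ring

lemma tendsto_two_mul_sub_atBot (ξ : ℝ) : Tendsto (fun y : ℝ => 2 * y - ξ) atBot atBot :=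
  tendsto_atBot_add_const_right _ (-ξ) (tendsto_id.const_mul_atBot two_pos)

lemma tendsto_two_mul_sub_atTop (ξ : ℝ) : Tendsto (fun y : ℝ => 2 * y - ξ) atTop atTop :=
  tendsto_atTop_add_const_right _ (-ξ) (tendsto_id.const_mul_atTop two_pos)

lemma tendsto_scatteredWave_atBot (u v : 𝓢(ℝ × ℝ, Wave n →L[ℂ] Wave n)) {a : ℝ → Wave n}
    (ha : MemLp a 2 volume) :
    Tendsto (fun y => eLpNorm (fun x => scatteredWave u v a x y - waveShift x a y) 2 volume)
      atBot (𝓝 0) := by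
  have hi := ha.isIncident
  obtain ⟨C₁, -, h₁⟩ := hi.exists_norm_scatteredField_le u v
  obtain ⟨C₂, -, h₂⟩ := hi.exists_norm_scatteredField_le (swapPotential v) (swapPotential u)
  refine tendsto_eLpNorm_mix (hi.continuous_scatteredField _ _) (hi.continuous_scatteredField _ _)
    h₁ h₂ (e₁ := fun _ => 0) (e₂ := fun _ => 0) aestronglyMeasurable_const
    aestronglyMeasurable_const (fun s => ?_) (fun ξ => ?_) (fun η => ?_)
  · rw [mixWave_self, add_zero]
  · exact (hi.tendsto_scatteredField_atBot u v ξ).comp (tendsto_two_mul_sub_atBot ξ)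
  · exact (hi.tendsto_scatteredField_atBot _ _ η).comp (tendsto_two_mul_sub_atBot η)

lemma aestronglyMeasurable_integral_scatteringKernel (u v : 𝓢(ℝ × ℝ, Wave n →L[ℂ] Wave n))
    {a : ℝ → Wave n} (ha : AEStronglyMeasurable a) :
    AEStronglyMeasurable fun s => ∫ τ, scatteringKernel u v (s, τ) (a τ) := by
  refine AEStronglyMeasurable.integral_prod_right'
    (f := fun q : ℝ × ℝ => scatteringKernel u v q (a q.2)) ?_
  exact (ContinuousLinearMap.id ℂ (Wave n →L[ℂ] Wave n)).aestronglyMeasurable_comp₂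
    (stronglyMeasurable_scatteringKernel u v).aestronglyMeasurable ha.comp_snd

lemma tendsto_scatteredWave_atTop (u v : 𝓢(ℝ × ℝ, Wave n →L[ℂ] Wave n)) {a : ℝ → Wave n}
    (ha : MemLp a 2 volume) :
    Tendsto (fun y => eLpNorm (fun x => scatteredWave u v a x y
      - waveShift x (scatteredProfile u v a) y) 2 volume) atTop (𝓝 0) := by
  have hi := ha.isIncident
  obtain ⟨C₁, -, h₁⟩ := hi.exists_norm_scatteredField_le u v
  obtain ⟨C₂, -, h₂⟩ := hi.exists_norm_scatteredField_le (swapPotential v) (swapPotential u)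
  refine tendsto_eLpNorm_mix (hi.continuous_scatteredField _ _) (hi.continuous_scatteredField _ _)
    h₁ h₂ (aestronglyMeasurable_integral_scatteringKernel _ _ ha.1)
    (aestronglyMeasurable_integral_scatteringKernel _ _ ha.1) (fun s => rfl)
    (fun ξ => ?_) (fun η => ?_)
  · exact (hi.tendsto_scatteredField_atTop u v ξ).comp (tendsto_two_mul_sub_atTop ξ)
  · exact (hi.tendsto_scatteredField_atTop _ _ η).comp (tendsto_two_mul_sub_atTop η)

end

noncomputable section

/-! ### Uniqueness of waves -/

variable {n : ℕ}

/-- The position at time `s` of the characteristic with parameter `ξ` for the component `i`. -/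
def charLine (i : Fin n ⊕ Unit) (ξ s : ℝ) : ℝ := Sum.elim (fun _ => ξ - s) (fun _ => s - ξ) i

lemma measurePreserving_charLine (i : Fin n ⊕ Unit) (s : ℝ) :
    MeasurePreserving (fun ξ => charLine i ξ s) := by
  rcases i with k | k
  · exact measurePreserving_sub_right volume s
  · exact measurePreserving_sub_left_real s

lemma continuous_charLine (i : Fin n ⊕ Unit) :
    Continuous fun p : ℝ × ℝ => charLine i p.1 p.2 := by
  rcases i with k | k
  · exact continuous_fst.sub continuous_snd
  · exact continuous_snd.sub continuous_fst

lemma charLine_neg (i : Fin n ⊕ Unit) (ξ s : ℝ) : charLine i (-ξ) (-s) = -charLine i ξ s := by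
  rcases i with k | k
  · change -ξ - -s = -(ξ - s); ring
  · change -s - -ξ = -(s - ξ); ring

lemma IsWaveSolution.eq_charLine {Q : ℝ → ℝ → Matrix (Fin n ⊕ Unit) (Fin n ⊕ Unit) ℂ}
    {ψ : ℝ → ℝ → Wave n} (h : IsWaveSolution Q ψ) (y₀ y : ℝ) (i : Fin n ⊕ Unit) :
    ∀ᵐ ξ : ℝ, ψ (charLine i ξ y) y i = ψ (charLine i ξ y₀) y₀ i
      - ∫ s in y₀..y, (Q (charLine i ξ s) s *ᵥ (ψ (charLine i ξ s) s).ofLp) i := by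
  rcases i with k | k
  · exact h.eq_fst y₀ y k
  · exact h.eq_snd y₀ y

/-- The potential decays in time, uniformly in space. Two powers of the weight are at hand: one
remains as the integrable weight in Grönwall's inequality after the Cauchy–Schwarz inequality has
used the other. -/
lemma SchwartzMap.exists_norm_le_decayWeight_sq (u : 𝓢(ℝ × ℝ, Wave n →L[ℂ] Wave n)) :
    ∃ C, 0 ≤ C ∧ ∀ x y, ‖u (y + x, y - x)‖ ≤ C * decayWeight y ^ 2 := by
  obtain ⟨C, hC, h⟩ := u.exists_one_add_norm_pow_le
  refine ⟨C, hC, fun x y => ?_⟩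
  have h1 := h (y + x, y - x)
  have h2 : |y| ≤ ‖((y + x, y - x) : ℝ × ℝ)‖ := by
    have a1 := norm_fst_le ((y + x, y - x) : ℝ × ℝ)
    have a2 := norm_snd_le ((y + x, y - x) : ℝ × ℝ)
    simp only [Real.norm_eq_abs] at a1 a2
    have a3 := abs_add_le (y + x) (y - x)
    have a4 : |y + x + (y - x)| = 2 * |y| := by
      rw [show y + x + (y - x) = 2 * y by ring, abs_mul, abs_two]
    linarith
  have h3 : (1 + y ^ 2) ^ 2 ≤ (1 + ‖((y + x, y - x) : ℝ × ℝ)‖) ^ 4 := by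
    have : 1 + y ^ 2 ≤ (1 + ‖((y + x, y - x) : ℝ × ℝ)‖) ^ 2 := by
      rw [← sq_abs]; nlinarith [abs_nonneg y]
    calc _ ≤ ((1 + ‖((y + x, y - x) : ℝ × ℝ)‖) ^ 2) ^ 2 := pow_le_pow_left₀ (by positivity) this 2
      _ = _ := by ring
  have h4 : (1 + y ^ 2) ^ 2 * ‖u (y + x, y - x)‖ ≤ C :=
    (mul_le_mul_of_nonneg_right h3 (norm_nonneg _)).trans h1
  unfold decayWeight
  rw [inv_pow, ← div_eq_mul_inv, le_div_iff₀ (by positivity), mul_comm]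
  exact h4

lemma IsBlockPotential.exists_norm_le {Q : ℝ → ℝ → Matrix (Fin n ⊕ Unit) (Fin n ⊕ Unit) ℂ}
    {u v : 𝓢(ℝ × ℝ, Wave n →L[ℂ] Wave n)} (hQ : IsBlockPotential Q u v) :
    ∃ C, 0 ≤ C ∧ ∀ x y (h : Wave n) i,
      ‖(Q x y *ᵥ h.ofLp) i‖ ≤ C * decayWeight y ^ 2 * ‖h‖ := by
  obtain ⟨A, hA, hu⟩ := u.exists_norm_le_decayWeight_sq
  obtain ⟨B, hB, hv⟩ := v.exists_norm_le_decayWeight_sq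
  have key : ∀ (L : Wave n →L[ℂ] Wave n) (h : Wave n) (i) {D w : ℝ}, ‖L‖ ≤ D * w → D ≤ A + B →
      0 ≤ w → ‖L h i‖ ≤ (A + B) * w * ‖h‖ := fun L h i D w h1 h2 h3 =>
    (PiLp.norm_apply_le (L h) i).trans ((L.le_opNorm h).trans (mul_le_mul_of_nonneg_right
      (h1.trans (mul_le_mul_of_nonneg_right h2 h3)) (norm_nonneg _)))
  refine ⟨A + B, add_nonneg hA hB, fun x y h i => ?_⟩
  rcases i with k | k
  · rw [hQ.fst x y h h rfl k]
    exact key _ _ _ (hu x y) (by linarith) (sq_nonneg _)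
  · rw [hQ.snd x y h h fun _ => rfl]
    exact key _ _ _ (hv x y) (by linarith) (sq_nonneg _)

lemma IsBlockPotential.measurable_mulVec {Q : ℝ → ℝ → Matrix (Fin n ⊕ Unit) (Fin n ⊕ Unit) ℂ}
    {u v : 𝓢(ℝ × ℝ, Wave n →L[ℂ] Wave n)} (hQ : IsBlockPotential Q u v) {ψ : ℝ → ℝ → Wave n}
    (hψ : Measurable (Function.uncurry ψ)) (i : Fin n ⊕ Unit) :
    Measurable fun p : ℝ × ℝ => (Q p.1 p.2 *ᵥ (ψ p.1 p.2).ofLp) i := by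
  have key : ∀ u : 𝓢(ℝ × ℝ, Wave n →L[ℂ] Wave n), Measurable fun p : ℝ × ℝ =>
      u (p.2 + p.1, p.2 - p.1) (ψ p.1 p.2) i := fun u => by
    have h1 : Continuous fun p : ℝ × ℝ => u (p.2 + p.1, p.2 - p.1) :=
      u.continuous.comp (by fun_prop)
    have h2 : StronglyMeasurable fun p : ℝ × ℝ => u (p.2 + p.1, p.2 - p.1) (ψ p.1 p.2) :=
      (isBoundedBilinearMap_apply (𝕜 := ℂ)).continuous.comp_stronglyMeasurable
        (h1.stronglyMeasurable.prodMk hψ.stronglyMeasurable)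
    exact (EuclideanSpace.proj (𝕜 := ℂ) i).continuous.measurable.comp h2.measurable
  rcases i with k | k
  · simp_rw [fun p : ℝ × ℝ => hQ.fst p.1 p.2 (ψ p.1 p.2) _ rfl k]
    exact key u
  · simp_rw [fun p : ℝ × ℝ => hQ.snd p.1 p.2 (ψ p.1 p.2) _ fun _ => rfl]
    exact key v

lemma eLpNorm_two_sq (f : ℝ → Wave n) : eLpNorm f 2 volume ^ 2 = ∫⁻ x, ‖f x‖ₑ ^ 2 := by
  rw [eLpNorm_eq_lintegral_rpow_enorm_toReal two_ne_zero ENNReal.ofNat_ne_top]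
  rw [← ENNReal.rpow_natCast, ← ENNReal.rpow_mul]
  simp

lemma enorm_sq_eq_sum (h : Wave n) : ‖h‖ₑ ^ 2 = ∑ i, ‖h i‖ₑ ^ 2 := by
  simp_rw [← ofReal_norm, ← ENNReal.ofReal_pow (norm_nonneg _)]
  rw [EuclideanSpace.norm_sq_eq, ENNReal.ofReal_sum_of_nonneg fun _ _ => sq_nonneg _]

lemma IsWaveSolution.exists_eLpNorm_le {Q : ℝ → ℝ → Matrix (Fin n ⊕ Unit) (Fin n ⊕ Unit) ℂ}
    {ψ : ℝ → ℝ → Wave n} (h : IsWaveSolution Q ψ) (y₀ y : ℝ) :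
    ∃ M : NNReal, ∀ s ∈ Set.Icc y₀ y, eLpNorm (fun x => ψ x s) 2 volume ≤ M := by
  have hc : Continuous fun y => (h.memLp y).toLp (fun x => ψ x y) := by
    refine continuous_iff_continuousAt.2 fun y₀ => ?_
    rw [ContinuousAt, tendsto_iff_edist_tendsto_0]
    refine (h.continuous y₀).congr fun y => ?_
    rw [Lp.edist_toLp_toLp]
    rfl
  obtain ⟨M, hM⟩ := isCompact_Icc.exists_bound_of_continuousOn (hc.continuousOn (s := Set.Icc y₀ y))
  refine ⟨M.toNNReal, fun s hs => ?_⟩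
  have h1 := hM s hs
  rw [Lp.norm_toLp] at h1
  rw [← ENNReal.ofReal_toReal (h.memLp s).2.ne]
  exact ENNReal.ofReal_le_ofReal h1

/-- Tonelli's theorem along characteristics. -/
lemma lintegral_charLine {ψ : ℝ → ℝ → Wave n} (hψ : Measurable (Function.uncurry ψ))
    (i : Fin n ⊕ Unit) {m : ℝ → ENNReal} (hm : Measurable m) (S : Set ℝ) :
    ∫⁻ ξ, ∫⁻ s in S, m s * ‖ψ (charLine i ξ s) s‖ₑ ^ 2
      = ∫⁻ s in S, m s * eLpNorm (fun x => ψ x s) 2 volume ^ 2 := by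
  have hmeas : Measurable fun p : ℝ × ℝ => ψ (charLine i p.1 p.2) p.2 :=
    hψ.comp ((continuous_charLine i).measurable.prodMk measurable_snd)
  have hm2 : Measurable (Function.uncurry fun ξ s => m s * ‖ψ (charLine i ξ s) s‖ₑ ^ 2) :=
    (hm.comp measurable_snd).mul (hmeas.enorm.pow_const 2)
  rw [lintegral_lintegral_swap hm2.aemeasurable]
  refine lintegral_congr fun s => ?_
  have hs : Measurable fun x => ψ x s := hψ.comp (measurable_id.prodMk measurable_const)
  have hsc : Measurable fun ξ => ‖ψ (charLine i ξ s) s‖ₑ ^ 2 :=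
    ((hs.comp (measurePreserving_charLine i s).measurable)).enorm.pow_const 2
  rw [lintegral_const_mul _ hsc, eLpNorm_two_sq]
  congr 1
  exact (measurePreserving_charLine i s).lintegral_comp (hs.enorm.pow_const 2)

/-- Along almost every characteristic the interaction term is integrable over bounded time intervals,
so that the integrated wave equation is linear in the wave. -/
lemma IsWaveSolution.ae_intervalIntegrable {Q : ℝ → ℝ → Matrix (Fin n ⊕ Unit) (Fin n ⊕ Unit) ℂ}
    {u v : 𝓢(ℝ × ℝ, Wave n →L[ℂ] Wave n)} (hQ : IsBlockPotential Q u v) {ψ : ℝ → ℝ → Wave n}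
    (h : IsWaveSolution Q ψ) (y₀ y : ℝ) (i : Fin n ⊕ Unit) : ∀ᵐ ξ : ℝ, IntervalIntegrable
      (fun s => (Q (charLine i ξ s) s *ᵥ (ψ (charLine i ξ s) s).ofLp) i) volume y₀ y := by
  obtain ⟨C, hC, hb⟩ := hQ.exists_norm_le
  have hmeas : Measurable fun p : ℝ × ℝ => ψ (charLine i p.1 p.2) p.2 :=
    h.measurable.comp ((continuous_charLine i).measurable.prodMk measurable_snd)
  have hfin : ∫⁻ ξ, ∫⁻ s in Set.uIoc y₀ y, 1 * ‖ψ (charLine i ξ s) s‖ₑ ^ 2 ≠ ⊤ := by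
    rw [lintegral_charLine h.measurable i measurable_const]
    obtain ⟨M, hM⟩ := h.exists_eLpNorm_le (min y₀ y) (max y₀ y)
    refine ne_top_of_le_ne_top (b := ∫⁻ _ in Set.uIoc y₀ y, (M : ENNReal) ^ 2) ?_ ?_
    · rw [setLIntegral_const]
      exact ENNReal.mul_ne_top (by simp) (by rw [Set.uIoc]; simp)
    · refine setLIntegral_mono measurable_const fun s hs => ?_
      rw [one_mul]
      exact pow_le_pow_left' (hM s (Set.Ioc_subset_Icc_self hs)) 2
  have hmeas2 : Measurable fun p : ℝ × ℝ => (1 : ENNReal) * ‖ψ (charLine i p.1 p.2) p.2‖ₑ ^ 2 :=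
    measurable_const.mul (hmeas.enorm.pow_const 2)
  filter_upwards [ae_lt_top (Measurable.lintegral_prod_right' (f := fun p : ℝ × ℝ =>
    (1 : ENNReal) * ‖ψ (charLine i p.1 p.2) p.2‖ₑ ^ 2) hmeas2) hfin] with ξ hξ
  have hmξ : Measurable fun s => ψ (charLine i ξ s) s :=
    hmeas.comp (measurable_const.prodMk measurable_id)
  have hint : IntegrableOn (fun s => ‖ψ (charLine i ξ s) s‖ ^ 2) (Set.uIoc y₀ y) := by
    refine ⟨(hmξ.norm.pow_const 2).aestronglyMeasurable, ?_⟩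
    refine lt_of_le_of_lt (lintegral_mono fun s => ?_) hξ
    rw [one_mul, enorm_pow, enorm_norm]
  rw [intervalIntegrable_iff]
  refine Integrable.mono' ((integrableOn_const (C := C) (by rw [Set.uIoc]; simp)).add
    (hint.const_mul C)) ?_ (Eventually.of_forall fun s => ?_)
  · exact ((hQ.measurable_mulVec h.measurable i).comp ((((continuous_charLine i).comp
      (by fun_prop : Continuous fun s : ℝ => (ξ, s))).measurable).prodMk
        measurable_id)).aestronglyMeasurable
  · refine (hb _ _ _ _).trans ?_
    have hw : decayWeight s ^ 2 ≤ 1 := pow_le_one₀ (decayWeight_pos s).le (decayWeight_le_one s)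
    have hx := norm_nonneg (ψ (charLine i ξ s) s)
    simp only [Pi.add_apply]
    calc C * decayWeight s ^ 2 * ‖ψ (charLine i ξ s) s‖ ≤ C * 1 * ‖ψ (charLine i ξ s) s‖ := by gcongr
      _ = C * ‖ψ (charLine i ξ s) s‖ := by ring
      _ ≤ C * (1 + ‖ψ (charLine i ξ s) s‖ ^ 2) := by
          refine mul_le_mul_of_nonneg_left ?_ hC
          nlinarith [sq_nonneg (‖ψ (charLine i ξ s) s‖ - 1)]
      _ = _ := by ring

/-- Waves may be subtracted. -/
lemma IsWaveSolution.sub {Q : ℝ → ℝ → Matrix (Fin n ⊕ Unit) (Fin n ⊕ Unit) ℂ}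
    {u v : 𝓢(ℝ × ℝ, Wave n →L[ℂ] Wave n)} (hQ : IsBlockPotential Q u v) {ψ φ : ℝ → ℝ → Wave n}
    (hψ : IsWaveSolution Q ψ) (hφ : IsWaveSolution Q φ) :
    IsWaveSolution Q fun x y => ψ x y - φ x y := by
  have key : ∀ (y₀ y : ℝ) (i : Fin n ⊕ Unit), ∀ᵐ ξ : ℝ,
      (ψ (charLine i ξ y) y - φ (charLine i ξ y) y) i
        = (ψ (charLine i ξ y₀) y₀ - φ (charLine i ξ y₀) y₀) i
        - ∫ s in y₀..y, (Q (charLine i ξ s) s *ᵥ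
          (ψ (charLine i ξ s) s - φ (charLine i ξ s) s).ofLp) i := fun y₀ y i => by
    filter_upwards [hψ.eq_charLine y₀ y i, hφ.eq_charLine y₀ y i,
      hψ.ae_intervalIntegrable hQ y₀ y i, hφ.ae_intervalIntegrable hQ y₀ y i] with ξ h1 h2 h3 h4
    simp_rw [WithLp.ofLp_sub, Matrix.mulVec_sub, Pi.sub_apply]
    rw [h1, h2, intervalIntegral.integral_sub h3 h4]
    ring
  refine ⟨hψ.measurable.sub hφ.measurable, fun y => (hψ.memLp y).sub (hφ.memLp y), fun y₀ => ?_,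
    fun y₀ y k => key y₀ y (Sum.inl k), fun y₀ y => key y₀ y (Sum.inr ())⟩
  have h := (hψ.continuous y₀).add (hφ.continuous y₀)
  rw [add_zero] at h
  refine tendsto_of_tendsto_of_tendsto_of_le_of_le tendsto_const_nhds h (fun _ => zero_le) fun y => ?_
  refine le_trans (le_of_eq ?_) (eLpNorm_sub_le ((hψ.memLp y).sub (hψ.memLp y₀)).1
    ((hφ.memLp y).sub (hφ.memLp y₀)).1 (by norm_num))
  congr 1
  funext x
  simp only [Pi.sub_apply]
  abel

end

noncomputable section

/-! ### The energy inequality -/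

lemma integrable_decayWeight_mul_exp (l : ℝ) :
    Integrable fun s => decayWeight s * (l * Real.exp (l * Real.arctan s)) := by
  refine integrable_inv_one_add_sq.mul_bdd (c := |l| * Real.exp (|l| * Real.pi))
    (by fun_prop) (Eventually.of_forall fun s => ?_)
  rw [norm_mul, Real.norm_eq_abs, Real.norm_of_nonneg (Real.exp_pos _).le]
  refine mul_le_mul_of_nonneg_left (Real.exp_le_exp.2 ?_) (abs_nonneg l)
  refine (le_abs_self _).trans ?_
  rw [abs_mul]
  refine mul_le_mul_of_nonneg_left ?_ (abs_nonneg l)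
  have h1 := Real.arctan_lt_pi_div_two s
  have h2 := Real.neg_pi_div_two_lt_arctan s
  rw [abs_le]
  constructor <;> linarith [Real.pi_pos]

lemma lintegral_decayWeight_mul_exp_le {l : ℝ} (hl : 0 ≤ l) (y : ℝ) :
    ∫⁻ s in Set.Iic y, ENNReal.ofReal (decayWeight s * (l * Real.exp (l * Real.arctan s)))
      ≤ ENNReal.ofReal (Real.exp (l * Real.arctan y)) := by
  have hi := integrable_decayWeight_mul_exp l
  rw [← ofReal_integral_eq_lintegral_ofReal hi.integrableOn (Eventually.of_forall fun s =>
    mul_nonneg (decayWeight_pos s).le (mul_nonneg hl (Real.exp_pos _).le))]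
  refine ENNReal.ofReal_le_ofReal ?_
  have hd : ∀ s ∈ Set.Iic y, HasDerivAt (fun s => Real.exp (l * Real.arctan s))
      (decayWeight s * (l * Real.exp (l * Real.arctan s))) s := fun s _ => by
    refine ((Real.hasDerivAt_arctan s).const_mul l).exp.congr_deriv ?_
    rw [decayWeight, one_div]
    ring
  have ht : Tendsto (fun s => Real.exp (l * Real.arctan s)) atBot
      (𝓝 (Real.exp (l * -(Real.pi / 2)))) :=
    (Real.continuous_exp.tendsto _).comp
      ((tendsto_nhds_of_tendsto_nhdsWithin Real.tendsto_arctan_atBot).const_mul l)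
  rw [integral_Iic_of_hasDerivAt_of_tendsto' hd hi.integrableOn ht]
  linarith [Real.exp_pos (l * -(Real.pi / 2))]

/-- Grönwall's inequality on a half-line `(-∞, Y]`, with integrable weight. The a priori bound on `f` is
needed, since the interval is infinite. -/
lemma eq_zero_of_le_lintegral_decayWeight {f : ℝ → ENNReal} {K M Y : ℝ} (hK : 0 < K)
    (hM : ∀ y ≤ Y, f y ≤ ENNReal.ofReal M)
    (h : ∀ y ≤ Y, f y ≤ ENNReal.ofReal K * ∫⁻ s in Set.Iic y, ENNReal.ofReal (decayWeight s) * f s) :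
    f Y = 0 := by
  set l : ℝ := 2 * K with hl
  have hl0 : 0 ≤ l := by positivity
  set A : ℝ := |M| * Real.exp (l * (Real.pi / 2)) with hA
  have hA0 : 0 ≤ A := by positivity
  -- each use of the integral inequality halves the bound relative to the exponential weight
  have key : ∀ k : ℕ, ∀ y ≤ Y, f y ≤ ENNReal.ofReal (A * (1 / 2) ^ k * Real.exp (l * Real.arctan y)) := by
    intro k
    induction k with
    | zero =>
      refine fun y hy => (hM y hy).trans (ENNReal.ofReal_le_ofReal ?_)
      rw [pow_zero, mul_one, hA, mul_assoc, ← Real.exp_add, ← mul_add]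
      have h2 := Real.neg_pi_div_two_lt_arctan y
      have h3 : 1 ≤ Real.exp (l * (Real.pi / 2 + Real.arctan y)) :=
        Real.one_le_exp (mul_nonneg hl0 (by linarith))
      nlinarith [le_abs_self M, abs_nonneg M]
    | succ k ih =>
      intro y hy
      have hB : 0 ≤ A * (1 / 2) ^ k := by positivity
      calc f y ≤ ENNReal.ofReal K * ∫⁻ s in Set.Iic y, ENNReal.ofReal (decayWeight s) * f s := h y hy
        _ ≤ ENNReal.ofReal K * ∫⁻ s in Set.Iic y, ENNReal.ofReal (A * (1 / 2) ^ k / l) *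
              ENNReal.ofReal (decayWeight s * (l * Real.exp (l * Real.arctan s))) := by
            refine mul_le_mul_right (setLIntegral_mono' measurableSet_Iic fun s hs => ?_) _
            refine (mul_le_mul_right (ih s (le_trans hs hy)) _).trans (le_of_eq ?_)
            rw [← ENNReal.ofReal_mul (decayWeight_pos s).le, ← ENNReal.ofReal_mul (by positivity)]
            congr 1
            have : l ≠ 0 := by positivity
            field_simp
        _ = ENNReal.ofReal (K * (A * (1 / 2) ^ k / l)) * ∫⁻ s in Set.Iic y,
              ENNReal.ofReal (decayWeight s * (l * Real.exp (l * Real.arctan s))) := by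
            rw [lintegral_const_mul' _ _ ENNReal.ofReal_ne_top, ENNReal.ofReal_mul hK.le,
              mul_assoc (ENNReal.ofReal K)]
        _ ≤ ENNReal.ofReal (K * (A * (1 / 2) ^ k / l)) *
              ENNReal.ofReal (Real.exp (l * Real.arctan y)) :=
            mul_le_mul_right (lintegral_decayWeight_mul_exp_le hl0 y) _
        _ = _ := by
            rw [← ENNReal.ofReal_mul (by positivity)]
            congr 1
            rw [hl]
            field_simp
            ring
  have ht : Tendsto (fun k : ℕ => ENNReal.ofReal (A * (1 / 2) ^ k * Real.exp (l * Real.arctan Y)))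
      atTop (𝓝 0) := by
    rw [← ENNReal.ofReal_zero]
    refine ENNReal.tendsto_ofReal ?_
    simpa using ((tendsto_pow_atTop_nhds_zero_of_lt_one (r := (1 / 2 : ℝ)) (by norm_num)
      (by norm_num)).const_mul A).mul_const (Real.exp (l * Real.arctan Y))
  exact le_antisymm (ge_of_tendsto' ht fun k => key k Y le_rfl) zero_le

/-- The Cauchy–Schwarz inequality for Lebesgue integrals. -/
lemma lintegral_mul_sq_le {μ : Measure ℝ} {f g : ℝ → ENNReal} (hf : AEMeasurable f μ)
    (hg : AEMeasurable g μ) : (∫⁻ s, f s * g s ∂μ) ^ 2 ≤ (∫⁻ s, f s ^ 2 ∂μ) * ∫⁻ s, g s ^ 2 ∂μ := by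
  have h := ENNReal.lintegral_mul_le_Lp_mul_Lq μ Real.HolderConjugate.two_two hf hg
  have h2 := pow_le_pow_left' h 2
  rw [mul_pow, ← ENNReal.rpow_natCast (_ ^ (1 / 2 : ℝ)), ← ENNReal.rpow_mul,
    ← ENNReal.rpow_natCast (_ ^ (1 / 2 : ℝ)), ← ENNReal.rpow_mul] at h2
  simpa using h2

lemma ENNReal.add_sq_le_two_mul (a b : ENNReal) : (a + b) ^ 2 ≤ 2 * a ^ 2 + 2 * b ^ 2 := by
  have h := ENNReal.rpow_add_le_mul_rpow_add_rpow a b (p := 2) one_le_two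
  rw [← mul_add]
  norm_num at h
  exact h

lemma lintegral_decayWeight_sq_le (S : Set ℝ) :
    ∫⁻ s in S, ENNReal.ofReal (decayWeight s) ^ 2 ≤ ENNReal.ofReal Real.pi := by
  rw [← integral_univ_inv_one_add_sq, ofReal_integral_eq_lintegral_ofReal integrable_inv_one_add_sq
    (Eventually.of_forall fun s => (decayWeight_pos s).le)]
  refine (setLIntegral_le_lintegral _ _).trans (lintegral_mono fun s => ?_)
  rw [← ENNReal.ofReal_pow (decayWeight_pos s).le]
  exact ENNReal.ofReal_le_ofReal (pow_le_of_le_one (decayWeight_pos s).le (decayWeight_le_one s)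
    two_ne_zero)

variable {n : ℕ}

lemma measurable_ofReal_decayWeight : Measurable fun s => ENNReal.ofReal (decayWeight s) :=
  ENNReal.measurable_ofReal.comp (by unfold decayWeight; fun_prop)

/-- The energy inequality for waves, from the Cauchy–Schwarz inequality along each characteristic and
Tonelli's theorem. -/
lemma IsBlockPotential.exists_eLpNorm_sq_le {Q : ℝ → ℝ → Matrix (Fin n ⊕ Unit) (Fin n ⊕ Unit) ℂ}
    {u v : 𝓢(ℝ × ℝ, Wave n →L[ℂ] Wave n)} (hQ : IsBlockPotential Q u v) :
    ∃ K : ℝ, 0 < K ∧ ∀ ψ, IsWaveSolution Q ψ → ∀ y₀ y, y₀ ≤ y →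
      eLpNorm (fun x => ψ x y) 2 volume ^ 2 ≤ 2 * eLpNorm (fun x => ψ x y₀) 2 volume ^ 2
        + ENNReal.ofReal K * ∫⁻ s in Set.Ioc y₀ y, ENNReal.ofReal (decayWeight s)
            * eLpNorm (fun x => ψ x s) 2 volume ^ 2 := by
  obtain ⟨C, hC, hb⟩ := hQ.exists_norm_le
  refine ⟨Fintype.card (Fin n ⊕ Unit) * (2 * (C ^ 2 * Real.pi)) + 1, by positivity, fun ψ h y₀ y hy => ?_⟩
  set N : ℝ → ENNReal := fun s => eLpNorm (fun x => ψ x s) 2 volume ^ 2 with hN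
  set I := ∫⁻ s in Set.Ioc y₀ y, ENNReal.ofReal (decayWeight s) * N s with hI
  have hms : ∀ s, Measurable fun x => ψ x s := fun s =>
    h.measurable.comp (measurable_id.prodMk measurable_const)
  have hmi : ∀ s i, Measurable fun x => ‖ψ x s i‖ₑ ^ 2 := fun s i =>
    (((EuclideanSpace.proj (𝕜 := ℂ) i).continuous.measurable.comp (hms s)).enorm.pow_const 2)
  have hmeas : ∀ i : Fin n ⊕ Unit, Measurable fun p : ℝ × ℝ => ψ (charLine i p.1 p.2) p.2 := fun i =>
    h.measurable.comp ((continuous_charLine i).measurable.prodMk measurable_snd)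
  have hsum : ∀ s, N s = ∑ i, ∫⁻ x, ‖ψ x s i‖ₑ ^ 2 := fun s => by
    rw [hN]
    simp only
    rw [eLpNorm_two_sq, ← lintegral_finsetSum _ fun i _ => hmi s i]
    exact lintegral_congr fun x => enorm_sq_eq_sum _
  have hcomp : ∀ i, ∫⁻ x, ‖ψ x y i‖ₑ ^ 2 ≤ 2 * (∫⁻ x, ‖ψ x y₀ i‖ₑ ^ 2)
      + ENNReal.ofReal (2 * (C ^ 2 * Real.pi)) * I := fun i => by
    rw [← (measurePreserving_charLine i y).lintegral_comp (hmi y i),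
      ← (measurePreserving_charLine i y₀).lintegral_comp (hmi y₀ i)]
    have hpt : ∀ᵐ ξ : ℝ, ‖ψ (charLine i ξ y) y i‖ₑ ^ 2 ≤ 2 * ‖ψ (charLine i ξ y₀) y₀ i‖ₑ ^ 2
        + ENNReal.ofReal (2 * (C ^ 2 * Real.pi)) * ∫⁻ s in Set.Ioc y₀ y,
          ENNReal.ofReal (decayWeight s) * ‖ψ (charLine i ξ s) s‖ₑ ^ 2 := by
      filter_upwards [h.eq_charLine y₀ y i] with ξ hξ
      have hmξ : Measurable fun s => ψ (charLine i ξ s) s :=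
        (hmeas i).comp (measurable_const.prodMk measurable_id)
      have h1 : ‖∫ s in y₀..y, (Q (charLine i ξ s) s *ᵥ (ψ (charLine i ξ s) s).ofLp) i‖ₑ
          ≤ ENNReal.ofReal C * ∫⁻ s in Set.Ioc y₀ y, ENNReal.ofReal (decayWeight s) *
            (ENNReal.ofReal (decayWeight s) * ‖ψ (charLine i ξ s) s‖ₑ) := by
        rw [intervalIntegral.integral_of_le hy, ← lintegral_const_mul' _ _ ENNReal.ofReal_ne_top]
        refine (enorm_integral_le_lintegral_enorm _).trans (lintegral_mono fun s => ?_)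
        rw [← ofReal_norm, ← ofReal_norm, ← ENNReal.ofReal_mul (decayWeight_pos s).le,
          ← ENNReal.ofReal_mul (decayWeight_pos s).le, ← ENNReal.ofReal_mul hC]
        refine ENNReal.ofReal_le_ofReal ((hb _ _ _ _).trans (le_of_eq (by ring)))
      have h2 : (∫⁻ s in Set.Ioc y₀ y, ENNReal.ofReal (decayWeight s) *
            (ENNReal.ofReal (decayWeight s) * ‖ψ (charLine i ξ s) s‖ₑ)) ^ 2
          ≤ ENNReal.ofReal Real.pi * ∫⁻ s in Set.Ioc y₀ y,
            ENNReal.ofReal (decayWeight s) * ‖ψ (charLine i ξ s) s‖ₑ ^ 2 := by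
        refine (lintegral_mul_sq_le measurable_ofReal_decayWeight.aemeasurable
          (measurable_ofReal_decayWeight.mul hmξ.enorm).aemeasurable).trans ?_
        refine mul_le_mul' (lintegral_decayWeight_sq_le _) (lintegral_mono fun s => ?_)
        rw [Pi.mul_apply, mul_pow]
        refine mul_le_mul_left (pow_le_of_le_one zero_le ?_ two_ne_zero) _
        exact ENNReal.ofReal_le_one.2 (decayWeight_le_one s)
      rw [hξ]
      refine (pow_le_pow_left' ((enorm_sub_le).trans (add_le_add_right h1 _)) 2).trans ?_
      refine (ENNReal.add_sq_le_two_mul _ _).trans (add_le_add_right ?_ _)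
      rw [mul_pow]
      refine (mul_le_mul_right (mul_le_mul_right h2 _) 2).trans (le_of_eq ?_)
      rw [ENNReal.ofReal_mul zero_le_two, ENNReal.ofReal_mul (sq_nonneg C), ENNReal.ofReal_pow hC,
        ENNReal.ofReal_ofNat]
      ring
    refine (lintegral_mono_ae hpt).trans ?_
    have hm0 : Measurable fun ξ => 2 * ‖ψ (charLine i ξ y₀) y₀ i‖ₑ ^ 2 :=
      ((hmi y₀ i).comp (measurePreserving_charLine i y₀).measurable).const_mul 2
    rw [lintegral_add_left hm0,
      lintegral_const_mul' _ _ (by simp), lintegral_const_mul' _ _ ENNReal.ofReal_ne_top,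
      lintegral_charLine h.measurable i measurable_ofReal_decayWeight]
  change N y ≤ 2 * N y₀ + ENNReal.ofReal _ * I
  rw [hsum, hsum y₀]
  refine (Finset.sum_le_sum fun i _ => hcomp i).trans ?_
  rw [Finset.sum_add_distrib, Finset.mul_sum, Finset.sum_const, nsmul_eq_mul, Finset.card_univ, ← mul_assoc]
  refine add_le_add_right (mul_le_mul_left ?_ _) _
  rw [← ENNReal.ofReal_natCast, ← ENNReal.ofReal_mul (Nat.cast_nonneg _)]
  exact ENNReal.ofReal_le_ofReal (by linarith)

/-- A wave that vanishes in the distant past vanishes: the initial time in the energy inequality tends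
to `-∞`, and Grönwall's inequality applies. -/
lemma IsWaveSolution.eLpNorm_eq_zero {Q : ℝ → ℝ → Matrix (Fin n ⊕ Unit) (Fin n ⊕ Unit) ℂ}
    {u v : 𝓢(ℝ × ℝ, Wave n →L[ℂ] Wave n)} (hQ : IsBlockPotential Q u v) {ψ : ℝ → ℝ → Wave n}
    (h : IsWaveSolution Q ψ)
    (h0 : Tendsto (fun y => eLpNorm (fun x => ψ x y) 2 volume) atBot (𝓝 0)) (y : ℝ) :
    eLpNorm (fun x => ψ x y) 2 volume = 0 := by
  obtain ⟨K, hK, hle⟩ := hQ.exists_eLpNorm_sq_le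
  obtain ⟨y₀, hy₀⟩ := eventually_atBot.1 (h0.eventually_le_const zero_lt_one)
  obtain ⟨M, hM⟩ := h.exists_eLpNorm_le y₀ y
  have hb : ∀ s ≤ y, eLpNorm (fun x => ψ x s) 2 volume ^ 2 ≤ ENNReal.ofReal ((max 1 M : NNReal) ^ 2 : ℝ) := by
    intro s hs
    rw [ENNReal.ofReal_pow (NNReal.coe_nonneg _), ENNReal.ofReal_coe_nnreal]
    refine pow_le_pow_left' ?_ 2
    rcases le_total s y₀ with h1 | h1
    · exact (hy₀ s h1).trans (by simp)
    · exact (hM s ⟨h1, hs⟩).trans (by simp)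
  refine pow_eq_zero_iff (two_ne_zero) |>.1 (eq_zero_of_le_lintegral_decayWeight
    (f := fun y => eLpNorm (fun x => ψ x y) 2 volume ^ 2) hK hb fun s _ => ?_)
  have ht := ((ENNReal.Tendsto.const_mul (a := 2) (ENNReal.Tendsto.pow (n := 2) h0) (by simp)).add_const
    (ENNReal.ofReal K * ∫⁻ s in Set.Iic s, ENNReal.ofReal (decayWeight s)
            * eLpNorm (fun x => ψ x s) 2 volume ^ 2))
  rw [zero_pow two_ne_zero, mul_zero, zero_add] at ht
  refine ge_of_tendsto ht ((eventually_le_atBot s).mono fun r hr => (hle ψ h r s hr).trans ?_)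
  exact add_le_add_right (mul_le_mul_right (lintegral_mono_set Set.Ioc_subset_Iic_self) _) _

end

noncomputable section

/-! ### The scattered profile -/

variable {n : ℕ}

/-- The free evolution is isometric in `L²`. -/
lemma eLpNorm_waveShift {h : ℝ → Wave n} (hh : AEStronglyMeasurable h) (y : ℝ) :
    eLpNorm (fun x => waveShift x h y) 2 volume = eLpNorm h 2 volume := by
  have hmi : ∀ i, AEMeasurable (fun x => ‖h x i‖ₑ ^ 2) := fun i =>
    ((EuclideanSpace.proj (𝕜 := ℂ) i).continuous.comp_aestronglyMeasurable hh).enorm.pow_const 2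
  have key : ∀ i, ∫⁻ x, ‖waveShift x h y i‖ₑ ^ 2 = ∫⁻ x, ‖h x i‖ₑ ^ 2 := fun i => by
    rcases i with k | k
    · exact lintegral_add_left_eq_self (fun x => ‖h x (Sum.inl k)‖ₑ ^ 2) y
    · exact lintegral_sub_left_eq_self (fun x => ‖h x (Sum.inr k)‖ₑ ^ 2) y
  have hmi' : ∀ i, AEMeasurable (fun x => ‖waveShift x h y i‖ₑ ^ 2) := fun i => by
    rcases i with k | k
    · exact (hmi (Sum.inl k)).comp_quasiMeasurePreserving
        (measurePreserving_add_left volume y).quasiMeasurePreserving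
    · exact (hmi (Sum.inr k)).comp_quasiMeasurePreserving
        (measurePreserving_sub_left_real y).quasiMeasurePreserving
  have h2 : eLpNorm (fun x => waveShift x h y) 2 volume ^ 2 = eLpNorm h 2 volume ^ 2 := by
    rw [eLpNorm_two_sq, eLpNorm_two_sq]
    simp_rw [enorm_sq_eq_sum]
    rw [lintegral_finsetSum' _ fun i _ => hmi' i, lintegral_finsetSum' _ fun i _ => hmi i]
    exact Finset.sum_congr rfl fun i _ => key i
  exact (ENNReal.pow_right_strictMono two_ne_zero).injective h2

lemma waveShift_sub (x : ℝ) (a c : ℝ → Wave n) (y : ℝ) :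
    waveShift x a y - waveShift x c y = waveShift x (a - c) y := by
  rw [waveShift_eq, waveShift_eq, waveShift_eq, mixWave_sub]
  rfl

lemma aestronglyMeasurable_waveShift {h : ℝ → Wave n} (hh : AEStronglyMeasurable h) (y : ℝ) :
    AEStronglyMeasurable (fun x => waveShift x h y) := by
  simp_rw [waveShift_eq]
  exact continuous_mixWave.comp_aestronglyMeasurable
    ((hh.comp_measurePreserving (measurePreserving_add_left volume y)).prodMk
      (hh.comp_measurePreserving (measurePreserving_sub_left_real y)))

/-- The asymptotic profile of a wave is unique. -/
lemma ae_eq_of_tendsto_waveShift {ψ : ℝ → ℝ → Wave n}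
    (hψ : ∀ y, AEStronglyMeasurable fun x => ψ x y) {a c : ℝ → Wave n}
    (ha : AEStronglyMeasurable a) (hc : AEStronglyMeasurable c) {l : Filter ℝ} [l.NeBot]
    (h₁ : Tendsto (fun y => eLpNorm (fun x => ψ x y - waveShift x a y) 2 volume) l (𝓝 0))
    (h₂ : Tendsto (fun y => eLpNorm (fun x => ψ x y - waveShift x c y) 2 volume) l (𝓝 0)) :
    a =ᵐ[volume] c := by
  have h := h₂.add h₁
  rw [add_zero] at h
  have h0 : eLpNorm (a - c) 2 volume = 0 := by
    refine le_antisymm (ge_of_tendsto' h fun y => ?_) zero_le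
    rw [← eLpNorm_waveShift (ha.sub hc) y]
    refine le_trans (le_of_eq ?_) (eLpNorm_sub_le ((hψ y).sub (aestronglyMeasurable_waveShift hc y))
      ((hψ y).sub (aestronglyMeasurable_waveShift ha y)) (by norm_num))
    congr 1
    funext x
    rw [← waveShift_sub, Pi.sub_apply, sub_sub_sub_cancel_left]
  rw [eLpNorm_eq_zero_iff (ha.sub hc) two_ne_zero] at h0
  filter_upwards [h0] with x hx
  exact sub_eq_zero.1 hx

lemma aestronglyMeasurable_scatteredProfile (u v : 𝓢(ℝ × ℝ, Wave n →L[ℂ] Wave n))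
    {a : ℝ → Wave n} (ha : AEStronglyMeasurable a) :
    AEStronglyMeasurable (scatteredProfile u v a) :=
  ha.add (continuous_mixWave.comp_aestronglyMeasurable
    ((aestronglyMeasurable_integral_scatteringKernel u v ha).prodMk
      (aestronglyMeasurable_integral_scatteringKernel (swapPotential v) (swapPotential u) ha)))

/-- A wave with incident profile `a` has the scattered profile `scatteredProfile u v a`, since it
agrees with the wave constructed from the kernel. -/
lemma IsWaveSolution.ae_eq_scatteredProfile
    {Q : ℝ → ℝ → Matrix (Fin n ⊕ Unit) (Fin n ⊕ Unit) ℂ}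
    {u v : 𝓢(ℝ × ℝ, Wave n →L[ℂ] Wave n)} (hQ : IsBlockPotential Q u v) {ψ : ℝ → ℝ → Wave n}
    (h : IsWaveSolution Q ψ) {a c : ℝ → Wave n} (ham : Measurable a) (ha : MemLp a 2 volume)
    (hc : AEStronglyMeasurable c)
    (h₁ : Tendsto (fun y => eLpNorm (fun x => ψ x y - waveShift x a y) 2 volume) atBot (𝓝 0))
    (h₂ : Tendsto (fun y => eLpNorm (fun x => ψ x y - waveShift x c y) 2 volume) atTop (𝓝 0)) :
    c =ᵐ[volume] scatteredProfile u v a := by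
  have hφ := hQ.isWaveSolution ham ha
  have hδ := h.sub hQ hφ
  have hs := aestronglyMeasurable_scatteredProfile u v ha.1
  have h0 : ∀ y, eLpNorm (fun x => ψ x y - scatteredWave u v a x y) 2 volume = 0 := by
    refine hδ.eLpNorm_eq_zero hQ ?_
    have ht := h₁.add (tendsto_scatteredWave_atBot u v ha)
    rw [add_zero] at ht
    refine tendsto_of_tendsto_of_tendsto_of_le_of_le tendsto_const_nhds ht (fun _ => zero_le)
      fun y => ?_
    refine le_trans (le_of_eq ?_) (eLpNorm_sub_le
      ((h.memLp y).1.sub (aestronglyMeasurable_waveShift ha.1 y))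
      ((hφ.memLp y).1.sub (aestronglyMeasurable_waveShift ha.1 y)) (by norm_num))
    congr 1
    funext x
    simp only [Pi.sub_apply]
    abel
  refine ae_eq_of_tendsto_waveShift (fun y => (h.memLp y).1) hc hs h₂
    ((tendsto_scatteredWave_atTop u v ha).congr fun y => eLpNorm_congr_ae ?_)
  have hy := (eLpNorm_eq_zero_iff ((h.memLp y).1.sub (hφ.memLp y).1) two_ne_zero).1 (h0 y)
  filter_upwards [hy] with x hx
  have hx' : ψ x y = scatteredWave u v a x y := sub_eq_zero.1 hx
  rw [hx']

/-! ### Reflection of waves -/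

/-- The reflection of a potential in the origin, with opposite sign. -/
def negReflect {H : Type*} [NormedAddCommGroup H] [NormedSpace ℂ H] (u : 𝓢(ℝ × ℝ, H →L[ℂ] H)) :
    𝓢(ℝ × ℝ, H →L[ℂ] H) :=
  -SchwartzMap.compCLMOfContinuousLinearEquiv ℝ (ContinuousLinearEquiv.neg ℝ) u

lemma negReflect_apply {H : Type*} [NormedAddCommGroup H] [NormedSpace ℂ H]
    (u : 𝓢(ℝ × ℝ, H →L[ℂ] H)) (z : ℝ × ℝ) : negReflect u z = -u (-z) := rfl

/-- The potential of the reflected waves `ψ(-x, -y)`. -/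
lemma IsBlockPotential.neg {Q : ℝ → ℝ → Matrix (Fin n ⊕ Unit) (Fin n ⊕ Unit) ℂ}
    {u v : 𝓢(ℝ × ℝ, Wave n →L[ℂ] Wave n)} (hQ : IsBlockPotential Q u v) :
    IsBlockPotential (fun x y => -Q (-x) (-y)) (negReflect u) (negReflect v) := by
  have e : ∀ x y : ℝ, -((y + x, y - x) : ℝ × ℝ) = (-y + -x, -y - -x) := fun x y => by
    ext <;> simp <;> ring
  constructor
  · intro x y h h' hh k
    rw [Matrix.neg_mulVec, Pi.neg_apply, hQ.fst _ _ h h' hh k, negReflect_apply, e]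
    rfl
  · intro x y h h' hh
    rw [Matrix.neg_mulVec, Pi.neg_apply, hQ.snd _ _ h h' hh, negReflect_apply, e]
    rfl

lemma IsWaveSolution.neg {Q : ℝ → ℝ → Matrix (Fin n ⊕ Unit) (Fin n ⊕ Unit) ℂ}
    {ψ : ℝ → ℝ → Wave n} (h : IsWaveSolution Q ψ) :
    IsWaveSolution (fun x y => -Q (-x) (-y)) fun x y => ψ (-x) (-y) := by
  have mp : MeasurePreserving (fun x : ℝ => -x) := Measure.measurePreserving_neg volume
  have key : ∀ (y₀ y : ℝ) (i : Fin n ⊕ Unit), ∀ᵐ ξ : ℝ,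
      ψ (-charLine i ξ y) (-y) i = ψ (-charLine i ξ y₀) (-y₀) i
        - ∫ s in y₀..y, (-Q (-charLine i ξ s) (-s) *ᵥ
          (ψ (-charLine i ξ s) (-s)).ofLp) i := fun y₀ y i => by
    filter_upwards [mp.quasiMeasurePreserving.ae (h.eq_charLine (-y₀) (-y) i)] with ξ hξ
    rw [charLine_neg, charLine_neg] at hξ
    rw [hξ, ← intervalIntegral.integral_comp_neg (a := y) (b := y₀), intervalIntegral.integral_symm,
      ← intervalIntegral.integral_neg]
    simp_rw [charLine_neg, Matrix.neg_mulVec, Pi.neg_apply]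
  refine ⟨?_, fun y => (h.memLp (-y)).comp_measurePreserving mp, fun y₀ => ?_,
    fun y₀ y k => key y₀ y (Sum.inl k), fun y₀ y => key y₀ y (Sum.inr ())⟩
  · exact h.measurable.comp (measurable_fst.neg.prodMk measurable_snd.neg)
  · refine ((h.continuous (-y₀)).comp (continuous_neg.tendsto y₀)).congr fun y => ?_
    exact (eLpNorm_comp_measurePreserving ((h.memLp (-y)).sub (h.memLp (-y₀))).1 mp).symm

/-- Reflection exchanges the asymptotics in the past with those in the future. -/
lemma tendsto_neg_waveShift {ψ : ℝ → ℝ → Wave n} (hψ : ∀ y, AEStronglyMeasurable fun x => ψ x y)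
    {a : ℝ → Wave n} (ha : AEStronglyMeasurable a) {l l' : Filter ℝ}
    (h : Tendsto (fun y => eLpNorm (fun x => ψ x y - waveShift x a y) 2 volume) l (𝓝 0))
    (hl : Tendsto (fun y : ℝ => -y) l' l) :
    Tendsto (fun y => eLpNorm (fun x => ψ (-x) (-y) - waveShift x (fun s => a (-s)) y) 2 volume) l'
      (𝓝 0) := by
  refine (h.comp hl).congr fun y => ?_
  have mp : MeasurePreserving (fun x : ℝ => -x) := Measure.measurePreserving_neg volume
  refine (eLpNorm_comp_measurePreserving
    ((hψ (-y)).sub (aestronglyMeasurable_waveShift ha (-y))) mp).symm.trans ?_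
  congr 1
  funext x
  have e₁ : -y + -x = -(y + x) := by ring
  have e₂ : -y - -x = -(y - x) := by ring
  simp only [Function.comp_apply, Pi.sub_apply, waveShift_eq, e₁, e₂]

end

noncomputable section

/-! ### The scattering operator -/

variable {n : ℕ}

lemma waveShift_ae_congr {a c : ℝ → Wave n} (h : a =ᵐ[volume] c) (y : ℝ) :
    (fun x => waveShift x a y) =ᵐ[volume] fun x => waveShift x c y := by
  filter_upwards [(measurePreserving_add_left volume y).quasiMeasurePreserving.ae h,
    (measurePreserving_sub_left_real y).quasiMeasurePreserving.ae h] with x h1 h2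
  rw [waveShift_eq, waveShift_eq, h1, h2]

lemma tendsto_waveShift_congr {ψ : ℝ → ℝ → Wave n} {a c : ℝ → Wave n} {l : Filter ℝ}
    (h : Tendsto (fun y => eLpNorm (fun x => ψ x y - waveShift x a y) 2 volume) l (𝓝 0))
    (hac : a =ᵐ[volume] c) :
    Tendsto (fun y => eLpNorm (fun x => ψ x y - waveShift x c y) 2 volume) l (𝓝 0) := by
  refine h.congr fun y => eLpNorm_congr_ae ?_
  filter_upwards [waveShift_ae_congr hac y] with x hx
  rw [hx]

/-- `mixWave` as a linear map. -/
def mixWaveCLM : (Wave n × Wave n) →L[ℂ] Wave n where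
  toFun p := mixWave p.1 p.2
  map_add' p q := (mixWave_add _ _ _ _).symm
  map_smul' c p := by ext (k | k) <;> simp
  cont := continuous_mixWave

lemma mixWaveCLM_apply (p : Wave n × Wave n) : mixWaveCLM p = mixWave p.1 p.2 := rfl

/-- The matrix of an operator on `ℂⁿ⁺¹` in the standard basis. -/
def waveMatrix (L : Wave n →L[ℂ] Wave n) : Matrix (Fin n ⊕ Unit) (Fin n ⊕ Unit) ℂ :=
  Matrix.of fun i j => L (EuclideanSpace.single j 1) i

lemma waveMatrix_mulVec (L : Wave n →L[ℂ] Wave n) (h : Wave n) (i : Fin n ⊕ Unit) :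
    (waveMatrix L *ᵥ h.ofLp) i = L h i := by
  have e : h = ∑ j, h j • EuclideanSpace.single j (1 : ℂ) := by
    ext k
    simp only [WithLp.ofLp_sum, WithLp.ofLp_smul, Finset.sum_apply, Pi.smul_apply,
      PiLp.single_apply, smul_eq_mul, mul_ite, mul_one, mul_zero, Finset.sum_ite_eq,
      Finset.mem_univ, if_true]
  conv_rhs => rw [e, map_sum]
  simp [Matrix.mulVec, dotProduct, waveMatrix, mul_comm]

lemma norm_waveMatrix_le (L : Wave n →L[ℂ] Wave n) (i j : Fin n ⊕ Unit) :
    ‖waveMatrix L i j‖ ≤ ‖L‖ := by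
  refine (PiLp.norm_apply_le (L (EuclideanSpace.single j 1)) i).trans ((L.le_opNorm _).trans ?_)
  simp

/-- The kernel of `S - 1` as an operator-valued function. -/
def fullKernel (u v : 𝓢(ℝ × ℝ, Wave n →L[ℂ] Wave n)) (z : ℝ × ℝ) : Wave n →L[ℂ] Wave n :=
  (mixWaveCLM ∘L ContinuousLinearMap.inl ℂ _ _) ∘L scatteringKernel u v z
    + (mixWaveCLM ∘L ContinuousLinearMap.inr ℂ _ _) ∘L
      scatteringKernel (swapPotential v) (swapPotential u) z

lemma fullKernel_apply (u v : 𝓢(ℝ × ℝ, Wave n →L[ℂ] Wave n)) (z : ℝ × ℝ) (h : Wave n) :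
    fullKernel u v z h = mixWave (scatteringKernel u v z h)
      (scatteringKernel (swapPotential v) (swapPotential u) z h) := by
  change mixWave _ 0 + mixWave 0 _ = _
  rw [mixWave_add, add_zero, zero_add]
  rfl

lemma stronglyMeasurable_fullKernel (u v : 𝓢(ℝ × ℝ, Wave n →L[ℂ] Wave n)) :
    StronglyMeasurable (fullKernel u v) := by
  have h : ∀ A : Wave n →L[ℂ] Wave n, Continuous fun L : Wave n →L[ℂ] Wave n => A ∘L L :=
    fun A => continuous_const.clm_comp continuous_id
  exact ((h _).comp_stronglyMeasurable (stronglyMeasurable_scatteringKernel u v)).add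
    ((h _).comp_stronglyMeasurable
      (stronglyMeasurable_scatteringKernel (swapPotential v) (swapPotential u)))

lemma exists_norm_fullKernel_le (u v : 𝓢(ℝ × ℝ, Wave n →L[ℂ] Wave n)) :
    ∃ C, 0 ≤ C ∧ ∀ z : ℝ × ℝ, ‖fullKernel u v z‖ ≤ C * (decayWeight z.1 * decayWeight z.2) := by
  obtain ⟨C₁, hC₁, h₁⟩ := exists_norm_scatteringKernel_le u v
  obtain ⟨C₂, hC₂, h₂⟩ := exists_norm_scatteringKernel_le (swapPotential v) (swapPotential u)
  have hw : ∀ z : ℝ × ℝ, 0 ≤ decayWeight z.1 * decayWeight z.2 := fun z =>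
    mul_nonneg (decayWeight_pos _).le (decayWeight_pos _).le
  refine ⟨C₁ + C₂, add_nonneg hC₁ hC₂, fun z => ContinuousLinearMap.opNorm_le_bound _
    (mul_nonneg (add_nonneg hC₁ hC₂) (hw z)) fun h => ?_⟩
  rw [fullKernel_apply]
  refine (norm_mixWave_le _ _).trans ?_
  rw [add_mul, add_mul]
  exact add_le_add
    ((ContinuousLinearMap.le_opNorm _ _).trans (mul_le_mul_of_nonneg_right (h₁ z) (norm_nonneg _)))
    ((ContinuousLinearMap.le_opNorm _ _).trans (mul_le_mul_of_nonneg_right (h₂ z) (norm_nonneg _)))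

lemma MeasureTheory.MemLp.integrable_clm_apply {K : ℝ × ℝ → Wave n →L[ℂ] Wave n}
    (hK : StronglyMeasurable K) {C : ℝ}
    (hb : ∀ z : ℝ × ℝ, ‖K z‖ ≤ C * (decayWeight z.1 * decayWeight z.2)) {a : ℝ → Wave n}
    (ha : MemLp a 2 volume) (s : ℝ) : Integrable fun τ => K (s, τ) (a τ) := by
  exact ha.isIncident.integrable_apply
    (hK.comp_measurable measurable_prodMk_left).aestronglyMeasurable (A := C * decayWeight s)
    fun τ => (hb (s, τ)).trans (le_of_eq (mul_assoc _ _ _).symm)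

lemma scatteredProfile_eq (u v : 𝓢(ℝ × ℝ, Wave n →L[ℂ] Wave n)) {a : ℝ → Wave n}
    (ha : MemLp a 2 volume) (s : ℝ) :
    scatteredProfile u v a s = a s + ∫ τ, fullKernel u v (s, τ) (a τ) := by
  obtain ⟨C₁, hC₁, h₁⟩ := exists_norm_scatteringKernel_le u v
  obtain ⟨C₂, hC₂, h₂⟩ := exists_norm_scatteringKernel_le (swapPotential v) (swapPotential u)
  have i₁ := ha.integrable_clm_apply (stronglyMeasurable_scatteringKernel u v) h₁ s
  have i₂ := ha.integrable_clm_apply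
    (stronglyMeasurable_scatteringKernel (swapPotential v) (swapPotential u)) h₂ s
  have e : ∫ τ, fullKernel u v (s, τ) (a τ) = mixWaveCLM (∫ τ, (scatteringKernel u v (s, τ) (a τ),
      scatteringKernel (swapPotential v) (swapPotential u) (s, τ) (a τ))) := by
    simp_rw [fullKernel_apply]
    exact mixWaveCLM.integral_comp_comm (i₁.prodMk i₂)
  rw [scatteredProfile, e, integral_pair i₁ i₂, mixWaveCLM_apply]

/-- A kernel bounded by the decay weights defines a bounded operator on `L²`. -/
lemma exists_integralOperator {K : ℝ × ℝ → Wave n →L[ℂ] Wave n}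
    (hK : StronglyMeasurable K) {C : ℝ} (hC : 0 ≤ C)
    (hb : ∀ z : ℝ × ℝ, ‖K z‖ ≤ C * (decayWeight z.1 * decayWeight z.2)) :
    ∃ T : Profile n →L[ℂ] Profile n, ∀ a : Profile n,
      T a =ᵐ[volume] fun s => ∫ τ, K (s, τ) (a τ) := by
  have hm : ∀ a : Profile n, AEStronglyMeasurable fun s => ∫ τ, K (s, τ) (a τ) := fun a => by
    refine AEStronglyMeasurable.integral_prod_right' (f := fun q : ℝ × ℝ => K q (a q.2)) ?_
    exact (ContinuousLinearMap.id ℂ (Wave n →L[ℂ] Wave n)).aestronglyMeasurable_comp₂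
      hK.aestronglyMeasurable (Lp.aestronglyMeasurable a).comp_snd
  have hle : ∀ a : Profile n, eLpNorm (fun s => ∫ τ, K (s, τ) (a τ)) 2 volume
      ≤ ENNReal.ofReal (C * Real.pi) * eLpNorm a 2 volume := fun a => by
    refine (ENNReal.pow_right_strictMono two_ne_zero).le_iff_le.1 ?_
    have h1 : ∀ s, ‖∫ τ, K (s, τ) (a τ)‖ₑ ^ 2 ≤ ENNReal.ofReal (decayWeight s) ^ 2 *
        (ENNReal.ofReal C ^ 2 * (ENNReal.ofReal Real.pi * eLpNorm a 2 volume ^ 2)) := fun s => by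
      have h2 : ‖∫ τ, K (s, τ) (a τ)‖ₑ ≤ ENNReal.ofReal (decayWeight s) * (ENNReal.ofReal C *
          ∫⁻ τ, ENNReal.ofReal (decayWeight τ) * ‖a τ‖ₑ) := by
        rw [← lintegral_const_mul' _ _ ENNReal.ofReal_ne_top,
          ← lintegral_const_mul' _ _ ENNReal.ofReal_ne_top]
        refine (enorm_integral_le_lintegral_enorm _).trans (lintegral_mono fun τ => ?_)
        rw [← ofReal_norm, ← ofReal_norm, ← ENNReal.ofReal_mul (decayWeight_pos τ).le,
          ← ENNReal.ofReal_mul hC, ← ENNReal.ofReal_mul (decayWeight_pos s).le]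
        refine ENNReal.ofReal_le_ofReal (((K (s, τ)).le_opNorm _).trans
          ((mul_le_mul_of_nonneg_right (hb (s, τ)) (norm_nonneg _)).trans (le_of_eq ?_)))
        ring
      refine (pow_le_pow_left' h2 2).trans ?_
      rw [mul_pow, mul_pow, eLpNorm_two_sq]
      refine mul_le_mul_right (mul_le_mul_right ((lintegral_mul_sq_le
        measurable_ofReal_decayWeight.aemeasurable (Lp.aestronglyMeasurable a).enorm).trans ?_) _) _
      refine mul_le_mul_left ?_ _
      simpa using lintegral_decayWeight_sq_le Set.univ
    rw [eLpNorm_two_sq]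
    refine (lintegral_mono h1).trans ?_
    rw [lintegral_mul_const'' _ (measurable_ofReal_decayWeight.pow_const 2).aemeasurable]
    have h3 : ∫⁻ s, ENNReal.ofReal (decayWeight s) ^ 2 ≤ ENNReal.ofReal Real.pi := by
      simpa using lintegral_decayWeight_sq_le Set.univ
    refine (mul_le_mul_left h3 _).trans (le_of_eq ?_)
    rw [ENNReal.ofReal_mul hC]
    ring
  have hmem : ∀ a : Profile n, MemLp (fun s => ∫ τ, K (s, τ) (a τ)) 2 volume := fun a =>
    ⟨hm a, (hle a).trans_lt (ENNReal.mul_lt_top ENNReal.ofReal_lt_top (Lp.eLpNorm_lt_top a))⟩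
  have hi : ∀ (a : Profile n) s, Integrable fun τ => K (s, τ) (a τ) := fun a s =>
    (Lp.memLp a).integrable_clm_apply hK hb s
  refine ⟨LinearMap.mkContinuous
    { toFun := fun a => (hmem a).toLp
      map_add' := fun a c => ?_
      map_smul' := fun r a => ?_ } (C * Real.pi) fun a => ?_, fun a => (hmem a).coeFn_toLp⟩
  · rw [← MemLp.toLp_add]
    refine (MemLp.toLp_eq_toLp_iff _ _).2 (Eventually.of_forall fun s => ?_)
    simp only [Pi.add_apply]
    rw [← integral_add (hi a s) (hi c s)]
    refine integral_congr_ae ?_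
    filter_upwards [Lp.coeFn_add a c] with τ hτ
    rw [hτ, Pi.add_apply, map_add]
  · rw [RingHom.id_apply, ← MemLp.toLp_const_smul]
    refine (MemLp.toLp_eq_toLp_iff _ _).2 (Eventually.of_forall fun s => ?_)
    simp only [Pi.smul_apply]
    rw [← integral_smul]
    refine integral_congr_ae ?_
    filter_upwards [Lp.coeFn_smul r a] with τ hτ
    rw [hτ, Pi.smul_apply, map_smul]
  · simp only [LinearMap.coe_mk, AddHom.coe_mk]
    rw [Lp.norm_toLp, Lp.norm_def, ← ENNReal.toReal_ofReal (mul_nonneg hC Real.pi_pos.le),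
      ← ENNReal.toReal_mul]
    exact ENNReal.toReal_mono (ENNReal.mul_ne_top ENNReal.ofReal_ne_top (Lp.eLpNorm_ne_top a)) (hle a)

/-- A kernel bounded by the square integrable product of the decay weights is Hilbert–Schmidt. -/
lemma isHilbertSchmidtKernel_of_ae_eq {K : ℝ × ℝ → Wave n →L[ℂ] Wave n}
    (hK : StronglyMeasurable K) {C : ℝ}
    (hb : ∀ z : ℝ × ℝ, ‖K z‖ ≤ C * (decayWeight z.1 * decayWeight z.2))
    {T : Profile n →L[ℂ] Profile n}
    (hT : ∀ a : Profile n, T a =ᵐ[volume] fun s => ∫ τ, K (s, τ) (a τ)) :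
    IsHilbertSchmidtKernel T fun y τ => waveMatrix (K (y, τ)) := by
  refine ⟨fun i j => ?_, fun a => ?_⟩
  · have hw : MemLp (fun z : ℝ × ℝ => decayWeight z.1 * decayWeight z.2) 2 volume := by
      have hc : Continuous fun z : ℝ × ℝ => decayWeight z.1 * decayWeight z.2 := by
        unfold decayWeight
        exact (Continuous.inv₀ (by fun_prop) fun z => by positivity).mul
          (Continuous.inv₀ (by fun_prop) fun z => by positivity)
      rw [memLp_two_iff_integrable_sq hc.aestronglyMeasurable]
      simp_rw [mul_pow]
      exact memLp_decayWeight.integrable_sq.mul_prod memLp_decayWeight.integrable_sq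
    refine (hw.const_mul C).mono' ?_ (Eventually.of_forall fun z =>
      (norm_waveMatrix_le _ i j).trans (hb z))
    have hc : Continuous fun L : Wave n →L[ℂ] Wave n => waveMatrix L i j := by
      have h1 : Continuous fun L : Wave n →L[ℂ] Wave n => L (EuclideanSpace.single j 1) :=
        (ContinuousLinearMap.apply ℂ (Wave n) (EuclideanSpace.single j 1)).continuous
      exact (EuclideanSpace.proj (𝕜 := ℂ) i).continuous.comp h1
    exact (hc.comp_stronglyMeasurable hK).aestronglyMeasurable
  · filter_upwards [hT a] with y hy i
    rw [hy]
    simp_rw [waveMatrix_mulVec]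
    exact ((EuclideanSpace.proj (𝕜 := ℂ) i).integral_comp_comm
      ((Lp.memLp a).integrable_clm_apply hK hb y)).symm

/-- The scattering operator exists for every block potential. Its inverse comes from the scattering
of the reflected waves. -/
theorem IsBlockPotential.exists_isScatteringOperator
    {Q : ℝ → ℝ → Matrix (Fin n ⊕ Unit) (Fin n ⊕ Unit) ℂ}
    {u v : 𝓢(ℝ × ℝ, Wave n →L[ℂ] Wave n)} (hQ : IsBlockPotential Q u v) :
    ∃ S : Profile n ≃L[ℂ] Profile n, IsScatteringOperator Q S ∧
      IsHilbertSchmidtKernel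
        ((S : Profile n →L[ℂ] Profile n) - ContinuousLinearMap.id ℂ (Profile n))
        (fun y τ => waveMatrix (fullKernel u v (y, τ))) ∧
      IsHilbertSchmidtKernel
        ((S.symm : Profile n →L[ℂ] Profile n) - ContinuousLinearMap.id ℂ (Profile n))
        (fun y τ => waveMatrix (fullKernel (negReflect u) (negReflect v) (-y, -τ))) := by
  obtain ⟨C, hC, hb⟩ := exists_norm_fullKernel_le u v
  obtain ⟨C', hC', hb'⟩ := exists_norm_fullKernel_le (negReflect u) (negReflect v)
  have hK := stronglyMeasurable_fullKernel u v
  have hK' : StronglyMeasurable fun z : ℝ × ℝ =>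
      fullKernel (negReflect u) (negReflect v) (-z.1, -z.2) :=
    (stronglyMeasurable_fullKernel _ _).comp_measurable
      (measurable_fst.neg.prodMk measurable_snd.neg)
  have hb'' : ∀ z : ℝ × ℝ, ‖fullKernel (negReflect u) (negReflect v) (-z.1, -z.2)‖
      ≤ C' * (decayWeight z.1 * decayWeight z.2) := fun z => by
    simpa [decayWeight] using hb' (-z.1, -z.2)
  obtain ⟨T, hT⟩ := exists_integralOperator hK hC hb
  obtain ⟨T', hT'⟩ := exists_integralOperator hK' hC' hb''
  have hmeas : ∀ a : Profile n, Measurable a := fun a => (Lp.stronglyMeasurable a).measurable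
  have hmeas' : ∀ a : Profile n, Measurable fun s => a (-s) := fun a =>
    (hmeas a).comp measurable_neg
  have mp : MeasurePreserving (fun x : ℝ => -x) := Measure.measurePreserving_neg volume
  have hmem' : ∀ a : Profile n, MemLp (fun s => a (-s)) 2 volume := fun a =>
    (Lp.memLp a).comp_measurePreserving mp
  obtain ⟨A, hTA⟩ : ∃ A : Profile n →L[ℂ] Profile n, A = ContinuousLinearMap.id ℂ _ + T :=
    ⟨_, rfl⟩
  obtain ⟨B, hTB⟩ : ∃ B : Profile n →L[ℂ] Profile n, B = ContinuousLinearMap.id ℂ _ + T' :=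
    ⟨_, rfl⟩
  have hA : ∀ a : Profile n, (A a) =ᵐ[volume]
      scatteredProfile u v a := fun a => by
    filter_upwards [Lp.coeFn_add a (T a), hT a] with s h1 h2
    rw [scatteredProfile_eq u v (Lp.memLp a), ← h2, hTA]
    exact h1
  have hB : ∀ a : Profile n, (B a) =ᵐ[volume]
      fun s => scatteredProfile (negReflect u) (negReflect v) (fun s => a (-s)) (-s) := fun a => by
    filter_upwards [Lp.coeFn_add a (T' a), hT' a] with s h1 h2
    rw [scatteredProfile_eq _ _ (hmem' a), neg_neg, ← integral_neg_eq_self]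
    simp only [neg_neg]
    rw [← h2, hTB]
    exact h1
  have hwave : ∀ a : Profile n, IsWaveSolution Q (scatteredWave u v a) := fun a =>
    hQ.isWaveSolution (hmeas a) (Lp.memLp a)
  have has : ∀ a : Profile n, Tendsto (fun y => eLpNorm (fun x => scatteredWave u v a x y
      - waveShift x (A a) y) 2 volume) atTop (𝓝 0) :=
    fun a => tendsto_waveShift_congr (tendsto_scatteredWave_atTop u v (Lp.memLp a)) (hA a).symm
  -- reflecting the wave with incident profile `a` gives the reflected wave with incident profile `A a`
  have hBA : ∀ a : Profile n, B (A a)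
      = a := fun a => by
    have hw := (hwave a).neg
    have h1 := tendsto_neg_waveShift (fun y => ((hwave a).memLp y).1)
      (Lp.aestronglyMeasurable _) (has a) tendsto_neg_atBot_atTop
    have h2 := tendsto_neg_waveShift (fun y => ((hwave a).memLp y).1)
      (Lp.aestronglyMeasurable _) (tendsto_scatteredWave_atBot u v (Lp.memLp a))
      tendsto_neg_atTop_atBot
    have h3 := hw.ae_eq_scatteredProfile hQ.neg (hmeas' _) (hmem' _) (hmem' a).1 h1 h2
    refine Lp.ext ?_
    filter_upwards [hB (A a), mp.quasiMeasurePreserving.ae h3]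
      with s h4 h5
    rw [h4, ← h5, neg_neg]
  -- the same with the wave that the reflected system produces from `a`
  have hAB : ∀ a : Profile n, A (B a)
      = a := fun a => by
    have hw₀ := hQ.neg.isWaveSolution (hmeas' a) (hmem' a)
    have hw : IsWaveSolution Q fun x y =>
        scatteredWave (negReflect u) (negReflect v) (fun s => a (-s)) (-x) (-y) := by
      simpa only [neg_neg] using hw₀.neg
    have h1 := tendsto_neg_waveShift (fun y => (hw₀.memLp y).1) (hmem' a).1
      (tendsto_scatteredWave_atBot _ _ (hmem' a)) tendsto_neg_atTop_atBot
    have h2 := tendsto_neg_waveShift (fun y => (hw₀.memLp y).1) ?_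
      (tendsto_scatteredWave_atTop _ _ (hmem' a)) tendsto_neg_atBot_atTop
    · simp only [neg_neg] at h1
      have h3 := hw.ae_eq_scatteredProfile hQ (hmeas _) (Lp.memLp _)
        (Lp.aestronglyMeasurable a) (tendsto_waveShift_congr h2 (hB a).symm) h1
      exact Lp.ext ((hA _).trans h3.symm)
    · exact aestronglyMeasurable_scatteredProfile _ _ (hmem' a).1
  refine ⟨ContinuousLinearEquiv.equivOfInverse A
    B hBA hAB, fun am ap => ⟨?_, ?_⟩, ?_, ?_⟩
  · rintro rfl
    exact ⟨scatteredWave u v am, hwave am, tendsto_scatteredWave_atBot u v (Lp.memLp am), has am⟩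
  · rintro ⟨ψ, hψ, h1, h2⟩
    exact Lp.ext ((hA am).trans (hψ.ae_eq_scatteredProfile hQ (hmeas am) (Lp.memLp am)
      (Lp.aestronglyMeasurable ap) h1 h2).symm)
  · refine isHilbertSchmidtKernel_of_ae_eq hK hb fun a => ?_
    have e : ((ContinuousLinearEquiv.equivOfInverse A
      B hBA hAB : Profile n →L[ℂ] Profile n)
        - ContinuousLinearMap.id ℂ (Profile n)) a = T a := by
      change A a - a = T a
      rw [hTA]
      exact add_sub_cancel_left a (T a)
    rw [e]
    exact hT a
  · refine isHilbertSchmidtKernel_of_ae_eq hK' hb'' fun a => ?_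
    have e : (((ContinuousLinearEquiv.equivOfInverse A
      B hBA hAB).symm : Profile n →L[ℂ] Profile n)
        - ContinuousLinearMap.id ℂ (Profile n)) a = T' a := by
      change B a - a = T' a
      rw [hTB]
      exact add_sub_cancel_left a (T' a)
    rw [e]
    exact hT' a

end

noncomputable section

/-! ### The dispersive system in characteristic coordinates -/

lemma dxi_deta_comm {𝔸 : Type*} [NormedRing 𝔸] [NormedAlgebra ℂ 𝔸] (u : 𝓢(ℝ × ℝ, 𝔸)) :
    deta (dxi u) = dxi (deta u) := by
  have key : ∀ (m m' : ℝ × ℝ) (x : ℝ × ℝ),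
      LineDeriv.lineDerivOp m (LineDeriv.lineDerivOp m' u) x = fderiv ℝ (fderiv ℝ u) x m m' := by
    intro m m' x
    rw [SchwartzMap.lineDerivOp_apply_eq_fderiv]
    have h : HasFDerivAt (fderiv ℝ u) (fderiv ℝ (fderiv ℝ u) x) x :=
      (SchwartzMap.fderivCLM ℝ (ℝ × ℝ) 𝔸 u).hasFDerivAt x
    exact congrArg (fun L : ℝ × ℝ →L[ℝ] 𝔸 => L m)
      ((ContinuousLinearMap.apply ℝ 𝔸 m').hasFDerivAt.comp x h).fderiv
  ext x
  rw [key, key]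
  have hs : IsSymmSndFDerivAt ℝ u x :=
    (u.smooth 2).contDiffAt.isSymmSndFDerivAt (by simp)
  exact hs _ _

/-- The coordinates `(x, y) = ((ξ - η) / 2, (ξ + η) / 2)` as a function of `(ξ, η)`. -/
def charEquiv : (ℝ × ℝ) ≃L[ℝ] (ℝ × ℝ) :=
  LinearEquiv.toContinuousLinearEquiv
    { toFun := fun z => ((z.1 - z.2) / 2, (z.1 + z.2) / 2)
      map_add' := fun z w => by ext <;> simp <;> ring
      map_smul' := fun r z => by ext <;> simp <;> ring
      invFun := fun z => (z.2 + z.1, z.2 - z.1)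
      left_inv := fun z => by ext <;> simp <;> ring
      right_inv := fun z => by ext <;> simp }

lemma charEquiv_apply (z : ℝ × ℝ) : charEquiv z = ((z.1 - z.2) / 2, (z.1 + z.2) / 2) := rfl

section Embedding

variable {E 𝔸 : Type*} [NormedRing E] [NormedAlgebra ℂ E] [NormedRing 𝔸] [NormedAlgebra ℂ 𝔸]

/-- The potential `L ∘ q` in characteristic coordinates; `L` embeds columns or rows into operators. -/
def charPotential (L : E →L[ℂ] 𝔸) : 𝓢(ℝ × ℝ, E) →L[ℂ] 𝓢(ℝ × ℝ, 𝔸) :=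
  SchwartzMap.postcompCLM L ∘L SchwartzMap.compCLMOfContinuousLinearEquiv ℂ charEquiv

lemma charPotential_apply (L : E →L[ℂ] 𝔸) (q : 𝓢(ℝ × ℝ, E)) (z : ℝ × ℝ) :
    charPotential L q z = L (q (charEquiv z)) := rfl

lemma lineDerivOp_charPotential (L : E →L[ℂ] 𝔸) (q : 𝓢(ℝ × ℝ, E)) (m : ℝ × ℝ) :
    LineDeriv.lineDerivOp m (charPotential L q)
      = charPotential L (LineDeriv.lineDerivOp (charEquiv m) q) := by
  ext z
  rw [SchwartzMap.lineDerivOp_apply_eq_fderiv, charPotential_apply,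
    SchwartzMap.lineDerivOp_apply_eq_fderiv]
  have h : HasFDerivAt (fun z => L (q (charEquiv z)))
      ((L.restrictScalars ℝ) ∘L (fderiv ℝ q (charEquiv z)) ∘L (charEquiv : ℝ × ℝ →L[ℝ] ℝ × ℝ)) z :=
    (L.restrictScalars ℝ).hasFDerivAt.comp z
      ((q.hasFDerivAt (charEquiv z)).comp z charEquiv.hasFDerivAt)
  exact congrArg (fun L : ℝ × ℝ →L[ℝ] 𝔸 => L m) h.fderiv

lemma half_smul_charPotential (L : E →L[ℂ] 𝔸) (q : 𝓢(ℝ × ℝ, E)) :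
    charPotential L ((2⁻¹ : ℝ) • q) = (2⁻¹ : ℂ) • charPotential L q := by
  ext z
  change L ((2⁻¹ : ℝ) • q (charEquiv z)) = (2⁻¹ : ℂ) • L (q (charEquiv z))
  rw [← L.map_smul, ← Complex.coe_smul]
  simp

/-- `∂/∂ξ = ½ (∂_y + ∂_x)`. -/
lemma dxi_charPotential (L : E →L[ℂ] 𝔸) (q : 𝓢(ℝ × ℝ, E)) :
    dxi (charPotential L q) = (2⁻¹ : ℂ) • charPotential L (deta q + dxi q) := by
  rw [dxi, lineDerivOp_charPotential, show charEquiv (1, 0) = (2⁻¹ : ℝ) • ((0, 1) + (1, 0)) by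
    ext <;> simp [charEquiv_apply], LineDeriv.lineDerivOp_left_smul,
    LineDeriv.lineDerivOp_left_add, half_smul_charPotential]

/-- `∂/∂η = ½ (∂_y - ∂_x)`. -/
lemma deta_charPotential (L : E →L[ℂ] 𝔸) (q : 𝓢(ℝ × ℝ, E)) :
    deta (charPotential L q) = (2⁻¹ : ℂ) • charPotential L (deta q - dxi q) := by
  rw [deta, lineDerivOp_charPotential, show charEquiv (0, 1) = (2⁻¹ : ℝ) • ((0, 1) + -(1, 0)) by
    ext
    · simp [charEquiv_apply]; norm_num
    · simp [charEquiv_apply], LineDeriv.lineDerivOp_left_smul,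
    LineDeriv.lineDerivOp_left_add, LineDeriv.lineDerivOp_left_neg, ← sub_eq_add_neg,
    half_smul_charPotential]

lemma dxi_charPotential_apply (L : E →L[ℂ] 𝔸) (q : 𝓢(ℝ × ℝ, E)) (z : ℝ × ℝ) :
    dxi (charPotential L q) z = (2⁻¹ : ℂ) • L (deta q (charEquiv z) + dxi q (charEquiv z)) := by
  rw [dxi_charPotential]
  rfl

lemma deta_charPotential_apply (L : E →L[ℂ] 𝔸) (q : 𝓢(ℝ × ℝ, E)) (z : ℝ × ℝ) :
    deta (charPotential L q) z = (2⁻¹ : ℂ) • L (deta q (charEquiv z) - dxi q (charEquiv z)) := by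
  rw [deta_charPotential]
  rfl

/-- `∂_x ∂_y = ∂²/∂ξ² - ∂²/∂η²`. -/
lemma dxi_dxi_sub_deta_deta_charPotential (L : E →L[ℂ] 𝔸) (q : 𝓢(ℝ × ℝ, E)) (z : ℝ × ℝ) :
    dxi (dxi (charPotential L q)) z - deta (deta (charPotential L q)) z
      = L (dxi (deta q) (charEquiv z)) := by
  have hx : ∀ f : 𝓢(ℝ × ℝ, 𝔸), dxi ((2⁻¹ : ℂ) • f) = (2⁻¹ : ℂ) • dxi f :=
    LineDeriv.lineDerivOp_smul (1, 0) (2⁻¹ : ℂ)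
  have he : ∀ f : 𝓢(ℝ × ℝ, 𝔸), deta ((2⁻¹ : ℂ) • f) = (2⁻¹ : ℂ) • deta f :=
    LineDeriv.lineDerivOp_smul (0, 1) (2⁻¹ : ℂ)
  have hsub : ∀ (m : ℝ × ℝ) (f g : 𝓢(ℝ × ℝ, E)), LineDeriv.lineDerivOp m (f - g)
      = LineDeriv.lineDerivOp m f - LineDeriv.lineDerivOp m g := fun m f g => by
    rw [sub_eq_add_neg, LineDeriv.lineDerivOp_add, LineDeriv.lineDerivOp_neg, ← sub_eq_add_neg]
  rw [dxi_charPotential L q, deta_charPotential L q, hx, he, _root_.smul_apply,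
    _root_.smul_apply, dxi_charPotential_apply, deta_charPotential_apply]
  have e1 : deta (deta q + dxi q) = deta (deta q) + dxi (deta q) := by
    rw [deta, LineDeriv.lineDerivOp_add, ← dxi_deta_comm]
  have e2 : dxi (deta q + dxi q) = dxi (deta q) + dxi (dxi q) := LineDeriv.lineDerivOp_add _ _ _
  have e3 : deta (deta q - dxi q) = deta (deta q) - dxi (deta q) := by
    rw [deta, hsub, ← dxi_deta_comm]
  have e4 : dxi (deta q - dxi q) = dxi (deta q) - dxi (dxi q) := hsub _ _ _
  rw [e1, e2, e3, e4]
  simp only [_root_.add_apply, _root_.sub_apply, map_add, map_sub]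
  module

lemma hasDerivAt_charPotential (L : E →L[ℂ] 𝔸) {q : ℝ → 𝓢(ℝ × ℝ, E)} {q' : E} {t : ℝ} {z : ℝ × ℝ}
    (h : HasDerivAt (fun s => q s (charEquiv z)) q' t) :
    HasDerivAt (fun s => charPotential L (q s) z) (L q') t :=
  (L.restrictScalars ℝ).hasFDerivAt.comp_hasDerivAt t h

end Embedding

end

noncomputable section

/-! ### Block operators on `ℂⁿ⁺¹` -/

variable {n : ℕ}

/-- The operator on `ℂⁿ⁺¹` with the given blocks. -/
def blockOp (A : Matrix (Fin n) (Fin n) ℂ) (q : Fin n → ℂ) (r : Fin n → ℂ) (d : ℂ) :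
    Wave n →L[ℂ] Wave n :=
  Matrix.toEuclideanCLM (n := Fin n ⊕ Unit) (𝕜 := ℂ)
    (fromBlocks A (replicateCol Unit q) (replicateRow Unit r) (of fun _ _ => d))

lemma blockOp_add (A A' : Matrix (Fin n) (Fin n) ℂ) (q q' r r' : Fin n → ℂ) (d d' : ℂ) :
    blockOp A q r d + blockOp A' q' r' d' = blockOp (A + A') (q + q') (r + r') (d + d') := by
  rw [blockOp, blockOp, blockOp, ← map_add, fromBlocks_add]
  rfl

lemma blockOp_sub (A A' : Matrix (Fin n) (Fin n) ℂ) (q q' r r' : Fin n → ℂ) (d d' : ℂ) :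
    blockOp A q r d - blockOp A' q' r' d' = blockOp (A - A') (q - q') (r - r') (d - d') := by
  rw [sub_eq_iff_eq_add, blockOp_add, sub_add_cancel, sub_add_cancel, sub_add_cancel,
    sub_add_cancel]

lemma smul_blockOp (c : ℂ) (A : Matrix (Fin n) (Fin n) ℂ) (q r : Fin n → ℂ) (d : ℂ) :
    c • blockOp A q r d = blockOp (c • A) (c • q) (c • r) (c * d) := by
  rw [blockOp, blockOp, ← map_smul, fromBlocks_smul]
  rfl

lemma blockOp_mul (A A' : Matrix (Fin n) (Fin n) ℂ) (q q' r r' : Fin n → ℂ) (d d' : ℂ) :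
    blockOp A q r d * blockOp A' q' r' d' = blockOp (A * A' + vecMulVec q r')
      (A *ᵥ q' + d' • q) (r ᵥ* A' + d • r') (r ⬝ᵥ q' + d * d') := by
  rw [blockOp, blockOp, blockOp, ← map_mul, fromBlocks_multiply]
  congr 2
  · ext i j
    simp [mul_apply, vecMulVec_apply]
  · ext i j
    simp [mul_apply, mulVec, dotProduct, mul_comm]
  · ext i j
    simp [mul_apply, vecMul, dotProduct, mul_comm]
  · ext i j
    simp [mul_apply, dotProduct]

lemma blockOp_apply (A : Matrix (Fin n) (Fin n) ℂ) (q r : Fin n → ℂ) (d : ℂ) (h : Wave n) :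
    blockOp A q r d h = WithLp.toLp 2 (Sum.elim
      (fun k => (A *ᵥ fun j => h (Sum.inl j)) k + q k * h (Sum.inr ()))
      (fun _ => (r ⬝ᵥ fun j => h (Sum.inl j)) + d * h (Sum.inr ()))) := by
  ext i
  rw [blockOp, Matrix.ofLp_toEuclideanCLM, Matrix.fromBlocks_mulVec]
  rcases i with k | k
  · simp [mulVec, dotProduct, replicateCol_apply]
  · simp [mulVec, dotProduct, replicateRow_apply]

/-- Columns as operators on `ℂⁿ⁺¹` that map the last component to the others. -/
def colOp : (Fin n → ℂ) →L[ℂ] (Wave n →L[ℂ] Wave n) :=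
  LinearMap.toContinuousLinearMap
    { toFun := fun q => blockOp 0 q 0 0
      map_add' := fun q q' => by simp [blockOp_add]
      map_smul' := fun c q => by simp [smul_blockOp] }

/-- Rows as operators on `ℂⁿ⁺¹` that map the first `n` components to the last one. -/
def rowOp : (Fin n → ℂ) →L[ℂ] (Wave n →L[ℂ] Wave n) :=
  LinearMap.toContinuousLinearMap
    { toFun := fun r => blockOp 0 0 r 0
      map_add' := fun q q' => by simp [blockOp_add]
      map_smul' := fun c q => by simp [smul_blockOp] }

lemma colOp_apply (q : Fin n → ℂ) : colOp q = blockOp 0 q 0 0 := rfl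

lemma rowOp_apply (r : Fin n → ℂ) : rowOp r = blockOp 0 0 r 0 := rfl

-- The block calculus above is all that is used about `blockOp`.
attribute [irreducible] blockOp

/-- The map `blockOp` on the diagonal blocks. -/
def diagOp : (Matrix (Fin n) (Fin n) ℂ × ℂ) →ₗ[ℂ] (Wave n →L[ℂ] Wave n) where
  toFun M := blockOp M.1 0 0 M.2
  map_add' M M' := by simp [blockOp_add]
  map_smul' c M := by simp [smul_blockOp]

/-- A block diagonal operator in terms of its entries. Hence differentiability and convergence of block
diagonal operators follow from those of the entries. -/
lemma blockOp_diag_eq_sum (A : Matrix (Fin n) (Fin n) ℂ) (d : ℂ) :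
    blockOp A 0 0 d = ∑ i, ∑ j, A i j • blockOp (Matrix.single i j 1) 0 0 0 + d • blockOp 0 0 0 1 := by
  have e : ((A, d) : Matrix (Fin n) (Fin n) ℂ × ℂ)
      = ∑ i, ∑ j, A i j • ((Matrix.single i j 1 : Matrix (Fin n) (Fin n) ℂ), (0 : ℂ))
        + d • ((0 : Matrix (Fin n) (Fin n) ℂ), (1 : ℂ)) := by
    refine Prod.ext ?_ ?_
    · rw [Prod.fst_add, Prod.fst_sum]
      simp_rw [Prod.fst_sum, Prod.smul_fst, Matrix.smul_single, smul_eq_mul, mul_one]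
      rw [smul_zero, add_zero]
      exact matrix_eq_sum_single A
    · simp [Prod.snd_sum]
  have h := congrArg diagOp e
  rw [map_add, map_sum, map_smul] at h
  simp_rw [map_sum, map_smul] at h
  exact h

lemma hasDerivAt_blockOp_diag {A : ℝ → Matrix (Fin n) (Fin n) ℂ} {A' : Matrix (Fin n) (Fin n) ℂ}
    {d : ℝ → ℂ} {d' : ℂ} {s : ℝ} (hA : ∀ i j, HasDerivAt (fun s => A s i j) (A' i j) s)
    (hd : HasDerivAt d d' s) :
    HasDerivAt (fun s => blockOp (A s) 0 0 (d s)) (blockOp A' 0 0 d') s := by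
  rw [funext fun s => blockOp_diag_eq_sum (A s) (d s), blockOp_diag_eq_sum A']
  have h1 : ∀ i j, HasDerivAt (fun s => A s i j • blockOp (Matrix.single i j 1) 0 0 0)
      (A' i j • blockOp (Matrix.single i j 1) 0 0 0) s := fun i j =>
    (hA i j).smul_const (blockOp (Matrix.single i j 1) 0 0 0)
  have h2 : HasDerivAt (fun s => d s • blockOp (0 : Matrix (Fin n) (Fin n) ℂ) 0 0 1)
      (d' • blockOp 0 0 0 1) s := hd.smul_const (blockOp 0 0 0 1)
  exact (HasDerivAt.fun_sum fun i _ => HasDerivAt.fun_sum fun j _ => h1 i j).fun_add h2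

lemma tendsto_blockOp_diag {A : ℝ → Matrix (Fin n) (Fin n) ℂ} {d : ℝ → ℂ} {l : Filter ℝ}
    (hA : ∀ i j, Tendsto (fun s => A s i j) l (𝓝 0)) (hd : Tendsto d l (𝓝 0)) :
    Tendsto (fun s => blockOp (A s) 0 0 (d s)) l (𝓝 0) := by
  rw [funext fun s => blockOp_diag_eq_sum (A s) (d s)]
  have h := (tendsto_finsetSum Finset.univ fun i _ => tendsto_finsetSum Finset.univ fun j _ =>
    (hA i j).smul_const (blockOp (Matrix.single i j 1) 0 0 0)).add
      (hd.smul_const (blockOp (0 : Matrix (Fin n) (Fin n) ℂ) 0 0 1))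
  have e : ∑ i : Fin n, ∑ j : Fin n, (0 : ℂ) • blockOp (Matrix.single i j 1) 0 0 0
      + (0 : ℂ) • blockOp (0 : Matrix (Fin n) (Fin n) ℂ) 0 0 1 = 0 := by
    rw [zero_smul ℂ (blockOp (0 : Matrix (Fin n) (Fin n) ℂ) 0 0 1), add_zero]
    exact Finset.sum_eq_zero fun i _ => Finset.sum_eq_zero fun j _ =>
      zero_smul ℂ (blockOp (Matrix.single i j 1) 0 0 0)
  rw [e] at h
  exact h

lemma pderivFst_coord (q : 𝓢(ℝ × ℝ, Fin n → ℂ)) (k : Fin n) :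
    pderivFst (fun x y => q (x, y) k) = fun x y => dxi q (x, y) k :=
  funext fun x => funext fun y => (hasDerivAt_pi.1 (hasDerivAt_fst q x y) k).deriv

lemma pderivSnd_coord (q : 𝓢(ℝ × ℝ, Fin n → ℂ)) (k : Fin n) :
    pderivSnd (fun x y => q (x, y) k) = fun x y => deta q (x, y) k :=
  funext fun x => funext fun y => (hasDerivAt_pi.1 (hasDerivAt_snd q x y) k).deriv

/-- The derivative along `(-1, 1)` is `∂_y - ∂_x = 2 ∂/∂η`. Only this directional derivative is assumed
to exist, so the chain rule is applied on the line itself. -/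
lemma hasDerivAt_comp_charEquiv_snd {f : ℝ × ℝ → ℂ} {D : ℂ} {ξ η : ℝ}
    (h : HasLineDerivAt ℝ f D (charEquiv (ξ, η)) (-1, 1)) :
    HasDerivAt (fun s => f (charEquiv (ξ, s))) (2⁻¹ * D) η := by
  have h1 : HasDerivAt (fun s : ℝ => (s - η) / 2) (1 / 2) η :=
    ((hasDerivAt_id η).sub_const η).div_const 2
  have h2 := HasDerivAt.scomp_of_eq η h h1 (by simp)
  refine (h2.congr_deriv ?_).congr_of_eventuallyEq (Eventually.of_forall fun s => ?_)
  · simp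
  · change f _ = f _
    congr 1
    ext <;> simp [charEquiv_apply] <;> ring

/-- The derivative along `(1, 1)` is `∂_y + ∂_x = 2 ∂/∂ξ`. -/
lemma hasDerivAt_comp_charEquiv_fst {f : ℝ × ℝ → ℂ} {D : ℂ} {ξ η : ℝ}
    (h : HasLineDerivAt ℝ f D (charEquiv (ξ, η)) (1, 1)) :
    HasDerivAt (fun s => f (charEquiv (s, η))) (2⁻¹ * D) ξ := by
  have h1 : HasDerivAt (fun s : ℝ => (s - ξ) / 2) (1 / 2) ξ :=
    ((hasDerivAt_id ξ).sub_const ξ).div_const 2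
  have h2 := HasDerivAt.scomp_of_eq ξ h h1 (by simp)
  refine (h2.congr_deriv ?_).congr_of_eventuallyEq (Eventually.of_forall fun s => ?_)
  · simp
  · change f _ = f _
    congr 1
    ext <;> simp [charEquiv_apply] <;> ring

lemma IsDispersiveWaveSolution.hasDerivAt_column {J : Set ℝ} {bs : Fin n → ℝ} {b γ : ℝ}
    {q₁₂ q₂₁ : ℝ → 𝓢(ℝ × ℝ, Fin n → ℂ)} {P : ℝ → ℝ × ℝ → Matrix (Fin n) (Fin n) ℂ}
    {p : ℝ → ℝ × ℝ → ℂ} (hsol : IsDispersiveWaveSolution J bs b γ q₁₂ q₂₁ P p)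
    {t : ℝ} (ht : t ∈ J) (w : ℝ × ℝ) : HasDerivAt (fun s => q₁₂ s w)
      (fun k => bs k * (deta (q₁₂ t) w k + dxi (q₁₂ t) w k)
        - b * (deta (q₁₂ t) w k - dxi (q₁₂ t) w k) + Complex.I * γ * dxi (deta (q₁₂ t)) w k
        + (P t w *ᵥ q₁₂ t w) k - p t w * q₁₂ t w k) t := by
  obtain ⟨x, y⟩ := w
  refine hasDerivAt_pi.2 fun k => (hsol.differentiable₁₂ t ht x y k).hasDerivAt.congr_deriv ?_
  have h := hsol.eq₁₂ t ht x y k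
  simp only [pderivFst_coord, pderivSnd_coord] at h
  rw [← sub_eq_zero] at h ⊢
  rw [← h]
  ring

lemma IsDispersiveWaveSolution.hasDerivAt_row {J : Set ℝ} {bs : Fin n → ℝ} {b γ : ℝ}
    {q₁₂ q₂₁ : ℝ → 𝓢(ℝ × ℝ, Fin n → ℂ)} {P : ℝ → ℝ × ℝ → Matrix (Fin n) (Fin n) ℂ}
    {p : ℝ → ℝ × ℝ → ℂ} (hsol : IsDispersiveWaveSolution J bs b γ q₁₂ q₂₁ P p)
    {t : ℝ} (ht : t ∈ J) (w : ℝ × ℝ) : HasDerivAt (fun s => q₂₁ s w)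
      (fun k => (deta (q₂₁ t) w k + dxi (q₂₁ t) w k) * bs k
        - b * (deta (q₂₁ t) w k - dxi (q₂₁ t) w k) - Complex.I * γ * dxi (deta (q₂₁ t)) w k
        + p t w * q₂₁ t w k - (q₂₁ t w ᵥ* P t w) k) t := by
  obtain ⟨x, y⟩ := w
  refine hasDerivAt_pi.2 fun k => (hsol.differentiable₂₁ t ht x y k).hasDerivAt.congr_deriv ?_
  have h := hsol.eq₂₁ t ht x y k
  simp only [pderivFst_coord, pderivSnd_coord] at h
  rw [← sub_eq_zero] at h ⊢
  rw [← h]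
  ring

/-- The right-hand side of the equation for the column `q₁₂` in terms of operators and of the
derivatives `∂/∂ξ`, `∂/∂η`. -/
lemma col_rate_identity (bs : Fin n → ℝ) (b c : ℂ) (q qx qy qxy : Fin n → ℂ)
    (P : Matrix (Fin n) (Fin n) ℂ) (p : ℂ) {u uξ uη uxy B₁ B₂ P' p' : Wave n →L[ℂ] Wave n}
    (hu : u = blockOp 0 q 0 0) (huξ : uξ = (2⁻¹ : ℂ) • blockOp 0 (qy + qx) 0 0)
    (huη : uη = (2⁻¹ : ℂ) • blockOp 0 (qy - qx) 0 0) (huxy : uxy = blockOp 0 qxy 0 0)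
    (hB₁ : B₁ = blockOp (speedMatrix bs) 0 0 0) (hB₂ : B₂ = blockOp 0 0 0 b)
    (hP : P' = blockOp P 0 0 0) (hp : p' = blockOp 0 0 0 p) :
    blockOp 0 (fun k => bs k * (qy k + qx k) - b * (qy k - qx k) + c * qxy k + (P *ᵥ q) k - p * q k)
      0 0 = (2 : ℂ) • (B₁ * uξ) - (2 : ℂ) • (uη * B₂) + c • uxy + P' * u - u * p' := by
  subst hu huξ huη huxy hB₁ hB₂ hP hp
  simp only [smul_blockOp, blockOp_mul, blockOp_add, blockOp_sub]
  congr 1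
  · simp
  · ext k
    simp [speedMatrix, mulVec_diagonal]
    ring
  · simp
  · simp

/-- The right-hand side of the equation for the row `q₂₁` in terms of operators. -/
lemma row_rate_identity (bs : Fin n → ℝ) (b c : ℂ) (q qx qy qxy : Fin n → ℂ)
    (P : Matrix (Fin n) (Fin n) ℂ) (p : ℂ) {u uξ uη uxy B₁ B₂ P' p' : Wave n →L[ℂ] Wave n}
    (hu : u = blockOp 0 0 q 0) (huξ : uξ = (2⁻¹ : ℂ) • blockOp 0 0 (qy + qx) 0)
    (huη : uη = (2⁻¹ : ℂ) • blockOp 0 0 (qy - qx) 0) (huxy : uxy = blockOp 0 0 qxy 0)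
    (hB₁ : B₁ = blockOp (speedMatrix bs) 0 0 0) (hB₂ : B₂ = blockOp 0 0 0 b)
    (hP : P' = blockOp P 0 0 0) (hp : p' = blockOp 0 0 0 p) :
    blockOp 0 0 (fun k => (qy k + qx k) * bs k - b * (qy k - qx k) - c * qxy k + p * q k
      - (q ᵥ* P) k) 0 = (2 : ℂ) • (uξ * B₁) - (2 : ℂ) • (B₂ * uη) - c • uxy + p' * u - u * P' := by
  subst hu huξ huη huxy hB₁ hB₂ hP hp
  simp only [smul_blockOp, blockOp_mul, blockOp_add, blockOp_sub]
  congr 1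
  · simp
  · simp
  · ext k
    simp [speedMatrix, vecMul_diagonal]
    ring
  · simp

end

noncomputable section

/-! ### The dispersive system in operator form -/

variable {n : ℕ}

/-- The right-hand side of the equation for `P` in terms of operators; the factor `2⁻¹` comes from
`∂_y - ∂_x = 2 ∂/∂η`. -/
lemma matrixField_rate_identity (bs : Fin n → ℝ) (c : ℂ) (q qx qy r rx ry : Fin n → ℂ)
    {u uξ uη v vξ vη B₁ : Wave n →L[ℂ] Wave n}
    (hu : u = blockOp 0 q 0 0) (huξ : uξ = (2⁻¹ : ℂ) • blockOp 0 (qy + qx) 0 0)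
    (huη : uη = (2⁻¹ : ℂ) • blockOp 0 (qy - qx) 0 0) (hv : v = blockOp 0 0 r 0)
    (hvξ : vξ = (2⁻¹ : ℂ) • blockOp 0 0 (ry + rx) 0)
    (hvη : vη = (2⁻¹ : ℂ) • blockOp 0 0 (ry - rx) 0) (hB₁ : B₁ = blockOp (speedMatrix bs) 0 0 0) :
    blockOp (Matrix.of fun i j => 2⁻¹ * (q i * r j * bs j - bs i * (q i * r j)
        - c * (qx i * r j + q i * rx j))) 0 0 0
      = (2⁻¹ : ℂ) • (u * (v * B₁) - B₁ * (u * v))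
        - (c * 2⁻¹) • (uξ * v + u * vξ - uη * v - u * vη) := by
  subst hu huξ huη hv hvξ hvη hB₁
  simp only [smul_blockOp, blockOp_mul, blockOp_add, blockOp_sub]
  congr 1
  · ext i j
    simp [speedMatrix, vecMulVec_apply, diagonal_mul, vecMul_diagonal]
    ring
  · simp
  · simp
  · simp

/-- The right-hand side of the equation for `p` in terms of operators. The commutator with the scalar
velocity `b`, which has no counterpart in the equation for `p`, vanishes. -/
lemma scalarField_rate_identity (b c : ℂ) (q qx qy r rx ry : Fin n → ℂ)
    {u uξ uη v vξ vη B₂ : Wave n →L[ℂ] Wave n}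
    (hu : u = blockOp 0 q 0 0) (huξ : uξ = (2⁻¹ : ℂ) • blockOp 0 (qy + qx) 0 0)
    (huη : uη = (2⁻¹ : ℂ) • blockOp 0 (qy - qx) 0 0) (hv : v = blockOp 0 0 r 0)
    (hvξ : vξ = (2⁻¹ : ℂ) • blockOp 0 0 (ry + rx) 0)
    (hvη : vη = (2⁻¹ : ℂ) • blockOp 0 0 (ry - rx) 0) (hB₂ : B₂ = blockOp 0 0 0 b) :
    blockOp 0 0 0 (2⁻¹ * (c * (rx ⬝ᵥ q + r ⬝ᵥ qx)))
      = (2⁻¹ : ℂ) • (B₂ * (v * u) - v * (u * B₂))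
        + (c * 2⁻¹) • (vξ * u + v * uξ - vη * u - v * uη) := by
  subst hu huξ huη hv hvξ hvη hB₂
  simp only [smul_blockOp, blockOp_mul, blockOp_add, blockOp_sub]
  congr 1
  · simp
  · simp
  · simp
  · simp
    ring

lemma IsDispersiveWaveSolution.hasDerivAt_matrixField {J : Set ℝ} {bs : Fin n → ℝ} {b γ : ℝ}
    {q₁₂ q₂₁ : ℝ → 𝓢(ℝ × ℝ, Fin n → ℂ)} {P : ℝ → ℝ × ℝ → Matrix (Fin n) (Fin n) ℂ}
    {p : ℝ → ℝ × ℝ → ℂ} (hsol : IsDispersiveWaveSolution J bs b γ q₁₂ q₂₁ P p)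
    {t : ℝ} (ht : t ∈ J) {ξ η : ℝ} {w : ℝ × ℝ} (hw : charEquiv (ξ, η) = w) (i j : Fin n) :
    HasDerivAt (fun s => P t (charEquiv (ξ, s)) i j)
      (2⁻¹ * (q₁₂ t w i * q₂₁ t w j * bs j - bs i * (q₁₂ t w i * q₂₁ t w j)
        - Complex.I * γ * (dxi (q₁₂ t) w i * q₂₁ t w j + q₁₂ t w i * dxi (q₂₁ t) w j))) η := by
  obtain ⟨x, y⟩ := w
  have h := hsol.eqP t ht x y i j
  rw [← hw] at h
  refine (hasDerivAt_comp_charEquiv_snd h).congr_deriv ?_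
  have hd : pderivFst (fun x y => colRow (q₁₂ t) (q₂₁ t) x y i j) x y
      = dxi (q₁₂ t) (x, y) i * q₂₁ t (x, y) j + q₁₂ t (x, y) i * dxi (q₂₁ t) (x, y) j :=
    ((hasDerivAt_pi.1 (hasDerivAt_fst (q₁₂ t) x y) i).fun_mul
      (hasDerivAt_pi.1 (hasDerivAt_fst (q₂₁ t) x y) j)).deriv
  rw [hd]
  simp [colRow, speedMatrix, vecMulVec_apply, mul_diagonal, diagonal_mul]

lemma IsDispersiveWaveSolution.hasDerivAt_scalarField {J : Set ℝ} {bs : Fin n → ℝ} {b γ : ℝ}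
    {q₁₂ q₂₁ : ℝ → 𝓢(ℝ × ℝ, Fin n → ℂ)} {P : ℝ → ℝ × ℝ → Matrix (Fin n) (Fin n) ℂ}
    {p : ℝ → ℝ × ℝ → ℂ} (hsol : IsDispersiveWaveSolution J bs b γ q₁₂ q₂₁ P p)
    {t : ℝ} (ht : t ∈ J) {ξ η : ℝ} {w : ℝ × ℝ} (hw : charEquiv (ξ, η) = w) :
    HasDerivAt (fun s => p t (charEquiv (s, η)))
      (2⁻¹ * (Complex.I * γ * (dxi (q₂₁ t) w ⬝ᵥ q₁₂ t w + q₂₁ t w ⬝ᵥ dxi (q₁₂ t) w))) ξ := by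
  obtain ⟨x, y⟩ := w
  have h := hsol.eqp t ht x y
  rw [← hw] at h
  refine (hasDerivAt_comp_charEquiv_fst h).congr_deriv ?_
  have hd : pderivFst (fun x y => q₂₁ t (x, y) ⬝ᵥ q₁₂ t (x, y)) x y
      = dxi (q₂₁ t) (x, y) ⬝ᵥ q₁₂ t (x, y) + q₂₁ t (x, y) ⬝ᵥ dxi (q₁₂ t) (x, y) := by
    refine (HasDerivAt.fun_sum (u := Finset.univ) fun i _ =>
      (hasDerivAt_pi.1 (hasDerivAt_fst (q₂₁ t) x y) i).fun_mul
        (hasDerivAt_pi.1 (hasDerivAt_fst (q₁₂ t) x y) i)).deriv.trans ?_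
    rw [Finset.sum_add_distrib]
    rfl
  rw [hd]

set_option maxHeartbeats 1600000 in
/-- The dispersive system is an instance of the system for operator-valued potentials, with the column
`q₁₂` as `u`, the row `q₂₁` as `v` and block diagonal velocities and fields. -/
theorem IsDispersiveWaveSolution.isCharacteristicSolution {J : Set ℝ} {bs : Fin n → ℝ} {b γ : ℝ}
    {q₁₂ q₂₁ : ℝ → 𝓢(ℝ × ℝ, Fin n → ℂ)} {P : ℝ → ℝ × ℝ → Matrix (Fin n) (Fin n) ℂ}
    {p : ℝ → ℝ × ℝ → ℂ} (hsol : IsDispersiveWaveSolution J bs b γ q₁₂ q₂₁ P p)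
    (hP : ∀ t ∈ J, ∀ (x y : ℝ) (i j : Fin n),
      Tendsto (fun s : ℝ => P t (x - s, y + s) i j) atTop (𝓝 0))
    (hp : ∀ t ∈ J, ∀ x y : ℝ, Tendsto (fun s : ℝ => p t (x + s, y + s)) atBot (𝓝 0)) :
    IsCharacteristicSolution J (Complex.I * γ) (blockOp (speedMatrix bs) 0 0 0)
      (blockOp 0 0 0 (b : ℂ)) (fun t => charPotential colOp (q₁₂ t))
      (fun t => charPotential rowOp (q₂₁ t)) (fun t z => blockOp (P t (charEquiv z)) 0 0 0)
      (fun t z => blockOp 0 0 0 (p t (charEquiv z))) where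
  deriv_u t ht z := (hasDerivAt_charPotential colOp (hsol.hasDerivAt_column ht _)).congr_deriv
    (col_rate_identity bs b (Complex.I * γ) (q₁₂ t (charEquiv z)) (dxi (q₁₂ t) (charEquiv z))
      (deta (q₁₂ t) (charEquiv z)) (dxi (deta (q₁₂ t)) (charEquiv z)) (P t (charEquiv z))
      (p t (charEquiv z)) rfl (dxi_charPotential_apply colOp _ z)
      (deta_charPotential_apply colOp _ z) (dxi_dxi_sub_deta_deta_charPotential colOp _ z)
      rfl rfl rfl rfl)
  deriv_v t ht z := (hasDerivAt_charPotential rowOp (hsol.hasDerivAt_row ht _)).congr_deriv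
    (row_rate_identity bs b (Complex.I * γ) (q₂₁ t (charEquiv z)) (dxi (q₂₁ t) (charEquiv z))
      (deta (q₂₁ t) (charEquiv z)) (dxi (deta (q₂₁ t)) (charEquiv z)) (P t (charEquiv z))
      (p t (charEquiv z)) rfl (dxi_charPotential_apply rowOp _ z)
      (deta_charPotential_apply rowOp _ z) (dxi_dxi_sub_deta_deta_charPotential rowOp _ z)
      rfl rfl rfl rfl)
  deriv_P t ht ξ η := (hasDerivAt_blockOp_diag (hsol.hasDerivAt_matrixField ht rfl)
    (hasDerivAt_const η 0)).congr_deriv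
    (matrixField_rate_identity bs (Complex.I * γ) (q₁₂ t (charEquiv (ξ, η)))
      (dxi (q₁₂ t) (charEquiv (ξ, η))) (deta (q₁₂ t) (charEquiv (ξ, η)))
      (q₂₁ t (charEquiv (ξ, η))) (dxi (q₂₁ t) (charEquiv (ξ, η)))
      (deta (q₂₁ t) (charEquiv (ξ, η))) rfl
      (dxi_charPotential_apply colOp _ _) (deta_charPotential_apply colOp _ _) rfl
      (dxi_charPotential_apply rowOp _ _) (deta_charPotential_apply rowOp _ _) rfl)
  tendsto_P t ht ξ := by
    refine tendsto_blockOp_diag (fun i j => ?_) tendsto_const_nhds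
    refine ((hP t ht (ξ / 2) (ξ / 2) i j).comp (tendsto_id.atTop_div_const two_pos)).congr fun s => ?_
    simp only [Function.comp_apply, charEquiv_apply, sub_div, add_div, id]
  deriv_p t ht ξ η := (hasDerivAt_blockOp_diag (fun i j => hasDerivAt_const ξ 0)
    (hsol.hasDerivAt_scalarField ht rfl)).congr_deriv
    (scalarField_rate_identity b (Complex.I * γ) (q₁₂ t (charEquiv (ξ, η)))
      (dxi (q₁₂ t) (charEquiv (ξ, η))) (deta (q₁₂ t) (charEquiv (ξ, η)))
      (q₂₁ t (charEquiv (ξ, η))) (dxi (q₂₁ t) (charEquiv (ξ, η)))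
      (deta (q₂₁ t) (charEquiv (ξ, η))) rfl
      (dxi_charPotential_apply colOp _ _) (deta_charPotential_apply colOp _ _) rfl
      (dxi_charPotential_apply rowOp _ _) (deta_charPotential_apply rowOp _ _) rfl)
  tendsto_p t ht η := by
    refine tendsto_blockOp_diag (fun i j => tendsto_const_nhds) ?_
    refine ((hp t ht (-η / 2) (η / 2)).comp (tendsto_id.atBot_div_const two_pos)).congr fun s => ?_
    simp only [Function.comp_apply, charEquiv_apply, id]
    congr 2 <;> ring

end

noncomputable section

/-! ### Reflection of the dispersive system -/

section Reflection

variable {H : Type*} [NormedAddCommGroup H] [NormedSpace ℂ H]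

lemma swapPotential_negReflect_apply (u : 𝓢(ℝ × ℝ, H →L[ℂ] H)) (ξ η : ℝ) :
    swapPotential (negReflect u) (ξ, η) = -u (-η, -ξ) := rfl

lemma continuous_swapPotential_negReflect :
    Continuous fun u : 𝓢(ℝ × ℝ, H →L[ℂ] H) => swapPotential (negReflect u) :=
  (SchwartzMap.compCLMOfContinuousLinearEquiv ℝ (ContinuousLinearEquiv.prodComm ℝ ℝ ℝ)).continuous.comp
    (SchwartzMap.compCLMOfContinuousLinearEquiv ℝ (ContinuousLinearEquiv.neg ℝ)).continuous.neg

lemma dxi_swapPotential_negReflect (u : 𝓢(ℝ × ℝ, H →L[ℂ] H)) :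
    dxi (swapPotential (negReflect u)) = -swapPotential (negReflect (deta u)) := by
  ext1 ⟨ξ, η⟩
  refine (hasDerivAt_fst (swapPotential (negReflect u)) ξ η).unique ?_
  have h := ((hasDerivAt_snd u (-η) (-ξ)).scomp ξ (hasDerivAt_neg ξ)).fun_neg
  refine h.congr_deriv ?_
  change _ = -(-deta u (-η, -ξ))
  rw [neg_smul, one_smul]

lemma deta_swapPotential_negReflect (u : 𝓢(ℝ × ℝ, H →L[ℂ] H)) :
    deta (swapPotential (negReflect u)) = -swapPotential (negReflect (dxi u)) := by
  ext1 ⟨ξ, η⟩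
  refine (hasDerivAt_snd (swapPotential (negReflect u)) ξ η).unique ?_
  have h := ((hasDerivAt_fst u (-η) (-ξ)).scomp η (hasDerivAt_neg η)).fun_neg
  refine h.congr_deriv ?_
  change _ = -(-dxi u (-η, -ξ))
  rw [neg_smul, one_smul]

lemma dxi_swapPotential_negReflect_apply (u : 𝓢(ℝ × ℝ, H →L[ℂ] H)) (ξ η : ℝ) :
    dxi (swapPotential (negReflect u)) (ξ, η) = deta u (-η, -ξ) := by
  rw [dxi_swapPotential_negReflect]
  exact neg_neg _

lemma deta_swapPotential_negReflect_apply (u : 𝓢(ℝ × ℝ, H →L[ℂ] H)) (ξ η : ℝ) :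
    deta (swapPotential (negReflect u)) (ξ, η) = dxi u (-η, -ξ) := by
  rw [deta_swapPotential_negReflect]
  exact neg_neg _

lemma dxi_dxi_swapPotential_negReflect_apply (u : 𝓢(ℝ × ℝ, H →L[ℂ] H)) (ξ η : ℝ) :
    dxi (dxi (swapPotential (negReflect u))) (ξ, η) = -deta (deta u) (-η, -ξ) := by
  have e : dxi (-swapPotential (negReflect (deta u))) = -dxi (swapPotential (negReflect (deta u))) :=
    LineDeriv.lineDerivOp_neg _ _
  rw [dxi_swapPotential_negReflect, e]
  exact congrArg Neg.neg (dxi_swapPotential_negReflect_apply (deta u) ξ η)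

lemma deta_deta_swapPotential_negReflect_apply (u : 𝓢(ℝ × ℝ, H →L[ℂ] H)) (ξ η : ℝ) :
    deta (deta (swapPotential (negReflect u))) (ξ, η) = -dxi (dxi u) (-η, -ξ) := by
  have e : deta (-swapPotential (negReflect (dxi u))) = -deta (swapPotential (negReflect (dxi u))) :=
    LineDeriv.lineDerivOp_neg _ _
  rw [deta_swapPotential_negReflect, e]
  exact congrArg Neg.neg (deta_swapPotential_negReflect_apply (dxi u) ξ η)

/-- The dispersive system is invariant under `(ξ, η) ↦ (-η, -ξ)`, with the two potentials, the two
velocities and the two fields exchanged. -/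
lemma IsCharacteristicSolution.reflect {J : Set ℝ} {c : ℂ} {B₁ B₂ : H →L[ℂ] H}
    {u v : ℝ → 𝓢(ℝ × ℝ, H →L[ℂ] H)} {P p : ℝ → ℝ × ℝ → H →L[ℂ] H}
    (h : IsCharacteristicSolution J c B₁ B₂ u v P p) :
    IsCharacteristicSolution J c B₂ B₁ (fun t => swapPotential (negReflect (v t)))
      (fun t => swapPotential (negReflect (u t))) (fun t z => p t (-z.2, -z.1))
      (fun t z => P t (-z.2, -z.1)) where
  deriv_u := by
    rintro t ht ⟨ξ, η⟩
    refine (h.deriv_v t ht (-η, -ξ)).fun_neg.congr_deriv ?_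
    rw [dxi_swapPotential_negReflect_apply, deta_swapPotential_negReflect_apply,
      dxi_dxi_swapPotential_negReflect_apply, deta_deta_swapPotential_negReflect_apply,
      swapPotential_negReflect_apply, mul_neg, neg_mul]
    module
  deriv_v := by
    rintro t ht ⟨ξ, η⟩
    refine (h.deriv_u t ht (-η, -ξ)).fun_neg.congr_deriv ?_
    rw [dxi_swapPotential_negReflect_apply, deta_swapPotential_negReflect_apply,
      dxi_dxi_swapPotential_negReflect_apply, deta_deta_swapPotential_negReflect_apply,
      swapPotential_negReflect_apply, mul_neg, neg_mul]
    module
  deriv_P t ht ξ η := by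
    refine ((h.deriv_p t ht (-η) (-ξ)).scomp η (hasDerivAt_neg η)).congr_deriv ?_
    rw [dxi_swapPotential_negReflect_apply, deta_swapPotential_negReflect_apply,
      dxi_swapPotential_negReflect_apply, deta_swapPotential_negReflect_apply,
      swapPotential_negReflect_apply, swapPotential_negReflect_apply]
    simp only [mul_neg, neg_mul, neg_neg]
    module
  tendsto_P t ht ξ := (h.tendsto_p t ht (-ξ)).comp tendsto_neg_atTop_atBot
  deriv_p t ht ξ η := by
    refine ((h.deriv_P t ht (-η) (-ξ)).scomp ξ (hasDerivAt_neg ξ)).congr_deriv ?_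
    rw [dxi_swapPotential_negReflect_apply, deta_swapPotential_negReflect_apply,
      dxi_swapPotential_negReflect_apply, deta_swapPotential_negReflect_apply,
      swapPotential_negReflect_apply, swapPotential_negReflect_apply]
    simp only [mul_neg, neg_mul, neg_neg]
    module
  tendsto_p t ht η := (h.tendsto_P t ht (-η)).comp tendsto_neg_atBot_atTop

end Reflection

/-! ### The evolution equations of the matrix entries -/

section Entries

variable {𝔸 : Type*} [NormedRing 𝔸] [NormedAlgebra ℂ 𝔸]

lemma pderivFst_eq_of_hasDerivAt {T f₁ : ℝ × ℝ → 𝔸} (ℓ : 𝔸 →L[ℂ] ℂ)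
    (h : ∀ z, HasDerivAt (fun s : ℝ => T (z + s • ((1, 0) : ℝ × ℝ))) (f₁ z) 0) :
    pderivFst (fun y τ => ℓ (T (y, τ))) = fun y τ => ℓ (f₁ (y, τ)) := by
  funext y τ
  have h1 := (ℓ.restrictScalars ℝ).hasFDerivAt.comp_hasDerivAt (0 : ℝ) (h (y, τ))
  have h2 := HasDerivAt.scomp_of_eq y h1 ((hasDerivAt_id y).sub_const y) (by simp)
  rw [one_smul] at h2
  refine (h2.congr_of_eventuallyEq (Eventually.of_forall fun s => ?_)).deriv
  simp

lemma pderivSnd_eq_of_hasDerivAt {T f₁ : ℝ × ℝ → 𝔸} (ℓ : 𝔸 →L[ℂ] ℂ)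
    (h : ∀ z, HasDerivAt (fun s : ℝ => T (z + s • ((0, 1) : ℝ × ℝ))) (f₁ z) 0) :
    pderivSnd (fun y τ => ℓ (T (y, τ))) = fun y τ => ℓ (f₁ (y, τ)) := by
  funext y τ
  have h1 := (ℓ.restrictScalars ℝ).hasFDerivAt.comp_hasDerivAt (0 : ℝ) (h (y, τ))
  have h2 := HasDerivAt.scomp_of_eq τ h1 ((hasDerivAt_id τ).sub_const τ) (by simp)
  rw [one_smul] at h2
  refine (h2.congr_of_eventuallyEq (Eventually.of_forall fun s => ?_)).deriv
  simp

variable [CompleteSpace 𝔸]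

lemma contDiff_entry_transmission (u v : 𝓢(ℝ × ℝ, 𝔸)) (ℓ : 𝔸 →L[ℂ] ℂ) :
    ContDiff ℝ 2 (Function.uncurry fun y τ => ℓ (transmission u v (y, τ))) :=
  (ℓ.restrictScalars ℝ).contDiff.comp (contDiff_transmission u v)

/-- The evolution equation of an entry of the transmission kernel on which the velocities act as
scalars. -/
lemma IsCharacteristicSolution.hasDerivAt_entry {J : Set ℝ} (hJ : IsOpen J) {c : ℂ} {B₁ B₂ : 𝔸}
    {u v : ℝ → 𝓢(ℝ × ℝ, 𝔸)} {P p : ℝ → ℝ × ℝ → 𝔸} (h : IsCharacteristicSolution J c B₁ B₂ u v P p)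
    (hu : ContinuousOn u J) (hv : ContinuousOn v J) {t : ℝ} (ht : t ∈ J) (ℓ : 𝔸 →L[ℂ] ℂ) {β₁ β₂ : ℂ}
    (h₁ : ∀ L, ℓ (B₁ * L) = β₁ * ℓ L) (h₂ : ∀ L, ℓ (L * B₂) = β₂ * ℓ L) {f : ℝ → ℝ → ℂ}
    (hf : f = fun y τ => ℓ (transmission (u t) (v t) (y, τ))) (y τ : ℝ) :
    HasDerivAt (fun s => ℓ (transmission (u s) (v s) (y, τ)))
      (2 * (β₁ * pderivFst f y τ - β₂ * pderivSnd f y τ)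
        + c * (pderivFst (pderivFst f) y τ - pderivSnd (pderivSnd f) y τ)) t := by
  obtain ⟨f₁, f₂, g₁, g₂, hf₁, hf₂, hg₁, hg₂, hT⟩ := h.hasDerivAt_transmission hJ hu hv ht
  subst hf
  rw [pderivFst_eq_of_hasDerivAt ℓ hf₁, pderivFst_eq_of_hasDerivAt ℓ hf₂,
    pderivSnd_eq_of_hasDerivAt ℓ hg₁, pderivSnd_eq_of_hasDerivAt ℓ hg₂]
  refine ((ℓ.restrictScalars ℝ).hasFDerivAt.comp_hasDerivAt t (hT (y, τ))).congr_deriv ?_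
  change ℓ _ = _
  simp only [map_add, map_sub, map_smul, h₁, h₂, smul_eq_mul]
  ring

end Entries

end

noncomputable section

/-! ### Matrix entries of the scattering kernels -/

variable {n : ℕ}

/-- The matrix potential in characteristic coordinates. -/
lemma isBlockPotential_potential (q₁₂ q₂₁ : 𝓢(ℝ × ℝ, Fin n → ℂ)) :
    IsBlockPotential (potential q₁₂ q₂₁) (charPotential colOp q₁₂) (charPotential rowOp q₂₁) := by
  have e : ∀ x y : ℝ, charEquiv (y + x, y - x) = (x, y) := fun x y => by
    ext <;> simp [charEquiv_apply]
  constructor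
  · intro x y h h' hh k
    rw [charPotential_apply, e, colOp_apply, blockOp_apply, ← hh]
    simp [potential, mulVec, dotProduct]
  · intro x y h h' hh
    rw [charPotential_apply, e, rowOp_apply, blockOp_apply]
    simp [potential, mulVec, dotProduct, hh]

/-- The matrix entry `(i, j)` of an operator on `ℂⁿ⁺¹`, as a continuous functional. -/
def entryCLM (i j : Fin n ⊕ Unit) : (Wave n →L[ℂ] Wave n) →L[ℂ] ℂ :=
  EuclideanSpace.proj i ∘L ContinuousLinearMap.apply ℂ (Wave n) (EuclideanSpace.single j 1)

lemma entryCLM_apply (i j : Fin n ⊕ Unit) (L : Wave n →L[ℂ] Wave n) :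
    entryCLM i j L = L (EuclideanSpace.single j 1) i := rfl

lemma waveMatrix_apply (L : Wave n →L[ℂ] Wave n) (i j : Fin n ⊕ Unit) :
    waveMatrix L i j = entryCLM i j L := rfl

lemma blockOp_scalar_single_inr (b : ℂ) :
    blockOp (0 : Matrix (Fin n) (Fin n) ℂ) 0 0 b (EuclideanSpace.single (Sum.inr ()) 1)
      = b • EuclideanSpace.single (Sum.inr ()) 1 := by
  ext (k | k) <;> simp [blockOp_apply]

lemma blockOp_diagonal_single_inl (bs : Fin n → ℝ) (k : Fin n) :
    blockOp (speedMatrix bs) 0 0 0 (EuclideanSpace.single (Sum.inl k) 1)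
      = (bs k : ℂ) • EuclideanSpace.single (Sum.inl k) 1 := by
  ext (j | j)
  · simp [blockOp_apply, speedMatrix, mulVec_diagonal]
    rcases eq_or_ne j k with rfl | hjk
    · simp
    · simp [hjk]
  · simp [blockOp_apply]

lemma entryCLM_mul (i j : Fin n ⊕ Unit) {B : Wave n →L[ℂ] Wave n} {β : ℂ}
    (hB : B (EuclideanSpace.single j 1) = β • EuclideanSpace.single j 1) (L : Wave n →L[ℂ] Wave n) :
    entryCLM i j (L * B) = β * entryCLM i j L := by
  change L (B (EuclideanSpace.single j 1)) i = β * L (EuclideanSpace.single j 1) i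
  rw [hB, map_smul]
  rfl

lemma entryCLM_diagonal_mul (bs : Fin n → ℝ) (k : Fin n) (j : Fin n ⊕ Unit)
    (L : Wave n →L[ℂ] Wave n) :
    entryCLM (Sum.inl k) j (blockOp (speedMatrix bs) 0 0 0 * L) = bs k * entryCLM (Sum.inl k) j L := by
  change blockOp (speedMatrix bs) 0 0 0 (L (EuclideanSpace.single j 1)) (Sum.inl k) = _
  simp [blockOp_apply, speedMatrix, mulVec_diagonal, entryCLM_apply]

lemma entryCLM_scalar_mul (b : ℂ) (j : Fin n ⊕ Unit) (L : Wave n →L[ℂ] Wave n) :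
    entryCLM (Sum.inr ()) j (blockOp (0 : Matrix (Fin n) (Fin n) ℂ) 0 0 b * L)
      = b * entryCLM (Sum.inr ()) j L := by
  change blockOp 0 0 0 b (L (EuclideanSpace.single j 1)) (Sum.inr ()) = _
  simp [blockOp_apply, entryCLM_apply]

/-- If `v` annihilates the vector `e`, the discontinuous part of the scattering kernel does too, and
only the transmission kernel remains. -/
lemma scatteringKernel_apply_eq {H : Type*} [NormedAddCommGroup H] [NormedSpace ℂ H]
    [CompleteSpace H] {u v : 𝓢(ℝ × ℝ, H →L[ℂ] H)} {E : H →L[ℂ] H} {e : H}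
    (hv : ∀ z, v z * E = 0) (he : E e = e) (z : ℝ × ℝ) :
    scatteringKernel u v z e = transmission u v z e := by
  have h : reflection (swapPotential v) (swapPotential u) z e = 0 := by
    have h1 := reflection_mul_eq_zero (u := swapPotential v) (v := swapPotential u) (E := E)
      (fun z => hv (z.2, z.1)) z
    have h2 := congrArg (fun L : H →L[ℂ] H => L e) h1
    change reflection (swapPotential v) (swapPotential u) z (E e) = 0 at h2
    rwa [he] at h2
  by_cases hz : z ∈ {z : ℝ × ℝ | z.2 ≤ z.1}
  · rw [scatteringKernel, Set.indicator_of_mem hz, _root_.add_apply, h, add_zero]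
  · rw [scatteringKernel, Set.indicator_of_notMem hz, add_zero]

lemma rowOp_mul_eq_zero (r : Fin n → ℂ) :
    rowOp r * blockOp (0 : Matrix (Fin n) (Fin n) ℂ) 0 0 1 = 0 := by
  ext h (k | k) <;> simp [rowOp_apply, blockOp_apply]

lemma colOp_mul_eq_zero (q : Fin n → ℂ) :
    colOp q * blockOp (1 : Matrix (Fin n) (Fin n) ℂ) 0 0 0 = 0 := by
  ext h (k | k) <;> simp [colOp_apply, blockOp_apply]

/-- The upper right column of `S - 1` consists of entries of the transmission kernel: `v` annihilates
the last basis vector. -/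
lemma waveMatrix_fullKernel_inl_inr (q₁₂ q₂₁ : 𝓢(ℝ × ℝ, Fin n → ℂ)) (z : ℝ × ℝ) (k : Fin n) :
    waveMatrix (fullKernel (charPotential colOp q₁₂) (charPotential rowOp q₂₁) z)
        (Sum.inl k) (Sum.inr ())
      = entryCLM (Sum.inl k) (Sum.inr ())
        (transmission (charPotential colOp q₁₂) (charPotential rowOp q₂₁) z) := by
  rw [waveMatrix_apply, entryCLM_apply, fullKernel_apply, mixWave_inl,
    scatteringKernel_apply_eq (E := blockOp (0 : Matrix (Fin n) (Fin n) ℂ) 0 0 1)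
      (fun z => rowOp_mul_eq_zero _), entryCLM_apply]
  rw [blockOp_scalar_single_inr, one_smul]

/-- The lower left row of `S⁻¹ - 1` consists of entries of a transmission kernel of the reflected
system: the column potential annihilates the first `n` basis vectors. -/
lemma waveMatrix_fullKernel_inr_inl (q₁₂ q₂₁ : 𝓢(ℝ × ℝ, Fin n → ℂ)) (z : ℝ × ℝ) (k : Fin n) :
    waveMatrix (fullKernel (negReflect (charPotential colOp q₁₂))
        (negReflect (charPotential rowOp q₂₁)) z) (Sum.inr ()) (Sum.inl k)
      = entryCLM (Sum.inr ()) (Sum.inl k)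
        (transmission (swapPotential (negReflect (charPotential rowOp q₂₁)))
          (swapPotential (negReflect (charPotential colOp q₁₂))) z) := by
  have h1 : ∀ z, negReflect (charPotential colOp q₁₂) z
      * blockOp (1 : Matrix (Fin n) (Fin n) ℂ) 0 0 0 = 0 := fun z => by
    rw [negReflect_apply, neg_mul, charPotential_apply, colOp_mul_eq_zero, neg_zero]
  have h2 : blockOp (1 : Matrix (Fin n) (Fin n) ℂ) 0 0 0 (EuclideanSpace.single (Sum.inl k) 1)
      = EuclideanSpace.single (Sum.inl k) 1 := by
    ext (j | j) <;> simp [blockOp_apply]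
  rw [waveMatrix_apply, entryCLM_apply, fullKernel_apply, mixWave_inr,
    scatteringKernel_apply_eq (fun z => h1 (z.2, z.1)) h2, entryCLM_apply]

lemma pderivFst_comp_neg (f : ℝ → ℝ → ℂ) :
    pderivFst (fun y τ => f (-y) (-τ)) = fun y τ => -pderivFst f (-y) (-τ) :=
  funext fun y => funext fun τ => deriv_comp_neg (fun s => f s (-τ)) y

lemma pderivSnd_comp_neg (f : ℝ → ℝ → ℂ) :
    pderivSnd (fun y τ => f (-y) (-τ)) = fun y τ => -pderivSnd f (-y) (-τ) :=
  funext fun y => funext fun τ => deriv_comp_neg (fun s => f (-y) s) τ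

lemma pderivFst_neg (f : ℝ → ℝ → ℂ) :
    pderivFst (fun y τ => -f y τ) = fun y τ => -pderivFst f y τ :=
  funext fun y => funext fun τ => deriv.fun_neg (f := fun s => f s τ) (x := y)

lemma pderivSnd_neg (f : ℝ → ℝ → ℂ) :
    pderivSnd (fun y τ => -f y τ) = fun y τ => -pderivSnd f y τ :=
  funext fun y => funext fun τ => deriv.fun_neg (f := fun s => f y s) (x := τ)

/-- The evolution equation of a reflected entry of the transmission kernel. -/
lemma IsCharacteristicSolution.hasDerivAt_entry_neg {𝔸 : Type*} [NormedRing 𝔸] [NormedAlgebra ℂ 𝔸]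
    [CompleteSpace 𝔸] {J : Set ℝ} (hJ : IsOpen J) {c : ℂ} {B₁ B₂ : 𝔸}
    {u v : ℝ → 𝓢(ℝ × ℝ, 𝔸)} {P p : ℝ → ℝ × ℝ → 𝔸} (h : IsCharacteristicSolution J c B₁ B₂ u v P p)
    (hu : ContinuousOn u J) (hv : ContinuousOn v J) {t : ℝ} (ht : t ∈ J) (ℓ : 𝔸 →L[ℂ] ℂ) {β₁ β₂ : ℂ}
    (h₁ : ∀ L, ℓ (B₁ * L) = β₁ * ℓ L) (h₂ : ∀ L, ℓ (L * B₂) = β₂ * ℓ L) {g : ℝ → ℝ → ℂ}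
    (hg : g = fun y τ => ℓ (transmission (u t) (v t) (-y, -τ))) (y τ : ℝ) :
    HasDerivAt (fun s => ℓ (transmission (u s) (v s) (-y, -τ)))
      (-2 * (β₁ * pderivFst g y τ - β₂ * pderivSnd g y τ)
        + c * (pderivFst (pderivFst g) y τ - pderivSnd (pderivSnd g) y τ)) t := by
  refine (h.hasDerivAt_entry hJ hu hv ht ℓ h₁ h₂ rfl (-y) (-τ)).congr_deriv ?_
  subst hg
  set f : ℝ → ℝ → ℂ := fun y τ => ℓ (transmission (u t) (v t) (y, τ)) with hf
  change _ = -2 * (β₁ * pderivFst (fun y τ => f (-y) (-τ)) y τ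
      - β₂ * pderivSnd (fun y τ => f (-y) (-τ)) y τ)
    + c * (pderivFst (pderivFst fun y τ => f (-y) (-τ)) y τ
      - pderivSnd (pderivSnd fun y τ => f (-y) (-τ)) y τ)
  rw [pderivFst_comp_neg, pderivSnd_comp_neg, pderivFst_neg, pderivSnd_neg,
    pderivFst_comp_neg, pderivSnd_comp_neg]
  ring

lemma contDiff_entry_transmission_neg {𝔸 : Type*} [NormedRing 𝔸] [NormedAlgebra ℂ 𝔸]
    [CompleteSpace 𝔸] (u v : 𝓢(ℝ × ℝ, 𝔸)) (ℓ : 𝔸 →L[ℂ] ℂ) :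
    ContDiff ℝ 2 (Function.uncurry fun y τ => ℓ (transmission u v (-y, -τ))) :=
  (contDiff_entry_transmission u v ℓ).comp contDiff_neg

/-- The evolution of the row of the kernel of `S⁻¹ - 1`. In the reflected system the scalar velocity
acts from the left and the diagonal one from the right. -/
lemma IsDispersiveWaveSolution.hasDerivAt_transmission_reflected {J : Set ℝ} (hJ : IsOpen J)
    {bs : Fin n → ℝ} {b γ : ℝ}
    {q₁₂ q₂₁ : ℝ → 𝓢(ℝ × ℝ, Fin n → ℂ)} {P : ℝ → ℝ × ℝ → Matrix (Fin n) (Fin n) ℂ}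
    {p : ℝ → ℝ × ℝ → ℂ} (hq₁₂ : ContinuousOn q₁₂ J) (hq₂₁ : ContinuousOn q₂₁ J)
    (hsol : IsDispersiveWaveSolution J bs b γ q₁₂ q₂₁ P p)
    (hP : ∀ t ∈ J, ∀ (x y : ℝ) (i j : Fin n),
      Tendsto (fun s : ℝ => P t (x - s, y + s) i j) atTop (𝓝 0))
    (hp : ∀ t ∈ J, ∀ x y : ℝ, Tendsto (fun s : ℝ => p t (x + s, y + s)) atBot (𝓝 0))
    {t : ℝ} (ht : t ∈ J) (k : Fin n) {g : ℝ → ℝ → ℂ}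
    (hg : g = fun y τ => entryCLM (Sum.inr ()) (Sum.inl k)
      (transmission (swapPotential (negReflect (charPotential rowOp (q₂₁ t))))
        (swapPotential (negReflect (charPotential colOp (q₁₂ t)))) (-y, -τ))) (y τ : ℝ) :
    HasDerivAt (fun s => entryCLM (Sum.inr ()) (Sum.inl k)
      (transmission (swapPotential (negReflect (charPotential rowOp (q₂₁ s))))
        (swapPotential (negReflect (charPotential colOp (q₁₂ s)))) (-y, -τ)))
      (-2 * (b * pderivFst g y τ - bs k * pderivSnd g y τ) + Complex.I * γ *
        (pderivFst (pderivFst g) y τ - pderivSnd (pderivSnd g) y τ)) t := by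
  have hcol : ContinuousOn (fun t => swapPotential (negReflect (charPotential colOp (q₁₂ t)))) J :=
    (continuous_swapPotential_negReflect.comp
      (charPotential (colOp (n := n))).continuous).comp_continuousOn hq₁₂
  have hrow : ContinuousOn (fun t => swapPotential (negReflect (charPotential rowOp (q₂₁ t)))) J :=
    (continuous_swapPotential_negReflect.comp
      (charPotential (rowOp (n := n))).continuous).comp_continuousOn hq₂₁
  exact (hsol.isCharacteristicSolution hP hp).reflect.hasDerivAt_entry_neg hJ hrow hcol ht
      (entryCLM (Sum.inr ()) (Sum.inl k)) (entryCLM_scalar_mul _ _)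
      (entryCLM_mul _ _ (blockOp_diagonal_single_inl bs k)) hg y τ

/-- The evolution of the column of the kernel of `S - 1`. -/
lemma IsDispersiveWaveSolution.hasDerivAt_transmission {J : Set ℝ} (hJ : IsOpen J)
    {bs : Fin n → ℝ} {b γ : ℝ}
    {q₁₂ q₂₁ : ℝ → 𝓢(ℝ × ℝ, Fin n → ℂ)} {P : ℝ → ℝ × ℝ → Matrix (Fin n) (Fin n) ℂ}
    {p : ℝ → ℝ × ℝ → ℂ} (hq₁₂ : ContinuousOn q₁₂ J) (hq₂₁ : ContinuousOn q₂₁ J)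
    (hsol : IsDispersiveWaveSolution J bs b γ q₁₂ q₂₁ P p)
    (hP : ∀ t ∈ J, ∀ (x y : ℝ) (i j : Fin n),
      Tendsto (fun s : ℝ => P t (x - s, y + s) i j) atTop (𝓝 0))
    (hp : ∀ t ∈ J, ∀ x y : ℝ, Tendsto (fun s : ℝ => p t (x + s, y + s)) atBot (𝓝 0))
    {t : ℝ} (ht : t ∈ J) (k : Fin n) {f : ℝ → ℝ → ℂ}
    (hf : f = fun y τ => entryCLM (Sum.inl k) (Sum.inr ())
      (transmission (charPotential colOp (q₁₂ t)) (charPotential rowOp (q₂₁ t)) (y, τ)))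
    (y τ : ℝ) :
    HasDerivAt (fun s => entryCLM (Sum.inl k) (Sum.inr ())
      (transmission (charPotential colOp (q₁₂ s)) (charPotential rowOp (q₂₁ s)) (y, τ)))
      (2 * (bs k * pderivFst f y τ - b * pderivSnd f y τ) + Complex.I * γ *
        (pderivFst (pderivFst f) y τ - pderivSnd (pderivSnd f) y τ)) t := by
  have hcol : ContinuousOn (fun t => charPotential colOp (q₁₂ t)) J :=
    (charPotential (colOp (n := n))).continuous.comp_continuousOn hq₁₂
  have hrow : ContinuousOn (fun t => charPotential rowOp (q₂₁ t)) J :=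
    (charPotential (rowOp (n := n))).continuous.comp_continuousOn hq₂₁
  exact (hsol.isCharacteristicSolution hP hp).hasDerivAt_entry hJ hcol hrow ht
    (entryCLM (Sum.inl k) (Sum.inr ())) (entryCLM_diagonal_mul bs k _)
    (entryCLM_mul _ _ (blockOp_scalar_single_inr _)) hf y τ

end

theorem mainTheorem1 {n : ℕ} (J : Set ℝ) (hJ : IsOpen J) (bs : Fin n → ℝ) (b γ : ℝ)
    (q₁₂ q₂₁ : ℝ → 𝓢(ℝ × ℝ, Fin n → ℂ))
    (P : ℝ → ℝ × ℝ → Matrix (Fin n) (Fin n) ℂ) (p : ℝ → ℝ × ℝ → ℂ)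
    (hq₁₂ : ContinuousOn q₁₂ J) (hq₂₁ : ContinuousOn q₂₁ J)
    (hsol : IsDispersiveWaveSolution J bs b γ q₁₂ q₂₁ P p)
    (hP : ∀ t ∈ J, ∀ (x y : ℝ) (i j : Fin n),
      Tendsto (fun s : ℝ => P t (x - s, y + s) i j) atTop (𝓝 0))
    (hp : ∀ t ∈ J, ∀ x y : ℝ, Tendsto (fun s : ℝ => p t (x + s, y + s)) atBot (𝓝 0)) :
    ∃ (S : ℝ → (Profile n ≃L[ℂ] Profile n))
      (F G : ℝ → ℝ → ℝ → Matrix (Fin n ⊕ Unit) (Fin n ⊕ Unit) ℂ),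
      (∀ t ∈ J,
        IsScatteringOperator (potential (q₁₂ t) (q₂₁ t)) (S t) ∧
        IsHilbertSchmidtKernel
          ((S t : Profile n →L[ℂ] Profile n) - ContinuousLinearMap.id ℂ (Profile n)) (F t) ∧
        IsHilbertSchmidtKernel
          (((S t).symm : Profile n →L[ℂ] Profile n) - ContinuousLinearMap.id ℂ (Profile n))
          (G t)) ∧
      -- the evolution equation of the column `F₁₂`
      (∀ t ∈ J, ∀ k : Fin n,
        let f : ℝ → ℝ → ℂ := fun y τ => F t y τ (Sum.inl k) (Sum.inr ())
        ContDiff ℝ 2 (Function.uncurry f) ∧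
        ∀ y τ : ℝ,
          DifferentiableAt ℝ (fun s => F s y τ (Sum.inl k) (Sum.inr ())) t ∧
          deriv (fun s => F s y τ (Sum.inl k) (Sum.inr ())) t
              - 2 * (bs k * pderivFst f y τ - b * pderivSnd f y τ)
              - Complex.I * γ *
                (pderivFst (pderivFst f) y τ - pderivSnd (pderivSnd f) y τ) = 0) ∧
      -- the evolution equation of the row `G₂₁`
      (∀ t ∈ J, ∀ k : Fin n,
        let g : ℝ → ℝ → ℂ := fun y τ => G t y τ (Sum.inr ()) (Sum.inl k)
        ContDiff ℝ 2 (Function.uncurry g) ∧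
        ∀ y τ : ℝ,
          DifferentiableAt ℝ (fun s => G s y τ (Sum.inr ()) (Sum.inl k)) t ∧
          deriv (fun s => G s y τ (Sum.inr ()) (Sum.inl k)) t
              + 2 * (b * pderivFst g y τ - pderivSnd g y τ * bs k)
              - Complex.I * γ *
                (pderivFst (pderivFst g) y τ - pderivSnd (pderivSnd g) y τ) = 0) := by
  choose S hS hF hG using fun t =>
    (isBlockPotential_potential (q₁₂ t) (q₂₁ t)).exists_isScatteringOperator
  refine ⟨S, fun t y τ => waveMatrix (fullKernel (charPotential colOp (q₁₂ t))
      (charPotential rowOp (q₂₁ t)) (y, τ)), fun t y τ => waveMatrix (fullKernel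
        (negReflect (charPotential colOp (q₁₂ t))) (negReflect (charPotential rowOp (q₂₁ t)))
          (-y, -τ)), fun t _ => ⟨hS t, hF t, hG t⟩, fun t ht k => ?_, fun t ht k => ?_⟩
  · simp only [waveMatrix_fullKernel_inl_inr]
    refine ⟨contDiff_entry_transmission _ _ _, fun y τ => ?_⟩
    have h := hsol.hasDerivAt_transmission hJ hq₁₂ hq₂₁ hP hp ht k rfl y τ
    refine ⟨h.differentiableAt, ?_⟩
    rw [h.deriv]
    ring
  · simp only [waveMatrix_fullKernel_inr_inl]
    refine ⟨contDiff_entry_transmission_neg _ _ _, fun y τ => ?_⟩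
    have h := hsol.hasDerivAt_transmission_reflected hJ hq₁₂ hq₂₁ hP hp ht k rfl y τ
    refine ⟨h.differentiableAt, ?_⟩
    rw [h.deriv]
    ring
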